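/- Let $d\ge 0$ be an integer (the dimension), $m\ge0$ a real number, $p=2^k$ with an integer $k\ge1$, and let $K>0$, $K_\xi,K_\eta\ge0$ be constants. There is a constant $N=N(d,p,m,K,K_\xi,K_\eta)$ such that the following holds. Let $T>0$, $H_T=[0,T]\times\mathbb R^d$, let $\mu,\nu$ be $\sigma$-finite measures on a measurable space $(Z,\mathcal Z)$, and let $\bar\eta,\bar\xi\ge0$ be $\mathcal Z$-measurable functions on $Z$ with $\int_Z\bar\eta^2\,d\mu=K_\eta^2$ and $\int_Z\bar\xi\,d\nu=K_\xi$. A multi-number of length $|\alpha|=l$ is a list $\alpha=\alpha_1\dots\alpha_l$ of elements of $\{1,\dots,d\}$, and $D_\alpha=D_{\alpha_1}\cdots D_{\alpha_l}$; derivatives of $a,b,c$ and of elements of Sobolev spaces are generalised derivatives in $x$. Put $|D^lf|=\big(\sum_{|\alpha|=l}|D_\alpha f|^2\big)^{1/2}$, $|v|_{W^l_p}=\sum_{|\alpha|\le l}|D_\alpha v|_{L_p}$, $(f,g)=\int_{\mathbb R^d}fg\,dx$. Repeated indices $i,j$ are summed over $1,\dots,d$. Assume: 1. $a^{ij},b^i,c:H_T\to\mathbb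 R$ are Borel, and they and their derivatives in $x$, up to order $\max(\lceil m\rceil,2)$ for $a^{ij}$, $\max(\lceil m\rceil,1)$ for $b^i$ and $\lceil m\rceil$ for $c$, are Borel functions on $H_T$ bounded by $K$; for almost all $(t,x)\in H_T$ the matrix $(a^{ij}(t,x))$ is symmetric and nonnegative definite. 2. $\eta:H_T\times Z\to\mathbb R^d$ is $\mathcal B(H_T)\otimes\mathcal Z$-measurable, has continuous derivatives in $x$ up to order $m_\eta=\max(\lceil m\rceil,3)$, and for all $(t,x,z)\in H_T\times Z$, $\theta\in[0,1]$: $|\eta_{t,z}(x)|\le\bar\eta(z)$, $|D^l\eta_{t,z}(x)|\le\min(\bar\eta(z),K)$ for $l=1,\dots,m_\eta$, and $K^{-1}\le|\det(\mathbb I+\theta D\eta_{t,z}(x))|$. 3. $\xi:H_T\times Z\to\mathbb R^d$ satisfies the same conditions with $\bar\xi$ in place of $\bar\eta$ and $m_\xi=\max(\lceil m\rceil,2)$ in place of $m_\eta$. 4. For every $t\in[0,T]$, $\mathcal R(t)$ is a bounded linear operator on $L_p(\mathbb R^d)$ such that $\mathcal R(t)\varphi\in W^l_p$ and $|\mathcal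 R(t)\varphi|_{W^l_p}\le K|\varphi|_{W^l_p}$ for all $\varphi\in C_0^\infty(\mathbb R^d)$ and integers $0\le l\le\lceil m\rceil$. Let $\mathcal A(t)=\mathcal L(t)+\mathcal M(t)+\mathcal N(t)+\mathcal R(t)$, where $$\mathcal L(t)v=a^{ij}(t,\cdot)D_{ij}v+b^i(t,\cdot)D_iv+c(t,\cdot)v,$$ $$\mathcal M(t)v(x)=\int_Z\big(v(x+\eta_{t,z}(x))-v(x)-\eta_{t,z}(x)\nabla v(x)\big)\,\mu(dz),\qquad \mathcal N(t)v(x)=\int_Z\big(v(x+\xi_{t,z}(x))-v(x)\big)\,\nu(dz).$$ Then for almost every $t\in[0,T]$, for all integers $0\le n\le m$ and all $v\in W^{n+2}_p$: the integrals defining $\mathcal M(t)v(x)$ and $\mathcal N(t)v(x)$ converge absolutely for almost every $x$, $\mathcal A(t)v\in W^n_p$, the functions $|D^nv|^{p-2}D_\alpha v\,D_\alpha\mathcal A(t)v$, $|\alpha|=n$, are integrable, and $$\sum_{|\alpha|=n}\big(|D^nv|^{p-2}D_\alpha v,\;D_\alpha\mathcal A(t)v\big)\le N\,|v|_{W^n_p}^p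 .$$ -/

import Mathlib

open MeasureTheory
open scoped ENNReal

noncomputable section

namespace IntegroDiff

/-- The Euclidean space of dimension `d`. -/
abbrev Rd (d : ℕ) : Type := EuclideanSpace ℝ (Fin d)

/-- The time interval `[0,T]`, with its Borel σ-algebra and Lebesgue measure. Functions on
`H_T = [0,T] × ℝ^d` are curried functions `TimeInterval T → Rd d → _`. -/
abbrev TimeInterval (T : ℝ) : Type := ↥(Set.Icc (0 : ℝ) T)

instance measureSpaceTimeInterval (T : ℝ) : MeasureSpace (TimeInterval T) := Measure.Subtype.measureSpace

/-- The space `L_p` of (classes of) real functions on `ℝ^d`. -/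
abbrev LpSpace (d p : ℕ) : Type := Lp ℝ (p : ℝ≥0∞) (volume : Measure (Rd d))

instance fact_one_le_two_pow (k : ℕ) : Fact ((1 : ℝ≥0∞) ≤ ((2 ^ k : ℕ) : ℝ≥0∞)) :=
  ⟨by exact_mod_cast Nat.one_le_two_pow⟩

/-- The classical derivative `D_α f = D_{α_1} ... D_{α_k} f` for a multi-number
`α = α_1 ... α_k`, i.e. a finite list of coordinate directions (`k = 0`: the identity). -/
def classicalD {d k : ℕ} {F : Type*} [NormedAddCommGroup F] [NormedSpace ℝ F]
    (α : Fin k → Fin d) (f : Rd d → F) (x : Rd d) : F :=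
  iteratedFDeriv ℝ k f x (fun i => EuclideanSpace.single (α i) (1 : ℝ))

/-- `|D^k f|`, the square root of the sum over all components of `f` and all multi-numbers of
length `k` of the squares of the derivatives. -/
def classicalDNorm {d : ℕ} (k : ℕ) (f : Rd d → Rd d) (x : Rd d) : ℝ :=
  √(∑ α : Fin k → Fin d, ‖classicalD α f x‖ ^ 2)

/-- Membership in `C_0^∞`. -/
def IsTestFunction {d : ℕ} (φ : Rd d → ℝ) : Prop :=
  ContDiff ℝ ((⊤ : ℕ∞) : WithTop ℕ∞) φ ∧ HasCompactSupport φ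

/-- `w` is the generalised derivative `D_α u`. -/
def IsWeakDeriv {d k : ℕ} (α : Fin k → Fin d) (u w : Rd d → ℝ) : Prop :=
  LocallyIntegrable u ∧ LocallyIntegrable w ∧
    ∀ φ : Rd d → ℝ, IsTestFunction φ →
      ∫ x, u x * classicalD α φ x = (-1 : ℝ) ^ k * ∫ x, w x * φ x

open Classical in
/-- The generalised derivative `D_α u` (determined up to null sets), where it exists. -/
def weakD {d k : ℕ} (α : Fin k → Fin d) (u : Rd d → ℝ) : Rd d → ℝ :=
  if h : ∃ w, IsWeakDeriv α u w then h.choose else 0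

/-- Membership in the Sobolev space `W^n_p`: `v` and all its generalised derivatives up to order
`n` belong to `L_p`. -/
def MemW {d : ℕ} (n p : ℕ) (v : Rd d → ℝ) : Prop :=
  MemLp v (p : ℝ≥0∞) ∧
    ∀ k ≤ n, ∀ α : Fin k → Fin d, ∃ w, IsWeakDeriv α v w ∧ MemLp w (p : ℝ≥0∞)

/-- The norm `∑_{|α| ≤ n} |D_α v|_{L_p}` of `W^n_p`. -/
def normW {d : ℕ} (n p : ℕ) (v : Rd d → ℝ) : ℝ :=
  ∑ k ∈ Finset.range (n + 1), ∑ α : Fin k → Fin d,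
    (eLpNorm (weakD α v) (p : ℝ≥0∞) volume).toReal

/-- `|D^n v| = (∑_{|α| = n} |D_α v|²)^{1/2}`, with generalised derivatives. -/
def weakDNorm {d : ℕ} (n : ℕ) (v : Rd d → ℝ) (x : Rd d) : ℝ :=
  √(∑ α : Fin n → Fin d, weakD α v x ^ 2)

/-! ### The operators at a fixed time -/

/-- `L v = a^{ij} D_{ij} v + b^i D_i v + c v`. -/
def opL {d : ℕ} (a : Fin d → Fin d → Rd d → ℝ) (b : Fin d → Rd d → ℝ) (c : Rd d → ℝ)
    (v : Rd d → ℝ) (x : Rd d) : ℝ :=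
  (∑ i, ∑ j, a i j x * weakD ![i, j] v x) + (∑ i, b i x * weakD ![i] v x) + c x * v x

/-- `J_z v(x) = v(x + η_z(x)) - v(x) - η_z(x) ∇v(x)`. -/
def opJ {d : ℕ} {Z : Type*} (η : Z → Rd d → Rd d) (z : Z) (v : Rd d → ℝ) (x : Rd d) : ℝ :=
  v (x + η z x) - v x - ∑ i, η z x i * weakD ![i] v x

/-- `I_z v(x) = v(x + ξ_z(x)) - v(x)`. -/
def opI {d : ℕ} {Z : Type*} (ξ : Z → Rd d → Rd d) (z : Z) (v : Rd d → ℝ) (x : Rd d) : ℝ :=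
  v (x + ξ z x) - v x

/-- `M v(x) = ∫_Z J_z v(x) μ(dz)`. -/
def opM {d : ℕ} {Z : Type*} [MeasurableSpace Z] (μ : Measure Z) (η : Z → Rd d → Rd d)
    (v : Rd d → ℝ) (x : Rd d) : ℝ :=
  ∫ z, opJ η z v x ∂μ

/-- `N v(x) = ∫_Z I_z v(x) ν(dz)`. -/
def opN {d : ℕ} {Z : Type*} [MeasurableSpace Z] (ν : Measure Z) (ξ : Z → Rd d → Rd d)
    (v : Rd d → ℝ) (x : Rd d) : ℝ :=
  ∫ z, opI ξ z v x ∂ν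

/-- `A = L + M + N + R`. -/
def opA {d p : ℕ} [Fact ((1 : ℝ≥0∞) ≤ (p : ℝ≥0∞))] {Z : Type*} [MeasurableSpace Z]
    (a : Fin d → Fin d → Rd d → ℝ) (b : Fin d → Rd d → ℝ) (c : Rd d → ℝ)
    (μ : Measure Z) (η : Z → Rd d → Rd d) (ν : Measure Z) (ξ : Z → Rd d → Rd d)
    (R : LpSpace d p →L[ℝ] LpSpace d p) (v : LpSpace d p) (x : Rd d) : ℝ :=
  opL a b c v x + opM μ η v x + opN ν ξ v x + R v x

/-! ### The assumptions -/

/-- `f` is Borel on `H_T` and bounded by `K`, and its generalised derivatives in `x` up to order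
`l` are Borel functions on `H_T`, bounded by `K`. -/
structure BoundedDerivs {d : ℕ} {T : ℝ} (l : ℕ) (K : ℝ) (f : TimeInterval T → Rd d → ℝ) :
    Prop where
  measurable : Measurable (Function.uncurry f)
  bound : ∀ t x, |f t x| ≤ K
  deriv : ∀ k, 1 ≤ k → k ≤ l → ∀ α : Fin k → Fin d, ∃ g : TimeInterval T → Rd d → ℝ,
    Measurable (Function.uncurry g) ∧ (∀ t x, |g t x| ≤ K) ∧
      ∀ᵐ t : TimeInterval T, IsWeakDeriv α (f t) (g t)

/-- The assumption on the (possibly degenerate) differential operator. -/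
structure AssumptionL {d : ℕ} {T : ℝ} (m K : ℝ)
    (a : TimeInterval T → Fin d → Fin d → Rd d → ℝ) (b : TimeInterval T → Fin d → Rd d → ℝ)
    (c : TimeInterval T → Rd d → ℝ) : Prop where
  c_bound : BoundedDerivs ⌈m⌉₊ K c
  b_bound : ∀ i, BoundedDerivs (max ⌈m⌉₊ 1) K (fun t => b t i)
  a_bound : ∀ i j, BoundedDerivs (max ⌈m⌉₊ 2) K (fun t => a t i j)
  a_symm : ∀ᵐ q : TimeInterval T × Rd d, ∀ i j, a q.1 i j q.2 = a q.1 j i q.2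
  a_nonneg : ∀ᵐ q : TimeInterval T × Rd d, ∀ y : Fin d → ℝ,
    0 ≤ ∑ i, ∑ j, a q.1 i j q.2 * y i * y j

/-- The assumption on a jump coefficient `η` with majorant `ηbar`, for derivatives up to order
`l`. -/
structure AssumptionJump {d : ℕ} {T : ℝ} {Z : Type*} [MeasurableSpace Z] (l : ℕ) (K : ℝ)
    (ηbar : Z → ℝ) (η : TimeInterval T → Z → Rd d → Rd d) : Prop where
  bar_measurable : Measurable ηbar
  bar_nonneg : ∀ z, 0 ≤ ηbar z
  measurable : Measurable (fun q : (TimeInterval T × Rd d) × Z => η q.1.1 q.2 q.1.2)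
  contDiff : ∀ t z, ContDiff ℝ l (η t z)
  bound : ∀ t z x, ‖η t z x‖ ≤ ηbar z
  deriv_bound : ∀ k, 1 ≤ k → k ≤ l → ∀ t z x,
    classicalDNorm k (η t z) x ≤ min (ηbar z) K
  det_bound : ∀ t z x, ∀ θ ∈ Set.Icc (0 : ℝ) 1,
    K⁻¹ ≤ |(ContinuousLinearMap.id ℝ (Rd d) + θ • fderiv ℝ (η t z) x).det|

/-- The assumption on the zero-order operator: it is bounded by `K` on `C_0^∞` in the norms of
`W^n_p` for `n = 0, 1, ..., ⌈m⌉`. A continuous operator on `L_p` is determined by its values on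
`C_0^∞`. -/
def AssumptionR {d p : ℕ} [Fact ((1 : ℝ≥0∞) ≤ (p : ℝ≥0∞))] {T : ℝ} (m K : ℝ)
    (R : TimeInterval T → LpSpace d p →L[ℝ] LpSpace d p) : Prop :=
  ∀ t, ∀ φ : LpSpace d p, (∃ f, IsTestFunction f ∧ φ =ᵐ[volume] f) →
    ∀ n ≤ ⌈m⌉₊, MemW n p (R t φ) ∧ normW n p (R t φ) ≤ K * normW n p φ

end IntegroDiff

end

noncomputable section

namespace IntegroDiff

/-! ### Classical partial derivatives -/

/-- The partial derivative `D_i f`. -/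
def pd {d : ℕ} (i : Fin d) (f : Rd d → ℝ) (x : Rd d) : ℝ :=
  fderiv ℝ f x (EuclideanSpace.single i (1 : ℝ))

section classical
variable {d : ℕ}

lemma contDiff_pd {r : WithTop ℕ∞} {f : Rd d → ℝ} (hf : ContDiff ℝ (r + 1) f) (i : Fin d) :
    ContDiff ℝ r (pd i f) :=
  (hf.fderiv_right le_rfl).clm_apply contDiff_const

lemma contDiff_classicalD {k r : ℕ} {f : Rd d → ℝ} (hf : ContDiff ℝ (r + k : ℕ) f)
    (α : Fin k → Fin d) : ContDiff ℝ r (classicalD α f) := by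
  have h1 : ContDiff ℝ r (iteratedFDeriv ℝ k f) :=
    hf.iteratedFDeriv_right (by push_cast; exact le_rfl)
  exact (ContinuousMultilinearMap.apply ℝ (fun _ : Fin k => Rd d) ℝ _).contDiff.comp h1

lemma classicalD_zero (α : Fin 0 → Fin d) (f : Rd d → ℝ) : classicalD α f = f := by
  ext x; simp [classicalD]

lemma classicalD_cons {k : ℕ} {f : Rd d → ℝ} (hf : ContDiff ℝ (k + 1 : ℕ) f) (i : Fin d)
    (α : Fin k → Fin d) : classicalD (Fin.cons i α) f = pd i (classicalD α f) := by
  ext x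
  have h1 : DifferentiableAt ℝ (iteratedFDeriv ℝ k f) x :=
    (hf.differentiable_iteratedFDeriv (by exact_mod_cast Nat.lt_succ_self k)) x
  unfold classicalD pd
  rw [iteratedFDeriv_succ_apply_left]
  have h2 := ((ContinuousMultilinearMap.apply ℝ (fun _ : Fin k => Rd d) ℝ
    (fun i => EuclideanSpace.single (α i) (1 : ℝ))).hasFDerivAt.comp x h1.hasFDerivAt).fderiv
  have h3 : (fun x => iteratedFDeriv ℝ k f x (fun i => EuclideanSpace.single (α i) (1 : ℝ))) =
    (ContinuousMultilinearMap.apply ℝ (fun _ : Fin k => Rd d) ℝ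
    (fun i => EuclideanSpace.single (α i) (1 : ℝ))) ∘ iteratedFDeriv ℝ k f := rfl
  rw [h3, h2]
  rfl

lemma classicalD_one {f : Rd d → ℝ} (i : Fin d) : classicalD ![i] f = pd i f := by
  ext x
  unfold classicalD pd
  rw [iteratedFDeriv_succ_apply_right]
  simp

lemma pd_comm {f : Rd d → ℝ} (hf : ContDiff ℝ 2 f) (i j : Fin d) :
    pd i (pd j f) = pd j (pd i f) := by
  ext x
  have hs : IsSymmSndFDerivAt ℝ f x := hf.contDiffAt.isSymmSndFDerivAt (by simp)
  have key : ∀ i j : Fin d, pd i (pd j f) x = fderiv ℝ (fderiv ℝ f) x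
      (EuclideanSpace.single i (1 : ℝ)) (EuclideanSpace.single j (1 : ℝ)) := by
    intro i j
    have h1 : DifferentiableAt ℝ (fderiv ℝ f) x :=
      ((hf.fderiv_right (m := 1) (by norm_num)).differentiable (by norm_num)) x
    unfold pd
    rw [fderiv_clm_apply h1 (by fun_prop)]
    simp
  rw [key, key, hs]

lemma classicalD_pd {k : ℕ} (α : Fin k → Fin d) {f : Rd d → ℝ} (hf : ContDiff ℝ (k + 1 : ℕ) f)
    (i : Fin d) : classicalD α (pd i f) = pd i (classicalD α f) := by
  induction k with
  | zero => simp [classicalD_zero]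
  | succ k ih =>
    obtain ⟨a, β, rfl⟩ : ∃ a β, α = Fin.cons a β := ⟨α 0, Fin.tail α, (Fin.cons_self_tail α).symm⟩
    rw [classicalD_cons (contDiff_pd (by exact_mod_cast hf) i), classicalD_cons (hf.of_le (by norm_cast; omega)),
      ih β (hf.of_le (by norm_cast; omega)), pd_comm]
    exact contDiff_classicalD (r := 2) (hf.of_le (by norm_cast; omega)) β

lemma classicalD_cons' {k : ℕ} {f : Rd d → ℝ} (hf : ContDiff ℝ (k + 1 : ℕ) f) (i : Fin d)
    (α : Fin k → Fin d) : classicalD (Fin.cons i α) f = classicalD α (pd i f) := by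
  rw [classicalD_cons hf, classicalD_pd α hf]

/-- Smooth functions. -/
def Sm (f : Rd d → ℝ) : Prop := ContDiff ℝ ((⊤ : ℕ∞) : WithTop ℕ∞) f

lemma Sm.nat {f : Rd d → ℝ} (hf : Sm f) (n : ℕ) : ContDiff ℝ (n : WithTop ℕ∞) f :=
  hf.of_le (by exact_mod_cast le_top)

lemma Sm.differentiable {f : Rd d → ℝ} (hf : Sm f) : Differentiable ℝ f :=
  (hf.nat 1).differentiable (by simp)

lemma Sm.pd {f : Rd d → ℝ} (hf : Sm f) (i : Fin d) : Sm (pd i f) :=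
  contDiff_pd (r := ((⊤ : ℕ∞) : WithTop ℕ∞)) (by exact hf) i

lemma Sm.cD {k : ℕ} {f : Rd d → ℝ} (hf : Sm f) (α : Fin k → Fin d) : Sm (classicalD α f) := by
  refine contDiff_infty.2 fun r => contDiff_classicalD (hf.nat _) α

lemma Sm.mul {f g : Rd d → ℝ} (hf : Sm f) (hg : Sm g) : Sm (fun x => f x * g x) :=
  ContDiff.mul hf hg

lemma Sm.add {f g : Rd d → ℝ} (hf : Sm f) (hg : Sm g) : Sm (fun x => f x + g x) :=
  ContDiff.add hf hg

lemma Sm.sub {f g : Rd d → ℝ} (hf : Sm f) (hg : Sm g) : Sm (fun x => f x - g x) :=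
  ContDiff.sub hf hg

lemma Sm.sum {ι : Type*} {s : Finset ι} {f : ι → Rd d → ℝ} (hf : ∀ i ∈ s, Sm (f i)) :
    Sm (fun x => ∑ i ∈ s, f i x) :=
  ContDiff.sum hf

lemma Sm.pow {f : Rd d → ℝ} (hf : Sm f) (n : ℕ) : Sm (fun x => f x ^ n) :=
  ContDiff.pow hf n

lemma IsTestFunction.sm {f : Rd d → ℝ} (hf : IsTestFunction f) : Sm f := hf.1

lemma hasCompactSupport_pd {f : Rd d → ℝ} (hf : HasCompactSupport f) (i : Fin d) :
    HasCompactSupport (pd i f) :=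
  (hf.fderiv (𝕜 := ℝ)).comp_left
    (g := fun L : Rd d →L[ℝ] ℝ => L (EuclideanSpace.single i (1 : ℝ))) rfl

lemma hasCompactSupport_classicalD {k : ℕ} {f : Rd d → ℝ} (hf : HasCompactSupport f)
    (α : Fin k → Fin d) : HasCompactSupport (classicalD α f) := by
  exact (hf.iteratedFDeriv (𝕜 := ℝ) k).comp_left
    (g := fun L : ContinuousMultilinearMap ℝ (fun _ : Fin k => Rd d) ℝ =>
      L (fun i => EuclideanSpace.single (α i) (1 : ℝ))) rfl

lemma IsTestFunction.pd {f : Rd d → ℝ} (hf : IsTestFunction f) (i : Fin d) :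
    IsTestFunction (pd i f) := ⟨hf.sm.pd i, hasCompactSupport_pd hf.2 i⟩

lemma IsTestFunction.cD {k : ℕ} {f : Rd d → ℝ} (hf : IsTestFunction f) (α : Fin k → Fin d) :
    IsTestFunction (classicalD α f) := ⟨hf.sm.cD α, hasCompactSupport_classicalD hf.2 α⟩

lemma IsTestFunction.sub {f g : Rd d → ℝ} (hf : IsTestFunction f) (hg : IsTestFunction g) :
    IsTestFunction (fun x => f x - g x) := ⟨hf.1.sub hg.1, hf.2.sub hg.2⟩

lemma IsTestFunction.mul {f g : Rd d → ℝ} (hf : Sm f) (hg : IsTestFunction g) :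
    IsTestFunction (fun x => f x * g x) := ⟨hf.mul hg.1, hg.2.mul_left⟩

lemma pd_mul {f g : Rd d → ℝ} (hf : Differentiable ℝ f) (hg : Differentiable ℝ g) (i : Fin d) :
    pd i (fun x => f x * g x) = fun x => pd i f x * g x + f x * pd i g x := by
  ext x
  unfold pd
  rw [fderiv_fun_mul (hf x) (hg x)]
  simp; ring

lemma pd_add {f g : Rd d → ℝ} (hf : Differentiable ℝ f) (hg : Differentiable ℝ g) (i : Fin d) :
    pd i (fun x => f x + g x) = fun x => pd i f x + pd i g x := by
  ext x
  unfold pd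
  rw [fderiv_fun_add (hf x) (hg x)]
  simp

lemma pd_sub {f g : Rd d → ℝ} (hf : Differentiable ℝ f) (hg : Differentiable ℝ g) (i : Fin d) :
    pd i (fun x => f x - g x) = fun x => pd i f x - pd i g x := by
  ext x
  unfold pd
  rw [fderiv_fun_sub (hf x) (hg x)]
  simp

lemma pd_sum {ι : Type*} {s : Finset ι} {f : ι → Rd d → ℝ}
    (hf : ∀ j ∈ s, Differentiable ℝ (f j)) (i : Fin d) :
    pd i (fun x => ∑ j ∈ s, f j x) = fun x => ∑ j ∈ s, pd i (f j) x := by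
  ext x
  unfold pd
  rw [fderiv_fun_sum (fun j hj => hf j hj x)]
  simp

lemma pd_pow {f : Rd d → ℝ} (hf : Differentiable ℝ f) (n : ℕ) (i : Fin d) :
    pd i (fun x => f x ^ n) = fun x => n * f x ^ (n - 1) * pd i f x := by
  ext x
  unfold pd
  rw [((hf x).hasFDerivAt.pow n).fderiv]
  simp

lemma classicalD_add {k : ℕ} {f g : Rd d → ℝ} (hf : ContDiff ℝ k f) (hg : ContDiff ℝ k g)
    (α : Fin k → Fin d) : classicalD α (fun x => f x + g x) =
      fun x => classicalD α f x + classicalD α g x := by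
  ext x
  unfold classicalD
  rw [show (fun x => f x + g x) = f + g from rfl,
    iteratedFDeriv_add_apply hf.contDiffAt hg.contDiffAt]
  rfl

lemma classicalD_const_mul {k : ℕ} {f : Rd d → ℝ} (hf : ContDiff ℝ k f) (c : ℝ)
    (α : Fin k → Fin d) : classicalD α (fun x => c * f x) = fun x => c * classicalD α f x := by
  ext x
  unfold classicalD
  rw [show (fun x => c * f x) = c • f from rfl, iteratedFDeriv_const_smul_apply hf.contDiffAt]
  rfl

lemma classicalD_sub {k : ℕ} {f g : Rd d → ℝ} (hf : ContDiff ℝ k f) (hg : ContDiff ℝ k g)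
    (α : Fin k → Fin d) : classicalD α (fun x => f x - g x) =
      fun x => classicalD α f x - classicalD α g x := by
  have h1 : (fun x => f x - g x) = fun x => f x + (-1) * g x := by ext; ring
  rw [h1, classicalD_add hf (contDiff_const.mul hg), classicalD_const_mul hg]
  ext; ring

lemma classicalD_sum {k : ℕ} {ι : Type*} {s : Finset ι} {f : ι → Rd d → ℝ}
    (hf : ∀ j ∈ s, ContDiff ℝ k (f j)) (α : Fin k → Fin d) :
    classicalD α (fun x => ∑ j ∈ s, f j x) = fun x => ∑ j ∈ s, classicalD α (f j) x := by
  classical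
  induction s using Finset.induction_on with
  | empty =>
    ext x
    have := classicalD_const_mul (k := k) (f := fun _ : Rd d => (0:ℝ)) contDiff_const 0 α
    simpa using congrFun this x
  | insert a s ha ih =>
    simp only [Finset.sum_insert ha]
    rw [classicalD_add (hf a (Finset.mem_insert_self a s))
      (ContDiff.sum fun j hj => hf j (Finset.mem_insert_of_mem hj)),
      ih (fun j hj => hf j (Finset.mem_insert_of_mem hj))]

end classical

/-! ### Integration by parts -/

section parts
variable {d : ℕ}

lemma integral_mul_pd {f g : Rd d → ℝ} (hf : ContDiff ℝ 1 f) (hg : ContDiff ℝ 1 g)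
    (hc : HasCompactSupport g) (i : Fin d) :
    ∫ x, f x * pd i g x = - ∫ x, pd i f x * g x := by
  have cf : Continuous (pd i f) := (contDiff_pd (r := 0) (by simpa using hf) i).continuous
  have cg : Continuous (pd i g) := (contDiff_pd (r := 0) (by simpa using hg) i).continuous
  refine integral_mul_fderiv_eq_neg_fderiv_mul_of_integrable ?_ ?_ ?_ ?_ ?_
  · exact (cf.mul hg.continuous).integrable_of_hasCompactSupport hc.mul_left
  · exact (hf.continuous.mul cg).integrable_of_hasCompactSupport
      ((hasCompactSupport_pd hc i).mul_left)
  · exact (hf.continuous.mul hg.continuous).integrable_of_hasCompactSupport hc.mul_left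
  · exact fun x _ => hf.differentiable (by simp) x
  · exact fun x _ => hg.differentiable (by simp) x

lemma integral_mul_classicalD {k : ℕ} (α : Fin k → Fin d) {f g : Rd d → ℝ} (hf : ContDiff ℝ k f)
    (hg : IsTestFunction g) :
    ∫ x, f x * classicalD α g x = (-1 : ℝ) ^ k * ∫ x, classicalD α f x * g x := by
  induction k generalizing f with
  | zero => simp [classicalD_zero]
  | succ k ih =>
    obtain ⟨a, β, rfl⟩ : ∃ a β, α = Fin.cons a β := ⟨α 0, Fin.tail α, (Fin.cons_self_tail α).symm⟩
    rw [classicalD_cons (hg.sm.nat _), integral_mul_pd (hf.of_le (by norm_cast; omega))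
      ((hg.cD β).sm.nat 1) (hg.cD β).2, ih β (contDiff_pd (by exact_mod_cast hf) a),
      classicalD_cons' hf, pow_succ]
    ring

lemma isWeakDeriv_classicalD {k : ℕ} (α : Fin k → Fin d) {f : Rd d → ℝ} (hf : ContDiff ℝ k f) :
    IsWeakDeriv α f (classicalD α f) :=
  ⟨hf.continuous.locallyIntegrable,
    (contDiff_classicalD (r := 0) (by simpa using hf) α).continuous.locallyIntegrable,
    fun _ hφ => integral_mul_classicalD α hf hφ⟩

end parts

/-! ### Generalised derivatives -/

section weak
variable {d k : ℕ} {α : Fin k → Fin d} {u u' w w' : Rd d → ℝ}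

lemma IsTestFunction.integrable_mul {φ : Rd d → ℝ} (hφ : IsTestFunction φ)
    (hu : LocallyIntegrable u) : Integrable (fun x => u x * φ x) := by
  have := hu.integrable_smul_right_of_hasCompactSupport hφ.1.continuous hφ.2
  simpa [mul_comm] using this

lemma IsWeakDeriv.ae_unique (h : IsWeakDeriv α u w) (h' : IsWeakDeriv α u w') :
    w =ᵐ[volume] w' := by
  refine ae_eq_of_integral_contDiff_smul_eq h.2.1 h'.2.1 fun g hg hc => ?_
  have h1 := (h.2.2 g ⟨hg, hc⟩).symm.trans (h'.2.2 g ⟨hg, hc⟩)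
  have h2 := mul_left_cancel₀ (pow_ne_zero k (by norm_num : (-1 : ℝ) ≠ 0)) h1
  simpa [mul_comm] using h2

lemma LocallyIntegrable.congr_ae (h : LocallyIntegrable u) (hu : u =ᵐ[volume] u') :
    LocallyIntegrable u' := fun x => by
  obtain ⟨s, hs, hi⟩ := h x
  exact ⟨s, hs, hi.congr_fun_ae (ae_restrict_of_ae hu)⟩

lemma IsWeakDeriv.congr (h : IsWeakDeriv α u w) (hu : u =ᵐ[volume] u') (hw : w =ᵐ[volume] w') :
    IsWeakDeriv α u' w' := by
  refine ⟨LocallyIntegrable.congr_ae h.1 hu, LocallyIntegrable.congr_ae h.2.1 hw, fun φ hφ => ?_⟩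
  rw [integral_congr_ae (g := fun x => u x * classicalD α φ x)
    (by filter_upwards [hu] with x hx; rw [hx]), h.2.2 φ hφ,
    integral_congr_ae (g := fun x => w' x * φ x) (by filter_upwards [hw] with x hx; rw [hx])]

lemma IsWeakDeriv.add (h : IsWeakDeriv α u w) (h' : IsWeakDeriv α u' w') :
    IsWeakDeriv α (fun x => u x + u' x) (fun x => w x + w' x) := by
  refine ⟨h.1.add h'.1, h.2.1.add h'.2.1, fun φ hφ => ?_⟩
  simp only [add_mul]
  rw [integral_add ((hφ.cD α).integrable_mul h.1) ((hφ.cD α).integrable_mul h'.1),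
    integral_add (hφ.integrable_mul h.2.1) (hφ.integrable_mul h'.2.1), h.2.2 φ hφ, h'.2.2 φ hφ]
  ring

lemma IsWeakDeriv.const_mul (h : IsWeakDeriv α u w) (c : ℝ) :
    IsWeakDeriv α (fun x => c * u x) (fun x => c * w x) := by
  refine ⟨h.1.smul c, h.2.1.smul c, fun φ hφ => ?_⟩
  simp only [mul_assoc, integral_const_mul]
  rw [h.2.2 φ hφ]; ring

lemma IsWeakDeriv.sub (h : IsWeakDeriv α u w) (h' : IsWeakDeriv α u' w') :
    IsWeakDeriv α (fun x => u x - u' x) (fun x => w x - w' x) := by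
  have := h.add (h'.const_mul (-1))
  simpa [sub_eq_add_neg] using this

lemma IsWeakDeriv.weakD_spec (h : IsWeakDeriv α u w) : IsWeakDeriv α u (weakD α u) := by
  have he : ∃ w, IsWeakDeriv α u w := ⟨w, h⟩
  rw [weakD, dif_pos he]
  exact he.choose_spec

lemma IsWeakDeriv.weakD_ae (h : IsWeakDeriv α u w) : weakD α u =ᵐ[volume] w :=
  h.weakD_spec.ae_unique h

lemma weakD_classical {f : Rd d → ℝ} (hf : ContDiff ℝ k f) (α : Fin k → Fin d)
    (hu : u =ᵐ[volume] f) : weakD α u =ᵐ[volume] classicalD α f :=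
  ((isWeakDeriv_classicalD α hf).congr hu.symm (Filter.EventuallyEq.refl _ _)).weakD_ae

lemma isWeakDeriv_zero (hu : LocallyIntegrable u) (α : Fin 0 → Fin d) : IsWeakDeriv α u u :=
  ⟨hu, hu, fun φ _ => by simp [classicalD_zero]⟩

end weak

/-! ### Sobolev spaces -/

section sob
variable {d n p : ℕ}

/-- The `W^n_p` norm with values in `[0,∞]`. -/
def sobN {d : ℕ} (n p : ℕ) (v : Rd d → ℝ) : ℝ≥0∞ :=
  ∑ k ∈ Finset.range (n + 1), ∑ α : Fin k → Fin d, eLpNorm (weakD α v) (p : ℝ≥0∞) volume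

lemma MemW.weakD_spec {v : Rd d → ℝ} (hv : MemW n p v) {k : ℕ} (hk : k ≤ n)
    (α : Fin k → Fin d) : IsWeakDeriv α v (weakD α v) :=
  (hv.2 k hk α).choose_spec.1.weakD_spec

lemma MemW.memLp_weakD {v : Rd d → ℝ} (hv : MemW n p v) {k : ℕ} (hk : k ≤ n)
    (α : Fin k → Fin d) : MemLp (weakD α v) (p : ℝ≥0∞) := by
  obtain ⟨w, h1, h2⟩ := hv.2 k hk α
  exact (memLp_congr_ae h1.weakD_ae).2 h2

lemma MemW.sobN_lt_top {v : Rd d → ℝ} (hv : MemW n p v) : sobN n p v < ∞ :=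
  ENNReal.sum_lt_top.2 fun k hk => ENNReal.sum_lt_top.2 fun α _ =>
    (hv.memLp_weakD (by simpa [Nat.lt_succ_iff] using hk) α).eLpNorm_lt_top

lemma MemW.normW_eq {v : Rd d → ℝ} (hv : MemW n p v) : normW n p v = (sobN n p v).toReal := by
  have h : ∀ k ∈ Finset.range (n + 1), ∀ α : Fin k → Fin d,
      eLpNorm (weakD α v) (p : ℝ≥0∞) volume ≠ ∞ := fun k hk α =>
    (hv.memLp_weakD (by simpa [Nat.lt_succ_iff] using hk) α).eLpNorm_lt_top.ne
  rw [normW, sobN, ENNReal.toReal_sum fun k hk => (ENNReal.sum_lt_top.2 fun α _ =>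
    (h k hk α).lt_top).ne]
  refine Finset.sum_congr rfl fun k hk => ?_
  rw [ENNReal.toReal_sum fun α _ => h k hk α]

lemma MemW.ofReal_normW {v : Rd d → ℝ} (hv : MemW n p v) :
    ENNReal.ofReal (normW n p v) = sobN n p v := by
  rw [hv.normW_eq, ENNReal.ofReal_toReal hv.sobN_lt_top.ne]

lemma normW_nonneg (v : Rd d → ℝ) : 0 ≤ normW n p v :=
  Finset.sum_nonneg fun _ _ => Finset.sum_nonneg fun _ _ => ENNReal.toReal_nonneg

lemma MemW.mono {n' : ℕ} {v : Rd d → ℝ} (hv : MemW n p v) (h : n' ≤ n) : MemW n' p v :=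
  ⟨hv.1, fun k hk => hv.2 k (hk.trans h)⟩

lemma eLpNorm_weakD_le_sobN {k : ℕ} (hk : k ≤ n) (α : Fin k → Fin d) (v : Rd d → ℝ) :
    eLpNorm (weakD α v) (p : ℝ≥0∞) volume ≤ sobN n p v := by
  refine le_trans ?_ (Finset.single_le_sum (f := fun k => ∑ α : Fin k → Fin d,
    eLpNorm (weakD α v) (p : ℝ≥0∞) volume) (fun _ _ => zero_le) (Finset.mem_range.2
      (Nat.lt_succ_of_le hk)))
  exact Finset.single_le_sum (f := fun α : Fin k → Fin d =>
    eLpNorm (weakD α v) (p : ℝ≥0∞) volume) (fun _ _ => zero_le) (Finset.mem_univ α)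

lemma sobN_mono {n' : ℕ} (h : n' ≤ n) (v : Rd d → ℝ) : sobN n' p v ≤ sobN n p v :=
  Finset.sum_le_sum_of_subset (Finset.range_subset_range.2 (by omega))

lemma MemW.congr {v v' : Rd d → ℝ} (hv : MemW n p v) (h : v =ᵐ[volume] v') : MemW n p v' :=
  ⟨(memLp_congr_ae h).1 hv.1, fun k hk α => by
    obtain ⟨w, h1, h2⟩ := hv.2 k hk α
    exact ⟨w, h1.congr h (Filter.EventuallyEq.refl _ _), h2⟩⟩

lemma weakD_congr {k : ℕ} {v v' : Rd d → ℝ} (h : v =ᵐ[volume] v') (α : Fin k → Fin d) :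
    weakD α v =ᵐ[volume] weakD α v' := by
  by_cases he : ∃ w, IsWeakDeriv α v w
  · obtain ⟨w, hw⟩ := he
    exact hw.weakD_ae.trans (hw.congr h (Filter.EventuallyEq.refl _ _)).weakD_ae.symm
  · have he' : ¬ ∃ w, IsWeakDeriv α v' w := fun ⟨w, hw⟩ =>
      he ⟨w, hw.congr h.symm (Filter.EventuallyEq.refl _ _)⟩
    rw [weakD, weakD, dif_neg he, dif_neg he']

lemma sobN_congr {v v' : Rd d → ℝ} (h : v =ᵐ[volume] v') : sobN n p v = sobN n p v' :=
  Finset.sum_congr rfl fun _ _ => Finset.sum_congr rfl fun α _ => eLpNorm_congr_ae (weakD_congr h α)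

lemma MemW.add {v v' : Rd d → ℝ} (hv : MemW n p v) (hv' : MemW n p v') :
    MemW n p (fun x => v x + v' x) :=
  ⟨hv.1.add hv'.1, fun _ hk α => ⟨_, (hv.weakD_spec hk α).add (hv'.weakD_spec hk α),
    (hv.memLp_weakD hk α).add (hv'.memLp_weakD hk α)⟩⟩

lemma MemW.sub {v v' : Rd d → ℝ} (hv : MemW n p v) (hv' : MemW n p v') :
    MemW n p (fun x => v x - v' x) :=
  ⟨hv.1.sub hv'.1, fun _ hk α => ⟨_, (hv.weakD_spec hk α).sub (hv'.weakD_spec hk α),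
    (hv.memLp_weakD hk α).sub (hv'.memLp_weakD hk α)⟩⟩

lemma MemW.weakD_add {v v' : Rd d → ℝ} (hv : MemW n p v) (hv' : MemW n p v') {k : ℕ} (hk : k ≤ n)
    (α : Fin k → Fin d) : weakD α (fun x => v x + v' x) =ᵐ[volume]
      fun x => weakD α v x + weakD α v' x :=
  ((hv.weakD_spec hk α).add (hv'.weakD_spec hk α)).weakD_ae

lemma MemW.weakD_sub {v v' : Rd d → ℝ} (hv : MemW n p v) (hv' : MemW n p v') {k : ℕ} (hk : k ≤ n)
    (α : Fin k → Fin d) : weakD α (fun x => v x - v' x) =ᵐ[volume]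
      fun x => weakD α v x - weakD α v' x :=
  ((hv.weakD_spec hk α).sub (hv'.weakD_spec hk α)).weakD_ae

lemma sobN_add_le {v v' : Rd d → ℝ} (hp : 1 ≤ p) (hv : MemW n p v) (hv' : MemW n p v') :
    sobN n p (fun x => v x + v' x) ≤ sobN n p v + sobN n p v' := by
  unfold sobN
  rw [← Finset.sum_add_distrib]
  refine Finset.sum_le_sum fun k hk => ?_
  rw [← Finset.sum_add_distrib]
  refine Finset.sum_le_sum fun α _ => ?_
  have hk' : k ≤ n := by simpa [Nat.lt_succ_iff] using hk
  rw [eLpNorm_congr_ae (hv.weakD_add hv' hk' α)]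
  exact eLpNorm_add_le (hv.memLp_weakD hk' α).1 (hv'.memLp_weakD hk' α).1 (by exact_mod_cast hp)

lemma sobN_sub_le {v v' : Rd d → ℝ} (hp : 1 ≤ p) (hv : MemW n p v) (hv' : MemW n p v') :
    sobN n p (fun x => v x - v' x) ≤ sobN n p v + sobN n p v' := by
  unfold sobN
  rw [← Finset.sum_add_distrib]
  refine Finset.sum_le_sum fun k hk => ?_
  rw [← Finset.sum_add_distrib]
  refine Finset.sum_le_sum fun α _ => ?_
  have hk' : k ≤ n := by simpa [Nat.lt_succ_iff] using hk
  rw [eLpNorm_congr_ae (hv.weakD_sub hv' hk' α)]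
  exact eLpNorm_sub_le (hv.memLp_weakD hk' α).1 (hv'.memLp_weakD hk' α).1 (by exact_mod_cast hp)

lemma IsTestFunction.memLp {f : Rd d → ℝ} (hf : IsTestFunction f) (q : ℝ≥0∞) : MemLp f q :=
  hf.1.continuous.memLp_of_hasCompactSupport hf.2

lemma memW_of_contDiff {f : Rd d → ℝ} (hf : ContDiff ℝ n f)
    (h : ∀ k ≤ n, ∀ α : Fin k → Fin d, MemLp (classicalD α f) (p : ℝ≥0∞)) : MemW n p f :=
  ⟨by simpa [classicalD_zero] using h 0 (Nat.zero_le _) Fin.elim0, fun k hk α =>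
    ⟨_, isWeakDeriv_classicalD α (hf.of_le (by exact_mod_cast hk)), h k hk α⟩⟩

lemma IsTestFunction.memW {f : Rd d → ℝ} (hf : IsTestFunction f) (n p : ℕ) : MemW n p f :=
  memW_of_contDiff (hf.sm.nat n) fun _ _ α => (hf.cD α).memLp _

lemma sobN_classical {f : Rd d → ℝ} (hf : ContDiff ℝ n f) : sobN n p f =
    ∑ k ∈ Finset.range (n + 1), ∑ α : Fin k → Fin d, eLpNorm (classicalD α f) (p : ℝ≥0∞) volume :=
  Finset.sum_congr rfl fun k hk => Finset.sum_congr rfl fun α _ =>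
    eLpNorm_congr_ae (weakD_classical (hf.of_le (by
      have : k ≤ n := by simpa [Nat.lt_succ_iff] using hk
      exact_mod_cast this)) α (Filter.EventuallyEq.refl _ _))

lemma MemLp.locInt {f : Rd d → ℝ} (hp : 1 ≤ p) (hf : MemLp f (p : ℝ≥0∞)) : LocallyIntegrable f :=
  hf.locallyIntegrable (by exact_mod_cast hp)

lemma weakD_zero_ae {v : Rd d → ℝ} (hp : 1 ≤ p) (hv : MemLp v (p : ℝ≥0∞)) (α : Fin 0 → Fin d) :
    weakD α v =ᵐ[volume] v := (isWeakDeriv_zero (MemLp.locInt hp hv) α).weakD_ae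

lemma eLpNorm_le_sobN {v : Rd d → ℝ} (hp : 1 ≤ p) (hv : MemLp v (p : ℝ≥0∞)) :
    eLpNorm v (p : ℝ≥0∞) volume ≤ sobN n p v := by
  rw [← eLpNorm_congr_ae (weakD_zero_ae hp hv Fin.elim0)]
  exact eLpNorm_weakD_le_sobN (Nat.zero_le n) _ v

/-- Generalised derivatives pass to limits in `L_p`. -/
lemma IsWeakDeriv.of_tendsto {k : ℕ} {α : Fin k → Fin d} (hp : 1 ≤ p) {u w : Rd d → ℝ}
    {U W : ℕ → Rd d → ℝ} (hU : ∀ j, MemLp (U j) (p : ℝ≥0∞)) (hW : ∀ j, MemLp (W j) (p : ℝ≥0∞))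
    (hu : MemLp u (p : ℝ≥0∞)) (hw : MemLp w (p : ℝ≥0∞)) (h : ∀ j, IsWeakDeriv α (U j) (W j))
    (h1 : Filter.Tendsto (fun j => eLpNorm (fun x => U j x - u x) (p : ℝ≥0∞) volume) Filter.atTop
      (nhds 0))
    (h2 : Filter.Tendsto (fun j => eLpNorm (fun x => W j x - w x) (p : ℝ≥0∞) volume) Filter.atTop
      (nhds 0)) : IsWeakDeriv α u w := by
  refine ⟨MemLp.locInt hp hu, MemLp.locInt hp hw, fun φ hφ => ?_⟩
  have key : ∀ (V : ℕ → Rd d → ℝ) (v ψ : Rd d → ℝ), IsTestFunction ψ →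
      (∀ j, MemLp (V j) (p : ℝ≥0∞)) → MemLp v (p : ℝ≥0∞) →
      Filter.Tendsto (fun j => eLpNorm (fun x => V j x - v x) (p : ℝ≥0∞) volume) Filter.atTop
      (nhds 0) → Filter.Tendsto (fun j => ∫ x, V j x * ψ x) Filter.atTop
        (nhds (∫ x, v x * ψ x)) := by
    intro V v ψ hψ hV hv hl
    refine tendsto_integral_of_L1' _ (hψ.integrable_mul (MemLp.locInt hp hv)).1
      (Filter.Eventually.of_forall fun j => hψ.integrable_mul (MemLp.locInt hp (hV j))) ?_
    have hle : ∀ j, eLpNorm ((fun x => V j x * ψ x) - fun x => v x * ψ x) 1 volume ≤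
        eLpNorm (fun x => V j x - v x) (p : ℝ≥0∞) volume *
          eLpNorm ψ (ENNReal.conjExponent (p : ℝ≥0∞)) volume := by
      intro j
      have : ((fun x => V j x * ψ x) - fun x => v x * ψ x) =
          (fun x => V j x - v x) • ψ := by
        ext x; simp [sub_mul]
      rw [this]
      have : ENNReal.HolderConjugate (p : ℝ≥0∞) (ENNReal.conjExponent (p : ℝ≥0∞)) :=
        ENNReal.HolderConjugate.conjExponent (by exact_mod_cast hp)
      exact eLpNorm_smul_le_mul_eLpNorm (hψ.memLp 1).1 ((hV j).sub hv).1
    refine tendsto_of_tendsto_of_tendsto_of_le_of_le tendsto_const_nhds ?_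
      (fun _ => zero_le) hle
    have := ENNReal.Tendsto.mul_const hl (Or.inr (hψ.memLp
      (ENNReal.conjExponent (p : ℝ≥0∞))).eLpNorm_lt_top.ne)
    simpa using this
  have e1 := key U u _ (hφ.cD α) hU hu h1
  have e2 := (key W w _ hφ hW hw h2).const_mul ((-1 : ℝ) ^ k)
  exact tendsto_nhds_unique e1 (e2.congr fun j => ((h j).2.2 φ hφ).symm)

end sob

end IntegroDiff

end

noncomputable section

namespace IntegroDiff

/-! ### Inequalities for integrals -/

section minkowski
variable {X Z : Type*} [MeasurableSpace X] [MeasurableSpace Z] {lam : Measure X} {μ : Measure Z}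

lemma eLpNorm_pow_eq {f : X → ℝ} {p : ℕ} (hp : 1 ≤ p) :
    eLpNorm f (p : ℝ≥0∞) lam ^ p = ∫⁻ x, ‖f x‖ₑ ^ p ∂lam := by
  have hp0 : (p : ℝ≥0∞) ≠ 0 := by simp; omega
  rw [eLpNorm_eq_lintegral_rpow_enorm_toReal hp0 (by simp)]
  simp only [ENNReal.toReal_natCast, ENNReal.rpow_natCast]
  rw [← ENNReal.rpow_natCast, ← ENNReal.rpow_mul, one_div, inv_mul_cancel₀ (by
    have : (1 : ℝ) ≤ p := by exact_mod_cast hp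
    positivity), ENNReal.rpow_one]

/-- Minkowski's integral inequality, for a family with prescribed bounds of its norms. -/
lemma lintegral_pow_lintegral_le [SFinite lam] [SFinite μ] {F : X → Z → ℝ≥0∞}
    (hF : Measurable (Function.uncurry F)) {h : Z → ℝ≥0∞} (hh : Measurable h)
    (hfin : ∫⁻ z, h z ∂μ ≠ ∞) {p : ℕ} (hp : 1 ≤ p)
    (hb : ∀ᵐ z ∂μ, ∫⁻ x, F x z ^ p ∂lam ≤ h z ^ p) :
    ∫⁻ x, (∫⁻ z, F x z ∂μ) ^ p ∂lam ≤ (∫⁻ z, h z ∂μ) ^ p := by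
  have hp0 : (0 : ℝ) < p := by exact_mod_cast hp
  have h1 : ∀ᵐ x ∂lam, ∀ᵐ z ∂μ, h z = 0 → F x z = 0 := by
    have hm : MeasurableSet {q : X × Z | h q.2 = 0 → F q.1 q.2 = 0} := by
      have : {q : X × Z | h q.2 = 0 → F q.1 q.2 = 0} =
          {q : X × Z | h q.2 = 0}ᶜ ∪ {q : X × Z | F q.1 q.2 = 0} := by
        ext q; simp [imp_iff_not_or]
      rw [this]
      exact ((hh.comp measurable_snd) (measurableSet_singleton 0)).compl.union
        (hF (measurableSet_singleton 0))
    refine (Measure.ae_ae_comm (p := fun x z => h z = 0 → F x z = 0) hm).2 ?_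
    filter_upwards [hb] with z hz
    by_cases h0 : h z = 0
    · have h2 : ∫⁻ x, F x z ^ p ∂lam = 0 := by
        rw [h0, zero_pow (by omega)] at hz
        exact le_antisymm hz zero_le
      have h3 : Measurable fun x => F x z ^ p :=
        (hF.comp (measurable_id.prodMk measurable_const)).pow_const p
      filter_upwards [(lintegral_eq_zero_iff h3).1 h2] with x hx _
      simpa using (pow_eq_zero_iff (by omega : p ≠ 0)).1 hx
    · exact Filter.Eventually.of_forall fun _ hz => absurd hz h0
  have hfin' : ∀ᵐ z ∂μ, h z < ∞ := ae_lt_top hh hfin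
  have h4 : ∀ᵐ x ∂lam, (∫⁻ z, F x z ∂μ) ^ p ≤
      (∫⁻ z, F x z ^ p * (h z ^ (p - 1))⁻¹ ∂μ) * (∫⁻ z, h z ∂μ) ^ (p - 1) := by
    filter_upwards [h1] with x hx
    have hFx : Measurable fun z => F x z := hF.comp (measurable_const.prodMk measurable_id)
    have h5 : ∫⁻ z, F x z ∂μ ≤ ∫⁻ z, (F x z ^ p * (h z ^ (p - 1))⁻¹) ^ (1 / (p : ℝ)) *
        h z ^ (((p - 1 : ℕ) : ℝ) / p) ∂μ := by
      refine lintegral_mono_ae ?_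
      filter_upwards [hx, hfin'] with z hz hz'
      by_cases h0 : h z = 0
      · rw [hz h0]; exact zero_le
      · have e1 : h z ^ (((p - 1 : ℕ) : ℝ) / p) = (h z ^ (p - 1)) ^ (1 / (p : ℝ)) := by
          rw [← ENNReal.rpow_natCast, ← ENNReal.rpow_mul]; congr 1; ring
        have e2 : (h z ^ (p - 1))⁻¹ * h z ^ (p - 1) = 1 :=
          ENNReal.inv_mul_cancel (pow_ne_zero _ h0) (ENNReal.pow_ne_top hz'.ne)
        rw [e1, ← ENNReal.mul_rpow_of_nonneg _ _ (by positivity), mul_assoc, e2, mul_one,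
          ← ENNReal.rpow_natCast, ← ENNReal.rpow_mul, mul_one_div_cancel hp0.ne', ENNReal.rpow_one]
    have h6 := h5.trans (ENNReal.lintegral_mul_norm_pow_le (μ := μ)
      ((hFx.pow_const p).mul (hh.pow_const (p - 1)).inv).aemeasurable hh.aemeasurable
      (p := 1 / (p : ℝ)) (q := ((p - 1 : ℕ) : ℝ) / p) (by positivity) (by positivity)
      (by rw [Nat.cast_sub hp]; field_simp; simp))
    calc (∫⁻ z, F x z ∂μ) ^ p ≤ _ := pow_le_pow_left' h6 p
      _ = _ := by
        rw [mul_pow, ← ENNReal.rpow_natCast, ← ENNReal.rpow_mul, one_div_mul_cancel hp0.ne',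
          ENNReal.rpow_one, ← ENNReal.rpow_natCast, ← ENNReal.rpow_mul, div_mul_cancel₀ _ hp0.ne',
          ENNReal.rpow_natCast]
        rfl
  have hm2 : Measurable fun q : X × Z => F q.1 q.2 ^ p * (h q.2 ^ (p - 1))⁻¹ :=
    (hF.pow_const p).mul ((hh.comp measurable_snd).pow_const (p - 1)).inv
  calc ∫⁻ x, (∫⁻ z, F x z ∂μ) ^ p ∂lam
      ≤ ∫⁻ x, (∫⁻ z, F x z ^ p * (h z ^ (p - 1))⁻¹ ∂μ) * (∫⁻ z, h z ∂μ) ^ (p - 1) ∂lam :=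
        lintegral_mono_ae h4
    _ = (∫⁻ x, ∫⁻ z, F x z ^ p * (h z ^ (p - 1))⁻¹ ∂μ ∂lam) * (∫⁻ z, h z ∂μ) ^ (p - 1) :=
        lintegral_mul_const' _ _ (ENNReal.pow_ne_top hfin)
    _ = (∫⁻ z, (∫⁻ x, F x z ^ p ∂lam) * (h z ^ (p - 1))⁻¹ ∂μ) * (∫⁻ z, h z ∂μ) ^ (p - 1) := by
        rw [lintegral_lintegral_swap hm2.aemeasurable]
        congr 1
        refine lintegral_congr fun z => ?_
        exact lintegral_mul_const _
          ((hF.comp (measurable_id.prodMk measurable_const)).pow_const p)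
    _ ≤ (∫⁻ z, h z ∂μ) * (∫⁻ z, h z ∂μ) ^ (p - 1) := by
        gcongr ?_ * _
        refine lintegral_mono_ae ?_
        filter_upwards [hb, hfin'] with z hz hz'
        refine (mul_le_mul_left hz _).trans ?_
        by_cases h0 : h z = 0
        · rw [h0, zero_pow (by omega)]; simp
        · obtain ⟨r, rfl⟩ : ∃ r, p = r + 1 := ⟨p - 1, by omega⟩
          rw [Nat.add_sub_cancel, pow_succ, mul_comm (h z ^ r), mul_assoc,
            ENNReal.mul_inv_cancel (pow_ne_zero _ h0) (ENNReal.pow_ne_top hz'.ne), mul_one]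
    _ = (∫⁻ z, h z ∂μ) ^ p := by
        rw [← pow_succ']; congr 1; omega

/-- Minkowski's integral inequality for a family `F(·, z)` of functions in `L_p`. -/
lemma minkowski_integral [SFinite lam] [SFinite μ] {F : X × Z → ℝ}
    (hF : AEStronglyMeasurable F (lam.prod μ)) {h : Z → ℝ≥0∞} (hh : Measurable h)
    (hfin : ∫⁻ z, h z ∂μ ≠ ∞) {p : ℕ} (hp : 1 ≤ p)
    (hb : ∀ᵐ z ∂μ, eLpNorm (fun x => F (x, z)) (p : ℝ≥0∞) lam ≤ h z) :
    (∀ᵐ x ∂lam, Integrable (fun z => F (x, z)) μ) ∧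
    MemLp (fun x => ∫ z, F (x, z) ∂μ) (p : ℝ≥0∞) lam ∧
    eLpNorm (fun x => ∫ z, F (x, z) ∂μ) (p : ℝ≥0∞) lam ≤ ∫⁻ z, h z ∂μ := by
  set G := hF.mk F with hG
  have hGm : Measurable G := hF.stronglyMeasurable_mk.measurable
  have hFG : F =ᵐ[lam.prod μ] G := hF.ae_eq_mk
  have e1 : ∀ᵐ x ∂lam, ∀ᵐ z ∂μ, F (x, z) = G (x, z) := Measure.ae_ae_of_ae_prod hFG
  have e2 : ∀ᵐ z ∂μ, ∀ᵐ x ∂lam, F (x, z) = G (x, z) :=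
    Measure.ae_ae_of_ae_prod ((Measure.measurePreserving_swap (μ := μ)
      (ν := lam)).quasiMeasurePreserving.ae hFG)
  have hb' : ∀ᵐ z ∂μ, ∫⁻ x, ‖G (x, z)‖ₑ ^ p ∂lam ≤ h z ^ p := by
    filter_upwards [hb, e2] with z hz hz2
    rw [← eLpNorm_pow_eq (f := fun x => G (x, z)) hp]
    refine pow_le_pow_left' ?_ p
    rwa [eLpNorm_congr_ae (f := fun x => G (x, z)) (g := fun x => F (x, z))
      (by filter_upwards [hz2] with x hx; exact hx.symm)]
  have key := lintegral_pow_lintegral_le (lam := lam) (μ := μ) (F := fun x z => ‖G (x, z)‖ₑ)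
    hGm.enorm hh hfin hp hb'
  have hfin2 : ∀ᵐ x ∂lam, ∫⁻ z, ‖G (x, z)‖ₑ ∂μ < ∞ := by
    have hm : Measurable fun x => (∫⁻ z, ‖G (x, z)‖ₑ ∂μ) ^ p :=
      (hGm.enorm.lintegral_prod_right').pow_const p
    filter_upwards [ae_lt_top hm (key.trans_lt (ENNReal.pow_lt_top hfin.lt_top)).ne] with x hx
    by_contra h0
    rw [not_lt, top_le_iff] at h0
    rw [h0, ENNReal.top_pow (by omega)] at hx
    exact lt_irrefl _ hx
  have hint : ∀ᵐ x ∂lam, Integrable (fun z => F (x, z)) μ := by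
    filter_upwards [e1, hfin2] with x hx hx2
    have : Integrable (fun z => G (x, z)) μ :=
      ⟨(hGm.comp (measurable_const.prodMk measurable_id)).aestronglyMeasurable, hx2⟩
    exact this.congr (by filter_upwards [hx] with z hz; exact hz.symm)
  have hle : eLpNorm (fun x => ∫ z, F (x, z) ∂μ) (p : ℝ≥0∞) lam ≤ ∫⁻ z, h z ∂μ := by
    have h1 : eLpNorm (fun x => ∫ z, F (x, z) ∂μ) (p : ℝ≥0∞) lam ^ p ≤ (∫⁻ z, h z ∂μ) ^ p := by
      rw [eLpNorm_pow_eq hp]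
      refine le_trans (lintegral_mono_ae ?_) key
      filter_upwards [e1] with x hx
      refine pow_le_pow_left' ?_ p
      rw [integral_congr_ae hx]
      exact enorm_integral_le_lintegral_enorm _
    exact le_of_not_gt fun h2 => not_lt_of_ge h1 (by gcongr)
  exact ⟨hint, ⟨hF.integral_prod_right', hle.trans_lt hfin.lt_top⟩, hle⟩

end minkowski

section holder
variable {X : Type*} [MeasurableSpace X] {lam : Measure X}

lemma lintegral_pow_mul_mul_le {p : ℕ} (hp : 2 ≤ p) {U V W : X → ℝ} (hU : AEStronglyMeasurable U lam)
    (hV : AEStronglyMeasurable V lam) (hW : AEStronglyMeasurable W lam) :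
    ∫⁻ x, ‖U x‖ₑ ^ (p - 2) * ‖V x‖ₑ * ‖W x‖ₑ ∂lam ≤
      eLpNorm U (p : ℝ≥0∞) lam ^ (p - 2) * eLpNorm V (p : ℝ≥0∞) lam *
        eLpNorm W (p : ℝ≥0∞) lam := by
  have hp0 : (0 : ℝ) < p := by exact_mod_cast (by omega : 0 < p)
  have h := ENNReal.lintegral_prod_norm_pow_le (μ := lam) (Finset.univ : Finset (Fin 3))
    (f := ![fun x => ‖U x‖ₑ ^ p, fun x => ‖V x‖ₑ ^ p, fun x => ‖W x‖ₑ ^ p])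
    (p := ![((p - 2 : ℕ) : ℝ) / p, 1 / p, 1 / p])
    (by
      intro i _
      fin_cases i
      exacts [hU.enorm.pow_const p, hV.enorm.pow_const p, hW.enorm.pow_const p])
    (by simp [Fin.sum_univ_three, Nat.cast_sub hp]; field_simp; ring)
    (by intro i _; fin_cases i <;> simp; positivity)
  have e : ∀ (a : ℝ≥0∞) (r : ℕ), (a ^ p) ^ ((r : ℝ) / p) = a ^ r := by
    intro a r
    rw [← ENNReal.rpow_natCast, ← ENNReal.rpow_mul, mul_div_cancel₀ _ hp0.ne', ENNReal.rpow_natCast]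
  have e1 : ∀ (a : ℝ≥0∞), (a ^ p) ^ (1 / (p : ℝ)) = a := by
    intro a; have := e a 1; simpa using this
  simp only [Fin.prod_univ_three, Matrix.cons_val_zero, Matrix.cons_val_one, Matrix.cons_val] at h
  simpa only [e, e1, ← eLpNorm_pow_eq (lam := lam) (show 1 ≤ p by omega)] using h

/-- The expression `|u|^(2q-2) u_α` for a finite family `u`. -/
def vpow {ι : Type*} [Fintype ι] (q : ℕ) (u : ι → ℝ) (α : ι) : ℝ := (∑ β, u β ^ 2) ^ (q - 1) * u α

variable {ι : Type*} [Fintype ι]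

lemma sum_sq_le_sq_sum_abs (u : ι → ℝ) : ∑ β, u β ^ 2 ≤ (∑ β, |u β|) ^ 2 := by
  have := Finset.sum_sq_le_sq_sum_of_nonneg (s := Finset.univ) (f := fun β => |u β|)
    (fun _ _ => abs_nonneg _)
  simpa [sq_abs] using this

lemma abs_le_sum_abs (u : ι → ℝ) (α : ι) : |u α| ≤ ∑ β, |u β| :=
  Finset.single_le_sum (f := fun β => |u β|) (fun _ _ => abs_nonneg _) (Finset.mem_univ α)

lemma abs_vpow_le {q : ℕ} (hq : 1 ≤ q) (u : ι → ℝ) (α : ι) :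
    |vpow q u α| ≤ (∑ β, |u β|) ^ (2 * q - 2) * ∑ β, |u β| := by
  have h0 : 0 ≤ ∑ β, u β ^ 2 := Finset.sum_nonneg fun _ _ => sq_nonneg _
  rw [vpow, abs_mul, abs_of_nonneg (pow_nonneg h0 _)]
  refine mul_le_mul ?_ (abs_le_sum_abs u α) (abs_nonneg _) (pow_nonneg
    (Finset.sum_nonneg fun _ _ => abs_nonneg _) _)
  calc (∑ β, u β ^ 2) ^ (q - 1) ≤ ((∑ β, |u β|) ^ 2) ^ (q - 1) :=
        pow_le_pow_left₀ h0 (sum_sq_le_sq_sum_abs u) _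
    _ = _ := by rw [← pow_mul]; congr 1; omega

lemma abs_vpow_sub_le {q : ℕ} (hq : 1 ≤ q) (u w : ι → ℝ) (α : ι) :
    |vpow q u α - vpow q w α| ≤
      q * (((∑ β, |u β|) + ∑ β, |w β|) ^ (2 * q - 2) * ∑ β, |u β - w β|) := by
  set A := ∑ β, u β ^ 2
  set B := ∑ β, w β ^ 2
  set U := ∑ β, |u β| with hU
  set V := ∑ β, |w β| with hV
  set D := ∑ β, |u β - w β| with hD
  have hA0 : 0 ≤ A := Finset.sum_nonneg fun _ _ => sq_nonneg _
  have hB0 : 0 ≤ B := Finset.sum_nonneg fun _ _ => sq_nonneg _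
  have hU0 : 0 ≤ U := Finset.sum_nonneg fun _ _ => abs_nonneg _
  have hV0 : 0 ≤ V := Finset.sum_nonneg fun _ _ => abs_nonneg _
  have hD0 : 0 ≤ D := Finset.sum_nonneg fun _ _ => abs_nonneg _
  have hAU : A ≤ (U + V) ^ 2 := (sum_sq_le_sq_sum_abs u).trans
    (pow_le_pow_left₀ hU0 (by linarith) 2)
  have hBV : B ≤ (U + V) ^ 2 := (sum_sq_le_sq_sum_abs w).trans
    (pow_le_pow_left₀ hV0 (by linarith) 2)
  have hAB : |A - B| ≤ D * (U + V) := by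
    have : A - B = ∑ β, (u β - w β) * (u β + w β) := by
      rw [← Finset.sum_sub_distrib]; exact Finset.sum_congr rfl fun β _ => by ring
    rw [this, hD, Finset.sum_mul]
    refine (Finset.abs_sum_le_sum_abs _ _).trans (Finset.sum_le_sum fun β _ => ?_)
    rw [abs_mul]
    refine mul_le_mul_of_nonneg_left ((abs_add_le _ _).trans
      (add_le_add (abs_le_sum_abs u β) (abs_le_sum_abs w β))) (abs_nonneg _)
  obtain ⟨r, rfl⟩ : ∃ r, q = r + 1 := ⟨q - 1, by omega⟩
  have e : 2 * (r + 1) - 2 = 2 * r := by omega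
  rw [e]
  simp only [vpow, Nat.add_sub_cancel]
  have h1 : A ^ r * u α - B ^ r * w α = (A ^ r - B ^ r) * u α + B ^ r * (u α - w α) := by ring
  have h2 : |A ^ r - B ^ r| * |u α| ≤ r * ((U + V) ^ (2 * r) * D) := by
    rcases Nat.eq_zero_or_pos r with rfl | hr
    · simp
    · have h3 : max |A| |B| ^ (r - 1) ≤ (U + V) ^ (2 * (r - 1)) := by
        rw [pow_mul]
        refine pow_le_pow_left₀ (le_max_of_le_left (abs_nonneg _)) ?_ _
        rw [abs_of_nonneg hA0, abs_of_nonneg hB0]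
        exact max_le hAU hBV
      have h4 : |u α| ≤ U + V := (abs_le_sum_abs u α).trans (by linarith)
      calc |A ^ r - B ^ r| * |u α| ≤ (D * (U + V) * r * (U + V) ^ (2 * (r - 1))) * (U + V) := by
            refine mul_le_mul ((abs_pow_sub_pow_le ..).trans ?_) h4 (abs_nonneg _) (by positivity)
            gcongr
        _ = r * ((U + V) ^ (2 * (r - 1) + 2) * D) := by rw [pow_add]; ring
        _ = _ := by congr 3; omega
  have h5 : |B ^ r| * |u α - w α| ≤ (U + V) ^ (2 * r) * D := by
    rw [abs_of_nonneg (pow_nonneg hB0 r), pow_mul]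
    exact mul_le_mul (pow_le_pow_left₀ hB0 hBV r) (abs_le_sum_abs (fun β => u β - w β) α)
      (abs_nonneg _) (by positivity)
  change |A ^ r * u α - B ^ r * w α| ≤ _
  rw [h1]
  refine (abs_add_le _ _).trans ?_
  rw [abs_mul, abs_mul]
  push_cast
  linarith

lemma eLpNorm_sum_abs_le {p : ℝ≥0∞} (hp : 1 ≤ p) {u : ι → X → ℝ} (hu : ∀ α, AEStronglyMeasurable (u α) lam) :
    eLpNorm (fun x => ∑ β, |u β x|) p lam ≤ ∑ β, eLpNorm (u β) p lam := by
  have h := eLpNorm_sum_le (s := Finset.univ) (f := fun β x => |u β x|)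
    (fun β _ => (hu β).norm) hp
  have e : (∑ β, fun x => |u β x|) = fun x => ∑ β, |u β x| := by ext x; simp
  rw [e] at h
  refine h.trans (Finset.sum_le_sum fun β _ => le_of_eq ?_)
  exact eLpNorm_norm (u β)

lemma aesm_sum_abs {u : ι → X → ℝ} (hu : ∀ α, AEStronglyMeasurable (u α) lam) :
    AEStronglyMeasurable (fun x => ∑ β, |u β x|) lam := by
  have := Finset.univ.aestronglyMeasurable_sum (f := fun β x => |u β x|) (μ := lam)
    fun β _ => (hu β).norm
  convert this using 1
  ext x; simp

lemma aesm_vpow {q : ℕ} {u : ι → X → ℝ} (hu : ∀ α, AEStronglyMeasurable (u α) lam) (α : ι) :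
    AEStronglyMeasurable (fun x => vpow q (fun β => u β x) α) lam := by
  have h1 : AEStronglyMeasurable (fun x => ∑ β, u β x ^ 2) lam := by
    have := Finset.univ.aestronglyMeasurable_sum (f := fun β x => u β x ^ 2) (μ := lam)
      fun β _ => (hu β).pow 2
    convert this using 1
    ext x; simp
  exact (h1.pow _).mul (hu α)

lemma lintegral_vpow_mul_le {q : ℕ} (hq : 1 ≤ q) {u : ι → X → ℝ}
    (hu : ∀ α, AEStronglyMeasurable (u α) lam) {g : X → ℝ} (hg : AEStronglyMeasurable g lam)
    (α : ι) :
    ∫⁻ x, ‖vpow q (fun β => u β x) α * g x‖ₑ ∂lam ≤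
      (∑ β, eLpNorm (u β) ((2 * q : ℕ) : ℝ≥0∞) lam) ^ (2 * q - 1) *
        eLpNorm g ((2 * q : ℕ) : ℝ≥0∞) lam := by
  have hU := aesm_sum_abs hu
  calc ∫⁻ x, ‖vpow q (fun β => u β x) α * g x‖ₑ ∂lam
      ≤ ∫⁻ x, ‖∑ β, |u β x|‖ₑ ^ (2 * q - 2) * ‖∑ β, |u β x|‖ₑ * ‖g x‖ₑ ∂lam := by
        refine lintegral_mono fun x => ?_
        rw [enorm_mul _ (g x), ← enorm_pow, ← enorm_mul ((∑ β, |u β x|) ^ (2 * q - 2))]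
        refine mul_le_mul_left ((enorm_le_iff_norm_le (E := ℝ) (F := ℝ)).2 ?_) _
        exact (abs_vpow_le hq _ α).trans (le_abs_self _)
    _ ≤ _ := lintegral_pow_mul_mul_le (by omega) hU hU hg
    _ ≤ _ := by
        rw [← pow_succ, show 2 * q - 2 + 1 = 2 * q - 1 by omega]
        gcongr
        exact eLpNorm_sum_abs_le (by exact_mod_cast (by omega : 1 ≤ 2 * q)) hu

lemma vpow_mul_integrable {q : ℕ} (hq : 1 ≤ q) {u : ι → X → ℝ}
    (hu : ∀ α, MemLp (u α) ((2 * q : ℕ) : ℝ≥0∞) lam) {g : X → ℝ}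
    (hg : MemLp g ((2 * q : ℕ) : ℝ≥0∞) lam) (α : ι) :
    Integrable (fun x => vpow q (fun β => u β x) α * g x) lam :=
  ⟨(aesm_vpow (fun β => (hu β).1) α).mul hg.1,
    (lintegral_vpow_mul_le hq (fun β => (hu β).1) hg.1 α).trans_lt (ENNReal.mul_lt_top
      (ENNReal.pow_lt_top (ENNReal.sum_lt_top.2 fun β _ => (hu β).eLpNorm_lt_top))
        hg.eLpNorm_lt_top)⟩

lemma abs_integral_vpow_mul_le {q : ℕ} (hq : 1 ≤ q) {u : ι → X → ℝ}
    (hu : ∀ α, MemLp (u α) ((2 * q : ℕ) : ℝ≥0∞) lam) {g : X → ℝ}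
    (hg : MemLp g ((2 * q : ℕ) : ℝ≥0∞) lam) (α : ι) {A B : ℝ} (hA : 0 ≤ A) (hB : 0 ≤ B)
    (h1 : ∑ β, eLpNorm (u β) ((2 * q : ℕ) : ℝ≥0∞) lam ≤ ENNReal.ofReal A)
    (h2 : eLpNorm g ((2 * q : ℕ) : ℝ≥0∞) lam ≤ ENNReal.ofReal B) :
    |∫ x, vpow q (fun β => u β x) α * g x ∂lam| ≤ A ^ (2 * q - 1) * B := by
  have h := (enorm_integral_le_lintegral_enorm (μ := lam)
    (fun x => vpow q (fun β => u β x) α * g x)).trans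
    (lintegral_vpow_mul_le hq (fun β => (hu β).1) hg.1 α)
  have h' : ‖∫ x, vpow q (fun β => u β x) α * g x ∂lam‖ₑ ≤
      ENNReal.ofReal (A ^ (2 * q - 1) * B) := by
    rw [ENNReal.ofReal_mul (by positivity), ENNReal.ofReal_pow hA]
    exact h.trans (by gcongr)
  rwa [Real.enorm_eq_ofReal_abs, ENNReal.ofReal_le_ofReal_iff (by positivity)] at h'

open Filter in
/-- The functional `(u, g) ↦ ∫ |u|^(2q-2) u_α g` is continuous in `L_{2q}`. -/
lemma tendsto_integral_vpow_mul {q : ℕ} (hq : 1 ≤ q) {u : ι → X → ℝ} {U : ℕ → ι → X → ℝ}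
    (hu : ∀ α, MemLp (u α) ((2 * q : ℕ) : ℝ≥0∞) lam)
    (hU : ∀ j α, MemLp (U j α) ((2 * q : ℕ) : ℝ≥0∞) lam) {g : X → ℝ} {G : ℕ → X → ℝ}
    (hg : MemLp g ((2 * q : ℕ) : ℝ≥0∞) lam) (hG : ∀ j, MemLp (G j) ((2 * q : ℕ) : ℝ≥0∞) lam)
    (h1 : ∀ α, Tendsto (fun j => eLpNorm (fun x => U j α x - u α x) ((2 * q : ℕ) : ℝ≥0∞) lam) atTop
      (nhds 0))
    (h2 : Tendsto (fun j => eLpNorm (fun x => G j x - g x) ((2 * q : ℕ) : ℝ≥0∞) lam) atTop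
      (nhds 0)) (α : ι) :
    Tendsto (fun j => ∫ x, vpow q (fun β => U j β x) α * G j x ∂lam) atTop
      (nhds (∫ x, vpow q (fun β => u β x) α * g x ∂lam)) := by
  set p : ℝ≥0∞ := ((2 * q : ℕ) : ℝ≥0∞) with hpdef
  have hp : 1 ≤ p := by rw [hpdef]; exact_mod_cast (by omega : 1 ≤ 2 * q)
  refine tendsto_integral_of_L1 _ (vpow_mul_integrable hq hu hg α).1
    (Eventually.of_forall fun j => vpow_mul_integrable hq (hU j) (hG j) α) ?_
  set A := ∑ β, eLpNorm (u β) p lam with hA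
  have hAt : A ≠ ∞ := (ENNReal.sum_lt_top.2 fun β _ => (hu β).eLpNorm_lt_top).ne
  set dj : ℕ → ℝ≥0∞ := fun j => ∑ β, eLpNorm (fun x => U j β x - u β x) p lam with hdj
  set ej : ℕ → ℝ≥0∞ := fun j => eLpNorm (fun x => G j x - g x) p lam with hej
  have hdj0 : Tendsto dj atTop (nhds 0) := by
    have := tendsto_finsetSum (Finset.univ : Finset ι) fun β _ => h1 β
    simpa using this
  have hsub : ∀ j β, AEStronglyMeasurable (fun x => U j β x - u β x) lam := fun j β =>
    ((hU j β).sub (hu β)).1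
  have hgsub : ∀ j, AEStronglyMeasurable (fun x => G j x - g x) lam := fun j => ((hG j).sub hg).1
  have hUj : ∀ j β, eLpNorm (U j β) p lam ≤
      eLpNorm (fun x => U j β x - u β x) p lam + eLpNorm (u β) p lam := by
    intro j β
    have h := eLpNorm_add_le (hsub j β) (hu β).1 hp
    have e : (fun x => U j β x - u β x) + u β = U j β := by ext x; simp
    rwa [e] at h
  have hGj : ∀ j, eLpNorm (G j) p lam ≤ ej j + eLpNorm g p lam := by
    intro j
    have h := eLpNorm_add_le (hgsub j) hg.1 hp
    have e : (fun x => G j x - g x) + g = G j := by ext x; simp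
    rwa [e] at h
  have hle : ∀ j, ∫⁻ x, ‖vpow q (fun β => U j β x) α * G j x -
      vpow q (fun β => u β x) α * g x‖ₑ ∂lam ≤
      q * ((dj j + A + A) ^ (2 * q - 2) * dj j * (ej j + eLpNorm g p lam)) +
        A ^ (2 * q - 1) * ej j := by
    intro j
    have ha : AEStronglyMeasurable (fun x => (∑ β, |U j β x|) + ∑ β, |u β x|) lam :=
      (aesm_sum_abs fun β => (hU j β).1).add (aesm_sum_abs fun β => (hu β).1)
    have hb : AEStronglyMeasurable (fun x => ∑ β, |U j β x - u β x|) lam :=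
      aesm_sum_abs (u := fun β x => U j β x - u β x) (hsub j)
    have hpt : ∀ x, ‖vpow q (fun β => U j β x) α * G j x - vpow q (fun β => u β x) α * g x‖ₑ ≤
        q * (‖(∑ β, |U j β x|) + ∑ β, |u β x|‖ₑ ^ (2 * q - 2) * ‖∑ β, |U j β x - u β x|‖ₑ *
          ‖G j x‖ₑ) + ‖vpow q (fun β => u β x) α * (G j x - g x)‖ₑ := by
      intro x
      have e : vpow q (fun β => U j β x) α * G j x - vpow q (fun β => u β x) α * g x =
          (vpow q (fun β => U j β x) α - vpow q (fun β => u β x) α) * G j x +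
          vpow q (fun β => u β x) α * (G j x - g x) := by ring
      rw [e]
      refine (enorm_add_le _ _).trans (add_le_add ?_ le_rfl)
      rw [enorm_mul _ (G j x), ← mul_assoc, ← enorm_pow, ← enorm_mul (_ ^ (2 * q - 2))]
      refine mul_le_mul' ?_ le_rfl
      have := abs_vpow_sub_le hq (fun β => U j β x) (fun β => u β x) α
      have h3 : ((q : ℝ≥0∞)) = ‖(q : ℝ)‖ₑ := by simp
      rw [h3, ← enorm_mul (q : ℝ)]
      exact enorm_le_iff_norm_le.2 (this.trans (le_abs_self _))
    have hm : AEMeasurable (fun x => ‖(∑ β, |U j β x|) + ∑ β, |u β x|‖ₑ ^ (2 * q - 2) *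
        ‖∑ β, |U j β x - u β x|‖ₑ * ‖G j x‖ₑ) lam :=
      ((ha.enorm.pow_const _).mul hb.enorm).mul (hG j).1.enorm
    refine (lintegral_mono hpt).trans ?_
    rw [lintegral_add_left' (hm.const_mul _)]
    refine add_le_add ?_ (lintegral_vpow_mul_le hq (fun β => (hu β).1) (hgsub j) α)
    rw [lintegral_const_mul'' _ hm]
    refine mul_le_mul_right ((lintegral_pow_mul_mul_le (p := 2 * q) (by omega) ha hb
      (hG j).1).trans ?_) _
    have h4 : eLpNorm (fun x => (∑ β, |U j β x|) + ∑ β, |u β x|) p lam ≤ dj j + A + A := by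
      refine (eLpNorm_add_le (aesm_sum_abs fun β => (hU j β).1)
        (aesm_sum_abs fun β => (hu β).1) hp).trans (add_le_add ?_
          (eLpNorm_sum_abs_le hp fun β => (hu β).1))
      refine (eLpNorm_sum_abs_le hp fun β => (hU j β).1).trans ?_
      rw [hdj, hA, ← Finset.sum_add_distrib]
      exact Finset.sum_le_sum fun β _ => hUj j β
    have h5 : eLpNorm (fun x => ∑ β, |U j β x - u β x|) p lam ≤ dj j :=
      eLpNorm_sum_abs_le (u := fun β x => U j β x - u β x) hp (hsub j)
    exact mul_le_mul' (mul_le_mul' (pow_le_pow_left' h4 _) h5) (hGj j)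
  refine tendsto_of_tendsto_of_tendsto_of_le_of_le tendsto_const_nhds ?_ (fun _ => zero_le) hle
  have hAA : Tendsto (fun j => (dj j + A + A) ^ (2 * q - 2)) atTop
      (nhds ((0 + A + A) ^ (2 * q - 2))) :=
    ((ENNReal.continuous_pow _).tendsto _).comp ((hdj0.add_const A).add_const A)
  have hfin : (0 + A + A) ^ (2 * q - 2) ≠ ∞ := ENNReal.pow_ne_top (by simp [hAt])
  have t1 := ENNReal.Tendsto.mul hAA (Or.inr (by simp)) hdj0 (Or.inr hfin)
  have t2 := ENNReal.Tendsto.mul t1 (Or.inr (by simpa using hg.eLpNorm_lt_top.ne))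
    (h2.add_const (eLpNorm g p lam)) (Or.inr (by simp))
  have t3 := ENNReal.Tendsto.const_mul (a := (q : ℝ≥0∞)) t2 (Or.inr (by simp))
  have t4 := ENNReal.Tendsto.const_mul (a := A ^ (2 * q - 1)) h2
    (Or.inr (ENNReal.pow_ne_top hAt))
  have t5 := t3.add t4
  simpa using t5

end holder
end IntegroDiff

end

noncomputable section

namespace IntegroDiff

/-! ### Dominated convergence in `L_p` and bounds for derivatives of products -/

section dct
open Filter Topology

lemma tendsto_zero_of_pow_tendsto_zero {p : ℕ} (hp : 1 ≤ p) {a : ℕ → ℝ≥0∞}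
    (h : Tendsto (fun j => a j ^ p) atTop (𝓝 0)) : Tendsto a atTop (𝓝 0) := by
  have hp0 : (0 : ℝ) < p := by exact_mod_cast hp
  have h1 := h.ennrpow_const (1 / (p : ℝ))
  rw [ENNReal.zero_rpow_of_pos (by positivity)] at h1
  refine h1.congr fun j => ?_
  rw [← ENNReal.rpow_natCast, ← ENNReal.rpow_mul, mul_one_div_cancel hp0.ne', ENNReal.rpow_one]

lemma tendsto_eLpNorm_of_dominated {X : Type*} [MeasurableSpace X] {lam : Measure X} {p : ℕ}
    (hp : 1 ≤ p) {F : ℕ → X → ℝ} {h : X → ℝ} (hF : ∀ j, AEStronglyMeasurable (F j) lam)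
    (hh : MemLp h (p : ℝ≥0∞) lam) (hb : ∀ j, ∀ᵐ x ∂lam, |F j x| ≤ h x)
    (hl : ∀ᵐ x ∂lam, Tendsto (fun j => F j x) atTop (𝓝 0)) :
    Tendsto (fun j => eLpNorm (F j) (p : ℝ≥0∞) lam) atTop (𝓝 0) := by
  refine tendsto_zero_of_pow_tendsto_zero hp ?_
  simp only [eLpNorm_pow_eq hp]
  have h1 := tendsto_lintegral_of_dominated_convergence' (μ := lam)
    (F := fun j x => ‖F j x‖ₑ ^ p) (f := fun _ => 0) (fun x => ‖h x‖ₑ ^ p)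
    (fun j => (hF j).enorm.pow_const p) (fun j => by
      filter_upwards [hb j] with x hx
      exact pow_le_pow_left' (enorm_le_iff_norm_le.2 (hx.trans (le_abs_self _))) p)
    (by rw [← eLpNorm_pow_eq hp]; exact ENNReal.pow_ne_top hh.eLpNorm_lt_top.ne)
    (by
      filter_upwards [hl] with x hx
      have h2 : Tendsto (fun j => ‖F j x‖ₑ) atTop (𝓝 0) := by simpa using hx.enorm
      have h3 := ((ENNReal.continuous_pow p).tendsto 0).comp h2
      rw [zero_pow (by omega)] at h3
      exact h3)
  simpa using h1

end dct

section jet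
variable {d : ℕ}

/-- The sum of the absolute values of the derivatives up to order `k`. -/
def jetAbs {d : ℕ} (k : ℕ) (f : Rd d → ℝ) (x : Rd d) : ℝ :=
  ∑ i ∈ Finset.range (k + 1), ∑ β : Fin i → Fin d, |classicalD β f x|

lemma jetAbs_nonneg (k : ℕ) (f : Rd d → ℝ) (x : Rd d) : 0 ≤ jetAbs k f x :=
  Finset.sum_nonneg fun _ _ => Finset.sum_nonneg fun _ _ => abs_nonneg _

lemma abs_classicalD_le_jetAbs {k i : ℕ} (hi : i ≤ k) (β : Fin i → Fin d) (f : Rd d → ℝ)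
    (x : Rd d) : |classicalD β f x| ≤ jetAbs k f x :=
  (Finset.single_le_sum (f := fun β : Fin i → Fin d => |classicalD β f x|)
    (fun _ _ => abs_nonneg _) (Finset.mem_univ β)).trans
    (Finset.single_le_sum (f := fun i => ∑ β : Fin i → Fin d, |classicalD β f x|)
      (fun _ _ => Finset.sum_nonneg fun _ _ => abs_nonneg _)
      (Finset.mem_range.2 (Nat.lt_succ_of_le hi)))

lemma jetAbs_mono {k l : ℕ} (h : k ≤ l) (f : Rd d → ℝ) (x : Rd d) : jetAbs k f x ≤ jetAbs l f x :=
  Finset.sum_le_sum_of_subset_of_nonneg (Finset.range_subset_range.2 (by omega))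
    fun _ _ _ => Finset.sum_nonneg fun _ _ => abs_nonneg _

lemma jetAbs_pd_le {k : ℕ} {f : Rd d → ℝ} (hf : ContDiff ℝ (k + 1 : ℕ) f) (i : Fin d) (x : Rd d) :
    jetAbs k (pd i f) x ≤ jetAbs (k + 1) f x := by
  have h1 : jetAbs k (pd i f) x ≤
      ∑ l ∈ Finset.range (k + 1), ∑ β : Fin (l + 1) → Fin d, |classicalD β f x| := by
    refine Finset.sum_le_sum fun l hl => ?_
    have hl' : l ≤ k := by simpa [Nat.lt_succ_iff] using hl
    have h2 : ∀ β : Fin l → Fin d, classicalD β (pd i f) x = classicalD (Fin.cons i β) f x :=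
      fun β => (congrFun (classicalD_cons' (hf.of_le (by norm_cast; omega)) i β) x).symm
    simp only [h2]
    rw [← Finset.sum_image (s := Finset.univ) (f := fun β : Fin (l + 1) → Fin d =>
      |classicalD β f x|) (g := fun β : Fin l → Fin d => (Fin.cons i β : Fin (l + 1) → Fin d))
      (fun β _ γ _ h => (Fin.cons_injective2 h).2)]
    exact Finset.sum_le_sum_of_subset_of_nonneg (Finset.subset_univ _) fun _ _ _ => abs_nonneg _
  refine h1.trans ?_
  rw [jetAbs, Finset.sum_range_succ' _ (k + 1)]
  exact le_add_of_nonneg_right (Finset.sum_nonneg fun _ _ => abs_nonneg _)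

lemma abs_classicalD_mul_le {k : ℕ} (α : Fin k → Fin d) {f g : Rd d → ℝ} (hf : ContDiff ℝ k f)
    (hg : ContDiff ℝ k g) (x : Rd d) :
    |classicalD α (fun x => f x * g x) x| ≤ 2 ^ k * (jetAbs k f x * jetAbs k g x) := by
  induction k generalizing f g with
  | zero => simp [classicalD_zero, jetAbs, abs_mul]
  | succ k ih =>
    obtain ⟨a, β, rfl⟩ : ∃ a β, α = Fin.cons a β := ⟨α 0, Fin.tail α, (Fin.cons_self_tail α).symm⟩
    have hf1 : ContDiff ℝ k (pd a f) := contDiff_pd (by exact_mod_cast hf) a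
    have hg1 : ContDiff ℝ k (pd a g) := contDiff_pd (by exact_mod_cast hg) a
    have hf0 : ContDiff ℝ k f := hf.of_le (by norm_cast; omega)
    have hg0 : ContDiff ℝ k g := hg.of_le (by norm_cast; omega)
    rw [classicalD_cons' (hf.mul hg), pd_mul (hf.differentiable (by norm_cast))
      (hg.differentiable (by norm_cast)), classicalD_add (hf1.mul hg0) (hf0.mul hg1)]
    refine (abs_add_le _ _).trans ((add_le_add (ih β hf1 hg0) (ih β hf0 hg1)).trans ?_)
    have h1 : jetAbs k (pd a f) x * jetAbs k g x ≤ jetAbs (k + 1) f x * jetAbs (k + 1) g x :=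
      mul_le_mul (jetAbs_pd_le hf a x) (jetAbs_mono (by omega) g x) (jetAbs_nonneg _ _ _)
        (jetAbs_nonneg _ _ _)
    have h2 : jetAbs k f x * jetAbs k (pd a g) x ≤ jetAbs (k + 1) f x * jetAbs (k + 1) g x :=
      mul_le_mul (jetAbs_mono (by omega) f x) (jetAbs_pd_le hg a x) (jetAbs_nonneg _ _ _)
        (jetAbs_nonneg _ _ _)
    have h3 : (0 : ℝ) ≤ 2 ^ k := by positivity
    calc _ ≤ 2 ^ k * (jetAbs (k + 1) f x * jetAbs (k + 1) g x) +
          2 ^ k * (jetAbs (k + 1) f x * jetAbs (k + 1) g x) := by gcongr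
      _ = _ := by ring

lemma memLp_jetAbs {k : ℕ} {p : ℝ≥0∞} {f : Rd d → ℝ}
    (h : ∀ i ≤ k, ∀ β : Fin i → Fin d, MemLp (classicalD β f) p) : MemLp (jetAbs k f) p := by
  refine memLp_finsetSum _ fun i hi => memLp_finsetSum _ fun β _ => ?_
  exact (h i (by simpa [Nat.lt_succ_iff] using hi) β).abs

end jet

/-! ### Mollification -/

section mollify
variable {d : ℕ}
open Convolution Filter Topology

/-- A sequence of bump functions whose supports shrink to the origin. -/
def bumpSeq (d j : ℕ) : ContDiffBump (0 : Rd d) where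
  rIn := 1 / (j + 1)
  rOut := 2 / (j + 1)
  rIn_pos := by positivity
  rIn_lt_rOut := by gcongr; norm_num

/-- Mollification of a function. -/
def mol (j : ℕ) (u : Rd d → ℝ) : Rd d → ℝ :=
  (bumpSeq d j).normed volume ⋆[ContinuousLinearMap.lsmul ℝ ℝ, volume] u

lemma tendsto_bumpSeq_rOut : Tendsto (fun j => (bumpSeq d j).rOut) atTop (𝓝 0) := by
  have := tendsto_one_div_add_atTop_nhds_zero_nat (𝕜 := ℝ)
  have h2 := this.const_mul 2
  simp only [mul_zero] at h2
  refine h2.congr fun j => ?_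
  simp [bumpSeq, div_eq_mul_inv]

lemma isTestFunction_bump (j : ℕ) : IsTestFunction ((bumpSeq d j).normed volume) :=
  ⟨(bumpSeq d j).contDiff_normed, (bumpSeq d j).hasCompactSupport_normed⟩

lemma sm_conv {ψ u : Rd d → ℝ} (hψ : IsTestFunction ψ) (hu : LocallyIntegrable u) :
    Sm (ψ ⋆[ContinuousLinearMap.lsmul ℝ ℝ, volume] u) :=
  hψ.2.contDiff_convolution_left _ hψ.1 hu

lemma pd_conv {ψ u : Rd d → ℝ} (hψ : IsTestFunction ψ) (hu : LocallyIntegrable u) (i : Fin d) :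
    pd i (ψ ⋆[ContinuousLinearMap.lsmul ℝ ℝ, volume] u) =
      (pd i ψ ⋆[ContinuousLinearMap.lsmul ℝ ℝ, volume] u) := by
  ext x
  have h := hψ.2.hasFDerivAt_convolution_left (ContinuousLinearMap.lsmul ℝ ℝ) (μ := volume)
    (hψ.1.of_le (by exact_mod_cast le_top)) hu x
  unfold pd
  rw [h.fderiv]
  have hce : ConvolutionExistsAt (fderiv ℝ ψ) u x
      ((ContinuousLinearMap.lsmul ℝ ℝ).precompL (Rd d)) volume :=
    (hψ.2.fderiv (𝕜 := ℝ)).convolutionExists_left _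
      ((hψ.sm.nat 1).continuous_fderiv (by simp)) hu x
  rw [convolution_def, ContinuousLinearMap.integral_apply hce.integrable, convolution_def]
  rfl

lemma classicalD_conv {k : ℕ} (α : Fin k → Fin d) {ψ u : Rd d → ℝ} (hψ : IsTestFunction ψ)
    (hu : LocallyIntegrable u) :
    classicalD α (ψ ⋆[ContinuousLinearMap.lsmul ℝ ℝ, volume] u) =
      (classicalD α ψ ⋆[ContinuousLinearMap.lsmul ℝ ℝ, volume] u) := by
  induction k with
  | zero => simp [classicalD_zero]
  | succ k ih =>
    obtain ⟨a, β, rfl⟩ : ∃ a β, α = Fin.cons a β := ⟨α 0, Fin.tail α, (Fin.cons_self_tail α).symm⟩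
    rw [classicalD_cons ((sm_conv hψ hu).nat _), ih, pd_conv (hψ.cD β) hu,
      classicalD_cons (hψ.sm.nat _)]

lemma pd_reflect {ψ : Rd d → ℝ} (hψ : Differentiable ℝ ψ) (x : Rd d) (i : Fin d) :
    pd i (fun y => ψ (x - y)) = fun y => -pd i ψ (x - y) := by
  ext y
  unfold pd
  have h1 : HasFDerivAt (fun y : Rd d => x - y) (-ContinuousLinearMap.id ℝ (Rd d)) y :=
    (hasFDerivAt_id y).const_sub x
  have := ((hψ (x - y)).hasFDerivAt.comp y h1).fderiv
  rw [show (fun y => ψ (x - y)) = ψ ∘ fun y => x - y from rfl, this]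
  simp

lemma IsTestFunction.reflect {ψ : Rd d → ℝ} (hψ : IsTestFunction ψ) (x : Rd d) :
    IsTestFunction (fun y => ψ (x - y)) :=
  ⟨hψ.1.comp (contDiff_const.sub contDiff_id),
    hψ.2.comp_homeomorph (Homeomorph.subLeft x)⟩

lemma classicalD_reflect {k : ℕ} (α : Fin k → Fin d) {ψ : Rd d → ℝ} (hψ : IsTestFunction ψ)
    (x : Rd d) : classicalD α (fun y => ψ (x - y)) = fun y => (-1) ^ k * classicalD α ψ (x - y) := by
  induction k with
  | zero => simp [classicalD_zero]
  | succ k ih =>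
    obtain ⟨a, β, rfl⟩ : ∃ a β, α = Fin.cons a β := ⟨α 0, Fin.tail α, (Fin.cons_self_tail α).symm⟩
    rw [classicalD_cons ((hψ.reflect x).sm.nat _), ih, classicalD_cons (hψ.sm.nat _)]
    have h1 := pd_reflect (hψ.cD β).sm.differentiable x a
    have h2 : pd a (fun y => (-1 : ℝ) ^ k * classicalD β ψ (x - y)) =
        fun y => (-1 : ℝ) ^ k * pd a (fun y => classicalD β ψ (x - y)) y := by
      have := classicalD_const_mul (k := 1) (((hψ.cD β).reflect x).sm.nat 1) ((-1) ^ k) ![a]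
      simpa only [classicalD_one] using this
    rw [h2, h1]
    ext y; ring

lemma sm_mol (j : ℕ) {u : Rd d → ℝ} (hu : LocallyIntegrable u) : Sm (mol j u) :=
  sm_conv (isTestFunction_bump j) hu

/-- Differentiation commutes with mollification. -/
lemma classicalD_mol {k : ℕ} {α : Fin k → Fin d} {u w : Rd d → ℝ} (h : IsWeakDeriv α u w) (j : ℕ) :
    classicalD α (mol j u) = mol j w := by
  have hb := isTestFunction_bump (d := d) j
  rw [mol, classicalD_conv α hb h.1]
  ext x
  rw [convolution_lsmul_swap, mol, convolution_lsmul_swap]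
  have h1 := h.2.2 _ (hb.reflect x)
  rw [classicalD_reflect α hb] at h1
  have h2 : ∫ y, u y * ((-1 : ℝ) ^ k * classicalD α ((bumpSeq d j).normed volume) (x - y)) =
      (-1 : ℝ) ^ k * ∫ y, classicalD α ((bumpSeq d j).normed volume) (x - y) • u y := by
    rw [← integral_const_mul]
    refine integral_congr_ae (Eventually.of_forall fun y => ?_)
    simp only [smul_eq_mul]; ring
  rw [h2] at h1
  have h3 := mul_left_cancel₀ (pow_ne_zero k (by norm_num : (-1 : ℝ) ≠ 0)) h1
  rw [h3]
  simp only [smul_eq_mul, mul_comm]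

lemma mol_apply (j : ℕ) (u : Rd d → ℝ) (x : Rd d) :
    mol j u x = ∫ y, (bumpSeq d j).normed volume y * u (x - y) := by
  rw [mol, convolution_def]; rfl

lemma integrable_mol (j : ℕ) {u : Rd d → ℝ} (hu : LocallyIntegrable u) (x : Rd d) :
    Integrable fun y => (bumpSeq d j).normed volume y * u (x - y) :=
  (isTestFunction_bump j).2.convolutionExists_left (ContinuousLinearMap.lsmul ℝ ℝ)
    (isTestFunction_bump j).1.continuous hu x

lemma abs_mol_le (j : ℕ) {u : Rd d → ℝ} {K : ℝ} (hK : ∀ x, |u x| ≤ K) (x : Rd d) :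
    |mol j u x| ≤ K := by
  rw [mol_apply, ← Real.norm_eq_abs]
  have h1 : ∫ y, (bumpSeq d j).normed volume y * K = K := by
    rw [integral_mul_const, ContDiffBump.integral_normed, one_mul]
  rw [← h1]
  refine norm_integral_le_of_norm_le ((bumpSeq d j).integrable_normed.mul_const K)
    (Eventually.of_forall fun y => ?_)
  rw [norm_mul, Real.norm_of_nonneg ((bumpSeq d j).nonneg_normed y)]
  exact mul_le_mul_of_nonneg_left (hK _) ((bumpSeq d j).nonneg_normed y)

lemma tendsto_mol_ae {u : Rd d → ℝ} (hu : LocallyIntegrable u) :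
    ∀ᵐ x, Tendsto (fun j => mol j u x) atTop (𝓝 (u x)) :=
  ContDiffBump.ae_convolution_tendsto_right_of_locallyIntegrable (K := 2) tendsto_bumpSeq_rOut
    (Eventually.of_forall fun j => by simp [bumpSeq, div_eq_mul_inv]) hu

/-- Translations are continuous in `L_p`. -/
lemma tendsto_translate {p : ℕ} (hp : 1 ≤ p) {u : Rd d → ℝ} (hu : MemLp u (p : ℝ≥0∞)) :
    Tendsto (fun y : Rd d => eLpNorm (fun x => u (x - y) - u x) (p : ℝ≥0∞) volume) (𝓝 0)
      (𝓝 0) := by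
  have : Fact ((1 : ℝ≥0∞) ≤ (p : ℝ≥0∞)) := ⟨by exact_mod_cast hp⟩
  let g : Rd d → C(Rd d, Rd d) := fun y => ⟨fun x => x - y, by fun_prop⟩
  have hgc : Continuous g := by
    have : Continuous fun q : Rd d × Rd d => q.2 - q.1 := by fun_prop
    exact (ContinuousMap.curry ⟨_, this⟩).continuous
  have hgm : ∀ y, MeasurePreserving (g y) volume volume := fun y => measurePreserving_sub_right _ y
  have h := Filter.Tendsto.compMeasurePreservingLp (f := fun _ : Rd d => hu.toLp u) (l := 𝓝 0)
    tendsto_const_nhds (hgc.tendsto 0) hgm (hgm 0) (by simp)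
  rw [tendsto_iff_edist_tendsto_0] at h
  refine h.congr fun y => ?_
  rw [Lp.toLp_compMeasurePreserving, Lp.toLp_compMeasurePreserving, Lp.edist_toLp_toLp]
  refine eLpNorm_congr_ae (Eventually.of_forall fun x => ?_)
  simp [g]

lemma tendsto_mol_Lp {p : ℕ} (hp : 1 ≤ p) {u : Rd d → ℝ} (hu : MemLp u (p : ℝ≥0∞)) :
    Tendsto (fun j => eLpNorm (fun x => mol j u x - u x) (p : ℝ≥0∞) volume) atTop (𝓝 0) := by
  rw [ENNReal.tendsto_nhds_zero]
  intro ε hε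
  rcases eq_or_ne ε ∞ with rfl | hε'
  · exact Eventually.of_forall fun _ => le_top
  have h1 := (ENNReal.tendsto_nhds_zero.1 (tendsto_translate hp hu)) ε hε
  obtain ⟨r, hr, hball⟩ := Metric.eventually_nhds_iff.1 h1
  filter_upwards [tendsto_bumpSeq_rOut.eventually (gt_mem_nhds hr)] with j hj
  have hloc := MemLp.locInt hp hu
  set φ := (bumpSeq d j).normed volume with hφ
  have hφc : Continuous φ := (isTestFunction_bump j).1.continuous
  have hmeas : AEStronglyMeasurable (fun q : Rd d × Rd d => φ q.2 * (u (q.1 - q.2) - u q.1))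
      (volume.prod volume) := by
    have e1 : AEStronglyMeasurable (fun q : Rd d × Rd d => u (q.1 - q.2)) (volume.prod volume) :=
      hu.1.comp_quasiMeasurePreserving (quasiMeasurePreserving_sub_of_right_invariant volume volume)
    exact ((hφc.comp continuous_snd).aestronglyMeasurable).mul (e1.sub hu.1.comp_fst)
  have hbound : ∀ y, eLpNorm (fun x => φ y * (u (x - y) - u x)) (p : ℝ≥0∞) volume ≤
      ENNReal.ofReal (φ y) * ε := by
    intro y
    have e2 : (fun x => φ y * (u (x - y) - u x)) = φ y • fun x => u (x - y) - u x := rfl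
    rw [e2, eLpNorm_const_smul, Real.enorm_of_nonneg ((bumpSeq d j).nonneg_normed y)]
    by_cases hy : φ y = 0
    · rw [hφ] at hy; simp [hy]
    · have : y ∈ Function.support φ := hy
      rw [hφ, ContDiffBump.support_normed_eq, Metric.mem_ball] at this
      exact mul_le_mul' le_rfl (hball (this.trans hj))
  have hint : ∫⁻ y, ENNReal.ofReal (φ y) * ε = ε := by
    rw [lintegral_mul_const _ (hφc.measurable.ennreal_ofReal),
      ← ofReal_integral_eq_lintegral_ofReal (bumpSeq d j).integrable_normed
        (Eventually.of_forall (bumpSeq d j).nonneg_normed), ContDiffBump.integral_normed]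
    simp
  have key := (minkowski_integral hmeas (h := fun y => ENNReal.ofReal (φ y) * ε)
    ((hφc.measurable.ennreal_ofReal).mul_const _) (by rw [hint]; exact hε') hp
    (Eventually.of_forall hbound)).2.2
  rw [hint] at key
  refine le_trans (le_of_eq (eLpNorm_congr_ae (Eventually.of_forall fun x => ?_))) key
  simp only [mul_sub]
  rw [integral_sub (integrable_mol j hloc x) ((bumpSeq d j).integrable_normed.mul_const _),
    integral_mul_const, ContDiffBump.integral_normed, one_mul, ← mol_apply]

end mollify

/-! ### Density of test functions -/

section density
variable {d : ℕ}
open Filter Topology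

lemma classicalD_scale {k : ℕ} (α : Fin k → Fin d) {f : Rd d → ℝ} (hf : Sm f) (c : ℝ) :
    classicalD α (fun x => f (c • x)) = fun x => c ^ k * classicalD α f (c • x) := by
  induction k with
  | zero => simp [classicalD_zero]
  | succ k ih =>
    obtain ⟨a, β, rfl⟩ : ∃ a β, α = Fin.cons a β := ⟨α 0, Fin.tail α, (Fin.cons_self_tail α).symm⟩
    have hs : ∀ {g : Rd d → ℝ}, Sm g → Sm (fun x => g (c • x)) := fun hg =>
      ContDiff.comp hg (contDiff_const_smul c)
    rw [classicalD_cons ((hs hf).nat _), ih, classicalD_cons (hf.nat _)]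
    have h2 : pd a (fun y => c ^ k * classicalD β f (c • y)) =
        fun y => c ^ k * pd a (fun y => classicalD β f (c • y)) y := by
      have := classicalD_const_mul (k := 1) ((hs (hf.cD β)).nat 1) (c ^ k) ![a]
      simpa only [classicalD_one] using this
    rw [h2]
    ext x
    unfold pd
    have h3 : HasFDerivAt (fun x : Rd d => c • x) (c • ContinuousLinearMap.id ℝ (Rd d)) x :=
      (hasFDerivAt_id x).const_smul c
    have h4 := (((hf.cD β).differentiable (c • x)).hasFDerivAt.comp x h3).fderiv
    rw [show (fun y => classicalD β f (c • y)) = classicalD β f ∘ fun y => c • y from rfl, h4]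
    simp; ring

lemma exists_cutoff (n : ℕ) : ∃ (C : ℝ) (χ : ℕ → Rd d → ℝ), (∀ R, IsTestFunction (χ R)) ∧
    (∀ R x, jetAbs n (fun x => χ R x - 1) x ≤ C) ∧
    ∀ R : ℕ, ∀ x, ‖x‖ < R + 1 → jetAbs n (fun x => χ R x - 1) x = 0 := by
  let b : ContDiffBump (0 : Rd d) := ⟨1, 2, one_pos, one_lt_two⟩
  have hb : IsTestFunction b := ⟨b.contDiff, b.hasCompactSupport⟩
  have hbs : Sm fun x : Rd d => b x - 1 := hb.sm.sub contDiff_const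
  have hbd : ∀ (i : ℕ) (β : Fin i → Fin d), ∃ C, 0 ≤ C ∧ ∀ x, |classicalD β (fun x => b x - 1) x| ≤ C := by
    intro i β
    obtain ⟨C, hC⟩ := (hb.cD β).1.continuous.bounded_above_of_compact_support (hb.cD β).2
    refine ⟨C + |classicalD β (fun _ : Rd d => (1 : ℝ)) 0|, ?_, fun x => ?_⟩
    · have := (norm_nonneg _).trans (hC 0); positivity
    · have e := classicalD_sub (hb.sm.nat i) (contDiff_const (c := (1:ℝ))) β
      rw [e]
      have e2 : classicalD β (fun _ : Rd d => (1 : ℝ)) x = classicalD β (fun _ : Rd d => (1 : ℝ)) 0 := by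
        rcases Nat.eq_zero_or_pos i with rfl | hi
        · simp [classicalD_zero]
        · simp [classicalD, iteratedFDeriv_const_of_ne hi.ne']
      simp only [e2]
      exact (abs_sub _ _).trans (add_le_add (hC x) le_rfl)
  choose C hC0 hC using hbd
  refine ⟨∑ i ∈ Finset.range (n + 1), ∑ β : Fin i → Fin d, C i β,
    fun R x => b (((R : ℝ) + 1)⁻¹ • x), fun R => ?_, fun R x => ?_, fun R x hx => ?_⟩
  · refine ⟨hb.1.comp (contDiff_const_smul _), ?_⟩
    exact hb.2.comp_smul (by positivity)
  · refine Finset.sum_le_sum fun i _ => Finset.sum_le_sum fun β _ => ?_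
    have e := congrFun (classicalD_scale β hbs (((R : ℝ) + 1)⁻¹)) x
    rw [e, abs_mul]
    have h1 : |(((R : ℝ) + 1)⁻¹) ^ i| ≤ 1 := by
      rw [abs_of_nonneg (by positivity)]
      exact pow_le_one₀ (by positivity) (inv_le_one_of_one_le₀ (by simp))
    calc _ ≤ 1 * C i β := mul_le_mul h1 (hC i β _) (abs_nonneg _) zero_le_one
      _ = _ := one_mul _
  · refine Finset.sum_eq_zero fun i _ => Finset.sum_eq_zero fun β _ => ?_
    have hev : (fun x => b (((R : ℝ) + 1)⁻¹ • x) - 1) =ᶠ[𝓝 x] fun _ => (0 : ℝ) := by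
      have : ∀ᶠ y in 𝓝 x, ‖y‖ < R + 1 := continuous_norm.continuousAt.eventually (gt_mem_nhds hx)
      filter_upwards [this] with y hy
      rw [b.one_of_mem_closedBall, sub_self]
      rw [mem_closedBall_zero_iff, norm_smul, norm_inv, Real.norm_of_nonneg (by positivity),
        inv_mul_le_iff₀ (by positivity)]
      simpa [b] using hy.le
    have := (hev.iteratedFDeriv ℝ i).eq_of_nhds
    rw [classicalD, this]
    simp

/-- Test functions are dense in `W^n_p`. -/
lemma exists_test_tendsto {n p : ℕ} (hp : 1 ≤ p) {v : Rd d → ℝ} (hv : MemW n p v) :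
    ∃ φ : ℕ → Rd d → ℝ, (∀ j, IsTestFunction (φ j)) ∧ ∀ k ≤ n, ∀ α : Fin k → Fin d,
      Tendsto (fun j => eLpNorm (fun x => classicalD α (φ j) x - weakD α v x) (p : ℝ≥0∞) volume)
        atTop (𝓝 0) := by
  have hp' : (1 : ℝ≥0∞) ≤ p := by exact_mod_cast hp
  suffices H : ∀ ε : ℝ≥0∞, 0 < ε → ε ≠ ∞ → ∃ φ : Rd d → ℝ, IsTestFunction φ ∧ ∀ k ≤ n, ∀ α : Fin k → Fin d,
      eLpNorm (fun x => classicalD α φ x - weakD α v x) (p : ℝ≥0∞) volume ≤ ε by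
    choose φ h1 h2 using fun j : ℕ => H ((j : ℝ≥0∞) + 1)⁻¹ (by simp) (by simp)
    refine ⟨φ, h1, fun k hk α => ?_⟩
    refine tendsto_of_tendsto_of_tendsto_of_le_of_le tendsto_const_nhds ?_ (fun _ => zero_le)
      (fun j => h2 j k hk α)
    simpa using (tendsto_add_atTop_iff_nat 1).2 ENNReal.tendsto_inv_nat_nhds_zero
  intro ε hε h0
  have hε2 : 0 < ε / 2 := ENNReal.half_pos hε.ne'
  have hfin : ∀ (Q : ℕ → ∀ k : ℕ, (Fin k → Fin d) → Prop),
      (∀ k ≤ n, ∀ α : Fin k → Fin d, ∀ᶠ j in atTop, Q j k α) →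
      ∃ j, ∀ k ≤ n, ∀ α : Fin k → Fin d, Q j k α := by
    intro Q hQ
    have : ∀ᶠ j in atTop, ∀ k ∈ Finset.range (n + 1), ∀ α : Fin k → Fin d, Q j k α := by
      rw [Filter.eventually_all_finset]
      intro k hk
      rw [Filter.eventually_all]
      exact hQ k (by simpa [Nat.lt_succ_iff] using hk)
    obtain ⟨j, hj⟩ := this.exists
    exact ⟨j, fun k hk => hj k (by simpa [Nat.lt_succ_iff] using hk)⟩
  have hloc := MemLp.locInt hp hv.1
  obtain ⟨j, hj⟩ := hfin (fun j k α => eLpNorm (fun x => classicalD α (mol j v) x - weakD α v x)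
    (p : ℝ≥0∞) volume ≤ ε / 2) (fun k hk α => by
      have h1 := ENNReal.tendsto_nhds_zero.1 (tendsto_mol_Lp hp (hv.memLp_weakD hk α)) _ hε2
      filter_upwards [h1] with j hj
      rwa [classicalD_mol (hv.weakD_spec hk α) j])
  set w := mol j v with hw
  have hws : Sm w := sm_mol j hloc
  have hwL : ∀ k ≤ n, ∀ α : Fin k → Fin d, MemLp (classicalD α w) (p : ℝ≥0∞) := by
    intro k hk α
    have hm := hv.memLp_weakD hk α
    have hd : MemLp (fun x => classicalD α w x - weakD α v x) (p : ℝ≥0∞) := by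
      refine ⟨((hws.cD α).continuous.aestronglyMeasurable).sub hm.1, ?_⟩
      exact (hj k hk α).trans_lt (ENNReal.half_lt_self hε.ne' h0 |>.trans h0.lt_top)
    have := hd.add hm
    refine (memLp_congr_ae (Eventually.of_forall fun x => ?_)).1 this
    simp
  obtain ⟨C, χ, hχ, hχb, hχ0⟩ := exists_cutoff (d := d) n
  have hχs : ∀ R, Sm fun x => χ R x - 1 := fun R => (hχ R).sm.sub contDiff_const
  obtain ⟨R, hR⟩ := hfin (fun R k α => eLpNorm (classicalD α (fun x => (χ R x - 1) * w x))
    (p : ℝ≥0∞) volume ≤ ε / 2) (fun k hk α => by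
      refine ENNReal.tendsto_nhds_zero.1 ?_ _ hε2
      refine tendsto_eLpNorm_of_dominated hp (h := fun x => 2 ^ k * C * jetAbs n w x)
        (fun R => (((hχs R).mul hws).cD α).continuous.aestronglyMeasurable)
        ((memLp_jetAbs hwL).const_mul _) (fun R => Eventually.of_forall fun x => ?_)
        (Eventually.of_forall fun x => ?_)
      · refine (abs_classicalD_mul_le α ((hχs R).nat k) (hws.nat k) x).trans ?_
        rw [mul_assoc]
        gcongr
        · exact jetAbs_nonneg _ _ _
        · exact (jetAbs_nonneg _ _ _).trans (hχb R x)
        · exact (jetAbs_mono hk _ x).trans (hχb R x)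
        · exact jetAbs_mono hk _ x
      · refine tendsto_const_nhds.congr' ?_
        obtain ⟨R0, hR0⟩ := exists_nat_gt ‖x‖
        filter_upwards [eventually_ge_atTop R0] with R hR
        have h0 : jetAbs k (fun x => χ R x - 1) x = 0 :=
          le_antisymm ((jetAbs_mono hk _ x).trans (hχ0 R x (by
            have : (R0 : ℝ) ≤ R := by exact_mod_cast hR
            linarith)).le) (jetAbs_nonneg _ _ _)
        have := abs_classicalD_mul_le α ((hχs R).nat k) (hws.nat k) x
        rw [h0, zero_mul, mul_zero] at this
        exact (abs_nonpos_iff.1 this).symm)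
  refine ⟨fun x => χ R x * w x, ?_, fun k hk α => ?_⟩
  · have := IsTestFunction.mul hws (hχ R)
    simpa only [mul_comm] using this
  · have e : (fun x => χ R x * w x) = fun x => (χ R x - 1) * w x + w x := by ext; ring
    rw [e, classicalD_add (((hχs R).mul hws).nat k) (hws.nat k)]
    have e2 : (fun x => classicalD α (fun x => (χ R x - 1) * w x) x + classicalD α w x -
        weakD α v x) = classicalD α (fun x => (χ R x - 1) * w x) +
        fun x => classicalD α w x - weakD α v x := by ext; simp; ring
    rw [e2]
    refine (eLpNorm_add_le (((hχs R).mul hws).cD α).continuous.aestronglyMeasurable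
      ((hwL k hk α).sub (hv.memLp_weakD hk α)).1 hp').trans ?_
    exact (add_le_add (hR k hk α) (hj k hk α)).trans (ENNReal.add_halves ε).le

end density
end IntegroDiff

end

noncomputable section

namespace IntegroDiff

/-! ### Convergence in Sobolev spaces -/

section conv
variable {d n p : ℕ}
open Filter Topology

lemma exists_Lp_limit (hp : 1 ≤ p) {W : ℕ → Rd d → ℝ} (hW : ∀ j, MemLp (W j) (p : ℝ≥0∞))
    {b : ℕ → ℝ≥0∞} (hb : Tendsto b atTop (𝓝 0))
    (h : ∀ j l, eLpNorm (fun x => W j x - W l x) (p : ℝ≥0∞) volume ≤ b j + b l) :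
    ∃ w, MemLp w (p : ℝ≥0∞) ∧
      Tendsto (fun j => eLpNorm (fun x => W j x - w x) (p : ℝ≥0∞) volume) atTop (𝓝 0) := by
  have : Fact ((1 : ℝ≥0∞) ≤ (p : ℝ≥0∞)) := ⟨by exact_mod_cast hp⟩
  have hc : CauchySeq fun j => (hW j).toLp (W j) := by
    rw [EMetric.cauchySeq_iff]
    intro ε hε
    obtain ⟨N, hN⟩ := eventually_atTop.1 ((tendsto_order.1 hb).2 (ε / 2) (ENNReal.half_pos hε.ne'))
    refine ⟨N, fun j hj l hl => ?_⟩
    rw [Lp.edist_toLp_toLp]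
    refine (h j l).trans_lt ?_
    calc b j + b l < ε / 2 + ε / 2 := ENNReal.add_lt_add (hN j hj) (hN l hl)
      _ = ε := ENNReal.add_halves ε
  obtain ⟨w, hw⟩ := cauchySeq_tendsto_of_complete hc
  refine ⟨w, Lp.memLp w, ?_⟩
  rw [tendsto_iff_edist_tendsto_0] at hw
  refine hw.congr fun j => ?_
  rw [Lp.edist_def]
  refine eLpNorm_congr_ae ?_
  filter_upwards [(hW j).coeFn_toLp] with x hx
  simp [hx]

lemma tendsto_sobN {f : Rd d → ℝ} {F : ℕ → Rd d → ℝ} (hF : ∀ j, MemW n p (F j)) (hf : MemW n p f)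
    (h : ∀ k ≤ n, ∀ α : Fin k → Fin d, Tendsto
      (fun j => eLpNorm (fun x => weakD α (F j) x - weakD α f x) (p : ℝ≥0∞) volume) atTop (𝓝 0)) :
    Tendsto (fun j => sobN n p (fun x => F j x - f x)) atTop (𝓝 0) := by
  have h1 : Tendsto (fun j => ∑ k ∈ Finset.range (n + 1), ∑ α : Fin k → Fin d,
      eLpNorm (fun x => weakD α (F j) x - weakD α f x) (p : ℝ≥0∞) volume) atTop
      (𝓝 (∑ k ∈ Finset.range (n + 1), ∑ _α : Fin k → Fin d, 0)) :=
    tendsto_finsetSum _ fun k hk => tendsto_finsetSum _ fun α _ =>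
      h k (by simpa [Nat.lt_succ_iff] using hk) α
  simp only [Finset.sum_const_zero] at h1
  refine h1.congr fun j => Finset.sum_congr rfl fun k hk => Finset.sum_congr rfl fun α _ => ?_
  exact (eLpNorm_congr_ae ((hF j).weakD_sub hf (by simpa [Nat.lt_succ_iff] using hk) α)).symm

lemma tendsto_weakD {f : Rd d → ℝ} {F : ℕ → Rd d → ℝ} (hF : ∀ j, MemW n p (F j)) (hf : MemW n p f)
    (h : Tendsto (fun j => sobN n p (fun x => F j x - f x)) atTop (𝓝 0)) {k : ℕ} (hk : k ≤ n)
    (α : Fin k → Fin d) : Tendsto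
      (fun j => eLpNorm (fun x => weakD α (F j) x - weakD α f x) (p : ℝ≥0∞) volume) atTop (𝓝 0) := by
  refine tendsto_of_tendsto_of_tendsto_of_le_of_le tendsto_const_nhds h (fun _ => zero_le)
    fun j => ?_
  rw [← eLpNorm_congr_ae ((hF j).weakD_sub hf hk α)]
  exact eLpNorm_weakD_le_sobN hk α _

lemma memW_of_cauchy (hp : 1 ≤ p) {f : Rd d → ℝ} {F : ℕ → Rd d → ℝ} (hF : ∀ j, MemW n p (F j))
    (hf : MemLp f (p : ℝ≥0∞))
    (h0 : Tendsto (fun j => eLpNorm (fun x => F j x - f x) (p : ℝ≥0∞) volume) atTop (𝓝 0))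
    {b : ℕ → ℝ≥0∞} (hb : Tendsto b atTop (𝓝 0))
    (h : ∀ j l, sobN n p (fun x => F j x - F l x) ≤ b j + b l) :
    MemW n p f ∧ Tendsto (fun j => sobN n p (fun x => F j x - f x)) atTop (𝓝 0) := by
  have key : ∀ k ≤ n, ∀ α : Fin k → Fin d, ∃ w, IsWeakDeriv α f w ∧ MemLp w (p : ℝ≥0∞) ∧
      Tendsto (fun j => eLpNorm (fun x => weakD α (F j) x - w x) (p : ℝ≥0∞) volume) atTop
        (𝓝 0) := by
    intro k hk α
    obtain ⟨w, hw, hl⟩ := exists_Lp_limit hp (fun j => (hF j).memLp_weakD hk α) hb fun j l => by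
      rw [← eLpNorm_congr_ae ((hF j).weakD_sub (hF l) hk α)]
      exact (eLpNorm_weakD_le_sobN hk α _).trans (h j l)
    exact ⟨w, IsWeakDeriv.of_tendsto hp (fun j => (hF j).1) (fun j => (hF j).memLp_weakD hk α)
      hf hw (fun j => (hF j).weakD_spec hk α) h0 hl, hw, hl⟩
  have hfW : MemW n p f := ⟨hf, fun k hk α => by
    obtain ⟨w, h1, h2, _⟩ := key k hk α
    exact ⟨w, h1, h2⟩⟩
  refine ⟨hfW, tendsto_sobN hF hfW fun k hk α => ?_⟩
  obtain ⟨w, h1, h2, h3⟩ := key k hk α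
  refine h3.congr fun j => eLpNorm_congr_ae ?_
  filter_upwards [h1.weakD_ae] with x hx
  rw [hx]

lemma tendsto_sobN_self (hp : 1 ≤ p) {f : Rd d → ℝ} {F : ℕ → Rd d → ℝ} (hF : ∀ j, MemW n p (F j))
    (hf : MemW n p f) (h : Tendsto (fun j => sobN n p (fun x => F j x - f x)) atTop (𝓝 0)) :
    Tendsto (fun j => sobN n p (F j)) atTop (𝓝 (sobN n p f)) := by
  have h1 : ∀ j, sobN n p (F j) ≤ sobN n p f + sobN n p (fun x => F j x - f x) := by
    intro j
    have := sobN_add_le hp hf ((hF j).sub hf)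
    simpa using this
  have h2 : ∀ j, sobN n p f - sobN n p (fun x => F j x - f x) ≤ sobN n p (F j) := by
    intro j
    have := sobN_sub_le hp (hF j) ((hF j).sub hf)
    rw [tsub_le_iff_right]
    simpa using this
  refine tendsto_of_tendsto_of_tendsto_of_le_of_le ?_ ?_ h2 h1
  · have := ENNReal.Tendsto.sub (tendsto_const_nhds (x := sobN n p f)) h
      (Or.inl hf.sobN_lt_top.ne)
    simpa using this
  · simpa using (tendsto_const_nhds (x := sobN n p f)).add h

lemma tendsto_normW (hp : 1 ≤ p) {f : Rd d → ℝ} {F : ℕ → Rd d → ℝ} (hF : ∀ j, MemW n p (F j))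
    (hf : MemW n p f) (h : Tendsto (fun j => sobN n p (fun x => F j x - f x)) atTop (𝓝 0)) :
    Tendsto (fun j => normW n p (F j)) atTop (𝓝 (normW n p f)) := by
  simp only [(hF _).normW_eq, hf.normW_eq]
  exact (ENNReal.tendsto_toReal hf.sobN_lt_top.ne).comp (tendsto_sobN_self hp hF hf h)

/-- The sum `∑ (|D^n v|^(p-2) D_α v, D_α g)`. -/
def energy {d : ℕ} (n p : ℕ) (v g : Rd d → ℝ) : ℝ :=
  ∑ α : Fin n → Fin d, ∫ x, weakDNorm n v x ^ (p - 2) * weakD α v x * weakD α g x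

lemma weakDNorm_pow {q : ℕ} (v g : Rd d → ℝ) (α : Fin n → Fin d) (x : Rd d) :
    weakDNorm n v x ^ (2 * q - 2) * weakD α v x * weakD α g x =
      vpow q (fun β : Fin n → Fin d => weakD β v x) α * weakD α g x := by
  rw [vpow, weakDNorm, show 2 * q - 2 = 2 * (q - 1) by omega, pow_mul, Real.sq_sqrt]
  exact Finset.sum_nonneg fun _ _ => sq_nonneg _

lemma energy_eq {q : ℕ} (v g : Rd d → ℝ) : energy n (2 * q) v g =
    ∑ α : Fin n → Fin d, ∫ x, vpow q (fun β : Fin n → Fin d => weakD β v x) α * weakD α g x := by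
  simp only [energy, weakDNorm_pow]

lemma energy_integrable {q : ℕ} (hq : 1 ≤ q) {v g : Rd d → ℝ} (hv : MemW n (2 * q) v)
    (hg : MemW n (2 * q) g) (α : Fin n → Fin d) :
    Integrable fun x => weakDNorm n v x ^ (2 * q - 2) * weakD α v x * weakD α g x := by
  simp only [weakDNorm_pow]
  exact vpow_mul_integrable (u := fun (β : Fin n → Fin d) x => weakD β v x) hq
    (fun β => hv.memLp_weakD le_rfl β) (hg.memLp_weakD le_rfl α) α

lemma tendsto_energy {q : ℕ} (hq : 1 ≤ q) {v g : Rd d → ℝ} {V G : ℕ → Rd d → ℝ}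
    (hV : ∀ j, MemW n (2 * q) (V j)) (hv : MemW n (2 * q) v) (hG : ∀ j, MemW n (2 * q) (G j))
    (hg : MemW n (2 * q) g)
    (h1 : Tendsto (fun j => sobN n (2 * q) (fun x => V j x - v x)) atTop (𝓝 0))
    (h2 : Tendsto (fun j => sobN n (2 * q) (fun x => G j x - g x)) atTop (𝓝 0)) :
    Tendsto (fun j => energy n (2 * q) (V j) (G j)) atTop (𝓝 (energy n (2 * q) v g)) := by
  simp only [energy_eq]
  refine tendsto_finsetSum _ fun α _ => ?_
  exact tendsto_integral_vpow_mul (u := fun (β : Fin n → Fin d) x => weakD β v x)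
    (U := fun j (β : Fin n → Fin d) x => weakD β (V j) x) hq
    (fun β => hv.memLp_weakD le_rfl β) (fun j β => (hV j).memLp_weakD le_rfl β)
    (hg.memLp_weakD le_rfl α) (fun j => (hG j).memLp_weakD le_rfl α)
    (fun β => tendsto_weakD hV hv h1 le_rfl β) (tendsto_weakD hG hg h2 le_rfl α) α

lemma energy_add {q : ℕ} (hq : 1 ≤ q) {v g g' : Rd d → ℝ} (hv : MemW n (2 * q) v)
    (hg : MemW n (2 * q) g) (hg' : MemW n (2 * q) g') :
    energy n (2 * q) v (fun x => g x + g' x) = energy n (2 * q) v g + energy n (2 * q) v g' := by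
  unfold energy
  rw [← Finset.sum_add_distrib]
  refine Finset.sum_congr rfl fun α _ => ?_
  rw [← integral_add (energy_integrable hq hv hg α) (energy_integrable hq hv hg' α)]
  refine integral_congr_ae ?_
  filter_upwards [hg.weakD_add hg' le_rfl α] with x hx
  rw [hx]; ring

/-- Hölder's inequality for the energy functional. -/
lemma energy_le {q : ℕ} (hq : 1 ≤ q) {v g : Rd d → ℝ} (hv : MemW n (2 * q) v)
    (hg : MemW n (2 * q) g) :
    energy n (2 * q) v g ≤ (d : ℝ) ^ n * (normW n (2 * q) v ^ (2 * q - 1) * normW n (2 * q) g) := by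
  rw [energy_eq]
  have h : ∀ α : Fin n → Fin d, ∫ x, vpow q (fun β : Fin n → Fin d => weakD β v x) α * weakD α g x ≤
      normW n (2 * q) v ^ (2 * q - 1) * normW n (2 * q) g := fun α => by
    refine (le_abs_self _).trans (abs_integral_vpow_mul_le
      (u := fun (β : Fin n → Fin d) x => weakD β v x) hq (fun β => hv.memLp_weakD le_rfl β)
      (hg.memLp_weakD le_rfl α) α (normW_nonneg _) (normW_nonneg _) ?_ ?_)
    · rw [hv.ofReal_normW]
      exact Finset.single_le_sum (f := fun k => ∑ α : Fin k → Fin d,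
        eLpNorm (weakD α v) ((2 * q : ℕ) : ℝ≥0∞) volume) (fun _ _ => zero_le)
        (Finset.mem_range.2 (Nat.lt_succ_self n))
    · rw [hg.ofReal_normW]
      exact eLpNorm_weakD_le_sobN le_rfl α g
  refine (Finset.sum_le_sum fun α _ => h α).trans (le_of_eq ?_)
  simp

end conv

/-! ### Operators controlled on test functions -/

section goodop
variable {d : ℕ}
open Filter Topology

/-- Operators which are bounded from `W^2_p` to `L_p`, map test functions to `W^n_p` with bounds by
norms in `W^{n+2}_p`, and satisfy the energy estimate with constant `N` for test functions. -/
structure GoodOp (n q : ℕ) (N : ℝ) (A : LpSpace d (2 * q) → Rd d → ℝ) : Prop where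
  memLp : ∃ C : ℝ≥0∞, C ≠ ∞ ∧ ∀ v : LpSpace d (2 * q), MemW 2 (2 * q) v →
    MemLp (A v) ((2 * q : ℕ) : ℝ≥0∞) ∧
      eLpNorm (A v) ((2 * q : ℕ) : ℝ≥0∞) volume ≤ C * sobN 2 (2 * q) v
  sub : ∀ v w : LpSpace d (2 * q), MemW 2 (2 * q) v → MemW 2 (2 * q) w →
    A (v - w) =ᵐ[volume] fun x => A v x - A w x
  test : ∃ C : ℝ≥0∞, C ≠ ∞ ∧ ∀ (v : LpSpace d (2 * q)) (φ : Rd d → ℝ), IsTestFunction φ →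
    v =ᵐ[volume] φ → MemW n (2 * q) (A v) ∧ sobN n (2 * q) (A v) ≤ C * sobN (n + 2) (2 * q) v
  est : ∀ (v : LpSpace d (2 * q)) (φ : Rd d → ℝ), IsTestFunction φ →
    v =ᵐ[volume] φ → energy n (2 * q) v (A v) ≤ N * normW n (2 * q) v ^ (2 * q)

variable {n q : ℕ}

lemma GoodOp.add {N M : ℝ} {A B : LpSpace d (2 * q) → Rd d → ℝ} (hq : 1 ≤ q) (hA : GoodOp n q N A)
    (hB : GoodOp n q M B) : GoodOp n q (N + M) (fun v x => A v x + B v x) where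
  memLp := by
    obtain ⟨C, hC, h1⟩ := hA.memLp
    obtain ⟨C', hC', h2⟩ := hB.memLp
    refine ⟨C + C', by simp [hC, hC'], fun v hv => ⟨(h1 v hv).1.add (h2 v hv).1, ?_⟩⟩
    rw [add_mul]
    exact (eLpNorm_add_le (h1 v hv).1.1 (h2 v hv).1.1
      (by exact_mod_cast (by omega : 1 ≤ 2 * q))).trans (add_le_add (h1 v hv).2 (h2 v hv).2)
  sub v w hv hw := by
    filter_upwards [hA.sub v w hv hw, hB.sub v w hv hw] with x h1 h2
    rw [h1, h2]; ring
  test := by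
    obtain ⟨C, hC, h1⟩ := hA.test
    obtain ⟨C', hC', h2⟩ := hB.test
    refine ⟨C + C', by simp [hC, hC'], fun v φ hφ hv =>
      ⟨(h1 v φ hφ hv).1.add (h2 v φ hφ hv).1, ?_⟩⟩
    rw [add_mul]
    exact (sobN_add_le (by omega) (h1 v φ hφ hv).1 (h2 v φ hφ hv).1).trans
      (add_le_add (h1 v φ hφ hv).2 (h2 v φ hφ hv).2)
  est v φ hφ hv := by
    obtain ⟨_, _, h1⟩ := hA.test
    obtain ⟨_, _, h2⟩ := hB.test
    have hvW : MemW n (2 * q) v := (hφ.memW n (2 * q)).congr hv.symm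
    rw [energy_add hq hvW (h1 v φ hφ hv).1 (h2 v φ hφ hv).1, add_mul]
    exact add_le_add (hA.est v φ hφ hv) (hB.est v φ hφ hv)

lemma GoodOp.mono {N M : ℝ} {A : LpSpace d (2 * q) → Rd d → ℝ} (hA : GoodOp n q N A)
    (h : N ≤ M) : GoodOp n q M A where
  memLp := hA.memLp
  sub := hA.sub
  test := hA.test
  est v φ hφ hv := (hA.est v φ hφ hv).trans
    (mul_le_mul_of_nonneg_right h (pow_nonneg (normW_nonneg _) _))

/-- For an element of a Sobolev space there are test functions converging to it, as elements of
`L_p`. -/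
lemma exists_testLp_tendsto (hq : 1 ≤ q) {v : LpSpace d (2 * q)} (hv : MemW n (2 * q) v) :
    ∃ (φ : ℕ → Rd d → ℝ) (V : ℕ → LpSpace d (2 * q)), (∀ j, IsTestFunction (φ j)) ∧
      (∀ j, V j =ᵐ[volume] φ j) ∧
      Tendsto (fun j => sobN n (2 * q) (fun x => V j x - v x)) atTop (𝓝 0) := by
  obtain ⟨φ, hφ, hl⟩ := exists_test_tendsto (p := 2 * q) (by omega) hv
  have hV : ∀ j, (((hφ j).memLp ((2 * q : ℕ) : ℝ≥0∞)).toLp (φ j) : LpSpace d (2 * q))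
      =ᵐ[volume] φ j := fun j => MemLp.coeFn_toLp _
  refine ⟨φ, fun j => ((hφ j).memLp _).toLp (φ j), hφ, hV, ?_⟩
  refine tendsto_sobN (fun j => ((hφ j).memW n _).congr (hV j).symm) hv fun k hk α => ?_
  refine (hl k hk α).congr fun j => eLpNorm_congr_ae ?_
  filter_upwards [weakD_classical ((hφ j).sm.nat k) α (hV j)] with x hx
  rw [hx]

/-- The estimates extend from test functions to `W^{n+2}_p`. -/
lemma GoodOp.extend {N : ℝ} {A : LpSpace d (2 * q) → Rd d → ℝ} (hq : 1 ≤ q) (hA : GoodOp n q N A)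
    {v : LpSpace d (2 * q)} (hv : MemW (n + 2) (2 * q) v) :
    MemW n (2 * q) (A v) ∧ energy n (2 * q) v (A v) ≤ N * normW n (2 * q) v ^ (2 * q) := by
  obtain ⟨φ, V, hφ, hVφ, hl⟩ := exists_testLp_tendsto hq hv
  have hp : 1 ≤ 2 * q := by omega
  obtain ⟨C, hC, hm⟩ := hA.memLp
  obtain ⟨C', hC', ht⟩ := hA.test
  have hV : ∀ k j, MemW k (2 * q) (V j) := fun k j => ((hφ j).memW k _).congr (hVφ j).symm
  have hAV := fun j => (ht (V j) (φ j) (hφ j) (hVφ j)).1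
  have hv2 : MemW 2 (2 * q) v := hv.mono (by omega)
  have hsub : ∀ u w : LpSpace d (2 * q), ((u - w : LpSpace d (2 * q)) : Rd d → ℝ) =ᵐ[volume]
      fun x => u x - w x := fun u w => Lp.coeFn_sub u w
  have h0 : Tendsto (fun j => eLpNorm (fun x => A (V j) x - A v x) ((2 * q : ℕ) : ℝ≥0∞) volume)
      atTop (𝓝 0) := by
    have hle : ∀ j, eLpNorm (fun x => A (V j) x - A v x) ((2 * q : ℕ) : ℝ≥0∞) volume ≤
        C * sobN (n + 2) (2 * q) (fun x => V j x - v x) := by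
      intro j
      have hs : MemW 2 (2 * q) ((V j - v : LpSpace d (2 * q)) : Rd d → ℝ) :=
        ((hV 2 j).sub hv2).congr (hsub _ _).symm
      rw [← eLpNorm_congr_ae (hA.sub (V j) v (hV 2 j) hv2)]
      refine (hm _ hs).2.trans (mul_le_mul' le_rfl ?_)
      rw [sobN_congr (hsub _ _)]
      exact sobN_mono (by omega) _
    refine tendsto_of_tendsto_of_tendsto_of_le_of_le tendsto_const_nhds ?_ (fun _ => zero_le) hle
    simpa using ENNReal.Tendsto.const_mul hl (Or.inr hC)
  have hb : Tendsto (fun j => C' * sobN (n + 2) (2 * q) (fun x => V j x - v x)) atTop (𝓝 0) := by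
    simpa using ENNReal.Tendsto.const_mul hl (Or.inr hC')
  obtain ⟨hW, hWl⟩ := memW_of_cauchy hp hAV (hm v hv2).1 h0 hb fun j l => by
    have hst : IsTestFunction fun x => φ j x - φ l x := (hφ j).sub (hφ l)
    have hse : ((V j - V l : LpSpace d (2 * q)) : Rd d → ℝ) =ᵐ[volume]
        fun x => φ j x - φ l x := by
      filter_upwards [hsub (V j) (V l), hVφ j, hVφ l] with x h1 h2 h3
      rw [h1, h2, h3]
    rw [← sobN_congr (hA.sub (V j) (V l) (hV 2 j) (hV 2 l)), ← mul_add]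
    refine (ht _ _ hst hse).2.trans (mul_le_mul' le_rfl ?_)
    rw [sobN_congr (hsub _ _)]
    have := sobN_sub_le hp ((hV (n + 2) j).sub hv) ((hV (n + 2) l).sub hv)
    simpa using this
  refine ⟨hW, ?_⟩
  have hvn : MemW n (2 * q) v := hv.mono (by omega)
  have hln : Tendsto (fun j => sobN n (2 * q) (fun x => V j x - v x)) atTop (𝓝 0) :=
    tendsto_of_tendsto_of_tendsto_of_le_of_le tendsto_const_nhds hl (fun _ => zero_le)
      fun j => sobN_mono (by omega) _
  refine le_of_tendsto_of_tendsto' (tendsto_energy hq (hV n) hvn hAV hW hln hWl)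
    (((tendsto_normW hp (hV n) hvn hln).pow (2 * q)).const_mul N) fun j => ?_
  exact hA.est (V j) (φ j) (hφ j) (hVφ j)

/-- A bounded operator on `L_p` which is bounded on `C_0^∞` in the norm of `W^n_p`. -/
lemma goodOp_bounded [Fact ((1 : ℝ≥0∞) ≤ ((2 * q : ℕ) : ℝ≥0∞))] (hq : 1 ≤ q) {K : ℝ} (hK : 0 ≤ K)
    (R : LpSpace d (2 * q) →L[ℝ] LpSpace d (2 * q))
    (h : ∀ φ : LpSpace d (2 * q), (∃ f, IsTestFunction f ∧ φ =ᵐ[volume] f) →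
      MemW n (2 * q) (R φ) ∧ normW n (2 * q) (R φ) ≤ K * normW n (2 * q) φ) :
    GoodOp n q ((d : ℝ) ^ n * K) (fun v => R v) where
  memLp := by
    refine ⟨‖R‖ₑ, by simp, fun v hv => ⟨Lp.memLp _, ?_⟩⟩
    rw [← Lp.enorm_def]
    refine (R.le_opENorm v).trans (mul_le_mul' le_rfl ?_)
    rw [Lp.enorm_def]
    exact eLpNorm_le_sobN (by omega) (Lp.memLp v)
  sub v w _ _ := by
    rw [map_sub]
    exact Lp.coeFn_sub _ _
  test := by
    refine ⟨ENNReal.ofReal K, by simp, fun v φ hφ hv => ?_⟩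
    obtain ⟨h1, h2⟩ := h v ⟨φ, hφ, hv⟩
    have hvW : MemW n (2 * q) v := (hφ.memW n (2 * q)).congr hv.symm
    refine ⟨h1, ?_⟩
    rw [← h1.ofReal_normW]
    refine (ENNReal.ofReal_le_ofReal h2).trans ?_
    rw [ENNReal.ofReal_mul hK, hvW.ofReal_normW]
    exact mul_le_mul' le_rfl (sobN_mono (by omega) _)
  est v φ hφ hv := by
    obtain ⟨h1, h2⟩ := h v ⟨φ, hφ, hv⟩
    have hvW : MemW n (2 * q) v := (hφ.memW n (2 * q)).congr hv.symm
    refine (energy_le hq hvW h1).trans ?_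
    have h3 : normW n (2 * q) (v : Rd d → ℝ) ^ (2 * q) =
        normW n (2 * q) (v : Rd d → ℝ) ^ (2 * q - 1) * normW n (2 * q) (v : Rd d → ℝ) := by
      rw [← pow_succ]; congr 1; omega
    rw [h3, mul_assoc]
    refine mul_le_mul_of_nonneg_left ?_ (by positivity)
    calc _ ≤ normW n (2 * q) (v : Rd d → ℝ) ^ (2 * q - 1) * (K * normW n (2 * q) (v : Rd d → ℝ)) :=
          mul_le_mul_of_nonneg_left h2 (pow_nonneg (normW_nonneg _) _)
      _ = _ := by ring

end goodop

end IntegroDiff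

end

noncomputable section

namespace IntegroDiff

/-! ### Perturbations of the identity -/

section diffeo
variable {d : ℕ}
open Filter Topology

lemma exists_inverse_bound (d : ℕ) (L : ℝ) {c : ℝ} (hc : 0 < c) : ∃ M : ℝ, 0 < M ∧
    ∀ A : Rd d →L[ℝ] Rd d, ‖A‖ ≤ L → c ≤ |A.det| → ∀ x, ‖x‖ ≤ M * ‖A x‖ := by
  set S : Set ((Rd d →L[ℝ] Rd d) × Rd d) :=
    {A | ‖A‖ ≤ L ∧ c ≤ |A.det|} ×ˢ Metric.sphere 0 1 with hS
  have hcomp : IsCompact S := by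
    refine IsCompact.prod ?_ (isCompact_sphere _ _)
    have h1 : IsClosed {A : Rd d →L[ℝ] Rd d | ‖A‖ ≤ L ∧ c ≤ |A.det|} :=
      (isClosed_le continuous_norm continuous_const).inter
        (isClosed_le continuous_const ContinuousLinearMap.continuous_det.abs)
    refine (isCompact_closedBall (0 : Rd d →L[ℝ] Rd d) L).of_isClosed_subset h1 fun A hA => ?_
    simpa using hA.1
  have hcont : Continuous fun q : (Rd d →L[ℝ] Rd d) × Rd d => ‖q.1 q.2‖ :=
    (continuous_fst.clm_apply continuous_snd).norm
  obtain ⟨M, hM, hMb⟩ : ∃ M : ℝ, 0 < M ∧ ∀ q ∈ S, M ≤ ‖q.1 q.2‖ := by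
    rcases S.eq_empty_or_nonempty with h0 | hne
    · exact ⟨1, one_pos, fun q hq => by rw [h0] at hq; exact hq.elim⟩
    · obtain ⟨q0, hq0, hmin⟩ := hcomp.exists_isMinOn hne hcont.continuousOn
      refine ⟨‖q0.1 q0.2‖, ?_, fun q hq => hmin hq⟩
      rw [norm_pos_iff]
      intro h0
      have hd : q0.1.det ≠ 0 := by
        intro h
        have := hq0.1.2
        rw [h, abs_zero] at this
        linarith
      have h1 : q0.2 = 0 := by
        have e := (ContinuousLinearMap.toContinuousLinearEquivOfDetNeZero q0.1 hd).map_eq_zero_iff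
          (x := q0.2)
        exact e.1 (by simpa using h0)
      have h2 := hq0.2
      rw [h1] at h2
      simp at h2
  refine ⟨M⁻¹, inv_pos.2 hM, fun A hA hdet x => ?_⟩
  rcases eq_or_ne x 0 with rfl | hx
  · simp
  · have hx0 : 0 < ‖x‖ := norm_pos_iff.2 hx
    have h := hMb (A, ‖x‖⁻¹ • x) ⟨⟨hA, hdet⟩, by simp [norm_smul, hx0.ne']⟩
    simp only [map_smul, norm_smul, norm_inv, norm_norm] at h
    rw [inv_mul_eq_div, le_div_iff₀ hM]
    rwa [inv_mul_eq_div, le_div_iff₀ hx0, mul_comm] at h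

/-- A local diffeomorphism which is a bounded perturbation of the identity is surjective. -/
lemma surjective_id_add {η : Rd d → Rd d} (hη : ContDiff ℝ 1 η) {δ : ℝ} (hb : ∀ x, ‖η x‖ ≤ δ)
    (hdet : ∀ x, (ContinuousLinearMap.id ℝ (Rd d) + fderiv ℝ η x).det ≠ 0) :
    IsOpenMap (fun x => x + η x) ∧ Function.Surjective (fun x => x + η x) := by
  have hτ : ContDiff ℝ 1 (fun x => x + η x) := contDiff_id.add hη
  have hs : ∀ x, HasStrictFDerivAt (fun x => x + η x)
      (ContinuousLinearMap.toContinuousLinearEquivOfDetNeZero _ (hdet x) : Rd d →L[ℝ] Rd d) x := by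
    intro x
    rw [ContinuousLinearMap.coe_toContinuousLinearEquivOfDetNeZero]
    exact (hasStrictFDerivAt_id x).add (hη.contDiffAt.hasStrictFDerivAt (x := x) (by simp))
  have hopen : IsOpenMap (fun x => x + η x) := isOpenMap_of_hasStrictFDerivAt_equiv hs
  refine ⟨hopen, ?_⟩
  have hclosed : IsClosedMap (fun x => x + η x) := by
    refine IsProperMap.isClosedMap (isProperMap_iff_tendsto_cocompact.2 ⟨hτ.continuous, ?_⟩)
    rw [← Metric.cobounded_eq_cocompact, ← tendsto_norm_atTop_iff_cobounded]
    refine tendsto_atTop_mono (f := fun x => ‖x‖ + -δ) (fun x => ?_)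
      (tendsto_atTop_add_const_right _ _ tendsto_norm_cobounded_atTop)
    have h1 := norm_sub_norm_le x (-η x)
    rw [norm_neg, sub_neg_eq_add] at h1
    linarith [hb x]
  have hr : Set.range (fun x => x + η x) = Set.univ :=
    IsClopen.eq_univ ⟨hclosed.isClosed_range, hopen.isOpen_range⟩ (Set.range_nonempty _)
  exact Set.range_eq_univ.1 hr

lemma antilipschitz_of_injective {η : Rd d → Rd d} (hη : ContDiff ℝ 1 η) {δ : ℝ}
    (hb : ∀ x, ‖η x‖ ≤ δ) {M : ℝ} (hM : 0 < M)
    (hdet : ∀ x, (ContinuousLinearMap.id ℝ (Rd d) + fderiv ℝ η x).det ≠ 0)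
    (hinv : ∀ x y, ‖y‖ ≤ M * ‖(ContinuousLinearMap.id ℝ (Rd d) + fderiv ℝ η x) y‖)
    (hinj : Function.Injective (fun x => x + η x)) (x y : Rd d) :
    ‖x - y‖ ≤ M * ‖(x + η x) - (y + η y)‖ := by
  obtain ⟨hopen, hsurj⟩ := surjective_id_add hη hb hdet
  have hcont : Continuous (fun x => x + η x) := continuous_id.add hη.continuous
  let e := Equiv.toHomeomorphOfContinuousOpen (Equiv.ofBijective _ ⟨hinj, hsurj⟩) hcont hopen
  have he : ∀ x, e x = x + η x := fun _ => rfl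
  have hd : ∀ y, HasFDerivAt e.symm ((ContinuousLinearMap.toContinuousLinearEquivOfDetNeZero _
      (hdet (e.symm y))).symm : Rd d →L[ℝ] Rd d) y := by
    intro y
    refine HasFDerivAt.of_local_left_inverse (f := e) e.symm.continuous.continuousAt ?_
      (Eventually.of_forall fun z => e.apply_symm_apply z)
    rw [ContinuousLinearMap.coe_toContinuousLinearEquivOfDetNeZero]
    exact (hasFDerivAt_id (𝕜 := ℝ) (e.symm y)).add
      ((hη.differentiable (by simp)) (e.symm y)).hasFDerivAt
  have hnorm : ∀ y, ‖((ContinuousLinearMap.toContinuousLinearEquivOfDetNeZero _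
      (hdet (e.symm y))).symm : Rd d →L[ℝ] Rd d)‖ ≤ M := by
    intro y
    refine ContinuousLinearMap.opNorm_le_bound _ hM.le fun z => ?_
    have h2 := hinv (e.symm y) ((ContinuousLinearMap.toContinuousLinearEquivOfDetNeZero _
      (hdet (e.symm y))).symm z)
    have h3 : (ContinuousLinearMap.id ℝ (Rd d) + fderiv ℝ η (e.symm y))
        ((ContinuousLinearMap.toContinuousLinearEquivOfDetNeZero _
        (hdet (e.symm y))).symm z) = z :=
      (ContinuousLinearMap.toContinuousLinearEquivOfDetNeZero _
        (hdet (e.symm y))).apply_symm_apply z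
    rw [h3] at h2
    exact h2
  have := Convex.norm_image_sub_le_of_norm_hasFDerivWithin_le (s := Set.univ)
    (fun y _ => (hd y).hasFDerivWithinAt) (fun y _ => hnorm y) convex_univ
    (Set.mem_univ (e y)) (Set.mem_univ (e x))
  rwa [e.symm_apply_apply, e.symm_apply_apply, he, he] at this

/-- If `η` is bounded with bounded derivative and the Jacobians of `id + θη`, `0 ≤ θ ≤ 1`, are
bounded away from `0`, then `id + η` is a bijection. -/
lemma bijective_id_add {η : Rd d → Rd d} (hη : ContDiff ℝ 1 η) {δ L c : ℝ}
    (hb : ∀ x, ‖η x‖ ≤ δ) (hL : ∀ x, ‖fderiv ℝ η x‖ ≤ L) (hc : 0 < c)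
    (hdet : ∀ x, ∀ θ ∈ Set.Icc (0 : ℝ) 1,
      c ≤ |(ContinuousLinearMap.id ℝ (Rd d) + θ • fderiv ℝ η x).det|) :
    Function.Bijective (fun x => x + η x) := by
  have hL0 : 0 ≤ L := (norm_nonneg _).trans (hL 0)
  have hδ0 : 0 ≤ δ := (norm_nonneg _).trans (hb 0)
  obtain ⟨M, hM, hinv⟩ := exists_inverse_bound d (1 + L) hc
  have hC : ∀ θ : ℝ, ContDiff ℝ 1 (fun x => θ • η x) := fun θ => hη.const_smul θ
  have hfd : ∀ (θ : ℝ) x, fderiv ℝ (fun x => θ • η x) x = θ • fderiv ℝ η x := fun θ x =>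
    fderiv_fun_const_smul ((hη.differentiable (by simp)) x) θ
  have hbθ : ∀ θ ∈ Set.Icc (0 : ℝ) 1, ∀ x, ‖θ • η x‖ ≤ δ := by
    intro θ hθ x
    rw [norm_smul, Real.norm_of_nonneg hθ.1]
    exact (mul_le_of_le_one_left (norm_nonneg _) hθ.2).trans (hb x)
  have hdet0 : ∀ θ ∈ Set.Icc (0 : ℝ) 1, ∀ x,
      (ContinuousLinearMap.id ℝ (Rd d) + fderiv ℝ (fun x => θ • η x) x).det ≠ 0 := by
    intro θ hθ x h0
    have := hdet x θ hθ
    rw [← hfd, h0, abs_zero] at this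
    linarith
  have hanti : ∀ θ ∈ Set.Icc (0 : ℝ) 1, Function.Injective (fun x => x + θ • η x) →
      ∀ x y, ‖x - y‖ ≤ M * ‖(x + θ • η x) - (y + θ • η y)‖ := by
    intro θ hθ hinj x y
    refine antilipschitz_of_injective (hC θ) (hbθ θ hθ) hM (hdet0 θ hθ) (fun x y => ?_) hinj x y
    rw [hfd]
    refine hinv _ ?_ (hdet x θ hθ) y
    refine (norm_add_le _ _).trans (add_le_add ContinuousLinearMap.norm_id_le ?_)
    rw [norm_smul, Real.norm_of_nonneg hθ.1]
    exact (mul_le_of_le_one_left (norm_nonneg _) hθ.2).trans (hL x)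
  have hlip : ∀ x y, ‖η x - η y‖ ≤ L * ‖x - y‖ := fun x y =>
    Convex.norm_image_sub_le_of_norm_fderiv_le (s := Set.univ)
      (fun x _ => (hη.differentiable (by simp)) x) (fun x _ => hL x) convex_univ
      (Set.mem_univ y) (Set.mem_univ x)
  obtain ⟨n, hn⟩ := exists_nat_gt (M * L)
  have hn0 : (0 : ℝ) < n := (by positivity : 0 ≤ M * L).trans_lt hn
  have hstep : ∀ j : ℕ, j ≤ n → Function.Injective (fun x => x + ((j : ℝ) / n) • η x) := by
    intro j
    induction j with
    | zero => intro _ x y hxy; simpa using hxy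
    | succ j ih =>
      intro hj x y hxy
      have hθ : (j : ℝ) / n ∈ Set.Icc (0 : ℝ) 1 :=
        ⟨by positivity, (div_le_one hn0).2 (by exact_mod_cast (by omega : j ≤ n))⟩
      have h1 := hanti _ hθ (ih (by omega)) x y
      have h2 : (x + ((j : ℝ) / n) • η x) - (y + ((j : ℝ) / n) • η y) =
          -((1 / (n : ℝ)) • (η x - η y)) := by
        have h3 : (x + (((j + 1 : ℕ) : ℝ) / n) • η x) - (y + (((j + 1 : ℕ) : ℝ) / n) • η y) = 0 :=
          sub_eq_zero.2 hxy
        have h4 : (((j + 1 : ℕ) : ℝ) / n) = (j : ℝ) / n + 1 / n := by push_cast; ring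
        rw [h4] at h3
        have h5 : (x + ((j : ℝ) / n) • η x) - (y + ((j : ℝ) / n) • η y) +
            (1 / (n : ℝ)) • (η x - η y) = 0 := by rw [← h3]; module
        exact eq_neg_of_add_eq_zero_left h5
      rw [h2, norm_neg, norm_smul, Real.norm_of_nonneg (by positivity)] at h1
      have h6 : ‖x - y‖ ≤ (M * L / n) * ‖x - y‖ := by
        calc ‖x - y‖ ≤ M * (1 / n * ‖η x - η y‖) := h1
          _ ≤ M * (1 / n * (L * ‖x - y‖)) := by gcongr; exact hlip x y
          _ = _ := by ring
      have h7 : M * L / n < 1 := (div_lt_one hn0).2 hn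
      by_contra hne
      have h8 : 0 < ‖x - y‖ := norm_pos_iff.2 (sub_ne_zero.2 hne)
      nlinarith
  have h1 := hstep n le_rfl
  rw [div_self hn0.ne'] at h1
  have hs := (surjective_id_add (hC 1) (hbθ 1 ⟨zero_le_one, le_rfl⟩)
    (hdet0 1 ⟨zero_le_one, le_rfl⟩)).2
  simp only [one_smul] at h1 hs
  exact ⟨h1, hs⟩

lemma det_pos_of_homotopy {A : Rd d →L[ℝ] Rd d}
    (h : ∀ θ ∈ Set.Icc (0 : ℝ) 1, (ContinuousLinearMap.id ℝ (Rd d) + θ • A).det ≠ 0) :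
    0 < (ContinuousLinearMap.id ℝ (Rd d) + A).det := by
  by_contra hneg
  rw [not_lt] at hneg
  have hc : Continuous fun θ : ℝ => (ContinuousLinearMap.id ℝ (Rd d) + θ • A).det :=
    ContinuousLinearMap.continuous_det.comp (by fun_prop)
  have h1 : (0 : ℝ) ∈ Set.Icc ((ContinuousLinearMap.id ℝ (Rd d) + (1 : ℝ) • A).det)
      ((ContinuousLinearMap.id ℝ (Rd d) + (0 : ℝ) • A).det) := by
    refine ⟨by simpa using hneg, ?_⟩
    simp [ContinuousLinearMap.det]
  obtain ⟨θ, hθ, h0⟩ := intermediate_value_Icc' (zero_le_one (α := ℝ)) hc.continuousOn h1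
  exact h θ hθ h0

end diffeo
end IntegroDiff

end

noncomputable section

namespace IntegroDiff

/-! ### Jump coefficients at a fixed time and mark -/

/-- The assumptions on a jump coefficient for a fixed time and mark. -/
structure JumpHyp {d : ℕ} (l : ℕ) (K δ : ℝ) (η : Rd d → Rd d) : Prop where
  contDiff : ContDiff ℝ l η
  bound : ∀ x, ‖η x‖ ≤ δ
  deriv_bound : ∀ k, 1 ≤ k → k ≤ l → ∀ x, classicalDNorm k η x ≤ min δ K
  det_bound : ∀ x, ∀ θ ∈ Set.Icc (0 : ℝ) 1,
    K⁻¹ ≤ |(ContinuousLinearMap.id ℝ (Rd d) + θ • fderiv ℝ η x).det|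

section det
variable {d : ℕ}

lemma hasDerivAt_det_one_add (M : Matrix (Fin d) (Fin d) ℝ) :
    HasDerivAt (fun t : ℝ => (1 + t • M).det) M.trace 0 := by
  have h1 : HasDerivAt (fun t : ℝ => 1 + M.trace * t) M.trace 0 := by
    simpa using ((hasDerivAt_id (0 : ℝ)).const_mul M.trace).const_add 1
  set P := (1 + (Polynomial.X : Polynomial ℝ) • M.map Polynomial.C).det.divX.divX with hP
  have h2 : HasDerivAt (fun t : ℝ => P.eval t * t ^ 2) 0 0 := by
    exact ((P.hasDerivAt (0 : ℝ)).mul (hasDerivAt_pow 2 (0 : ℝ))).congr_deriv (by simp)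
  have e : (fun t : ℝ => (1 + t • M).det) = fun t => 1 + M.trace * t + P.eval t * t ^ 2 :=
    funext fun t => Matrix.det_one_add_smul t M
  rw [e]
  exact (h1.add h2).congr_deriv (by simp)

lemma contDiff_det_one_add :
    ContDiff ℝ 2 (fun M : Fin d → Fin d → ℝ => (1 + Matrix.of M).det) := by
  simp only [Matrix.det_apply, Matrix.add_apply, Matrix.of_apply]
  refine ContDiff.sum fun σ _ => ContDiff.const_smul _ (contDiff_prod fun i _ => ?_)
  exact contDiff_const.add (contDiff_apply_apply ℝ ℝ _ _)

/-- First and second order expansions of the determinant at the identity. -/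
lemma exists_det_expansion (d : ℕ) (L : ℝ) : ∃ C : ℝ, 0 ≤ C ∧ ∀ (M : Fin d → Fin d → ℝ) (r : ℝ),
    0 ≤ r → r ≤ L → (∀ i j, |M i j| ≤ r) →
    |(1 + Matrix.of M).det - 1| ≤ C * r ∧ |(1 + Matrix.of M).det - 1 - (Matrix.of M).trace| ≤ C * r ^ 2 := by
  set G : (Fin d → Fin d → ℝ) → ℝ := fun M => (1 + Matrix.of M).det with hG
  have hGc : ContDiff ℝ 2 G := contDiff_det_one_add
  have hG0 : G 0 = 1 := by simp [hG]
  have hGd : ∀ M : Fin d → Fin d → ℝ, fderiv ℝ G 0 M = (Matrix.of M).trace := by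
    intro M
    have h1 : HasDerivAt (fun t : ℝ => G (t • M)) (fderiv ℝ G 0 M) 0 := by
      have h2 : HasDerivAt (fun t : ℝ => t • M) M 0 := by
        simpa using (hasDerivAt_id (0 : ℝ)).smul_const M
      have h3 : HasFDerivAt G (fderiv ℝ G 0) ((0 : ℝ) • M) := by
        rw [zero_smul]
        exact ((hGc.differentiable (by simp)) 0).hasFDerivAt
      exact h3.comp_hasDerivAt (0 : ℝ) h2
    exact h1.unique (hasDerivAt_det_one_add (Matrix.of M))
  have hcomp : IsCompact (Metric.closedBall (0 : Fin d → Fin d → ℝ) L) := isCompact_closedBall _ _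
  obtain ⟨C1, hC1⟩ := hcomp.exists_bound_of_continuousOn
    (hGc.continuous_fderiv (by simp)).continuousOn
  have hGc' : ContDiff ℝ 1 (fderiv ℝ G) := hGc.fderiv_right (by norm_num)
  obtain ⟨C2, hC2⟩ := hcomp.exists_bound_of_continuousOn
    (hGc'.continuous_fderiv (by simp)).continuousOn
  refine ⟨max (max C1 C2) 0, le_max_right _ _, fun M r hr hrL hM => ?_⟩
  have hMr : ‖M‖ ≤ r :=
    (pi_norm_le_iff_of_nonneg hr).2 fun i => (pi_norm_le_iff_of_nonneg hr).2 fun j => hM i j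
  have hsub : Metric.closedBall (0 : Fin d → Fin d → ℝ) r ⊆ Metric.closedBall 0 L :=
    Metric.closedBall_subset_closedBall hrL
  have hMmem : M ∈ Metric.closedBall (0 : Fin d → Fin d → ℝ) r := by
    simpa using hMr
  have h0mem : (0 : Fin d → Fin d → ℝ) ∈ Metric.closedBall (0 : Fin d → Fin d → ℝ) r := by
    simpa using hr
  have hGM : G M = (1 + Matrix.of M).det := rfl
  have hmax1 : C1 ≤ max (max C1 C2) 0 := (le_max_left _ _).trans (le_max_left _ _)
  have hmax2 : C2 ≤ max (max C1 C2) 0 := (le_max_right _ _).trans (le_max_left _ _)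
  have hm0 : 0 ≤ max (max C1 C2) 0 := le_max_right _ _
  constructor
  · have := Convex.norm_image_sub_le_of_norm_fderiv_le (𝕜 := ℝ) (f := G)
      (s := Metric.closedBall 0 r) (C := max (max C1 C2) 0)
      (fun x _ => (hGc.differentiable (by simp)) x)
      (fun x hx => (hC1 x (hsub hx)).trans hmax1) (convex_closedBall _ _) h0mem hMmem
    rw [hG0, sub_zero, hGM, Real.norm_eq_abs] at this
    exact this.trans (mul_le_mul_of_nonneg_left hMr hm0)
  · have hlip : ∀ x ∈ Metric.closedBall (0 : Fin d → Fin d → ℝ) r,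
        ‖fderiv ℝ G x - fderiv ℝ G 0‖ ≤ max (max C1 C2) 0 * r := by
      intro x hx
      have := Convex.norm_image_sub_le_of_norm_fderiv_le (𝕜 := ℝ) (f := fderiv ℝ G)
        (s := Metric.closedBall 0 r) (C := max (max C1 C2) 0)
        (fun x _ => (hGc'.differentiable (by simp)) x)
        (fun x hx => (hC2 x (hsub hx)).trans hmax2) (convex_closedBall _ _) h0mem hx
      rw [sub_zero] at this
      exact this.trans (mul_le_mul_of_nonneg_left (by simpa using hx) hm0)
    have := Convex.norm_image_sub_le_of_norm_fderiv_le' (𝕜 := ℝ) (f := G) (φ := fderiv ℝ G 0)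
      (s := Metric.closedBall 0 r) (fun x _ => (hGc.differentiable (by simp)) x) hlip
      (convex_closedBall _ _) h0mem hMmem
    rw [hG0, sub_zero, hGM, Real.norm_eq_abs, hGd] at this
    refine this.trans ?_
    calc _ ≤ max (max C1 C2) 0 * r * r := mul_le_mul_of_nonneg_left hMr (by positivity)
      _ = _ := by ring

end det

section jump
variable {d l : ℕ} {K δ : ℝ} {η : Rd d → Rd d}
open Filter Topology

lemma classicalD_component {k : ℕ} (hη : ContDiff ℝ k η) (α : Fin k → Fin d) (i : Fin d) (x : Rd d) :
    classicalD α (fun x => η x i) x = classicalD α η x i := by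
  have h := (EuclideanSpace.proj (𝕜 := ℝ) i).iteratedFDeriv_comp_left (f := η) (x := x)
    hη.contDiffAt (i := k) le_rfl
  unfold classicalD
  rw [show (fun x => η x i) = (EuclideanSpace.proj (𝕜 := ℝ) i) ∘ η from rfl, h]
  rfl

lemma norm_classicalD_le (k : ℕ) (f : Rd d → Rd d) (α : Fin k → Fin d) (x : Rd d) :
    ‖classicalD α f x‖ ≤ classicalDNorm k f x := by
  refine Real.le_sqrt_of_sq_le ?_
  exact Finset.single_le_sum (f := fun α : Fin k → Fin d => ‖classicalD α f x‖ ^ 2)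
    (fun _ _ => sq_nonneg _) (Finset.mem_univ α)

namespace JumpHyp

lemma delta_nonneg (h : JumpHyp l K δ η) : 0 ≤ δ := (norm_nonneg _).trans (h.bound 0)

lemma contDiff_comp (h : JumpHyp l K δ η) (i : Fin d) : ContDiff ℝ l (fun x => η x i) :=
  (EuclideanSpace.proj (𝕜 := ℝ) i).contDiff.comp h.contDiff

lemma abs_comp_le (h : JumpHyp l K δ η) (i : Fin d) (x : Rd d) : |η x i| ≤ δ :=
  (PiLp.norm_apply_le (η x) i).trans (h.bound x)

lemma abs_classicalD_le (h : JumpHyp l K δ η) {k : ℕ} (hk : 1 ≤ k) (hkl : k ≤ l) (α : Fin k → Fin d)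
    (i : Fin d) (x : Rd d) : |classicalD α (fun x => η x i) x| ≤ min δ K := by
  rw [classicalD_component (h.contDiff.of_le (by exact_mod_cast hkl))]
  exact (PiLp.norm_apply_le _ i).trans ((norm_classicalD_le k η α x).trans (h.deriv_bound k hk hkl x))

lemma abs_pd_le (h : JumpHyp l K δ η) (hl : 1 ≤ l) (j i : Fin d) (x : Rd d) :
    |pd j (fun x => η x i) x| ≤ min δ K := by
  rw [← classicalD_one]
  exact h.abs_classicalD_le le_rfl hl _ i x

lemma cd1 (h : JumpHyp l K δ η) (hl : 1 ≤ l) : ContDiff ℝ 1 η :=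
  h.contDiff.of_le (by exact_mod_cast hl)

lemma pd_eq (h : JumpHyp l K δ η) (hl : 1 ≤ l) (j i : Fin d) (x : Rd d) :
    pd j (fun x => η x i) x = fderiv ℝ η x (EuclideanSpace.single j 1) i := by
  unfold pd
  have h1 := (EuclideanSpace.proj (𝕜 := ℝ) i).hasFDerivAt.comp x
    (((h.cd1 hl).differentiable (by simp)) x).hasFDerivAt
  rw [show (fun x => η x i) = (EuclideanSpace.proj (𝕜 := ℝ) i) ∘ η from rfl, h1.fderiv]
  rfl

lemma norm_fderiv_le (h : JumpHyp l K δ η) (hl : 1 ≤ l) (x : Rd d) :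
    ‖fderiv ℝ η x‖ ≤ d * min δ K := by
  have h0 : ∀ i, ‖fderiv ℝ η x (EuclideanSpace.single i 1)‖ ≤ min δ K := by
    intro i
    have h1 := (norm_classicalD_le 1 η ![i] x).trans (h.deriv_bound 1 le_rfl hl x)
    have h2 : classicalD ![i] η x = fderiv ℝ η x (EuclideanSpace.single i 1) := by
      unfold classicalD
      rw [iteratedFDeriv_succ_apply_right]
      simp
    rwa [h2] at h1
  rcases Nat.eq_zero_or_pos d with rfl | hd
  · have : fderiv ℝ η x = 0 := by
      ext v i; exact i.elim0
    simp [this]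
  · have hm : 0 ≤ min δ K := (norm_nonneg _).trans (h0 ⟨0, hd⟩)
    refine ContinuousLinearMap.opNorm_le_bound _ (by positivity) fun v => ?_
    have hv : v = ∑ i, v i • (EuclideanSpace.single i (1 : ℝ) : Rd d) := by
      have := (EuclideanSpace.basisFun (Fin d) ℝ).sum_repr v
      simpa using this.symm
    calc ‖fderiv ℝ η x v‖ = ‖∑ i, v i • fderiv ℝ η x (EuclideanSpace.single i (1 : ℝ))‖ := by
          conv_lhs => rw [hv]
          rw [map_sum]; simp only [map_smul]
      _ ≤ ∑ i : Fin d, ‖v‖ * min δ K := by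
          refine (norm_sum_le _ _).trans (Finset.sum_le_sum fun i _ => ?_)
          rw [norm_smul]
          exact mul_le_mul (PiLp.norm_apply_le v i) (h0 i) (norm_nonneg _) (norm_nonneg _)
      _ = d * min δ K * ‖v‖ := by simp; ring

lemma bijective (h : JumpHyp l K δ η) (hl : 1 ≤ l) (hK : 0 < K) :
    Function.Bijective (fun x => x + η x) :=
  bijective_id_add (h.cd1 hl) h.bound (h.norm_fderiv_le hl) (inv_pos.2 hK) h.det_bound

lemma det_pos (h : JumpHyp l K δ η) (hK : 0 < K) (x : Rd d) :
    0 < (ContinuousLinearMap.id ℝ (Rd d) + fderiv ℝ η x).det :=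
  det_pos_of_homotopy fun θ hθ h0 => by
    have := h.det_bound x θ hθ
    rw [h0, abs_zero] at this
    exact absurd this (not_le.2 (inv_pos.2 hK))

lemma det_ge (h : JumpHyp l K δ η) (hK : 0 < K) (x : Rd d) :
    K⁻¹ ≤ (ContinuousLinearMap.id ℝ (Rd d) + fderiv ℝ η x).det := by
  have := h.det_bound x 1 ⟨zero_le_one, le_rfl⟩
  rwa [one_smul, abs_of_pos (h.det_pos hK x)] at this

lemma smul (h : JumpHyp l K δ η) (hl : 1 ≤ l) {θ : ℝ} (hθ : θ ∈ Set.Icc (0 : ℝ) 1) :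
    JumpHyp l K δ (fun x => θ • η x) where
  contDiff := h.contDiff.const_smul θ
  bound x := by
    rw [norm_smul, Real.norm_of_nonneg hθ.1]
    exact (mul_le_of_le_one_left (norm_nonneg _) hθ.2).trans (h.bound x)
  deriv_bound k hk hkl x := by
    refine le_trans ?_ (h.deriv_bound k hk hkl x)
    refine Real.sqrt_le_sqrt (Finset.sum_le_sum fun α _ => ?_)
    have : classicalD α (fun x => θ • η x) x = θ • classicalD α η x := by
      unfold classicalD
      rw [show (fun x => θ • η x) = θ • η from rfl, iteratedFDeriv_const_smul_apply
        (h.contDiff.of_le (by exact_mod_cast hkl)).contDiffAt]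
      rfl
    rw [this, norm_smul, Real.norm_of_nonneg hθ.1]
    exact pow_le_pow_left₀ (mul_nonneg hθ.1 (norm_nonneg _))
      (mul_le_of_le_one_left (norm_nonneg _) hθ.2) 2
  det_bound x s hs := by
    have h1 : fderiv ℝ (fun x => θ • η x) x = θ • fderiv ℝ η x :=
      fderiv_fun_const_smul (((h.cd1 hl).differentiable (by simp)) x) θ
    rw [h1, smul_smul]
    exact h.det_bound x _ ⟨mul_nonneg hs.1 hθ.1, mul_le_one₀ hs.2 hθ.1 hθ.2⟩

lemma hasFDerivAt_tau (h : JumpHyp l K δ η) (hl : 1 ≤ l) (x : Rd d) :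
    HasFDerivAt (fun x => x + η x) (ContinuousLinearMap.id ℝ (Rd d) + fderiv ℝ η x) x :=
  (hasFDerivAt_id x).add (((h.cd1 hl).differentiable (by simp)) x).hasFDerivAt

lemma contDiff_tau (h : JumpHyp l K δ η) : ContDiff ℝ l (fun x => x + η x) :=
  contDiff_id.add h.contDiff

lemma lintegral_change (h : JumpHyp l K δ η) (hl : 1 ≤ l) (hK : 0 < K) (g : Rd d → ℝ≥0∞) :
    ∫⁻ y, g y = ∫⁻ x, ENNReal.ofReal |(ContinuousLinearMap.id ℝ (Rd d) + fderiv ℝ η x).det| *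
      g (x + η x) := by
  have hb := h.bijective hl hK
  have := lintegral_image_eq_lintegral_abs_det_fderiv_mul volume MeasurableSet.univ
    (fun x _ => (h.hasFDerivAt_tau hl x).hasFDerivWithinAt) hb.1.injOn g
  rw [Set.image_univ, hb.2.range_eq] at this
  simpa using this

lemma integral_change (h : JumpHyp l K δ η) (hl : 1 ≤ l) (hK : 0 < K) (g : Rd d → ℝ) :
    ∫ y, g y = ∫ x, (ContinuousLinearMap.id ℝ (Rd d) + fderiv ℝ η x).det * g (x + η x) := by
  have hb := h.bijective hl hK
  have := integral_image_eq_integral_abs_det_fderiv_smul volume MeasurableSet.univ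
    (fun x _ => (h.hasFDerivAt_tau hl x).hasFDerivWithinAt) hb.1.injOn g
  rw [Set.image_univ, hb.2.range_eq] at this
  simpa [abs_of_pos (h.det_pos hK _)] using this

lemma lintegral_comp_le (h : JumpHyp l K δ η) (hl : 1 ≤ l) (hK : 0 < K) (g : Rd d → ℝ≥0∞) :
    ∫⁻ x, g (x + η x) ≤ ENNReal.ofReal K * ∫⁻ y, g y := by
  rw [h.lintegral_change hl hK g, ← lintegral_const_mul' _ _ ENNReal.ofReal_ne_top]
  refine lintegral_mono fun x => ?_
  rw [← mul_assoc, ← ENNReal.ofReal_mul hK.le]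
  refine le_mul_of_one_le_left zero_le ?_
  rw [ENNReal.one_le_ofReal, abs_of_pos (h.det_pos hK x)]
  calc (1 : ℝ) = K * K⁻¹ := (mul_inv_cancel₀ hK.ne').symm
    _ ≤ _ := mul_le_mul_of_nonneg_left (h.det_ge hK x) hK.le

lemma quasiMeasurePreserving (h : JumpHyp l K δ η) (hl : 1 ≤ l) (hK : 0 < K) :
    Measure.QuasiMeasurePreserving (fun x => x + η x) volume volume := by
  have hm : Measurable (fun x => x + η x) := h.contDiff_tau.continuous.measurable
  refine ⟨hm, Measure.AbsolutelyContinuous.mk fun s hs h0 => ?_⟩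
  rw [Measure.map_apply hm hs]
  have h1 := h.lintegral_comp_le hl hK (s.indicator 1)
  rw [lintegral_indicator_one hs, h0, mul_zero] at h1
  have h2 : ∫⁻ x, s.indicator (1 : Rd d → ℝ≥0∞) (x + η x) = volume ((fun x => x + η x) ⁻¹' s) := by
    rw [← lintegral_indicator_one (hm hs)]; rfl
  rw [h2] at h1
  exact le_antisymm h1 zero_le

lemma eLpNorm_comp_le (h : JumpHyp l K δ η) (hl : 1 ≤ l) (hK : 0 < K) {p : ℕ} (hp : 1 ≤ p)
    (g : Rd d → ℝ) : eLpNorm (fun x => g (x + η x)) (p : ℝ≥0∞) volume ≤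
      ENNReal.ofReal (max 1 K) * eLpNorm g (p : ℝ≥0∞) volume := by
  have h1 : eLpNorm (fun x => g (x + η x)) (p : ℝ≥0∞) volume ^ p ≤
      (ENNReal.ofReal (max 1 K) * eLpNorm g (p : ℝ≥0∞) volume) ^ p := by
    rw [mul_pow, eLpNorm_pow_eq hp, eLpNorm_pow_eq hp]
    refine (h.lintegral_comp_le hl hK fun y => ‖g y‖ₑ ^ p).trans (mul_le_mul' ?_ le_rfl)
    rw [← ENNReal.ofReal_pow (by positivity)]
    exact ENNReal.ofReal_le_ofReal ((le_max_right 1 K).trans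
      (le_self_pow₀ (le_max_left _ _) (by omega)))
  exact le_of_not_gt fun h2 => not_lt_of_ge h1 (by gcongr)

lemma memLp_comp (h : JumpHyp l K δ η) (hl : 1 ≤ l) (hK : 0 < K) {p : ℕ} (hp : 1 ≤ p)
    {g : Rd d → ℝ} (hg : MemLp g (p : ℝ≥0∞)) : MemLp (fun x => g (x + η x)) (p : ℝ≥0∞) :=
  ⟨hg.1.comp_quasiMeasurePreserving (h.quasiMeasurePreserving hl hK),
    (h.eLpNorm_comp_le hl hK hp g).trans_lt (ENNReal.mul_lt_top (by simp) hg.eLpNorm_lt_top)⟩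

lemma hasCompactSupport_comp (h : JumpHyp l K δ η) {g : Rd d → ℝ}
    (hg : HasCompactSupport g) : HasCompactSupport (fun x => g (x + η x)) := by
  obtain ⟨r, hr⟩ := hg.isCompact.isBounded.subset_closedBall 0
  refine HasCompactSupport.of_support_subset_isCompact (isCompact_closedBall (0 : Rd d) (r + δ))
    fun x hx => ?_
  have h1 : x + η x ∈ tsupport g := subset_tsupport g hx
  have h2 := hr h1
  simp only [mem_closedBall_zero_iff] at h2 ⊢
  have h3 := norm_sub_le (x + η x) (η x)
  rw [add_sub_cancel_right] at h3
  linarith [h.bound x]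

/-- The Jacobian matrix of the jump coefficient. -/
lemma det_eq (h : JumpHyp l K δ η) (hl : 1 ≤ l) (x : Rd d) :
    (ContinuousLinearMap.id ℝ (Rd d) + fderiv ℝ η x).det =
      (1 + Matrix.of fun i j => pd j (fun x => η x i) x).det := by
  rw [ContinuousLinearMap.det, ← LinearMap.det_toMatrix (EuclideanSpace.basisFun (Fin d) ℝ).toBasis]
  congr 1
  ext i j
  rw [LinearMap.toMatrix_apply, Matrix.add_apply, Matrix.of_apply, h.pd_eq hl]
  simp [Matrix.one_apply]

end JumpHyp

lemma norm_fderiv_le_of_pd {f : Rd d → ℝ} {x : Rd d} {B : ℝ} (hB : 0 ≤ B)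
    (h : ∀ i, |pd i f x| ≤ B) : ‖fderiv ℝ f x‖ ≤ d * B := by
  refine ContinuousLinearMap.opNorm_le_bound _ (by positivity) fun v => ?_
  have hv : v = ∑ i, v i • (EuclideanSpace.single i (1 : ℝ) : Rd d) := by
    have := (EuclideanSpace.basisFun (Fin d) ℝ).sum_repr v
    simpa using this.symm
  calc ‖fderiv ℝ f x v‖ = ‖∑ i, v i • pd i f x‖ := by
        conv_lhs => rw [hv]
        rw [map_sum]; simp only [map_smul]; rfl
    _ ≤ ∑ i : Fin d, ‖v‖ * B := by
        refine (norm_sum_le _ _).trans (Finset.sum_le_sum fun i _ => ?_)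
        rw [norm_smul]
        exact mul_le_mul (PiLp.norm_apply_le v i) (h i) (norm_nonneg _) (norm_nonneg _)
    _ = d * B * ‖v‖ := by simp; ring

lemma abs_sub_le_of_pd {f : Rd d → ℝ} (hf : Differentiable ℝ f) {B : ℝ} (hB : 0 ≤ B)
    (h : ∀ i x, |pd i f x| ≤ B) (x y : Rd d) : |f y - f x| ≤ d * B * ‖y - x‖ :=
  Convex.norm_image_sub_le_of_norm_fderiv_le (s := Set.univ) (fun x _ => hf x)
    (fun x _ => norm_fderiv_le_of_pd hB fun i => h i x) convex_univ (Set.mem_univ x)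
    (Set.mem_univ y)

/-- The integrals of `I g` and `J g` for nonnegative test functions `g`. -/
lemma exists_integral_jump_le (d : ℕ) {K : ℝ} (hK : 0 < K) : ∃ C : ℝ, 0 ≤ C ∧
    ∀ (δ : ℝ) (η : Rd d → Rd d), JumpHyp 2 K δ η → ∀ g : Rd d → ℝ, IsTestFunction g →
      (∀ x, 0 ≤ g x) →
      ∫ x, (g (x + η x) - g x) ≤ C * δ * ∫ x, g x ∧
      ∫ x, (g (x + η x) - g x - ∑ i, η x i * pd i g x) ≤ C * δ ^ 2 * ∫ x, g x := by
  obtain ⟨C0, hC0, hdet⟩ := exists_det_expansion d K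
  set C1 : ℝ := C0 + d * C0 + (1 + C0 * K) * (d * d) with hC1
  have hC1' : 0 ≤ C1 := by positivity
  refine ⟨(C0 + C1) * K, by positivity, fun δ η h g hg hg0 => ?_⟩
  have hδ := h.delta_nonneg
  set r := min δ K with hr
  have hr0 : 0 ≤ r := le_min hδ hK.le
  have hrδ : r ≤ δ := min_le_left _ _
  have hrK : r ≤ K := min_le_right _ _
  set D : Rd d → ℝ := fun x => (ContinuousLinearMap.id ℝ (Rd d) + fderiv ℝ η x).det with hD
  set dv : Rd d → ℝ := fun x => ∑ i, pd i (fun x => η x i) x with hdv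
  have hDx : ∀ x, |D x - 1| ≤ C0 * r ∧ |D x - 1 - dv x| ≤ C0 * r ^ 2 := by
    intro x
    have h1 := hdet (fun i j => pd j (fun x => η x i) x) r hr0 hrK
      (fun i j => h.abs_pd_le (by norm_num) j i x)
    rw [← h.det_eq (by norm_num)] at h1
    exact h1
  have hDpos : ∀ x, 0 < D x := h.det_pos hK
  have hdvb : ∀ x, |dv x| ≤ d * r := by
    intro x
    refine (Finset.abs_sum_le_sum_abs _ _).trans ((Finset.sum_le_sum fun i _ =>
      h.abs_pd_le (by norm_num) i i x).trans (by simp [hr]))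
  have hpdc : ∀ i, ContDiff ℝ 1 (pd i (fun x => η x i)) := fun i =>
    contDiff_pd (r := 1) (by exact_mod_cast h.contDiff_comp i) i
  have hdvl : ∀ x y, |dv y - dv x| ≤ d * d * r * ‖y - x‖ := by
    intro x y
    have h1 : dv y - dv x = ∑ i, (pd i (fun x => η x i) y - pd i (fun x => η x i) x) := by
      rw [Finset.sum_sub_distrib]
    rw [h1]
    refine (Finset.abs_sum_le_sum_abs _ _).trans ((Finset.sum_le_sum fun i _ =>
      abs_sub_le_of_pd ((hpdc i).differentiable (by simp)) hr0 (fun j x => ?_) x y).trans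
        (le_of_eq ?_))
    · rw [← classicalD_one i, ← classicalD_cons (h.contDiff_comp i)]
      exact h.abs_classicalD_le (by norm_num) le_rfl _ i x
    · simp; ring
  have hdvc : Continuous dv := continuous_finsetSum _ fun i _ => (hpdc i).continuous
  have hDc : Continuous D := ContinuousLinearMap.continuous_det.comp
    (continuous_const.add ((h.cd1 (by norm_num)).continuous_fderiv (by simp)))
  have hτc : Continuous fun x => x + η x := h.contDiff_tau.continuous
  have hgτs : HasCompactSupport fun x => g (x + η x) := h.hasCompactSupport_comp hg.2
  have hgτc : Continuous fun x => g (x + η x) := hg.1.continuous.comp hτc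
  have ig : Integrable g := hg.1.continuous.integrable_of_hasCompactSupport hg.2
  have igτ : Integrable fun x => g (x + η x) := hgτc.integrable_of_hasCompactSupport hgτs
  have imul : ∀ {f : Rd d → ℝ}, Continuous f → Integrable fun x => f x * g (x + η x) := fun hf =>
    (hf.mul hgτc).integrable_of_hasCompactSupport hgτs.mul_left
  have hgτ : ∫ x, g (x + η x) ≤ K * ∫ x, g x := by
    rw [h.integral_change (by norm_num) hK g, ← integral_const_mul]
    refine integral_mono igτ ((imul hDc).const_mul K) fun x => ?_
    simp only
    rw [← mul_assoc]
    refine le_mul_of_one_le_left (hg0 _) ?_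
    calc (1 : ℝ) = K * K⁻¹ := (mul_inv_cancel₀ hK.ne').symm
      _ ≤ _ := mul_le_mul_of_nonneg_left (h.det_ge hK x) hK.le
  have hgi0 : 0 ≤ ∫ x, g x := integral_nonneg hg0
  have hgτ0 : 0 ≤ ∫ x, g (x + η x) := integral_nonneg fun x => hg0 _
  constructor
  · have e : ∫ x, (g (x + η x) - g x) = ∫ x, (1 - D x) * g (x + η x) := by
      rw [integral_sub igτ ig, h.integral_change (by norm_num) hK g, ← integral_sub igτ (imul hDc)]
      refine integral_congr_ae (Eventually.of_forall fun x => ?_)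
      simp only [hD]; ring
    rw [e]
    calc ∫ x, (1 - D x) * g (x + η x) ≤ ∫ x, C0 * δ * g (x + η x) := by
          refine integral_mono (imul (continuous_const.sub hDc)) (igτ.const_mul _) fun x => ?_
          refine mul_le_mul_of_nonneg_right ?_ (hg0 _)
          have h1 := (abs_le.1 (hDx x).1).1
          have : C0 * r ≤ C0 * δ := mul_le_mul_of_nonneg_left hrδ hC0
          linarith
      _ = C0 * δ * ∫ x, g (x + η x) := integral_const_mul _ _
      _ ≤ C0 * δ * (K * ∫ x, g x) := mul_le_mul_of_nonneg_left hgτ (by positivity)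
      _ = C0 * K * δ * ∫ x, g x := by ring
      _ ≤ (C0 + C1) * K * δ * ∫ x, g x := by gcongr; linarith
  · have ihe : ∀ i, Integrable fun x => η x i * pd i g x := fun i =>
      ((h.contDiff_comp i).continuous.mul (hg.pd i).1.continuous).integrable_of_hasCompactSupport
        (hg.pd i).2.mul_left
    have idv : Integrable fun x => dv x * g x :=
      (hdvc.mul hg.1.continuous).integrable_of_hasCompactSupport hg.2.mul_left
    have e1 : ∫ x, ∑ i, η x i * pd i g x = - ∫ x, dv x * g x := by
      rw [integral_finsetSum _ fun i _ => ihe i]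
      simp only [hdv, Finset.sum_mul]
      rw [integral_finsetSum _ fun i _ => ?_, ← Finset.sum_neg_distrib]
      · refine Finset.sum_congr rfl fun i _ => ?_
        exact integral_mul_pd ((h.contDiff_comp i).of_le (by norm_num)) (hg.sm.nat 1) hg.2 i
      · exact ((hpdc i).continuous.mul hg.1.continuous).integrable_of_hasCompactSupport
          hg.2.mul_left
    have e : ∫ x, (g (x + η x) - g x - ∑ i, η x i * pd i g x) =
        ∫ x, (1 - D x + D x * dv (x + η x)) * g (x + η x) := by
      have i1 : Integrable fun x => g (x + η x) - g x := igτ.sub ig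
      have i2 : Integrable fun x => g (x + η x) - D x * g (x + η x) := igτ.sub (imul hDc)
      rw [integral_sub i1 (integrable_finsetSum _ fun i _ => ihe i), e1,
        integral_sub igτ ig, h.integral_change (by norm_num) hK g,
        h.integral_change (by norm_num) hK (fun x => dv x * g x), sub_neg_eq_add]
      have i3 : Integrable fun x => D x * (dv (x + η x) * g (x + η x)) := by
        simp only [← mul_assoc]
        exact imul (hDc.mul (hdvc.comp hτc))
      rw [← integral_sub igτ (imul hDc), ← integral_add i2 i3]
      refine integral_congr_ae (Eventually.of_forall fun x => ?_)
      simp only [hD]; ring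
    rw [e]
    have hpt : ∀ x, 1 - D x + D x * dv (x + η x) ≤ C1 * δ ^ 2 := by
      intro x
      have h1 := (abs_le.1 (hDx x).2).1
      have e2 : 1 - D x + D x * dv (x + η x) =
          -(D x - 1 - dv x) + dv x * (D x - 1) + D x * (dv (x + η x) - dv x) := by ring
      have h2 : dv x * (D x - 1) ≤ (d * r) * (C0 * r) := by
        refine (le_abs_self _).trans ?_
        rw [abs_mul]
        exact mul_le_mul (hdvb x) (hDx x).1 (abs_nonneg _) (by positivity)
      have h3 : D x ≤ 1 + C0 * K := by
        have := (abs_le.1 (hDx x).1).2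
        have h4 : C0 * r ≤ C0 * K := mul_le_mul_of_nonneg_left hrK hC0
        linarith
      have h5 : D x * (dv (x + η x) - dv x) ≤ (1 + C0 * K) * (d * d * r * δ) := by
        refine (le_abs_self _).trans ?_
        rw [abs_mul, abs_of_pos (hDpos x)]
        refine mul_le_mul h3 ((hdvl x (x + η x)).trans ?_) (abs_nonneg _) (by positivity)
        rw [add_sub_cancel_left]
        exact mul_le_mul_of_nonneg_left (h.bound x) (by positivity)
      have hr2 : r ^ 2 ≤ δ ^ 2 := pow_le_pow_left₀ hr0 hrδ 2
      have hrd : r * δ ≤ δ ^ 2 := by rw [sq]; exact mul_le_mul_of_nonneg_right hrδ hδ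
      calc 1 - D x + D x * dv (x + η x)
          ≤ C0 * r ^ 2 + (d * r) * (C0 * r) + (1 + C0 * K) * (d * d * r * δ) := by
            rw [e2]; linarith
        _ = C0 * r ^ 2 + d * C0 * r ^ 2 + (1 + C0 * K) * (d * d) * (r * δ) := by ring
        _ ≤ C0 * δ ^ 2 + d * C0 * δ ^ 2 + (1 + C0 * K) * (d * d) * δ ^ 2 := by gcongr
        _ = C1 * δ ^ 2 := by rw [hC1]; ring
    calc ∫ x, (1 - D x + D x * dv (x + η x)) * g (x + η x) ≤ ∫ x, C1 * δ ^ 2 * g (x + η x) := by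
          refine integral_mono (imul ((continuous_const.sub hDc).add
            (hDc.mul (hdvc.comp hτc)))) (igτ.const_mul _) fun x => ?_
          exact mul_le_mul_of_nonneg_right (hpt x) (hg0 _)
      _ = C1 * δ ^ 2 * ∫ x, g (x + η x) := integral_const_mul _ _
      _ ≤ C1 * δ ^ 2 * (K * ∫ x, g x) := mul_le_mul_of_nonneg_left hgτ (by positivity)
      _ = C1 * K * δ ^ 2 * ∫ x, g x := by ring
      _ ≤ (C0 + C1) * K * δ ^ 2 * ∫ x, g x := by gcongr; linarith

end jump

end IntegroDiff

end

noncomputable section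

namespace IntegroDiff

/-! ### Families of symbols and of error operators -/

section symbols
variable {d : ℕ} {S : Type*}

/-- The functions `f s` have derivatives up to order `r`, bounded by a multiple of `w s`. -/
def SymbolBound (w : S → ℝ) (r : ℕ) (f : S → Rd d → ℝ) : Prop :=
  (∀ s, ContDiff ℝ r (f s)) ∧ ∃ C : ℝ, 0 ≤ C ∧ ∀ s x, jetAbs r (f s) x ≤ C * w s

namespace SymbolBound
variable {w w' : S → ℝ} {r r' : ℕ} {f g : S → Rd d → ℝ}

lemma mono (h : SymbolBound w r f) (hr : r' ≤ r) : SymbolBound w r' f := by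
  obtain ⟨h1, C, hC, h2⟩ := h
  exact ⟨fun s => (h1 s).of_le (by exact_mod_cast hr), C, hC,
    fun s x => (jetAbs_mono hr _ _).trans (h2 s x)⟩

lemma mono_weight (h : SymbolBound w r f) (hw : ∀ s, w s ≤ w' s) : SymbolBound w' r f := by
  obtain ⟨h1, C, hC, h2⟩ := h
  exact ⟨h1, C, hC, fun s x => (h2 s x).trans (mul_le_mul_of_nonneg_left (hw s) hC)⟩

lemma pd (h : SymbolBound w (r + 1) f) (i : Fin d) : SymbolBound w r (fun s => pd i (f s)) := by
  obtain ⟨h1, C, hC, h2⟩ := h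
  exact ⟨fun s => contDiff_pd (by exact_mod_cast h1 s) i, C, hC,
    fun s x => (jetAbs_pd_le (h1 s) i x).trans (h2 s x)⟩

lemma mul (hf : SymbolBound w r f) (hg : SymbolBound w' r g) :
    SymbolBound (fun s => w s * w' s) r (fun s x => f s x * g s x) := by
  obtain ⟨h1, C, hC, h2⟩ := hf
  obtain ⟨h3, D, hD, h4⟩ := hg
  refine ⟨fun s => (h1 s).mul (h3 s),
    ∑ i ∈ Finset.range (r + 1), ∑ _β : Fin i → Fin d, 2 ^ i * (C * D), by positivity,
    fun s x => ?_⟩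
  unfold jetAbs
  rw [Finset.sum_mul]
  refine Finset.sum_le_sum fun i hi => ?_
  rw [Finset.sum_mul]
  refine Finset.sum_le_sum fun β _ => ?_
  have hi' : i ≤ r := by simpa [Nat.lt_succ_iff] using hi
  refine (abs_classicalD_mul_le β ((h1 s).of_le (by exact_mod_cast hi'))
    ((h3 s).of_le (by exact_mod_cast hi')) x).trans ?_
  have h5 : jetAbs i (f s) x * jetAbs i (g s) x ≤ (C * w s) * (D * w' s) :=
    mul_le_mul ((jetAbs_mono hi' _ _).trans (h2 s x)) ((jetAbs_mono hi' _ _).trans (h4 s x))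
      (jetAbs_nonneg _ _ _) ((jetAbs_nonneg _ _ _).trans (h2 s x))
  calc _ ≤ 2 ^ i * ((C * w s) * (D * w' s)) := by gcongr
    _ = _ := by ring

lemma zero : SymbolBound w r (fun (_ : S) (_ : Rd d) => (0 : ℝ)) := by
  refine ⟨fun _ => contDiff_const, 0, le_rfl, fun s x => ?_⟩
  rw [zero_mul]
  refine Finset.sum_nonpos fun i _ => Finset.sum_nonpos fun β _ => ?_
  have := classicalD_const_mul (k := i) (f := fun _ : Rd d => (0 : ℝ)) contDiff_const 0 β
  have h := congrFun this x
  simp only [zero_mul] at h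
  rw [h, abs_zero]

lemma abs_le (h : SymbolBound w r f) : ∃ C : ℝ, 0 ≤ C ∧ ∀ s x, |f s x| ≤ C * w s := by
  obtain ⟨_, C, hC, h2⟩ := h
  refine ⟨C, hC, fun s x => le_trans ?_ (h2 s x)⟩
  have := abs_classicalD_le_jetAbs (k := r) (i := 0) (by omega) Fin.elim0 (f s) x
  rwa [classicalD_zero] at this

end SymbolBound

/-- A family of jump coefficients, the derivatives of which are bounded by `δ` and by a constant. -/
structure JumpFamily (l : ℕ) (δ : S → ℝ) (η : S → Rd d → Rd d) : Prop where
  nonneg : ∀ s, 0 ≤ δ s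
  contDiff : ∀ s j, ContDiff ℝ l (fun x => η s x j)
  deriv_le : ∀ i j, SymbolBound δ (l - 1) (fun s => pd i (fun x => η s x j))
  deriv_bound : ∀ i j, SymbolBound (fun _ => 1) (l - 1) (fun s => pd i (fun x => η s x j))

lemma contDiff_of_components {r : ℕ} {η : Rd d → Rd d} (h : ∀ j, ContDiff ℝ r (fun x => η x j)) :
    ContDiff ℝ r η := (contDiff_piLp 2).2 h

/-- The chain rule for `φ(x + η(x))`. -/
lemma pd_comp_tau {φ : Rd d → ℝ} {η : Rd d → Rd d} (hφ : Differentiable ℝ φ)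
    (hη : ∀ j, ContDiff ℝ 1 (fun x => η x j)) (i : Fin d) :
    pd i (fun x => φ (x + η x)) = fun x => pd i φ (x + η x) +
      ∑ j, pd i (fun x => η x j) x * pd j φ (x + η x) := by
  ext x
  have hd : DifferentiableAt ℝ η x :=
    ((contDiff_of_components (r := 1) hη).differentiable (by simp)) x
  have h1 : HasFDerivAt (fun x => x + η x) (ContinuousLinearMap.id ℝ (Rd d) + fderiv ℝ η x) x :=
    (hasFDerivAt_id x).add hd.hasFDerivAt
  have h2 := (hφ (x + η x)).hasFDerivAt.comp x h1
  have h3 : ∀ j, pd i (fun x => η x j) x = fderiv ℝ η x (EuclideanSpace.single i 1) j := by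
    intro j
    have := (EuclideanSpace.proj (𝕜 := ℝ) j).hasFDerivAt.comp x hd.hasFDerivAt
    unfold IntegroDiff.pd
    rw [show (fun x => η x j) = (EuclideanSpace.proj (𝕜 := ℝ) j) ∘ η from rfl, this.fderiv]
    rfl
  simp only [h3]
  unfold IntegroDiff.pd
  rw [show (fun x => φ (x + η x)) = φ ∘ fun x => x + η x from rfl, h2.fderiv]
  simp only [ContinuousLinearMap.comp_apply, add_apply,
    ContinuousLinearMap.id_apply, map_add]
  congr 1
  set y := fderiv ℝ η x (EuclideanSpace.single i 1) with hy
  have h4 : y = ∑ j, y j • EuclideanSpace.single j (1 : ℝ) := by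
    ext k
    simp [Pi.single_apply]
  conv_lhs => rw [h4, map_sum]
  simp

/-- Error terms: sums of terms `P (D_β φ)(x + η(x))` and `Q ((D_β φ)(x + η(x)) - D_β φ(x))` with
`|β| ≤ n`, where the derivatives of `P` and `Q` up to order `r` are bounded by `w₁` and `w₂`. -/
inductive ErrorTerm (η : S → Rd d → Rd d) (w₁ w₂ : S → ℝ) (r n : ℕ) :
    (S → (Rd d → ℝ) → Rd d → ℝ) → Prop
  | comp {k : ℕ} (hk : k ≤ n) (β : Fin k → Fin d) {P : S → Rd d → ℝ} (hP : SymbolBound w₁ r P) :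
      ErrorTerm η w₁ w₂ r n (fun s φ x => P s x * classicalD β φ (x + η s x))
  | diff {k : ℕ} (hk : k ≤ n) (β : Fin k → Fin d) {Q : S → Rd d → ℝ} (hQ : SymbolBound w₂ r Q) :
      ErrorTerm η w₁ w₂ r n
        (fun s φ x => Q s x * (classicalD β φ (x + η s x) - classicalD β φ x))
  | add {T T' : S → (Rd d → ℝ) → Rd d → ℝ} (hT : ErrorTerm η w₁ w₂ r n T)
      (hT' : ErrorTerm η w₁ w₂ r n T') :
      ErrorTerm η w₁ w₂ r n (fun s φ x => T s φ x + T' s φ x)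
  | congr {T T' : S → (Rd d → ℝ) → Rd d → ℝ} (hT : ErrorTerm η w₁ w₂ r n T)
      (h : ∀ s φ, Sm φ → T' s φ = T s φ) : ErrorTerm η w₁ w₂ r n T'

namespace ErrorTerm
variable {η : S → Rd d → Rd d} {w₁ w₂ δ : S → ℝ} {r n l : ℕ} {T T' : S → (Rd d → ℝ) → Rd d → ℝ}

lemma zero : ErrorTerm η w₁ w₂ r n (fun _ _ _ => 0) :=
  congr (comp (Nat.zero_le n) Fin.elim0 SymbolBound.zero) fun s φ _ => by simp

lemma sum {ι : Type*} (A : Finset ι) {T : ι → S → (Rd d → ℝ) → Rd d → ℝ}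
    (h : ∀ i ∈ A, ErrorTerm η w₁ w₂ r n (T i)) :
    ErrorTerm η w₁ w₂ r n (fun s φ x => ∑ i ∈ A, T i s φ x) := by
  classical
  induction A using Finset.induction_on with
  | empty => simpa using zero
  | insert a A ha ih =>
    simp only [Finset.sum_insert ha]
    exact add (h a (Finset.mem_insert_self _ _))
      (ih fun i hi => h i (Finset.mem_insert_of_mem hi))

lemma contDiff (hη : JumpFamily l δ η) (hr : r ≤ l) (h : ErrorTerm η w₁ w₂ r n T) (s : S)
    {φ : Rd d → ℝ} (hφ : Sm φ) : ContDiff ℝ r (T s φ) := by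
  have hτ : ContDiff ℝ r (fun x => x + η s x) :=
    contDiff_id.add (contDiff_of_components fun j => (hη.contDiff s j).of_le (by exact_mod_cast hr))
  induction h with
  | comp hk β hP => exact (hP.1 s).mul (((hφ.cD β).nat r).comp hτ)
  | diff hk β hP => exact (hP.1 s).mul ((((hφ.cD β).nat r).comp hτ).sub ((hφ.cD β).nat r))
  | add _ _ h1 h2 => exact h1.add h2
  | congr _ h h1 => rw [h s φ hφ]; exact h1

lemma pd (hη : JumpFamily l δ η) (hr : r + 1 ≤ l)
    (hw : ∀ s, w₂ s * δ s ≤ w₁ s)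
    (h : ErrorTerm η w₁ w₂ (r + 1) n T) (i : Fin d) :
    ErrorTerm η w₁ w₂ r (n + 1) (fun s φ => pd i (T s φ)) := by
  have hη1 : ∀ s j, ContDiff ℝ 1 (fun x => η s x j) := fun s j =>
    (hη.contDiff s j).of_le (by exact_mod_cast (by omega : 1 ≤ l))
  have hτ : ∀ s, ContDiff ℝ 1 (fun x => x + η s x) := fun s =>
    contDiff_id.add (contDiff_of_components (r := 1) fun j => hη1 s j)
  have hcomp : ∀ {ψ : Rd d → ℝ} (_ : Sm ψ) s, Differentiable ℝ fun x => ψ (x + η s x) :=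
    fun hψ s => (((hψ.nat 1).comp (hτ s)).differentiable (by simp))
  have hdiff : ∀ {w : S → ℝ} {P : S → Rd d → ℝ}, SymbolBound w (r + 1) P → ∀ s,
      Differentiable ℝ (P s) := fun hP s => (hP.1 s).differentiable (by norm_cast)
  induction h with
  | @comp k hk β P hP =>
    have e1 : ErrorTerm η w₁ w₂ r (n + 1)
        (fun s φ x => IntegroDiff.pd i (P s) x * classicalD β φ (x + η s x)) :=
      comp (by omega) β (hP.pd i)
    have e2 : ErrorTerm η w₁ w₂ r (n + 1)
        (fun s φ x => P s x * classicalD (Fin.cons i β : Fin (k + 1) → Fin d) φ (x + η s x)) :=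
      comp (by omega) _ (hP.mono (by omega))
    have e3 : ∀ j : Fin d, ErrorTerm η w₁ w₂ r (n + 1)
        (fun s φ x => (P s x * IntegroDiff.pd i (fun x => η s x j) x) *
          classicalD (Fin.cons j β : Fin (k + 1) → Fin d) φ (x + η s x)) := fun j => by
      have := (hP.mono (Nat.le_succ r)).mul ((hη.deriv_bound i j).mono (r' := r) (by omega))
      simp only [mul_one] at this
      exact comp (by omega) _ this
    refine congr ((e1.add e2).add (sum Finset.univ fun j _ => e3 j)) fun s φ hφ => ?_
    rw [pd_mul (hdiff hP s) (hcomp (hφ.cD β) s), pd_comp_tau (hφ.cD β).differentiable (hη1 s)]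
    ext x
    simp only [classicalD_cons (hφ.nat (k + 1)), mul_add, Finset.mul_sum]
    rw [add_assoc]
    simp only [mul_assoc]
  | @diff k hk β Q hQ =>
    have e1 : ErrorTerm η w₁ w₂ r (n + 1)
        (fun s φ x => IntegroDiff.pd i (Q s) x * (classicalD β φ (x + η s x) - classicalD β φ x)) :=
      diff (by omega) β (hQ.pd i)
    have e2 : ErrorTerm η w₁ w₂ r (n + 1)
        (fun s φ x => Q s x * (classicalD (Fin.cons i β : Fin (k + 1) → Fin d) φ (x + η s x) -
          classicalD (Fin.cons i β : Fin (k + 1) → Fin d) φ x)) :=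
      diff (by omega) _ (hQ.mono (by omega))
    have e3 : ∀ j : Fin d, ErrorTerm η w₁ w₂ r (n + 1)
        (fun s φ x => (Q s x * IntegroDiff.pd i (fun x => η s x j) x) *
          classicalD (Fin.cons j β : Fin (k + 1) → Fin d) φ (x + η s x)) := fun j =>
      comp (by omega) _ (((hQ.mono (Nat.le_succ r)).mul
        ((hη.deriv_le i j).mono (r' := r) (by omega))).mono_weight hw)
    refine congr ((e1.add e2).add (sum Finset.univ fun j _ => e3 j)) fun s φ hφ => ?_
    have d3 : Differentiable ℝ fun x => classicalD β φ (x + η s x) - classicalD β φ x :=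
      (hcomp (hφ.cD β) s).sub (hφ.cD β).differentiable
    rw [pd_mul (hdiff hQ s) d3,
      pd_sub (hcomp (hφ.cD β) s) (hφ.cD β).differentiable,
      pd_comp_tau (hφ.cD β).differentiable (hη1 s)]
    ext x
    simp only [classicalD_cons (hφ.nat (k + 1)), mul_assoc, ← Finset.mul_sum]
    ring
  | @add T T' h1' h2' h1 h2 =>
    refine congr (h1.add h2) fun s φ hφ => ?_
    have d1 := (h1'.contDiff hη hr s hφ).differentiable (by norm_cast)
    have d2 := (h2'.contDiff hη hr s hφ).differentiable (by norm_cast)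
    exact pd_add d1 d2 i
  | congr _ h h1 => exact congr h1 fun s φ hφ => by rw [h s φ hφ]

lemma bound (h : ErrorTerm η w₁ w₂ r n T) (hw₁ : ∀ s, 0 ≤ w₁ s) (hw₂ : ∀ s, 0 ≤ w₂ s) :
    ∃ C : ℝ, 0 ≤ C ∧ ∀ s φ, Sm φ → ∀ x,
      |T s φ x| ≤ C * (w₁ s * jetAbs n φ (x + η s x) + w₂ s * ∑ k ∈ Finset.range (n + 1),
        ∑ β : Fin k → Fin d, |classicalD β φ (x + η s x) - classicalD β φ x|) := by
  have hS : ∀ (s : S) (φ : Rd d → ℝ) x, 0 ≤ ∑ k ∈ Finset.range (n + 1),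
        ∑ β : Fin k → Fin d, |classicalD β φ (x + η s x) - classicalD β φ x| := fun s φ x =>
    Finset.sum_nonneg fun _ _ => Finset.sum_nonneg fun _ _ => abs_nonneg _
  induction h with
  | @comp k hk β P hP =>
    obtain ⟨C, hC, h⟩ := hP.abs_le
    refine ⟨C, hC, fun s φ hφ x => ?_⟩
    rw [abs_mul]
    calc _ ≤ (C * w₁ s) * jetAbs n φ (x + η s x) :=
          mul_le_mul (h s x) (abs_classicalD_le_jetAbs hk β φ _) (abs_nonneg _)
            (mul_nonneg hC (hw₁ s))
      _ ≤ _ := by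
          rw [mul_assoc]
          exact mul_le_mul_of_nonneg_left (le_add_of_nonneg_right (mul_nonneg (hw₂ s) (hS s φ x))) hC
  | @diff k hk β Q hQ =>
    obtain ⟨C, hC, h⟩ := hQ.abs_le
    refine ⟨C, hC, fun s φ hφ x => ?_⟩
    rw [abs_mul]
    have h1 : |classicalD β φ (x + η s x) - classicalD β φ x| ≤ ∑ k ∈ Finset.range (n + 1),
        ∑ β : Fin k → Fin d, |classicalD β φ (x + η s x) - classicalD β φ x| :=
      (Finset.single_le_sum (f := fun β : Fin k → Fin d =>
        |classicalD β φ (x + η s x) - classicalD β φ x|)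
        (fun _ _ => abs_nonneg _) (Finset.mem_univ β)).trans
        (Finset.single_le_sum (f := fun k => ∑ β : Fin k → Fin d,
          |classicalD β φ (x + η s x) - classicalD β φ x|)
        (fun _ _ => Finset.sum_nonneg fun _ _ => abs_nonneg _)
        (Finset.mem_range.2 (Nat.lt_succ_of_le hk)))
    calc _ ≤ (C * w₂ s) * _ :=
          mul_le_mul (h s x) h1 (abs_nonneg _) (mul_nonneg hC (hw₂ s))
      _ ≤ _ := by
          rw [mul_assoc]
          exact mul_le_mul_of_nonneg_left
            (le_add_of_nonneg_left (mul_nonneg (hw₁ s) (jetAbs_nonneg _ _ _))) hC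
  | @add T T' _ _ h1 h2 =>
    obtain ⟨C, hC, h1⟩ := h1
    obtain ⟨D, hD, h2⟩ := h2
    refine ⟨C + D, add_nonneg hC hD, fun s φ hφ x => ?_⟩
    rw [add_mul]
    exact (abs_add_le _ _).trans (add_le_add (h1 s φ hφ x) (h2 s φ hφ x))
  | congr _ h h1 =>
    obtain ⟨C, hC, h1⟩ := h1
    exact ⟨C, hC, fun s φ hφ x => by rw [h s φ hφ]; exact h1 s φ hφ x⟩

end ErrorTerm

section commutators
variable {η : S → Rd d → Rd d} {δ : S → ℝ} {l : ℕ}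

/-- `D_α (φ ∘ τ) - (D_α φ) ∘ τ`, for `τ(x) = x + η(x)`. -/
lemma errorTerm_comp (hη : JumpFamily l δ η) : ∀ n, n ≤ l → ∀ α : Fin n → Fin d,
    ErrorTerm η δ (fun _ => 0) (l - n) n
      (fun s φ x => classicalD α (fun x => φ (x + η s x)) x - classicalD α φ (x + η s x)) := by
  intro n
  induction n with
  | zero =>
    intro _ α
    refine ErrorTerm.zero.congr fun s φ _ => ?_
    simp only [classicalD_zero, sub_self]
  | succ n ih =>
    intro hn α
    obtain ⟨i, β, rfl⟩ : ∃ i β, α = Fin.cons i β := ⟨α 0, Fin.tail α, (Fin.cons_self_tail α).symm⟩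
    have h0 := ih (by omega) β
    have hr : l - n = l - (n + 1) + 1 := by omega
    rw [hr] at h0
    have h1 := h0.pd hη (by omega) (by simpa using hη.nonneg) i
    have h2 : ∀ j : Fin d, ErrorTerm η δ (fun _ => 0) (l - (n + 1)) (n + 1)
        (fun s φ x => IntegroDiff.pd i (fun x => η s x j) x *
          classicalD (Fin.cons j β : Fin (n + 1) → Fin d) φ (x + η s x)) := fun j =>
      .comp le_rfl _ ((hη.deriv_le i j).mono (by omega))
    refine (h1.add (ErrorTerm.sum Finset.univ fun j _ => h2 j)).congr fun s φ hφ => ?_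
    have hη1 : ∀ j, ContDiff ℝ 1 (fun x => η s x j) := fun j =>
      (hη.contDiff s j).of_le (by exact_mod_cast (by omega : 1 ≤ l))
    have hτ : ContDiff ℝ (n + 1 : ℕ) (fun x => x + η s x) :=
      contDiff_id.add (contDiff_of_components fun j => (hη.contDiff s j).of_le (by exact_mod_cast hn))
    have hτ1 : ContDiff ℝ 1 (fun x => x + η s x) := hτ.of_le (by norm_cast; omega)
    have hc : ContDiff ℝ (n + 1 : ℕ) (fun x => φ (x + η s x)) := (hφ.nat (n + 1)).comp hτ
    have d1 : Differentiable ℝ (classicalD β (fun x => φ (x + η s x))) :=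
      (contDiff_classicalD (r := 1) (hc.of_le (by norm_cast; omega)) β).differentiable (by simp)
    have d2 : Differentiable ℝ (fun x => classicalD β φ (x + η s x)) :=
      (((hφ.cD β).nat 1).comp hτ1).differentiable (by simp)
    ext x
    rw [pd_sub d1 d2, pd_comp_tau (hφ.cD β).differentiable hη1, classicalD_cons hc]
    simp only [classicalD_cons (hφ.nat (n + 1))]
    ring

/-- `φ(x + η(x)) - φ(x) - η(x) ∇φ(x)`. -/
def jump (η : Rd d → Rd d) (φ : Rd d → ℝ) (x : Rd d) : ℝ :=
  φ (x + η x) - φ x - ∑ i, η x i * pd i φ x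

lemma contDiff_jump {r : ℕ} {η : Rd d → Rd d} (hη : ∀ j, ContDiff ℝ r (fun x => η x j))
    {φ : Rd d → ℝ} (hφ : Sm φ) : ContDiff ℝ r (jump η φ) :=
  (((hφ.nat r).comp (contDiff_id.add (contDiff_of_components hη))).sub (hφ.nat r)).sub
    (ContDiff.sum fun i _ => (hη i).mul ((hφ.pd i).nat r))

lemma pd_jump {η : Rd d → Rd d} (hη : ∀ j, ContDiff ℝ 1 (fun x => η x j))
    {φ : Rd d → ℝ} (hφ : Sm φ) (i : Fin d) : pd i (jump η φ) = fun x => jump η (pd i φ) x +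
      ∑ j, pd i (fun x => η x j) x * (pd j φ (x + η x) - pd j φ x) := by
  have d0 : Differentiable ℝ fun x => φ (x + η x) :=
    ((hφ.nat 1).comp (contDiff_id.add (contDiff_of_components (r := 1) hη))).differentiable (by simp)
  have d1 : ∀ j, Differentiable ℝ fun x => η x j := fun j => (hη j).differentiable (by simp)
  have e : jump η φ = fun x => (φ (x + η x) - φ x) - ∑ i, η x i * pd i φ x := rfl
  have d2 : Differentiable ℝ fun x => φ (x + η x) - φ x := d0.sub hφ.differentiable
  have d3 : ∀ j, Differentiable ℝ fun x => η x j * pd j φ x := fun j =>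
    (d1 j).mul (hφ.pd j).differentiable
  rw [e, pd_sub d2 (Differentiable.fun_sum fun j _ => d3 j), pd_sub d0 hφ.differentiable,
    pd_comp_tau hφ.differentiable hη, pd_sum fun j _ => d3 j]
  ext x
  simp only [jump, fun j => pd_mul (d1 j) (hφ.pd j).differentiable i, mul_sub,
    Finset.sum_add_distrib, Finset.sum_sub_distrib, pd_comm (hφ.nat 2) i]
  ring

/-- `D_α J φ - J D_α φ`. -/
lemma errorTerm_jump (hη : JumpFamily l δ η) : ∀ n, n ≤ l → ∀ α : Fin n → Fin d,
    ErrorTerm η (fun s => δ s * δ s) δ (l - n) n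
      (fun s φ x => classicalD α (jump (η s) φ) x - jump (η s) (classicalD α φ) x) := by
  intro n
  induction n with
  | zero =>
    intro _ α
    refine ErrorTerm.zero.congr fun s φ _ => ?_
    simp only [classicalD_zero, sub_self]
  | succ n ih =>
    intro hn α
    obtain ⟨i, β, rfl⟩ : ∃ i β, α = Fin.cons i β := ⟨α 0, Fin.tail α, (Fin.cons_self_tail α).symm⟩
    have h0 := ih (by omega) β
    have hr : l - n = l - (n + 1) + 1 := by omega
    rw [hr] at h0
    have h1 := h0.pd hη (by omega) (fun _ => le_rfl) i
    have h2 : ∀ j : Fin d, ErrorTerm η (fun s => δ s * δ s) δ (l - (n + 1)) (n + 1)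
        (fun s φ x => IntegroDiff.pd i (fun x => η s x j) x *
          (classicalD (Fin.cons j β : Fin (n + 1) → Fin d) φ (x + η s x) -
            classicalD (Fin.cons j β : Fin (n + 1) → Fin d) φ x)) := fun j =>
      .diff le_rfl _ ((hη.deriv_le i j).mono (by omega))
    refine (h1.add (ErrorTerm.sum Finset.univ fun j _ => h2 j)).congr fun s φ hφ => ?_
    have hη1 : ∀ j, ContDiff ℝ 1 (fun x => η s x j) := fun j =>
      (hη.contDiff s j).of_le (by exact_mod_cast (by omega : 1 ≤ l))
    have hc : ContDiff ℝ (n + 1 : ℕ) (jump (η s) φ) :=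
      contDiff_jump (fun j => (hη.contDiff s j).of_le (by exact_mod_cast hn)) hφ
    have d1 : Differentiable ℝ (classicalD β (jump (η s) φ)) :=
      (contDiff_classicalD (r := 1) (hc.of_le (by norm_cast; omega)) β).differentiable (by simp)
    have d2 : Differentiable ℝ (jump (η s) (classicalD β φ)) :=
      (contDiff_jump (r := 1) hη1 (hφ.cD β)).differentiable (by simp)
    ext x
    rw [pd_sub d1 d2, pd_jump hη1 (hφ.cD β), classicalD_cons hc]
    simp only [classicalD_cons (hφ.nat (n + 1))]
    ring

end commutators

end symbols

end IntegroDiff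

end

noncomputable section

namespace IntegroDiff

/-! ### Estimates in `L_p` of the jump operators for a single mark -/

section jumpLp
variable {d l : ℕ} {K δ : ℝ} {η : Rd d → Rd d}

lemma JumpHyp.mono {l' : ℕ} (h : JumpHyp l K δ η) (hl : l' ≤ l) : JumpHyp l' K δ η :=
  ⟨h.contDiff.of_le (by exact_mod_cast hl), h.bound,
    fun k hk hkl => h.deriv_bound k hk (hkl.trans hl), h.det_bound⟩

lemma fderiv_eq_sum_pd (φ : Rd d → ℝ) (x y : Rd d) :
    fderiv ℝ φ x y = ∑ j, y j * pd j φ x := by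
  have h4 : y = ∑ j, y j • EuclideanSpace.single j (1 : ℝ) := by
    ext k
    simp [Pi.single_apply]
  conv_lhs => rw [h4, map_sum]
  simp [pd]

lemma sub_eq_integral_pd {φ : Rd d → ℝ} (hφ : ContDiff ℝ 1 φ) (x y : Rd d) :
    φ (x + y) - φ x = ∫ θ in Set.Ioc (0 : ℝ) 1, ∑ i, y i * pd i φ (x + θ • y) := by
  have h1 : ∀ θ : ℝ, HasDerivAt (fun θ : ℝ => φ (x + θ • y)) (∑ i, y i * pd i φ (x + θ • y)) θ := by
    intro θ
    have h2 : HasDerivAt (fun θ : ℝ => x + θ • y) y θ := by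
      simpa using ((hasDerivAt_id θ).smul_const y).const_add x
    have h3 := ((hφ.differentiable (by simp)) (x + θ • y)).hasFDerivAt.comp_hasDerivAt θ h2
    rw [fderiv_eq_sum_pd] at h3
    exact h3
  have hc : Continuous fun θ : ℝ => ∑ i, y i * pd i φ (x + θ • y) :=
    continuous_finsetSum _ fun i _ => continuous_const.mul
      ((contDiff_pd (r := 0) (by simpa using hφ) i).continuous.comp (by fun_prop))
  rw [← intervalIntegral.integral_of_le zero_le_one,
    intervalIntegral.integral_eq_sub_of_hasDerivAt (fun θ _ => h1 θ) (hc.intervalIntegrable _ _)]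
  simp

lemma eLpNorm_mul_le_of_abs_le {p : ℝ≥0∞} {X : Type*} [MeasurableSpace X] {lam : Measure X}
    {f g : X → ℝ} {C : ℝ} (hf : ∀ x, |f x| ≤ C) :
    eLpNorm (fun x => f x * g x) p lam ≤ ENNReal.ofReal C * eLpNorm g p lam := by
  refine eLpNorm_le_mul_eLpNorm_of_ae_le_mul (Filter.Eventually.of_forall fun x => ?_) p
  rw [norm_mul]
  exact mul_le_mul_of_nonneg_right (hf x) (norm_nonneg _)

lemma eLpNorm_sum_mul_le {p : ℝ≥0∞} (hp : 1 ≤ p) {X : Type*} [MeasurableSpace X] {lam : Measure X}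
    {ι : Type*} [Fintype ι] {f g : ι → X → ℝ} {C : ℝ} (hf : ∀ i x, |f i x| ≤ C)
    (hm : ∀ i, AEStronglyMeasurable (f i) lam) (hg : ∀ i, AEStronglyMeasurable (g i) lam) :
    eLpNorm (fun x => ∑ i, f i x * g i x) p lam ≤ ENNReal.ofReal C * ∑ i, eLpNorm (g i) p lam := by
  have h1 : (fun x => ∑ i, f i x * g i x) = ∑ i, fun x => f i x * g i x := by
    ext x; simp
  rw [h1, Finset.mul_sum]
  exact (eLpNorm_sum_le (fun i _ => (hm i).mul (hg i)) hp).trans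
    (Finset.sum_le_sum fun i _ => eLpNorm_mul_le_of_abs_le (hf i))

/-- `|φ ∘ τ - φ|_p ≤ C δ |∇φ|_p`. -/
lemma JumpHyp.eLpNorm_diff_le (h : JumpHyp l K δ η) (hl : 1 ≤ l) (hK : 0 < K) {p : ℕ} (hp : 1 ≤ p)
    {φ : Rd d → ℝ} (hφ : IsTestFunction φ) :
    eLpNorm (fun x => φ (x + η x) - φ x) (p : ℝ≥0∞) volume ≤
      ENNReal.ofReal (δ * max 1 K) * ∑ i, eLpNorm (pd i φ) (p : ℝ≥0∞) volume := by
  have hp' : (1 : ℝ≥0∞) ≤ p := by exact_mod_cast hp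
  have hηc : Continuous η := h.contDiff.continuous
  set B := ENNReal.ofReal (δ * max 1 K) * ∑ i, eLpNorm (pd i φ) (p : ℝ≥0∞) volume with hB
  have hF : Continuous fun q : Rd d × ℝ => ∑ i, η q.1 i * pd i φ (q.1 + q.2 • η q.1) :=
    continuous_finsetSum _ fun i _ => ((h.contDiff_comp i).continuous.comp continuous_fst).mul
      ((hφ.pd i).1.continuous.comp (continuous_fst.add
        (continuous_snd.smul (hηc.comp continuous_fst))))
  have hBt : B ≠ ∞ := ENNReal.mul_ne_top ENNReal.ofReal_ne_top
    (ENNReal.sum_ne_top.2 fun i _ => ((hφ.pd i).memLp p).eLpNorm_ne_top)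
  have key := (minkowski_integral (lam := (volume : Measure (Rd d)))
    (μ := volume.restrict (Set.Ioc (0 : ℝ) 1)) (h := fun _ => B)
    hF.aestronglyMeasurable measurable_const (by simpa using hBt) hp ?_).2.2
  · simp only [← sub_eq_integral_pd (hφ.sm.nat 1)] at key
    simpa using key
  · refine (ae_restrict_iff' measurableSet_Ioc).2 (Filter.Eventually.of_forall fun θ hθ => ?_)
    have hs := h.smul hl (θ := θ) ⟨hθ.1.le, hθ.2⟩
    refine (eLpNorm_sum_mul_le hp' (fun i x => h.abs_comp_le i x)
      (fun i => (h.contDiff_comp i).continuous.aestronglyMeasurable)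
      (fun i => ((hφ.pd i).1.continuous.comp
        (continuous_id.add (hηc.const_smul θ))).aestronglyMeasurable)).trans ?_
    rw [hB, ENNReal.ofReal_mul h.delta_nonneg, mul_assoc]
    refine mul_le_mul' le_rfl ?_
    rw [Finset.mul_sum]
    exact Finset.sum_le_sum fun i _ => hs.eLpNorm_comp_le hl hK hp (pd i φ)

lemma jump_eq_integral {φ : Rd d → ℝ} (hφ : ContDiff ℝ 1 φ) (η : Rd d → Rd d) (x : Rd d) :
    jump η φ x = ∫ θ in Set.Ioc (0 : ℝ) 1, ∑ i, η x i * (pd i φ (x + θ • η x) - pd i φ x) := by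
  have hc : ∀ i, Continuous (pd i φ) := fun i =>
    (contDiff_pd (r := 0) (by simpa using hφ) i).continuous
  have h1 : IntegrableOn (fun θ : ℝ => ∑ i, η x i * pd i φ (x + θ • η x)) (Set.Ioc 0 1) :=
    (continuous_finsetSum _ fun i _ => continuous_const.mul ((hc i).comp
      (by fun_prop))).integrableOn_Ioc
  have h2 : IntegrableOn (fun _ : ℝ => ∑ i, η x i * pd i φ x) (Set.Ioc (0 : ℝ) 1) :=
    continuous_const.integrableOn_Ioc
  simp only [mul_sub, Finset.sum_sub_distrib]
  rw [integral_sub h1 h2, ← sub_eq_integral_pd hφ]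
  simp [jump]

/-- `|φ ∘ τ - φ - η ∇φ|_p ≤ C δ² |D²φ|_p`. -/
lemma JumpHyp.eLpNorm_jump_le (h : JumpHyp l K δ η) (hl : 1 ≤ l) (hK : 0 < K) {p : ℕ} (hp : 1 ≤ p)
    {φ : Rd d → ℝ} (hφ : IsTestFunction φ) :
    eLpNorm (jump η φ) (p : ℝ≥0∞) volume ≤
      ENNReal.ofReal (δ ^ 2 * max 1 K) * ∑ i, ∑ j, eLpNorm (pd j (pd i φ)) (p : ℝ≥0∞) volume := by
  have hp' : (1 : ℝ≥0∞) ≤ p := by exact_mod_cast hp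
  have hηc : Continuous η := h.contDiff.continuous
  set B := ENNReal.ofReal (δ ^ 2 * max 1 K) *
    ∑ i, ∑ j, eLpNorm (pd j (pd i φ)) (p : ℝ≥0∞) volume with hB
  have hF : Continuous fun q : Rd d × ℝ =>
      ∑ i, η q.1 i * (pd i φ (q.1 + q.2 • η q.1) - pd i φ q.1) :=
    continuous_finsetSum _ fun i _ => ((h.contDiff_comp i).continuous.comp continuous_fst).mul
      (((hφ.pd i).1.continuous.comp (continuous_fst.add
        (continuous_snd.smul (hηc.comp continuous_fst)))).sub
        ((hφ.pd i).1.continuous.comp continuous_fst))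
  have hBt : B ≠ ∞ := ENNReal.mul_ne_top ENNReal.ofReal_ne_top
    (ENNReal.sum_ne_top.2 fun i _ => ENNReal.sum_ne_top.2 fun j _ =>
      (((hφ.pd i).pd j).memLp p).eLpNorm_ne_top)
  have key := (minkowski_integral (lam := (volume : Measure (Rd d)))
    (μ := volume.restrict (Set.Ioc (0 : ℝ) 1)) (h := fun _ => B)
    hF.aestronglyMeasurable measurable_const (by simpa using hBt) hp ?_).2.2
  · simp only [← jump_eq_integral (hφ.sm.nat 1)] at key
    simpa using key
  · refine (ae_restrict_iff' measurableSet_Ioc).2 (Filter.Eventually.of_forall fun θ hθ => ?_)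
    have hs := h.smul hl (θ := θ) ⟨hθ.1.le, hθ.2⟩
    refine (eLpNorm_sum_mul_le hp' (fun i x => h.abs_comp_le i x)
      (fun i => (h.contDiff_comp i).continuous.aestronglyMeasurable)
      (fun i => (((hφ.pd i).1.continuous.comp
        (continuous_id.add (hηc.const_smul θ))).sub (hφ.pd i).1.continuous).aestronglyMeasurable)).trans ?_
    rw [hB, pow_two, mul_assoc δ, ENNReal.ofReal_mul h.delta_nonneg, mul_assoc]
    refine mul_le_mul' le_rfl ?_
    rw [Finset.mul_sum]
    exact Finset.sum_le_sum fun i _ => hs.eLpNorm_diff_le hl hK hp (hφ.pd i)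

end jumpLp

/-! ### Commutators of derivatives and jump operators -/

section commutatorBounds
variable {d : ℕ}

/-- The jump coefficients which satisfy the assumptions with given constants. -/
def JumpIndex (d l : ℕ) (K : ℝ) : Type := {s : ℝ × (Rd d → Rd d) // JumpHyp l K s.1 s.2}

lemma jumpFamily (d : ℕ) {l : ℕ} (hl : 1 ≤ l) {K : ℝ} (hK : 0 < K) :
    JumpFamily l (fun s : JumpIndex d l K => s.1.1) (fun s => s.1.2) := by
  obtain ⟨A, hA⟩ : ∃ A : ℝ, A = ∑ k ∈ Finset.range (l - 1 + 1), ∑ _β : Fin k → Fin d, (1 : ℝ) :=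
    ⟨_, rfl⟩
  have hpos : 0 ≤ A := hA ▸ Finset.sum_nonneg fun _ _ => Finset.sum_nonneg fun _ _ => zero_le_one
  have key : ∀ (i j : Fin d) (δ : ℝ) (η : Rd d → Rd d), JumpHyp l K δ η → ∀ x,
      jetAbs (l - 1) (pd i (fun x => η x j)) x ≤ A * min δ K := by
    intro i j δ η hη x
    unfold jetAbs
    rw [hA, Finset.sum_mul]
    refine Finset.sum_le_sum fun k hk => ?_
    rw [Finset.sum_mul]
    refine Finset.sum_le_sum fun β _ => ?_
    have hk' : k + 1 ≤ l := by have := Finset.mem_range.1 hk; omega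
    rw [one_mul, ← classicalD_cons' ((hη.contDiff_comp j).of_le (by exact_mod_cast hk'))]
    exact hη.abs_classicalD_le (by omega) hk' _ j x
  have hc : ∀ (i j : Fin d) (δ : ℝ) (η : Rd d → Rd d), JumpHyp l K δ η →
      ContDiff ℝ (l - 1 : ℕ) (pd i (fun x => η x j)) := fun i j δ η hη =>
    contDiff_pd ((hη.contDiff_comp j).of_le (by norm_cast; omega)) i
  refine ⟨fun s => s.2.delta_nonneg, fun s j => s.2.contDiff_comp j, fun i j => ?_, fun i j => ?_⟩
  · exact ⟨fun s => hc i j _ _ s.2, A, hpos, fun s x => (key i j _ _ s.2 x).trans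
      (mul_le_mul_of_nonneg_left (min_le_left _ _) hpos)⟩
  · refine ⟨fun s => hc i j _ _ s.2, A * K, mul_nonneg hpos hK.le, fun s x =>
      (key i j _ _ s.2 x).trans ?_⟩
    rw [mul_one]
    exact mul_le_mul_of_nonneg_left (min_le_right _ _) hpos

/-- `D_α(φ ∘ τ) - (D_α φ) ∘ τ` is of order `δ`. -/
lemma exists_commutator_comp_le (d : ℕ) {l : ℕ} (hl : 1 ≤ l) {K : ℝ} (hK : 0 < K) {n : ℕ}
    (hn : n ≤ l) : ∃ C : ℝ, 0 ≤ C ∧ ∀ δ (η : Rd d → Rd d), JumpHyp l K δ η →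
      ∀ (α : Fin n → Fin d) φ, Sm φ → ∀ x,
        |classicalD α (fun x => φ (x + η x)) x - classicalD α φ (x + η x)| ≤
          C * (δ * jetAbs n φ (x + η x)) := by
  have hf := jumpFamily d hl hK
  choose C hC h using fun α : Fin n → Fin d =>
    (errorTerm_comp hf n hn α).bound hf.nonneg (fun _ => le_rfl)
  refine ⟨∑ α, C α, Finset.sum_nonneg fun α _ => hC α, fun δ η hη α φ hφ x => ?_⟩
  have h1 := h α ⟨(δ, η), hη⟩ φ hφ x
  simp only [zero_mul, add_zero] at h1
  refine h1.trans (mul_le_mul_of_nonneg_right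
    (Finset.single_le_sum (fun α _ => hC α) (Finset.mem_univ α)) ?_)
  exact mul_nonneg hη.delta_nonneg (jetAbs_nonneg _ _ _)

/-- `D_α J φ - J D_α φ` is of order `δ²`, up to terms of order `δ` with differences. -/
lemma exists_commutator_jump_le (d : ℕ) {l : ℕ} (hl : 1 ≤ l) {K : ℝ} (hK : 0 < K) {n : ℕ}
    (hn : n ≤ l) : ∃ C : ℝ, 0 ≤ C ∧ ∀ δ (η : Rd d → Rd d), JumpHyp l K δ η →
      ∀ (α : Fin n → Fin d) φ, Sm φ → ∀ x,
        |classicalD α (jump η φ) x - jump η (classicalD α φ) x| ≤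
          C * (δ ^ 2 * jetAbs n φ (x + η x) + δ * ∑ k ∈ Finset.range (n + 1),
            ∑ β : Fin k → Fin d, |classicalD β φ (x + η x) - classicalD β φ x|) := by
  have hf := jumpFamily d hl hK
  choose C hC h using fun α : Fin n → Fin d =>
    (errorTerm_jump hf n hn α).bound (fun s => mul_self_nonneg s.1.1) hf.nonneg
  refine ⟨∑ α, C α, Finset.sum_nonneg fun α _ => hC α, fun δ η hη α φ hφ x => ?_⟩
  have h1 := h α ⟨(δ, η), hη⟩ φ hφ x
  simp only [← pow_two] at h1
  refine h1.trans (mul_le_mul_of_nonneg_right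
    (Finset.single_le_sum (fun α _ => hC α) (Finset.mem_univ α)) ?_)
  have := hη.delta_nonneg
  exact add_nonneg (mul_nonneg (sq_nonneg _) (jetAbs_nonneg _ _ _)) (mul_nonneg hη.delta_nonneg
    (Finset.sum_nonneg fun _ _ => Finset.sum_nonneg fun _ _ => abs_nonneg _))

end commutatorBounds

end IntegroDiff

end

noncomputable section

namespace IntegroDiff

/-! ### Energy estimates for a single mark -/

section pointwise
variable {ι : Type*} [Fintype ι]

lemma mul_pow_mul_sub_le {A B : ℝ} (hA : 0 ≤ A) (hB : 0 ≤ B) (q : ℕ) :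
    q * A ^ (q - 1) * (B - A) ≤ B ^ q - A ^ q := by
  induction q with
  | zero => simp
  | succ q ih =>
    have h1 : 0 ≤ (B - A) * (B ^ q - A ^ q) := by
      rcases le_total A B with h | h
      · exact mul_nonneg (sub_nonneg.2 h) (sub_nonneg.2 (pow_le_pow_left₀ hA h q))
      · exact mul_nonneg_of_nonpos_of_nonpos (sub_nonpos.2 h)
          (sub_nonpos.2 (pow_le_pow_left₀ hB h q))
    have h2 := mul_le_mul_of_nonneg_left ih hA
    have h3 : A * (q * A ^ (q - 1) * (B - A)) = q * A ^ q * (B - A) := by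
      rcases q with _ | q
      · simp
      · simp only [Nat.add_sub_cancel, pow_succ]; ring
    rw [h3] at h2
    push_cast
    rw [pow_succ, pow_succ]
    nlinarith

lemma sq_sum_abs_le (u : ι → ℝ) : (∑ α, |u α|) ^ 2 ≤ Fintype.card ι * ∑ α, u α ^ 2 := by
  have := sq_sum_le_card_mul_sum_sq (s := Finset.univ) (f := fun α => |u α|)
  simpa using this

lemma mul_sum_abs_mul_sum_abs_le (u w : ι → ℝ) (c : ℝ) :
    c * (∑ α, |u α|) * ∑ β, |w β| ≤
      1 / 2 * ∑ β, w β ^ 2 + 1 / 2 * (Fintype.card ι) ^ 2 * c ^ 2 * ∑ α, u α ^ 2 := by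
  rcases isEmpty_or_nonempty ι with h | h
  · simp
  have hm : (0 : ℝ) < Fintype.card ι := by exact_mod_cast Fintype.card_pos
  have h1 := sq_sum_abs_le u
  have h2 := sq_sum_abs_le w
  set m : ℝ := (Fintype.card ι : ℝ)
  set U := ∑ α, |u α|
  set G := ∑ β, |w β|
  have h3 : 0 ≤ (m * c * U - G) ^ 2 := sq_nonneg _
  have h4 : m ^ 2 * c ^ 2 * U ^ 2 ≤ m ^ 2 * c ^ 2 * (m * ∑ α, u α ^ 2) :=
    mul_le_mul_of_nonneg_left h1 (by positivity)
  refine le_of_mul_le_mul_left ?_ (mul_pos two_pos hm)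
  nlinarith

lemma vpow_mul_eq_pow {q : ℕ} (hq : 1 ≤ q) (u : ι → ℝ) :
    ∑ α, vpow q u α * u α = (∑ α, u α ^ 2) ^ q := by
  obtain ⟨q, rfl⟩ : ∃ r, q = r + 1 := ⟨q - 1, by omega⟩
  simp only [vpow, Nat.add_sub_cancel, pow_succ, mul_assoc, ← Finset.mul_sum]
  congr 1
  exact Finset.sum_congr rfl fun α _ => by ring

lemma sum_vpow_mul_diff_le {q : ℕ} (hq : 1 ≤ q) (u v e : ι → ℝ) {W c : ℝ} (hW : 0 ≤ W)
    (he : ∀ α, |e α| ≤ W + c * ∑ β, |v β - u β|) :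
    ∑ α, vpow q u α * (v α - u α + e α) ≤
      1 / (2 * q) * ((∑ α, v α ^ 2) ^ q - (∑ α, u α ^ 2) ^ q) +
      1 / 2 * (Fintype.card ι) ^ 2 * c ^ 2 * (∑ α, u α ^ 2) ^ q + ∑ α, |vpow q u α * W| := by
  have hA : 0 ≤ ∑ α, u α ^ 2 := Finset.sum_nonneg fun _ _ => sq_nonneg _
  have hB : 0 ≤ ∑ α, v α ^ 2 := Finset.sum_nonneg fun _ _ => sq_nonneg _
  have hq0 : (0 : ℝ) < q := by exact_mod_cast hq
  set A := ∑ α, u α ^ 2 with hAdef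
  set B := ∑ α, v α ^ 2 with hBdef
  set P := A ^ (q - 1) with hP
  have hP0 : 0 ≤ P := pow_nonneg hA _
  have hAq : P * A = A ^ q := by rw [hP, ← pow_succ]; congr 1; omega
  have hv : ∀ α, vpow q u α = P * u α := fun α => rfl
  have h1 : ∑ α, vpow q u α * (v α - u α) =
      P * (1 / 2 * (B - A) - 1 / 2 * ∑ α, (v α - u α) ^ 2) := by
    simp only [hv, hAdef, hBdef, mul_assoc, ← Finset.mul_sum]
    congr 1
    rw [← Finset.sum_sub_distrib, Finset.mul_sum, Finset.mul_sum, ← Finset.sum_sub_distrib]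
    exact Finset.sum_congr rfl fun α _ => by ring
  have h2 : P * (1 / 2 * (B - A)) ≤ 1 / (2 * q) * (B ^ q - A ^ q) := by
    have := mul_le_mul_of_nonneg_left (mul_pow_mul_sub_le hA hB q)
      (by positivity : (0 : ℝ) ≤ 1 / (2 * q))
    refine le_trans (le_of_eq ?_) this
    rw [← hP]; field_simp
  have h3 : ∑ α, vpow q u α * e α ≤ ∑ α, |vpow q u α * W| +
      P * (c * (∑ α, |u α|) * ∑ β, |v β - u β|) := by
    have : P * (c * (∑ α, |u α|) * ∑ β, |v β - u β|) =
        ∑ α, |vpow q u α| * (c * ∑ β, |v β - u β|) := by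
      simp only [hv, abs_mul, abs_of_nonneg hP0, ← Finset.sum_mul, ← Finset.mul_sum]
      ring
    rw [this, ← Finset.sum_add_distrib]
    refine Finset.sum_le_sum fun α _ => ?_
    rw [abs_mul, abs_of_nonneg hW, ← mul_add]
    exact (le_abs_self _).trans ((abs_mul _ _).le.trans
      (mul_le_mul_of_nonneg_left (he α) (abs_nonneg _)))
  have h4 := mul_le_mul_of_nonneg_left (mul_sum_abs_mul_sum_abs_le u (fun β => v β - u β) c) hP0
  rw [← hAdef] at h4
  simp only [mul_add, Finset.sum_add_distrib]
  rw [← hAq]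
  rw [h1]
  rw [← hAq] at h2
  nlinarith

end pointwise

section markEnergy
variable {d l : ℕ} {K δ : ℝ} {η : Rd d → Rd d} {ι : Type*} [Fintype ι]

lemma integral_abs_vpow_mul_le {X : Type*} [MeasurableSpace X] {lam : Measure X} {q : ℕ}
    (hq : 1 ≤ q) {u : ι → X → ℝ}
    (hu : ∀ α, MemLp (u α) ((2 * q : ℕ) : ℝ≥0∞) lam) {g : X → ℝ}
    (hg : MemLp g ((2 * q : ℕ) : ℝ≥0∞) lam) (α : ι) {A B : ℝ} (hA : 0 ≤ A) (hB : 0 ≤ B)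
    (h1 : ∑ β, eLpNorm (u β) ((2 * q : ℕ) : ℝ≥0∞) lam ≤ ENNReal.ofReal A)
    (h2 : eLpNorm g ((2 * q : ℕ) : ℝ≥0∞) lam ≤ ENNReal.ofReal B) :
    ∫ x, |vpow q (fun β => u β x) α * g x| ∂lam ≤ A ^ (2 * q - 1) * B := by
  have h := lintegral_vpow_mul_le hq (fun β => (hu β).1) hg.1 α
  have h3 := integral_norm_eq_lintegral_enorm (vpow_mul_integrable hq hu hg α).1
  simp only [Real.norm_eq_abs] at h3
  rw [h3]
  refine ENNReal.toReal_le_of_le_ofReal (by positivity) ?_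
  rw [ENNReal.ofReal_mul (by positivity), ENNReal.ofReal_pow hA]
  exact h.trans (by gcongr)

lemma pd_sum_sq_pow {u : ι → Rd d → ℝ} (hu : ∀ α, Sm (u α)) (q : ℕ) (i : Fin d) (x : Rd d) :
    pd i (fun x => (∑ α, u α x ^ 2) ^ q) x =
      2 * q * ∑ α, vpow q (fun β => u β x) α * pd i (u α) x := by
  have hs : ∀ α, Differentiable ℝ fun x => u α x ^ 2 := fun α => ((hu α).pow 2).differentiable
  rw [pd_pow (Differentiable.fun_sum fun α _ => hs α), pd_sum fun α _ => hs α]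
  simp only [fun α => pd_pow (hu α).differentiable 2 i, vpow, mul_assoc, ← Finset.mul_sum]
  norm_num
  ring

lemma isTestFunction_sum_sq_pow {u : ι → Rd d → ℝ} (hu : ∀ α, IsTestFunction (u α)) {q : ℕ}
    (hq : 1 ≤ q) : IsTestFunction (fun x => (∑ α, u α x ^ 2) ^ q) := by
  classical
  refine ⟨Sm.pow (Sm.sum fun α _ => (hu α).sm.pow 2) q, ?_⟩
  refine HasCompactSupport.intro
    ((isCompact_iUnion fun α => (hu α).2.isCompact) : IsCompact (⋃ α, tsupport (u α))) fun x hx => ?_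
  have : ∀ α, u α x = 0 := fun α => image_eq_zero_of_notMem_tsupport fun h =>
    hx (Set.mem_iUnion.2 ⟨α, h⟩)
  simp [this, show q ≠ 0 by omega]

/-- The basic energy estimate for a jump operator and a system `u` of test functions; the case
`κ = 1` includes the compensator. -/
lemma JumpHyp.sum_integral_vpow_mul_le (h : JumpHyp l K δ η) {q : ℕ} (hq : 1 ≤ q)
    {u g : ι → Rd d → ℝ} (hu : ∀ α, IsTestFunction (u α))
    (hg : ∀ α, MemLp (g α) ((2 * q : ℕ) : ℝ≥0∞)) {W : Rd d → ℝ}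
    (hW : MemLp W ((2 * q : ℕ) : ℝ≥0∞)) (hW0 : ∀ x, 0 ≤ W x) {c κ A B : ℝ}
    (hA : 0 ≤ A) (hB : 0 ≤ B)
    (h1 : ∑ β, eLpNorm (u β) ((2 * q : ℕ) : ℝ≥0∞) volume ≤ ENNReal.ofReal A)
    (h2 : eLpNorm W ((2 * q : ℕ) : ℝ≥0∞) volume ≤ ENNReal.ofReal B)
    (he : ∀ α x, |g α x - (u α (x + η x) - u α x - κ * ∑ i, η x i * pd i (u α) x)| ≤
      W x + c * ∑ β, |u β (x + η x) - u β x|) :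
    ∑ α, ∫ x, vpow q (fun β => u β x) α * g α x ≤
      (1 / (2 * q) * ∫ x, ((fun x => (∑ α, u α x ^ 2) ^ q) (x + η x) - (∑ α, u α x ^ 2) ^ q -
        κ * ∑ i, η x i * pd i (fun x => (∑ α, u α x ^ 2) ^ q) x)) +
      (1 / 2 * (Fintype.card ι) ^ 2 * c ^ 2 * ∫ x, (∑ α, u α x ^ 2) ^ q) +
      Fintype.card ι * (A ^ (2 * q - 1) * B) := by
  have hq0 : (q : ℝ) ≠ 0 := by exact_mod_cast (by omega : q ≠ 0)
  have hF := isTestFunction_sum_sq_pow hu hq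
  set F : Rd d → ℝ := fun x => (∑ α, u α x ^ 2) ^ q with hFdef
  have huL : ∀ α, MemLp (u α) ((2 * q : ℕ) : ℝ≥0∞) := fun α => (hu α).memLp _
  have iF : Integrable F := hF.1.continuous.integrable_of_hasCompactSupport hF.2
  have iFτ : Integrable fun x => F (x + η x) :=
    (hF.1.continuous.comp (continuous_id.add h.contDiff.continuous)).integrable_of_hasCompactSupport
      (h.hasCompactSupport_comp hF.2)
  have ig : Integrable fun x => κ * ∑ i, η x i * pd i F x :=
    (integrable_finsetSum _ fun i _ =>
      ((h.contDiff_comp i).continuous.mul (hF.pd i).1.continuous).integrable_of_hasCompactSupport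
        (hF.pd i).2.mul_left).const_mul κ
  have iJ : Integrable fun x => F (x + η x) - F x - κ * ∑ i, η x i * pd i F x :=
    (iFτ.sub iF).sub ig
  have iW : ∀ α, Integrable fun x => |vpow q (fun β => u β x) α * W x| := fun α =>
    (vpow_mul_integrable hq huL hW α).abs
  have iv : ∀ α, Integrable fun x => vpow q (fun β => u β x) α * g α x := fun α =>
    vpow_mul_integrable hq huL (hg α) α
  have hpt : ∀ x, ∑ α, vpow q (fun β => u β x) α * g α x ≤
      1 / (2 * q) * (F (x + η x) - F x - κ * ∑ i, η x i * pd i F x) +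
      1 / 2 * (Fintype.card ι) ^ 2 * c ^ 2 * F x + ∑ α, |vpow q (fun β => u β x) α * W x| := by
    intro x
    have h3 := sum_vpow_mul_diff_le hq (fun α => u α x) (fun α => u α (x + η x))
      (fun α => g α x - (u α (x + η x) - u α x - κ * ∑ i, η x i * pd i (u α) x)) (hW0 x)
      (fun α => he α x)
    have h4 : ∑ i, η x i * pd i F x = 2 * q * ∑ α, vpow q (fun β => u β x) α *
        ∑ i, η x i * pd i (u α) x := by
      simp only [hFdef, fun i => pd_sum_sq_pow (fun α => (hu α).sm) q i x, Finset.mul_sum]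
      rw [Finset.sum_comm]
      exact Finset.sum_congr rfl fun α _ => Finset.sum_congr rfl fun i _ => by ring
    have h5 : ∑ α, vpow q (fun β => u β x) α * g α x =
        ∑ α, vpow q (fun β => u β x) α * (u α (x + η x) - u α x +
          (g α x - (u α (x + η x) - u α x - κ * ∑ i, η x i * pd i (u α) x))) -
        κ * ∑ α, vpow q (fun β => u β x) α * ∑ i, η x i * pd i (u α) x := by
      rw [Finset.mul_sum, ← Finset.sum_sub_distrib]
      exact Finset.sum_congr rfl fun α _ => by ring
    rw [h5, h4]
    refine (sub_le_sub_right h3 _).trans (le_of_eq ?_)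
    generalize (∑ α, |vpow q (fun α => u α x) α * W x|) = Y
    simp only [hFdef]
    field_simp
    ring
  rw [← integral_finsetSum _ fun α _ => iv α]
  refine (integral_mono (integrable_finsetSum _ fun α _ => iv α) ?_ hpt).trans ?_
  · exact ((iJ.const_mul _).add (iF.const_mul _)).add (integrable_finsetSum _ fun α _ => iW α)
  have i1 : Integrable fun x => 1 / (2 * q) * (F (x + η x) - F x - κ * ∑ i, η x i * pd i F x) +
      1 / 2 * (Fintype.card ι) ^ 2 * c ^ 2 * F x := (iJ.const_mul _).add (iF.const_mul _)
  rw [integral_add i1 (integrable_finsetSum _ fun α _ => iW α),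
    integral_add (iJ.const_mul _) (iF.const_mul _), integral_const_mul, integral_const_mul,
    integral_finsetSum _ fun α _ => iW α]
  refine add_le_add le_rfl ?_
  refine (Finset.sum_le_sum fun α _ =>
    integral_abs_vpow_mul_le hq huL hW α hA hB h1 h2).trans ?_
  simp

lemma integral_sum_sq_pow_le {q : ℕ} (hq : 1 ≤ q) {u : ι → Rd d → ℝ}
    (hu : ∀ α, MemLp (u α) ((2 * q : ℕ) : ℝ≥0∞)) {A : ℝ} (hA : 0 ≤ A)
    (h1 : ∑ β, eLpNorm (u β) ((2 * q : ℕ) : ℝ≥0∞) volume ≤ ENNReal.ofReal A) :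
    ∫ x, (∑ α, u α x ^ 2) ^ q ≤ Fintype.card ι * A ^ (2 * q) := by
  have h2 : ∀ α, ∫ x, vpow q (fun β => u β x) α * u α x ≤ A ^ (2 * q) := fun α => by
    have := abs_integral_vpow_mul_le hq hu (hu α) α hA hA h1
      ((Finset.single_le_sum (f := fun β => eLpNorm (u β) ((2 * q : ℕ) : ℝ≥0∞) volume)
        (fun _ _ => zero_le) (Finset.mem_univ α)).trans h1)
    rw [← pow_succ, show 2 * q - 1 + 1 = 2 * q by omega] at this
    exact (le_abs_self _).trans this
  simp only [← vpow_mul_eq_pow hq]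
  rw [integral_finsetSum _ fun α _ => vpow_mul_integrable hq hu (hu α) α]
  refine (Finset.sum_le_sum fun α _ => h2 α).trans ?_
  simp

end markEnergy

end IntegroDiff

end

noncomputable section

namespace IntegroDiff

/-! ### The estimates for a single mark -/

section mark
variable {d l : ℕ} {K δ : ℝ} {η : Rd d → Rd d}

lemma eLpNorm_classicalD_le_sobN {n p k : ℕ} (hk : k ≤ n) (α : Fin k → Fin d) {φ : Rd d → ℝ}
    (hφ : Sm φ) : eLpNorm (classicalD α φ) (p : ℝ≥0∞) volume ≤ sobN n p φ := by
  rw [← eLpNorm_congr_ae (weakD_classical (hφ.nat k) α (Filter.EventuallyEq.refl _ _))]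
  exact eLpNorm_weakD_le_sobN hk α φ

lemma sum_eLpNorm_classicalD_le {n p : ℕ} {φ : Rd d → ℝ} (hφ : Sm φ) :
    ∑ β : Fin n → Fin d, eLpNorm (classicalD β φ) (p : ℝ≥0∞) volume ≤ sobN n p φ := by
  rw [sobN_classical (hφ.nat n)]
  exact Finset.single_le_sum (f := fun k => ∑ β : Fin k → Fin d,
    eLpNorm (classicalD β φ) (p : ℝ≥0∞) volume) (fun _ _ => zero_le)
    (Finset.mem_range.2 (Nat.lt_succ_self n))

lemma eLpNorm_jetAbs_le {n p : ℕ} (hp : 1 ≤ p) {φ : Rd d → ℝ} (hφ : IsTestFunction φ) :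
    eLpNorm (jetAbs n φ) (p : ℝ≥0∞) volume ≤ sobN n p φ := by
  have hp' : (1 : ℝ≥0∞) ≤ p := by exact_mod_cast hp
  rw [sobN_classical (hφ.sm.nat n)]
  have h1 : jetAbs n φ = ∑ k ∈ Finset.range (n + 1), fun x =>
      ∑ β : Fin k → Fin d, |classicalD β φ x| := by
    ext x; simp [jetAbs]
  rw [h1]
  refine (eLpNorm_sum_le (fun k _ => aesm_sum_abs fun β =>
    ((hφ.cD β).memLp p).1) hp').trans (Finset.sum_le_sum fun k _ => ?_)
  exact eLpNorm_sum_abs_le hp' fun β => ((hφ.cD β).memLp p).1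

lemma JumpHyp.eLpNorm_jetAbs_comp_le (h : JumpHyp l K δ η) (hl : 1 ≤ l) (hK : 0 < K) {n p : ℕ}
    (hp : 1 ≤ p) {φ : Rd d → ℝ} (hφ : IsTestFunction φ) :
    MemLp (fun x => jetAbs n φ (x + η x)) (p : ℝ≥0∞) ∧
    eLpNorm (fun x => jetAbs n φ (x + η x)) (p : ℝ≥0∞) volume ≤
      ENNReal.ofReal (max 1 K) * sobN n p φ :=
  ⟨h.memLp_comp hl hK hp (memLp_jetAbs fun _ _ β => (hφ.cD β).memLp p),
    (h.eLpNorm_comp_le hl hK hp _).trans (mul_le_mul' le_rfl (eLpNorm_jetAbs_le hp hφ))⟩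

/-- The sum of the absolute values of the increments of the derivatives of order less than `r`. -/
def diffAbs (r : ℕ) (η : Rd d → Rd d) (φ : Rd d → ℝ) (x : Rd d) : ℝ :=
  ∑ k ∈ Finset.range r, ∑ β : Fin k → Fin d, |classicalD β φ (x + η x) - classicalD β φ x|

lemma diffAbs_nonneg (r : ℕ) (η : Rd d → Rd d) (φ : Rd d → ℝ) (x : Rd d) : 0 ≤ diffAbs r η φ x :=
  Finset.sum_nonneg fun _ _ => Finset.sum_nonneg fun _ _ => abs_nonneg _

lemma JumpHyp.memLp_diff (h : JumpHyp l K δ η) (hl : 1 ≤ l) (hK : 0 < K) {p : ℕ}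
    (hp : 1 ≤ p) {φ : Rd d → ℝ} (hφ : IsTestFunction φ) :
    MemLp (fun x => φ (x + η x) - φ x) (p : ℝ≥0∞) :=
  (h.memLp_comp hl hK hp (hφ.memLp p)).sub (hφ.memLp p)

lemma exists_eLpNorm_diffAbs_le (d r : ℕ) {K : ℝ} (hK : 0 < K) : ∃ C : ℝ, 0 ≤ C ∧
    ∀ δ (η : Rd d → Rd d), JumpHyp 1 K δ η → ∀ p : ℕ, 1 ≤ p → ∀ φ, IsTestFunction φ →
      MemLp (diffAbs r η φ) (p : ℝ≥0∞) ∧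
      eLpNorm (diffAbs r η φ) (p : ℝ≥0∞) volume ≤ ENNReal.ofReal (C * δ) * sobN r p φ := by
  refine ⟨∑ k ∈ Finset.range r, ∑ _β : Fin k → Fin d, ∑ _i : Fin d, max 1 K,
    Finset.sum_nonneg fun _ _ => Finset.sum_nonneg fun _ _ => Finset.sum_nonneg fun _ _ =>
      zero_le_one.trans (le_max_left _ _), fun δ η h p hp φ hφ => ?_⟩
  have hp' : (1 : ℝ≥0∞) ≤ p := by exact_mod_cast hp
  have hδ := h.delta_nonneg
  have hM : 0 ≤ max 1 K := zero_le_one.trans (le_max_left _ _)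
  have hm : ∀ {k : ℕ} (β : Fin k → Fin d),
      MemLp (fun x => classicalD β φ (x + η x) - classicalD β φ x) (p : ℝ≥0∞) := fun β =>
    h.memLp_diff le_rfl hK hp (hφ.cD β)
  have e : diffAbs r η φ = ∑ k ∈ Finset.range r, fun x =>
      ∑ β : Fin k → Fin d, |classicalD β φ (x + η x) - classicalD β φ x| := by
    ext x; simp [diffAbs]
  constructor
  · exact memLp_finsetSum _ fun k _ => memLp_finsetSum _ fun β _ => (hm β).abs
  rw [e]
  refine (eLpNorm_sum_le (fun k _ => aesm_sum_abs fun β => (hm β).1) hp').trans ?_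
  rw [Finset.sum_mul, ENNReal.ofReal_sum_of_nonneg fun _ _ => mul_nonneg (Finset.sum_nonneg
    fun _ _ => Finset.sum_nonneg fun _ _ => hM) hδ, Finset.sum_mul]
  refine Finset.sum_le_sum fun k hk => (eLpNorm_sum_abs_le hp' fun β => (hm β).1).trans ?_
  rw [Finset.sum_mul, ENNReal.ofReal_sum_of_nonneg fun _ _ => mul_nonneg (Finset.sum_nonneg
    fun _ _ => hM) hδ, Finset.sum_mul]
  refine Finset.sum_le_sum fun β _ => (h.eLpNorm_diff_le le_rfl hK hp (hφ.cD β)).trans ?_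
  rw [Finset.sum_mul, ENNReal.ofReal_sum_of_nonneg fun _ _ => mul_nonneg hM hδ, Finset.sum_mul,
    Finset.mul_sum]
  refine Finset.sum_le_sum fun i _ => ?_
  rw [mul_comm δ, ← classicalD_cons (hφ.sm.nat (k + 1))]
  exact mul_le_mul' le_rfl (eLpNorm_classicalD_le_sobN (by
    have := Finset.mem_range.1 hk; omega) _ hφ.sm)

lemma JumpHyp.hasCompactSupport_jump (h : JumpHyp l K δ η) {φ : Rd d → ℝ} (hφ : IsTestFunction φ) :
    HasCompactSupport (jump η φ) := by
  have h1 : HasCompactSupport fun x => ∑ i, η x i * IntegroDiff.pd i φ x := by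
    have : (fun x => ∑ i, η x i * IntegroDiff.pd i φ x) = fun x => fderiv ℝ φ x (η x) := by
      ext x; rw [fderiv_eq_sum_pd]
    rw [this]
    exact (hφ.2.fderiv (𝕜 := ℝ)).mono fun x hx => by
      simp only [Function.mem_support] at hx ⊢
      intro h0
      exact hx (by simp [h0])
  exact ((h.hasCompactSupport_comp hφ.2).sub hφ.2).sub h1

lemma memLp_classicalD {p k : ℕ} {f : Rd d → ℝ} (hf : ContDiff ℝ k f) (hc : HasCompactSupport f)
    (α : Fin k → Fin d) : MemLp (classicalD α f) (p : ℝ≥0∞) :=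
  (contDiff_classicalD (r := 0) (by simpa using hf) α).continuous.memLp_of_hasCompactSupport
    (hasCompactSupport_classicalD hc α)

lemma eLpNorm_add_le_of_abs_le {p : ℕ} (hp : 1 ≤ p) {f g G : Rd d → ℝ} {a b : ℝ} {S : ℝ≥0∞}
    (hf : MemLp f (p : ℝ≥0∞)) (hg : MemLp g (p : ℝ≥0∞)) (ha : 0 ≤ a) (hb : 0 ≤ b)
    (h1 : eLpNorm g (p : ℝ≥0∞) volume ≤ ENNReal.ofReal a * S) (h : ∀ x, |f x - g x| ≤ G x)
    (h2 : eLpNorm G (p : ℝ≥0∞) volume ≤ ENNReal.ofReal b * S) :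
    eLpNorm f (p : ℝ≥0∞) volume ≤ ENNReal.ofReal (a + b) * S := by
  have hp' : (1 : ℝ≥0∞) ≤ p := by exact_mod_cast hp
  have e : f = g + fun x => f x - g x := by ext x; simp
  rw [e, ENNReal.ofReal_add ha hb, add_mul]
  refine (eLpNorm_add_le hg.1 (hf.sub hg).1 hp').trans (add_le_add h1 ((eLpNorm_mono_real h).trans h2))

lemma exists_diff_mark (d n : ℕ) {q : ℕ} (hq : 1 ≤ q) {K : ℝ} (hK : 0 < K) : ∃ C : ℝ, 0 ≤ C ∧
    ∀ δ (η : Rd d → Rd d), JumpHyp (max n 2) K δ η → ∀ φ, IsTestFunction φ →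
      (∀ k ≤ n, ∀ α : Fin k → Fin d,
        eLpNorm (classicalD α fun x => φ (x + η x) - φ x) ((2 * q : ℕ) : ℝ≥0∞) volume ≤
          ENNReal.ofReal (C * δ) * sobN (n + 2) (2 * q) φ) ∧
      ∑ α : Fin n → Fin d, ∫ x, vpow q (fun β : Fin n → Fin d => classicalD β φ x) α *
        classicalD α (fun x => φ (x + η x) - φ x) x ≤
          C * δ * normW n (2 * q) φ ^ (2 * q) := by
  have hp : 1 ≤ 2 * q := by omega
  have hl : 1 ≤ max n 2 := by omega
  set M := max 1 K with hMdef
  have hM : 0 ≤ M := zero_le_one.trans (le_max_left _ _)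
  choose C₁ hC₁ hC using fun k : Fin (n + 1) =>
    exists_commutator_comp_le d hl hK (n := k) (by have := k.2; omega : (k : ℕ) ≤ max n 2)
  obtain ⟨C₂, hC₂, hCI⟩ := exists_integral_jump_le d hK
  have hsplit : ∀ δ (η : Rd d → Rd d), JumpHyp (max n 2) K δ η → ∀ φ, IsTestFunction φ →
      ∀ (k : Fin (n + 1)) (α : Fin k → Fin d) x,
      |classicalD α (fun x => φ (x + η x) - φ x) x - (classicalD α φ (x + η x) - classicalD α φ x)| ≤
        C₁ k * δ * jetAbs k φ (x + η x) := by
    intro δ η h φ hφ k α x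
    have hk : (k : ℕ) ≤ max n 2 := by have := k.2; omega
    have hτ : ContDiff ℝ (k : ℕ) (fun x => φ (x + η x)) :=
      (hφ.sm.nat k).comp (h.contDiff_tau.of_le (by exact_mod_cast hk))
    have := hC k δ η h α φ hφ.sm x
    rw [classicalD_sub hτ (hφ.sm.nat k), mul_assoc]
    convert this using 2
    ring
  set m : ℝ := (Fintype.card (Fin n → Fin d) : ℝ) with hm
  refine ⟨(∑ k, C₁ k * M + M * d) + (1 / (2 * q) * C₂ * m + m * (C₁ ⟨n, by omega⟩ * M)), by
    have : 0 ≤ ∑ k, C₁ k * M := Finset.sum_nonneg fun k _ => mul_nonneg (hC₁ k) hM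
    have := hC₁ ⟨n, by omega⟩
    positivity, fun δ η h φ hφ => ⟨fun k hk α => ?_, ?_⟩⟩
  · have hδ := h.delta_nonneg
    have h1 := hsplit δ η h φ hφ ⟨k, by omega⟩ α
    have hkl : k ≤ max n 2 := by omega
    have hcd : ContDiff ℝ k (fun x => φ (x + η x) - φ x) :=
      ((hφ.sm.nat k).comp (h.contDiff_tau.of_le (by exact_mod_cast hkl))).sub (hφ.sm.nat k)
    have hfm := memLp_classicalD (p := 2 * q) hcd ((h.hasCompactSupport_comp hφ.2).sub hφ.2) α
    have hI : eLpNorm (fun x => classicalD α φ (x + η x) - classicalD α φ x)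
        ((2 * q : ℕ) : ℝ≥0∞) volume ≤ ENNReal.ofReal (δ * M * d) * sobN (n + 2) (2 * q) φ := by
      refine (h.eLpNorm_diff_le hl hK hp (hφ.cD α)).trans ?_
      rw [ENNReal.ofReal_mul (p := δ * M) (by positivity), ENNReal.ofReal_natCast, mul_assoc]
      refine mul_le_mul' le_rfl ?_
      refine (Finset.sum_le_sum fun i _ => ?_).trans (le_of_eq (by
        rw [Finset.sum_const, Finset.card_univ, Fintype.card_fin, nsmul_eq_mul]))
      rw [← classicalD_cons (hφ.sm.nat (k + 1))]
      exact eLpNorm_classicalD_le_sobN (by omega) _ hφ.sm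
    have hE : eLpNorm (fun x => C₁ ⟨k, by omega⟩ * δ * jetAbs k φ (x + η x))
        ((2 * q : ℕ) : ℝ≥0∞) volume ≤
        ENNReal.ofReal (C₁ ⟨k, by omega⟩ * δ * M) * sobN (n + 2) (2 * q) φ := by
      have hc := hC₁ ⟨k, by omega⟩
      rw [ENNReal.ofReal_mul (by positivity), mul_assoc]
      refine (eLpNorm_mul_le_of_abs_le (fun _ => (abs_of_nonneg (mul_nonneg hc hδ)).le)).trans ?_
      refine mul_le_mul' le_rfl ((h.eLpNorm_jetAbs_comp_le hl hK hp hφ).2.trans ?_)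
      exact mul_le_mul' le_rfl (sobN_mono (by omega) _)
    refine (eLpNorm_add_le_of_abs_le hp hfm (h.memLp_diff hl hK hp (hφ.cD α)) (by positivity)
      (mul_nonneg (mul_nonneg (hC₁ _) hδ) hM) hI h1 hE).trans ?_
    refine mul_le_mul' (ENNReal.ofReal_le_ofReal ?_) le_rfl
    have h3 : C₁ ⟨k, by omega⟩ * M ≤ ∑ k, C₁ k * M :=
      Finset.single_le_sum (f := fun k => C₁ k * M) (fun k _ => mul_nonneg (hC₁ k) hM)
        (Finset.mem_univ _)
    have h4 : 0 ≤ 1 / (2 * q) * C₂ * m + m * (C₁ ⟨n, by omega⟩ * M) := by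
      have := hC₁ ⟨n, by omega⟩
      positivity
    nlinarith
  · have hδ := h.delta_nonneg
    set A := normW n (2 * q) φ with hA
    have hA0 : 0 ≤ A := normW_nonneg φ
    have hAS : ENNReal.ofReal A = sobN n (2 * q) φ := (hφ.memW n (2 * q)).ofReal_normW
    set c := C₁ ⟨n, by omega⟩ with hc
    have hc0 : 0 ≤ c := hC₁ _
    have hcd : ContDiff ℝ n (fun x => φ (x + η x) - φ x) :=
      ((hφ.sm.nat n).comp (h.contDiff_tau.of_le (by norm_cast; omega))).sub (hφ.sm.nat n)
    have hfm := fun α : Fin n → Fin d =>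
      memLp_classicalD (p := 2 * q) hcd ((h.hasCompactSupport_comp hφ.2).sub hφ.2) α
    have hjet := h.eLpNorm_jetAbs_comp_le (n := n) hl hK hp hφ
    have hWn : eLpNorm (fun x => c * δ * jetAbs n φ (x + η x)) ((2 * q : ℕ) : ℝ≥0∞) volume ≤
        ENNReal.ofReal (c * δ * (M * A)) := by
      rw [ENNReal.ofReal_mul (by positivity), ENNReal.ofReal_mul hM, hAS]
      exact (eLpNorm_mul_le_of_abs_le (fun _ => (abs_of_nonneg (mul_nonneg hc0 hδ)).le)).trans
        (mul_le_mul' le_rfl hjet.2)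
    have h1 : ∑ β : Fin n → Fin d, eLpNorm (classicalD β φ) ((2 * q : ℕ) : ℝ≥0∞) volume ≤
        ENNReal.ofReal A := by
      rw [hAS]; exact sum_eLpNorm_classicalD_le hφ.sm
    have key := h.sum_integral_vpow_mul_le hq (fun α : Fin n → Fin d => hφ.cD α) hfm
      (hjet.1.const_mul (c * δ)) (fun x => mul_nonneg (mul_nonneg hc0 hδ) (jetAbs_nonneg _ _ _))
      (c := 0) (κ := 0) hA0 (by positivity : 0 ≤ c * δ * (M * A)) h1 hWn (fun α x => by
        simpa using hsplit δ η h φ hφ ⟨n, by omega⟩ α x)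
    refine key.trans ?_
    have hF := isTestFunction_sum_sq_pow (fun α : Fin n → Fin d => hφ.cD α) hq
    have hF0 : ∀ x, 0 ≤ (∑ α : Fin n → Fin d, classicalD α φ x ^ 2) ^ q := fun x => by positivity
    have h5 := (hCI δ η (h.mono (by omega)) _ hF hF0).1
    have h6 := integral_sum_sq_pow_le hq (fun α : Fin n → Fin d => (hφ.cD α).memLp _) hA0 h1
    have h7 : A ^ (2 * q) = A ^ (2 * q - 1) * A := by rw [← pow_succ]; congr 1; omega
    simp only [zero_mul, sub_zero]
    have h8 : 1 / (2 * q) * ∫ x, ((∑ α : Fin n → Fin d, classicalD α φ (x + η x) ^ 2) ^ q -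
        (∑ α : Fin n → Fin d, classicalD α φ x ^ 2) ^ q) ≤
        1 / (2 * q) * (C₂ * δ * (m * A ^ (2 * q))) :=
      mul_le_mul_of_nonneg_left (h5.trans (mul_le_mul_of_nonneg_left h6 (by positivity)))
        (by positivity)
    refine (add_le_add (add_le_add h8 le_rfl) le_rfl).trans ?_
    have h9 : 0 ≤ (∑ k, C₁ k * M + M * d) * δ * A ^ (2 * q) := by
      have : 0 ≤ ∑ k, C₁ k * M := Finset.sum_nonneg fun k _ => mul_nonneg (hC₁ k) hM
      positivity
    have h10 : (1 / (2 * q) * (C₂ * δ * (m * A ^ (2 * q))) + 1 / 2 * m ^ 2 * 0 ^ 2 *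
        ∫ x, (∑ α : Fin n → Fin d, classicalD α φ x ^ 2) ^ q) +
        m * (A ^ (2 * q - 1) * (c * δ * (M * A))) =
        (1 / (2 * q) * C₂ * m + m * (c * M)) * δ * A ^ (2 * q) := by
      rw [h7]; ring
    rw [h10, add_mul (∑ k, C₁ k * M + M * d) _ δ, add_mul (_ * δ)]
    exact le_add_of_nonneg_left h9

lemma exists_jump_mark (d n : ℕ) {q : ℕ} (hq : 1 ≤ q) {K : ℝ} (hK : 0 < K) : ∃ C : ℝ, 0 ≤ C ∧
    ∀ δ (η : Rd d → Rd d), JumpHyp (max n 2) K δ η → ∀ φ, IsTestFunction φ →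
      (∀ k ≤ n, ∀ α : Fin k → Fin d,
        eLpNorm (classicalD α (jump η φ)) ((2 * q : ℕ) : ℝ≥0∞) volume ≤
          ENNReal.ofReal (C * δ ^ 2) * sobN (n + 2) (2 * q) φ) ∧
      ∑ α : Fin n → Fin d, ∫ x, vpow q (fun β : Fin n → Fin d => classicalD β φ x) α *
        classicalD α (jump η φ) x ≤ C * δ ^ 2 * normW n (2 * q) φ ^ (2 * q) := by
  have hp : 1 ≤ 2 * q := by omega
  have hp' : (1 : ℝ≥0∞) ≤ ((2 * q : ℕ) : ℝ≥0∞) := by exact_mod_cast hp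
  have hl : 1 ≤ max n 2 := by omega
  set M := max 1 K with hMdef
  have hM : 0 ≤ M := zero_le_one.trans (le_max_left _ _)
  choose C₁ hC₁ hC using fun k : Fin (n + 1) =>
    exists_commutator_jump_le d hl hK (n := k) (by have := k.2; omega : (k : ℕ) ≤ max n 2)
  choose D hD hDb using fun r : Fin (n + 2) => exists_eLpNorm_diffAbs_le d r hK
  obtain ⟨C₂, hC₂, hCI⟩ := exists_integral_jump_le d hK
  have herr : ∀ δ (η : Rd d → Rd d), JumpHyp (max n 2) K δ η → ∀ φ, IsTestFunction φ →
      ∀ (k r : ℕ) (hr : r < n + 2) (c : ℝ), k ≤ n → 0 ≤ c → ∀ N, k ≤ N → r ≤ N →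
      MemLp (fun x => c * (δ ^ 2 * jetAbs k φ (x + η x) + δ * diffAbs r η φ x))
        ((2 * q : ℕ) : ℝ≥0∞) ∧
      eLpNorm (fun x => c * (δ ^ 2 * jetAbs k φ (x + η x) + δ * diffAbs r η φ x))
        ((2 * q : ℕ) : ℝ≥0∞) volume ≤
        ENNReal.ofReal (c * (M + D ⟨r, hr⟩) * δ ^ 2) * sobN N (2 * q) φ := by
    intro δ η h φ hφ k r hr c hk hc N hkN hrN
    have hδ := h.delta_nonneg
    have h1 := h.eLpNorm_jetAbs_comp_le (n := k) hl hK hp hφ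
    have h2 := hDb ⟨r, hr⟩ δ η (h.mono (by omega)) (2 * q) hp φ hφ
    have m1 := h1.1.const_mul (δ ^ 2)
    have m2 := h2.1.const_mul δ
    refine ⟨(m1.add m2).const_mul c, ?_⟩
    refine (eLpNorm_mul_le_of_abs_le (fun _ => (abs_of_nonneg hc).le)).trans ?_
    rw [mul_assoc c, ENNReal.ofReal_mul hc, mul_assoc]
    refine mul_le_mul' le_rfl ((eLpNorm_add_le m1.1 m2.1 hp').trans ?_)
    rw [add_mul, ENNReal.ofReal_add (by positivity) (mul_nonneg (hD _) (by positivity)), add_mul]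
    refine add_le_add ?_ ?_
    · refine (eLpNorm_mul_le_of_abs_le (fun _ => (abs_of_nonneg (by positivity)).le)).trans ?_
      rw [mul_comm M, ENNReal.ofReal_mul (by positivity), mul_assoc]
      exact mul_le_mul' le_rfl (h1.2.trans (mul_le_mul' le_rfl (sobN_mono hkN _)))
    · refine (eLpNorm_mul_le_of_abs_le (fun _ => (abs_of_nonneg hδ).le)).trans ?_
      rw [show D ⟨r, hr⟩ * δ ^ 2 = δ * (D ⟨r, hr⟩ * δ) by ring, ENNReal.ofReal_mul hδ, mul_assoc]
      exact mul_le_mul' le_rfl (h2.2.trans (mul_le_mul' le_rfl (sobN_mono hrN _)))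
  set m : ℝ := (Fintype.card (Fin n → Fin d) : ℝ) with hm
  set c := C₁ ⟨n, by omega⟩ with hc
  have hc0 : 0 ≤ c := hC₁ _
  set E := ∑ k : Fin (n + 1), C₁ k * (M + D ⟨k + 1, by omega⟩) + M * (d * d) with hE
  have hE0 : ∀ k : Fin (n + 1), 0 ≤ C₁ k * (M + D ⟨k + 1, by omega⟩) := fun k =>
    mul_nonneg (hC₁ k) (add_nonneg hM (hD _))
  have hE1 : 0 ≤ ∑ k : Fin (n + 1), C₁ k * (M + D ⟨k + 1, by omega⟩) :=
    Finset.sum_nonneg fun k _ => hE0 k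
  have hE2 : 0 ≤ E := by positivity
  set B := 1 / (2 * q) * C₂ * m + 1 / 2 * m ^ 2 * c ^ 2 * m + m * (c * (M + D ⟨n, by omega⟩)) with hB
  have hB0 : 0 ≤ B := by
    have := hD ⟨n, by omega⟩
    positivity
  refine ⟨E + B, add_nonneg hE2 hB0, fun δ η h φ hφ => ⟨fun k hk α => ?_, ?_⟩⟩
  · have hδ := h.delta_nonneg
    have hkl : k ≤ max n 2 := by omega
    have hcd : ContDiff ℝ k (jump η φ) :=
      contDiff_jump (fun j => (h.contDiff_comp j).of_le (by exact_mod_cast hkl)) hφ.sm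
    have hfm := memLp_classicalD (p := 2 * q) hcd (h.hasCompactSupport_jump hφ) α
    have hgm : MemLp (jump η (classicalD α φ)) ((2 * q : ℕ) : ℝ≥0∞) :=
      (contDiff_jump (r := 0) (fun j => (h.contDiff_comp j).of_le (by simp))
        (hφ.cD α).sm).continuous.memLp_of_hasCompactSupport (h.hasCompactSupport_jump (hφ.cD α))
    have hJ : eLpNorm (jump η (classicalD α φ)) ((2 * q : ℕ) : ℝ≥0∞) volume ≤
        ENNReal.ofReal (δ ^ 2 * M * (d * d)) * sobN (n + 2) (2 * q) φ := by
      refine (h.eLpNorm_jump_le hl hK hp (hφ.cD α)).trans ?_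
      rw [ENNReal.ofReal_mul (p := δ ^ 2 * M) (by positivity), mul_assoc]
      refine mul_le_mul' le_rfl ?_
      rw [ENNReal.ofReal_mul (by positivity), ENNReal.ofReal_natCast, mul_assoc]
      refine (Finset.sum_le_sum fun i _ => (Finset.sum_le_sum fun j _ => ?_).trans (le_of_eq (by
        rw [Finset.sum_const, Finset.card_univ, Fintype.card_fin, nsmul_eq_mul]))).trans
        (le_of_eq (by rw [Finset.sum_const, Finset.card_univ, Fintype.card_fin, nsmul_eq_mul]))
      rw [← classicalD_cons (hφ.sm.nat (k + 1)), ← classicalD_cons (hφ.sm.nat (k + 1 + 1))]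
      exact eLpNorm_classicalD_le_sobN (by omega) _ hφ.sm
    refine (eLpNorm_add_le_of_abs_le hp hfm hgm (by positivity)
      (mul_nonneg (hE0 ⟨k, by omega⟩) (sq_nonneg δ)) hJ (hC ⟨k, by omega⟩ δ η h α φ hφ.sm)
      (herr δ η h φ hφ k (k + 1) (by omega) _ hk (hC₁ _) (n + 2) (by omega) (by omega)).2).trans ?_
    refine mul_le_mul' (ENNReal.ofReal_le_ofReal ?_) le_rfl
    have h3 : C₁ ⟨k, by omega⟩ * (M + D ⟨k + 1, by omega⟩) ≤
        ∑ k : Fin (n + 1), C₁ k * (M + D ⟨k + 1, by omega⟩) :=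
      Finset.single_le_sum (f := fun k : Fin (n + 1) => C₁ k * (M + D ⟨k + 1, by omega⟩))
        (fun k _ => hE0 k) (Finset.mem_univ _)
    have h4 := mul_le_mul_of_nonneg_right h3 (sq_nonneg δ)
    have h5 := mul_nonneg hB0 (sq_nonneg δ)
    rw [hE]
    linarith
  · have hδ := h.delta_nonneg
    set A := normW n (2 * q) φ with hA
    have hA0 : 0 ≤ A := normW_nonneg φ
    have hAS : ENNReal.ofReal A = sobN n (2 * q) φ := (hφ.memW n (2 * q)).ofReal_normW
    have hcd : ContDiff ℝ n (jump η φ) :=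
      contDiff_jump (fun j => (h.contDiff_comp j).of_le (by norm_cast; omega)) hφ.sm
    have hfm := fun α : Fin n → Fin d =>
      memLp_classicalD (p := 2 * q) hcd (h.hasCompactSupport_jump hφ) α
    have hWn := herr δ η h φ hφ n n (by omega) c le_rfl hc0 n le_rfl le_rfl
    have hD0 := hD ⟨n, by omega⟩
    have hW2 := hWn.2
    rw [← hAS, ← ENNReal.ofReal_mul (by positivity)] at hW2
    have h1 : ∑ β : Fin n → Fin d, eLpNorm (classicalD β φ) ((2 * q : ℕ) : ℝ≥0∞) volume ≤
        ENNReal.ofReal A := by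
      rw [hAS]; exact sum_eLpNorm_classicalD_le hφ.sm
    have key := h.sum_integral_vpow_mul_le hq (fun α : Fin n → Fin d => hφ.cD α) hfm
      hWn.1 (fun x => mul_nonneg hc0 (add_nonneg (mul_nonneg (sq_nonneg _) (jetAbs_nonneg _ _ _))
        (mul_nonneg hδ (diffAbs_nonneg _ _ _ _))))
      (c := c * δ) (κ := 1) hA0 (by positivity : 0 ≤ c * (M + D ⟨n, _⟩) * δ ^ 2 * A) h1 hW2
      (fun α x => by
        have h2 := hC ⟨n, by omega⟩ δ η h α φ hφ.sm x
        rw [Finset.sum_range_succ] at h2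
        rw [one_mul]
        refine h2.trans (le_of_eq ?_)
        simp only [diffAbs]
        ring)
    refine key.trans ?_
    have hF := isTestFunction_sum_sq_pow (fun α : Fin n → Fin d => hφ.cD α) hq
    have hF0 : ∀ x, 0 ≤ (∑ α : Fin n → Fin d, classicalD α φ x ^ 2) ^ q := fun x => by positivity
    have h5 := (hCI δ η (h.mono (by omega)) _ hF hF0).2
    have h6 := integral_sum_sq_pow_le hq (fun α : Fin n → Fin d => (hφ.cD α).memLp _) hA0 h1
    have h7 : A ^ (2 * q) = A ^ (2 * q - 1) * A := by rw [← pow_succ]; congr 1; omega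
    simp only [one_mul]
    have h8 := mul_le_mul_of_nonneg_left
      (h5.trans (mul_le_mul_of_nonneg_left h6 (by positivity : 0 ≤ C₂ * δ ^ 2)))
      (by positivity : (0 : ℝ) ≤ 1 / (2 * q))
    have h9 := mul_le_mul_of_nonneg_left h6 (by positivity : 0 ≤ 1 / 2 * m ^ 2 * (c * δ) ^ 2)
    refine (add_le_add (add_le_add h8 h9) le_rfl).trans ?_
    have h10 : 1 / (2 * q) * (C₂ * δ ^ 2 * (m * A ^ (2 * q))) +
        1 / 2 * m ^ 2 * (c * δ) ^ 2 * (m * A ^ (2 * q)) +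
        m * (A ^ (2 * q - 1) * (c * (M + D ⟨n, by omega⟩) * δ ^ 2 * A)) =
        B * δ ^ 2 * A ^ (2 * q) := by
      rw [h7, hB]; ring
    have h11 : 0 ≤ E * δ ^ 2 * A ^ (2 * q) := by positivity
    rw [h10, add_mul E B, add_mul (E * δ ^ 2)]
    exact le_add_of_nonneg_left h11

end mark

end IntegroDiff

end

noncomputable section

namespace IntegroDiff

/-! ### Integration over the marks -/

section fubini
open Filter Topology
variable {d : ℕ} {Z : Type*} [MeasurableSpace Z]

lemma pd_eq_lim {f : Rd d → ℝ} (hf : Differentiable ℝ f) (i : Fin d) (x : Rd d) :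
    Tendsto (fun j : ℕ => ((j : ℝ) + 1) *
      (f (x + ((j : ℝ) + 1)⁻¹ • EuclideanSpace.single i 1) - f x)) atTop (𝓝 (pd i f x)) := by
  have h1 : Tendsto (fun j : ℕ => ((j : ℝ) + 1)) atTop atTop :=
    tendsto_atTop_add_const_right _ _ tendsto_natCast_atTop_atTop
  exact (hf x).hasFDerivAt.lim (EuclideanSpace.single i (1 : ℝ)) (c := fun j : ℕ => (j : ℝ) + 1)
    (tendsto_norm_atTop_atTop.comp h1)

lemma measurable_pd {f : Z → Rd d → ℝ} (hf : ∀ z, Differentiable ℝ (f z))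
    (hm : Measurable fun q : Rd d × Z => f q.2 q.1) (i : Fin d) :
    Measurable fun q : Rd d × Z => pd i (f q.2) q.1 := by
  refine measurable_of_tendsto_metrizable (f := fun (j : ℕ) (q : Rd d × Z) => ((j : ℝ) + 1) *
    (f q.2 (q.1 + ((j : ℝ) + 1)⁻¹ • EuclideanSpace.single i 1) - f q.2 q.1)) (fun j => ?_)
    (tendsto_pi_nhds.2 fun q => pd_eq_lim (hf q.2) i q.1)
  have : Measurable fun q : Rd d × Z =>
      f q.2 (q.1 + ((j : ℝ) + 1)⁻¹ • EuclideanSpace.single i 1) :=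
    hm.comp ((measurable_fst.add_const _).prodMk measurable_snd)
  exact (this.sub hm).const_mul _

lemma measurable_classicalD {k : ℕ} {f : Z → Rd d → ℝ} (hf : ∀ z, ContDiff ℝ k (f z))
    (hm : Measurable fun q : Rd d × Z => f q.2 q.1) (α : Fin k → Fin d) :
    Measurable fun q : Rd d × Z => classicalD α (f q.2) q.1 := by
  induction k with
  | zero => simpa only [classicalD_zero] using hm
  | succ k ih =>
    obtain ⟨i, β, rfl⟩ : ∃ i β, α = Fin.cons i β := ⟨α 0, Fin.tail α, (Fin.cons_self_tail α).symm⟩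
    have h1 := ih (fun z => (hf z).of_le (by norm_cast; omega)) β
    simp only [fun z => classicalD_cons (hf z) i β]
    exact measurable_pd (fun z => (contDiff_classicalD (r := 1) ((hf z).of_le
      (by norm_cast; omega)) β).differentiable (by simp)) h1 i

variable {X : Type*} [MeasurableSpace X] {lam : Measure X} [SFinite lam] {μ : Measure Z} [SFinite μ]

lemma ae_prod_eq_of_forall {F G : X × Z → ℝ} (hF : AEStronglyMeasurable F (lam.prod μ))
    (hG : AEStronglyMeasurable G (lam.prod μ)) (h : ∀ z, ∀ᵐ x ∂lam, F (x, z) = G (x, z)) :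
    ∀ᵐ x ∂lam, ∀ᵐ z ∂μ, F (x, z) = G (x, z) := by
  have hm : AEMeasurable (fun q => ‖F q - G q‖ₑ) (lam.prod μ) := (hF.sub hG).enorm
  have h1 : ∫⁻ q, ‖F q - G q‖ₑ ∂(lam.prod μ) = 0 := by
    rw [lintegral_prod_symm _ hm]
    refine (lintegral_congr fun z => ?_).trans lintegral_zero
    refine (lintegral_congr_ae ?_).trans lintegral_zero
    filter_upwards [h z] with x hx
    simp [hx]
  rw [lintegral_eq_zero_iff' hm] at h1
  filter_upwards [Measure.ae_ae_of_ae_prod h1] with x hx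
  filter_upwards [hx] with z hz
  simpa [sub_eq_zero] using hz

/-- A criterion for integrability on a product, by duality with `L_p`. -/
lemma integrable_mul_of_duality {p : ℕ} {F : X × Z → ℝ} (hF : AEStronglyMeasurable F (lam.prod μ))
    {g : X → ℝ} (hg : AEStronglyMeasurable g lam) {c : ℝ≥0∞} (hc : c ≠ ∞)
    (hd : ∀ f : X → ℝ, AEStronglyMeasurable f lam →
      ∫⁻ x, ‖g x * f x‖ₑ ∂lam ≤ c * eLpNorm f (p : ℝ≥0∞) lam) {h : Z → ℝ≥0∞}
    (hfin : ∫⁻ z, h z ∂μ ≠ ∞) (hm : ∀ z, AEStronglyMeasurable (fun x => F (x, z)) lam)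
    (hb : ∀ z, eLpNorm (fun x => F (x, z)) (p : ℝ≥0∞) lam ≤ h z) :
    Integrable (fun q : X × Z => g q.1 * F q) (lam.prod μ) := by
  have hm' : AEStronglyMeasurable (fun q : X × Z => g q.1 * F q) (lam.prod μ) :=
    hg.comp_fst.mul hF
  refine ⟨hm', ?_⟩
  rw [HasFiniteIntegral, lintegral_prod_symm _ hm'.enorm]
  calc ∫⁻ z, ∫⁻ x, ‖g x * F (x, z)‖ₑ ∂lam ∂μ ≤ ∫⁻ z, c * h z ∂μ :=
        lintegral_mono fun z => (hd _ (hm z)).trans (mul_le_mul' le_rfl (hb z))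
    _ = c * ∫⁻ z, h z ∂μ := lintegral_const_mul' _ _ hc
    _ < ∞ := ENNReal.mul_lt_top hc.lt_top hfin.lt_top

lemma exists_duality_test {p : ℕ} (hp : 2 ≤ p) {g : Rd d → ℝ} (hg : IsTestFunction g) :
    ∃ c : ℝ≥0∞, c ≠ ∞ ∧ ∀ f : Rd d → ℝ, AEStronglyMeasurable f volume →
      ∫⁻ x, ‖g x * f x‖ₑ ≤ c * eLpNorm f (p : ℝ≥0∞) volume := by
  set U : Rd d → ℝ := (tsupport g).indicator fun _ => 1 with hU
  have hUm : MemLp U (p : ℝ≥0∞) volume :=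
    memLp_indicator_const _ (isClosed_tsupport g).measurableSet 1
      (Or.inr hg.2.isCompact.measure_lt_top.ne)
  refine ⟨eLpNorm U p volume ^ (p - 2) * eLpNorm g p volume, ENNReal.mul_ne_top
    (ENNReal.pow_ne_top hUm.eLpNorm_ne_top) (hg.memLp p).eLpNorm_ne_top, fun f hf => ?_⟩
  refine le_trans (lintegral_mono fun x => ?_) (lintegral_pow_mul_mul_le hp hUm.1 (hg.memLp p).1 hf)
  by_cases hx : x ∈ tsupport g
  · simp [hU, hx]
  · simp [image_eq_zero_of_notMem_tsupport hx]

end fubini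

section markOp
open Filter Topology
variable {d n q : ℕ} {Z : Type*} [MeasurableSpace Z] {μ : Measure Z}

/-- A measurable family of operators `G z`, given on test functions by `G₀ z`, with bounds and an
energy estimate of size `w z`. -/
structure MarkOp (n q : ℕ) (μ : Measure Z) (w : Z → ℝ) (C : ℝ) (G : Z → (Rd d → ℝ) → Rd d → ℝ)
    (G₀ : Z → (Rd d → ℝ) → Rd d → ℝ) : Prop where
  aesm : ∀ v : LpSpace d (2 * q), MemW 2 (2 * q) v →
    AEStronglyMeasurable (fun y : Rd d × Z => G y.2 v y.1) (volume.prod μ)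
  sub : ∀ z (v w : LpSpace d (2 * q)), MemW 2 (2 * q) v → MemW 2 (2 * q) w →
    G z ((v - w : LpSpace d (2 * q)) : Rd d → ℝ) =ᵐ[volume] fun x => G z v x - G z w x
  crude : ∀ z, ∃ c : ℝ≥0∞, c ≠ ∞ ∧ ∀ v : LpSpace d (2 * q), MemW 2 (2 * q) v →
    MemLp (G z v) ((2 * q : ℕ) : ℝ≥0∞) ∧
      eLpNorm (G z v) ((2 * q : ℕ) : ℝ≥0∞) volume ≤ c * sobN 2 (2 * q) v
  test : ∀ z (v : LpSpace d (2 * q)) φ, IsTestFunction φ → v =ᵐ[volume] φ →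
    G z v =ᵐ[volume] G₀ z φ
  contDiff : ∀ z φ, IsTestFunction φ → ContDiff ℝ n (G₀ z φ)
  measurable : ∀ φ, IsTestFunction φ → Measurable fun y : Rd d × Z => G₀ y.2 φ y.1
  bound_two : ∀ z φ, IsTestFunction φ → eLpNorm (G₀ z φ) ((2 * q : ℕ) : ℝ≥0∞) volume ≤
    ENNReal.ofReal (C * w z) * sobN 2 (2 * q) φ
  bound : ∀ z φ, IsTestFunction φ → ∀ k ≤ n, ∀ α : Fin k → Fin d,
    eLpNorm (classicalD α (G₀ z φ)) ((2 * q : ℕ) : ℝ≥0∞) volume ≤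
      ENNReal.ofReal (C * w z) * sobN (n + 2) (2 * q) φ
  energy_le : ∀ z φ, IsTestFunction φ →
    ∑ α : Fin n → Fin d, ∫ x, vpow q (fun β : Fin n → Fin d => classicalD β φ x) α *
      classicalD α (G₀ z φ) x ≤ C * w z * normW n (2 * q) φ ^ (2 * q)

namespace MarkOp
variable {w : Z → ℝ} {C : ℝ} {G G₀ : Z → (Rd d → ℝ) → Rd d → ℝ}

lemma eLpNorm_le (h : MarkOp n q μ w C G G₀) (hq : 1 ≤ q) (z : Z) {v : LpSpace d (2 * q)}
    (hv : MemW 2 (2 * q) v) : eLpNorm (G z v) ((2 * q : ℕ) : ℝ≥0∞) volume ≤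
      ENNReal.ofReal (C * w z) * sobN 2 (2 * q) v := by
  have hp : 1 ≤ 2 * q := by omega
  have hp' : (1 : ℝ≥0∞) ≤ ((2 * q : ℕ) : ℝ≥0∞) := by exact_mod_cast hp
  obtain ⟨φ, V, hφ, hV, hl⟩ := exists_testLp_tendsto hq hv
  obtain ⟨c, hc, hcr⟩ := h.crude z
  have hVW : ∀ j, MemW 2 (2 * q) (V j) := fun j => ((hφ j).memW 2 (2 * q)).congr (hV j).symm
  have hsub : ∀ j, ((V j - v : LpSpace d (2 * q)) : Rd d → ℝ) =ᵐ[volume] fun x => V j x - v x :=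
    fun j => Lp.coeFn_sub _ _
  have h1 : ∀ j, eLpNorm (G z v) ((2 * q : ℕ) : ℝ≥0∞) volume ≤
      ENNReal.ofReal (C * w z) * sobN 2 (2 * q) (V j) +
        c * sobN 2 (2 * q) (fun x => V j x - v x) := by
    intro j
    have e1 : G z v = fun x => G z (V j) x - (G z (V j) x - G z v x) := by ext x; ring
    have m1 := (hcr (V j) (hVW j)).1
    have m2 := (hcr v hv).1
    rw [e1]
    refine (eLpNorm_sub_le m1.1 (m1.sub m2).1 hp').trans (add_le_add ?_ ?_)
    · rw [eLpNorm_congr_ae (h.test z (V j) (φ j) (hφ j) (hV j)), sobN_congr (hV j)]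
      exact h.bound_two z (φ j) (hφ j)
    · have hW : MemW 2 (2 * q) ((V j - v : LpSpace d (2 * q)) : Rd d → ℝ) :=
        ((hVW j).sub hv).congr (hsub j).symm
      have := (hcr _ hW).2
      rwa [eLpNorm_congr_ae (h.sub z (V j) v (hVW j) hv), sobN_congr (hsub j)] at this
  have l1 := tendsto_sobN_self hp hVW hv hl
  have l2 : Tendsto (fun j => ENNReal.ofReal (C * w z) * sobN 2 (2 * q) (V j) +
      c * sobN 2 (2 * q) (fun x => V j x - v x)) atTop
      (𝓝 (ENNReal.ofReal (C * w z) * sobN 2 (2 * q) v + c * 0)) :=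
    (ENNReal.Tendsto.const_mul l1 (Or.inr ENNReal.ofReal_ne_top)).add
      (ENNReal.Tendsto.const_mul hl (Or.inr hc))
  rw [mul_zero, add_zero] at l2
  exact ge_of_tendsto' l2 h1

variable [SFinite μ]

lemma minkowski (h : MarkOp n q μ w C G G₀) (hq : 1 ≤ q) (hw : Measurable w)
    (hC : 0 ≤ C) (hwi : ∫⁻ z, ENNReal.ofReal (w z) ∂μ ≠ ∞) {v : LpSpace d (2 * q)}
    (hv : MemW 2 (2 * q) v) :
    (∀ᵐ x : Rd d, Integrable (fun z => G z v x) μ) ∧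
    MemLp (fun x => ∫ z, G z v x ∂μ) ((2 * q : ℕ) : ℝ≥0∞) ∧
    eLpNorm (fun x => ∫ z, G z v x ∂μ) ((2 * q : ℕ) : ℝ≥0∞) volume ≤
      ENNReal.ofReal C * (∫⁻ z, ENNReal.ofReal (w z) ∂μ) * sobN 2 (2 * q) v := by
  have hS : sobN 2 (2 * q) v ≠ ∞ := hv.sobN_lt_top.ne
  have e : ∫⁻ z, ENNReal.ofReal (C * w z) * sobN 2 (2 * q) v ∂μ =
      ENNReal.ofReal C * (∫⁻ z, ENNReal.ofReal (w z) ∂μ) * sobN 2 (2 * q) v := by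
    rw [lintegral_mul_const' _ _ hS]
    simp only [ENNReal.ofReal_mul hC]
    rw [lintegral_const_mul' _ _ ENNReal.ofReal_ne_top]
  rw [← e]
  have hfin : ∫⁻ z, ENNReal.ofReal (C * w z) * sobN 2 (2 * q) v ∂μ ≠ ∞ := by
    rw [e]
    exact ENNReal.mul_ne_top (ENNReal.mul_ne_top ENNReal.ofReal_ne_top hwi) hS
  exact minkowski_integral (F := fun y : Rd d × Z => G y.2 v y.1) (h.aesm v hv)
    ((ENNReal.measurable_ofReal.comp (hw.const_mul C)).mul_const _) hfin (by omega)
    (Eventually.of_forall fun z => h.eLpNorm_le hq z hv)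

lemma goodOp (h : MarkOp n q μ w C G G₀) (hq : 1 ≤ q) (hw : Measurable w) (hw0 : ∀ z, 0 ≤ w z)
    (hC : 0 ≤ C) (hwi : Integrable w μ) :
    GoodOp n q (C * ∫ z, w z ∂μ) (fun v x => ∫ z, G z v x ∂μ) := by
  have hp : 1 ≤ 2 * q := by omega
  have hp2 : 2 ≤ 2 * q := by omega
  have hwi' : ∫⁻ z, ENNReal.ofReal (w z) ∂μ ≠ ∞ := by
    rw [← ofReal_integral_eq_lintegral_ofReal hwi (Eventually.of_forall hw0)]
    exact ENNReal.ofReal_ne_top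
  have hsmall : ∀ φ : Rd d → ℝ, IsTestFunction φ →
      ∫⁻ z, ENNReal.ofReal (C * w z) * sobN (n + 2) (2 * q) φ ∂μ =
        ENNReal.ofReal C * (∫⁻ z, ENNReal.ofReal (w z) ∂μ) * sobN (n + 2) (2 * q) φ := by
    intro φ hφ
    rw [lintegral_mul_const' _ _ (hφ.memW _ _).sobN_lt_top.ne]
    simp only [ENNReal.ofReal_mul hC]
    rw [lintegral_const_mul' _ _ ENNReal.ofReal_ne_top]
  have hfin : ∀ φ : Rd d → ℝ, IsTestFunction φ →
      ∫⁻ z, ENNReal.ofReal (C * w z) * sobN (n + 2) (2 * q) φ ∂μ ≠ ∞ := fun φ hφ => by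
    rw [hsmall φ hφ]
    exact ENNReal.mul_ne_top (ENNReal.mul_ne_top ENNReal.ofReal_ne_top hwi')
      (hφ.memW _ _).sobN_lt_top.ne
  have hcd : ∀ z φ, IsTestFunction φ → ∀ k ≤ n, ContDiff ℝ k (G₀ z φ) := fun z φ hφ k hk =>
    (h.contDiff z φ hφ).of_le (by exact_mod_cast hk)
  have hDm : ∀ φ, IsTestFunction φ → ∀ k ≤ n, ∀ α : Fin k → Fin d,
      Measurable fun y : Rd d × Z => classicalD α (G₀ y.2 φ) y.1 := fun φ hφ k hk α =>
    measurable_classicalD (fun z => hcd z φ hφ k hk) (h.measurable φ hφ) α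
  have hDmz : ∀ φ, IsTestFunction φ → ∀ k ≤ n, ∀ (α : Fin k → Fin d) z,
      AEStronglyMeasurable (classicalD α (G₀ z φ)) (volume : Measure (Rd d)) :=
    fun φ hφ k hk α z =>
      ((hDm φ hφ k hk α).comp (measurable_id.prodMk measurable_const)).aestronglyMeasurable
  have hmink : ∀ φ, IsTestFunction φ → ∀ k ≤ n, ∀ α : Fin k → Fin d,
      MemLp (fun x => ∫ z, classicalD α (G₀ z φ) x ∂μ) ((2 * q : ℕ) : ℝ≥0∞) ∧
      eLpNorm (fun x => ∫ z, classicalD α (G₀ z φ) x ∂μ) ((2 * q : ℕ) : ℝ≥0∞) volume ≤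
        ENNReal.ofReal C * (∫⁻ z, ENNReal.ofReal (w z) ∂μ) * sobN (n + 2) (2 * q) φ := by
    intro φ hφ k hk α
    rw [← hsmall φ hφ]
    exact (minkowski_integral (F := fun y : Rd d × Z => classicalD α (G₀ y.2 φ) y.1)
      (lam := (volume : Measure (Rd d))) (μ := μ) (hDm φ hφ k hk α).aestronglyMeasurable
      ((ENNReal.measurable_ofReal.comp (hw.const_mul C)).mul_const _) (hfin φ hφ) hp
      (Eventually.of_forall fun z => h.bound z φ hφ k hk α)).2
  have hint : ∀ φ, IsTestFunction φ → ∀ k ≤ n, ∀ (α : Fin k → Fin d) ψ, IsTestFunction ψ →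
      Integrable (fun y : Rd d × Z => ψ y.1 * classicalD α (G₀ y.2 φ) y.1)
        (volume.prod μ) := by
    intro φ hφ k hk α ψ hψ
    obtain ⟨c, hc, hdual⟩ := exists_duality_test hp2 hψ
    exact integrable_mul_of_duality (F := fun y : Rd d × Z => classicalD α (G₀ y.2 φ) y.1)
      (hDm φ hφ k hk α).aestronglyMeasurable
      hψ.1.continuous.aestronglyMeasurable hc hdual (hfin φ hφ) (hDmz φ hφ k hk α)
      (fun z => h.bound z φ hφ k hk α)
  have hAeq : ∀ (v : LpSpace d (2 * q)) φ, IsTestFunction φ → v =ᵐ[volume] φ →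
      (fun x => ∫ z, G z v x ∂μ) =ᵐ[volume] fun x => ∫ z, G₀ z φ x ∂μ := by
    intro v φ hφ hv
    filter_upwards [ae_prod_eq_of_forall (F := fun y : Rd d × Z => G y.2 v y.1)
      (G := fun y => G₀ y.2 φ y.1) (h.aesm v ((hφ.memW 2 (2 * q)).congr hv.symm))
      (h.measurable φ hφ).aestronglyMeasurable (fun z => h.test z v φ hφ hv)] with x hx
    exact integral_congr_ae hx
  have hweak : ∀ (v : LpSpace d (2 * q)) φ, IsTestFunction φ → v =ᵐ[volume] φ →
      ∀ k ≤ n, ∀ α : Fin k → Fin d, IsWeakDeriv α (fun x => ∫ z, G z v x ∂μ)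
        (fun x => ∫ z, classicalD α (G₀ z φ) x ∂μ) := by
    intro v φ hφ hv k hk α
    have m0 := (hmink φ hφ 0 (Nat.zero_le n) Fin.elim0).1
    simp only [classicalD_zero] at m0
    refine IsWeakDeriv.congr (u := fun x => ∫ z, G₀ z φ x ∂μ) ?_ (hAeq v φ hφ hv).symm
      (EventuallyEq.refl _ _)
    refine ⟨MemLp.locInt hp m0, MemLp.locInt hp (hmink φ hφ k hk α).1, fun ψ hψ => ?_⟩
    have i1 := hint φ hφ 0 (Nat.zero_le n) Fin.elim0 (classicalD α ψ) (hψ.cD α)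
    simp only [classicalD_zero] at i1
    have i2 := hint φ hφ k hk α ψ hψ
    have s1 : ∀ x, (∫ z, G₀ z φ x ∂μ) * classicalD α ψ x =
        ∫ z, classicalD α ψ x * G₀ z φ x ∂μ := fun x => by
      rw [integral_const_mul, mul_comm]
    have s2 : ∀ x, (∫ z, classicalD α (G₀ z φ) x ∂μ) * ψ x =
        ∫ z, ψ x * classicalD α (G₀ z φ) x ∂μ := fun x => by
      rw [integral_const_mul, mul_comm]
    simp only [s1, s2]
    have s3 : ∫ x, ∫ z, ψ x * classicalD α (G₀ z φ) x ∂μ =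
        ∫ z, (∫ x, ψ x * classicalD α (G₀ z φ) x) ∂μ := integral_integral_swap i2
    rw [integral_integral_swap i1, s3, ← integral_const_mul]
    refine integral_congr_ae (Eventually.of_forall fun z => ?_)
    have := (isWeakDeriv_classicalD α (hcd z φ hφ k hk)).2.2 ψ hψ
    simp only [mul_comm (classicalD α ψ _), mul_comm (ψ _)]
    exact this
  have hMemW : ∀ (v : LpSpace d (2 * q)) φ, IsTestFunction φ → v =ᵐ[volume] φ →
      MemW n (2 * q) (fun x => ∫ z, G z v x ∂μ) := fun v φ hφ hv =>
    ⟨(h.minkowski hq hw hC hwi' ((hφ.memW 2 (2 * q)).congr hv.symm)).2.1, fun k hk α =>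
      ⟨_, hweak v φ hφ hv k hk α, (hmink φ hφ k hk α).1⟩⟩
  refine ⟨?_, ?_, ?_, ?_⟩
  · exact ⟨_, ENNReal.mul_ne_top ENNReal.ofReal_ne_top hwi', fun v hv =>
      (h.minkowski hq hw hC hwi' hv).2⟩
  · intro v v' hv hv'
    have hvv : MemW 2 (2 * q) ((v - v' : LpSpace d (2 * q)) : Rd d → ℝ) :=
      (hv.sub hv').congr (Lp.coeFn_sub v v').symm
    filter_upwards [ae_prod_eq_of_forall (F := fun y : Rd d × Z =>
      G y.2 ((v - v' : LpSpace d (2 * q)) : Rd d → ℝ) y.1)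
      (G := fun y => G y.2 v y.1 - G y.2 v' y.1) (h.aesm _ hvv)
      ((h.aesm v hv).sub (h.aesm v' hv')) (fun z => h.sub z v v' hv hv'),
      (h.minkowski hq hw hC hwi' hv).1, (h.minkowski hq hw hC hwi' hv').1] with x h1 h2 h3
    rw [integral_congr_ae h1, integral_sub h2 h3]
  · refine ⟨(∑ k ∈ Finset.range (n + 1), ∑ _α : Fin k → Fin d,
      ENNReal.ofReal C * ∫⁻ z, ENNReal.ofReal (w z) ∂μ), ENNReal.sum_ne_top.2 fun _ _ =>
        ENNReal.sum_ne_top.2 fun _ _ => ENNReal.mul_ne_top ENNReal.ofReal_ne_top hwi',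
      fun v φ hφ hv => ⟨hMemW v φ hφ hv, ?_⟩⟩
    rw [sobN, Finset.sum_mul]
    refine Finset.sum_le_sum fun k hk => ?_
    rw [Finset.sum_mul]
    refine Finset.sum_le_sum fun α _ => ?_
    have hk' : k ≤ n := by have := Finset.mem_range.1 hk; omega
    rw [eLpNorm_congr_ae (hweak v φ hφ hv k hk' α).weakD_ae, sobN_congr hv]
    exact (hmink φ hφ k hk' α).2
  · intro v φ hφ hv
    rw [energy_eq]
    have hvW : MemW n (2 * q) v := (hφ.memW n (2 * q)).congr hv.symm
    have hnorm : normW n (2 * q) (v : Rd d → ℝ) = normW n (2 * q) φ := by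
      rw [hvW.normW_eq, (hφ.memW n (2 * q)).normW_eq, sobN_congr hv]
    set V : (Fin n → Fin d) → Rd d → ℝ := fun α x =>
      vpow q (fun β : Fin n → Fin d => classicalD β φ x) α with hV
    have hae : ∀ᵐ x : Rd d, ∀ β : Fin n → Fin d, weakD β v x = classicalD β φ x :=
      ae_all_iff.2 fun β => weakD_classical (hφ.sm.nat n) β hv
    have hui : ∀ α, Integrable (fun y : Rd d × Z => V α y.1 * classicalD α (G₀ y.2 φ) y.1)
        (volume.prod μ) := fun α => by
      have hum : ∀ β : Fin n → Fin d, MemLp (classicalD β φ) ((2 * q : ℕ) : ℝ≥0∞) :=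
        fun β => (hφ.cD β).memLp _
      refine integrable_mul_of_duality (p := 2 * q)
        (F := fun y : Rd d × Z => classicalD α (G₀ y.2 φ) y.1)
        (hDm φ hφ n le_rfl α).aestronglyMeasurable (aesm_vpow (fun β => (hum β).1) α)
        (c := (∑ β : Fin n → Fin d, eLpNorm (classicalD β φ) ((2 * q : ℕ) : ℝ≥0∞) volume) ^ (2 * q - 1))
        (ENNReal.pow_ne_top (ENNReal.sum_ne_top.2 fun β _ => (hum β).eLpNorm_ne_top))
        (fun f hf => lintegral_vpow_mul_le hq (fun β => (hum β).1) hf α) (hfin φ hφ)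
        (hDmz φ hφ n le_rfl α) (fun z => h.bound z φ hφ n le_rfl α)
    have h1 : ∀ α : Fin n → Fin d, ∫ x, vpow q (fun β : Fin n → Fin d => weakD β v x) α *
        weakD α (fun x => ∫ z, G z v x ∂μ) x =
        ∫ z, (∫ x, V α x * classicalD α (G₀ z φ) x) ∂μ := by
      intro α
      have s3 : ∫ x, ∫ z, V α x * classicalD α (G₀ z φ) x ∂μ =
        ∫ z, (∫ x, V α x * classicalD α (G₀ z φ) x) ∂μ := integral_integral_swap (hui α)
      rw [← s3]
      refine integral_congr_ae ?_
      filter_upwards [hae, (hweak v φ hφ hv n le_rfl α).weakD_ae] with x hx1 hx2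
      simp only [hx1, hx2, hV]
      rw [integral_const_mul]
    simp only [h1]
    rw [← integral_finsetSum _ fun α _ => (hui α).integral_prod_right, hnorm]
    rw [← integral_const_mul, ← integral_mul_const]
    refine integral_mono (integrable_finsetSum _ fun α _ => (hui α).integral_prod_right)
      ((hwi.const_mul C).mul_const _) fun z => ?_
    exact h.energy_le z φ hφ

end MarkOp

end markOp

end IntegroDiff

end

noncomputable section

namespace IntegroDiff

/-! ### The nonlocal operators -/

section nonlocal
open Filter Topology
variable {d l q : ℕ} {K δ : ℝ}

lemma JumpHyp.memLp_diff_eLpNorm_le {η : Rd d → Rd d} (h : JumpHyp l K δ η) (hl : 1 ≤ l)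
    (hK : 0 < K) {p : ℕ} (hp : 1 ≤ p) {v : Rd d → ℝ} (hv : MemLp v (p : ℝ≥0∞)) :
    MemLp (fun x => v (x + η x) - v x) (p : ℝ≥0∞) ∧
    eLpNorm (fun x => v (x + η x) - v x) (p : ℝ≥0∞) volume ≤
      (ENNReal.ofReal (max 1 K) + 1) * eLpNorm v (p : ℝ≥0∞) volume := by
  have h1 := h.memLp_comp hl hK hp hv
  refine ⟨h1.sub hv, (eLpNorm_sub_le h1.1 hv.1 (by exact_mod_cast hp)).trans ?_⟩
  rw [add_mul, one_mul]
  exact add_le_add (h.eLpNorm_comp_le hl hK hp v) le_rfl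

lemma JumpHyp.ae_comp {η : Rd d → Rd d} (h : JumpHyp l K δ η) (hl : 1 ≤ l) (hK : 0 < K)
    {P : Rd d → Prop} (hP : ∀ᵐ x, P x) : ∀ᵐ x, P (x + η x) :=
  (h.quasiMeasurePreserving hl hK).ae hP

lemma measurable_comp_mark {Z : Type*} [MeasurableSpace Z] {η : Z → Rd d → Rd d}
    (hη : Measurable fun y : Rd d × Z => η y.2 y.1) {f : Rd d → ℝ} (hf : Measurable f) :
    Measurable fun y : Rd d × Z => f (y.1 + η y.2 y.1) :=
  hf.comp (measurable_fst.add hη)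

lemma exists_markOp_I (d n : ℕ) {q : ℕ} (hq : 1 ≤ q) {K : ℝ} (hK : 0 < K) : ∃ C : ℝ, 0 ≤ C ∧
    ∀ (Z : Type*) [MeasurableSpace Z] (ν : Measure Z) [SFinite ν] (ξbar : Z → ℝ)
      (ξ : Z → Rd d → Rd d), (Measurable fun y : Rd d × Z => ξ y.2 y.1) →
      (∀ z, JumpHyp (max n 2) K (ξbar z) (ξ z)) →
      MarkOp n q ν ξbar C (fun z v => opI ξ z v) (fun z φ x => φ (x + ξ z x) - φ x) := by
  have hp : 1 ≤ 2 * q := by omega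
  have hl : 1 ≤ max n 2 := by omega
  obtain ⟨C, hC, hb⟩ := exists_diff_mark d n hq hK
  obtain ⟨C', hC', hb'⟩ := exists_diff_mark d 0 hq hK
  refine ⟨C + C', add_nonneg hC hC', fun Z _ ν _ ξbar ξ hm h => ⟨?_, ?_, ?_, ?_, ?_, ?_, ?_, ?_, ?_⟩⟩
  · intro v _
    have hv : Measurable v := (Lp.stronglyMeasurable v).measurable
    exact ((measurable_comp_mark hm hv).sub (hv.comp measurable_fst)).aestronglyMeasurable
  · intro z v w _ _
    have h1 := Lp.coeFn_sub v w
    filter_upwards [h1, (h z).ae_comp hl hK h1] with x h2 h3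
    simp only [opI, h2, h3, Pi.sub_apply]
    ring
  · intro z
    refine ⟨ENNReal.ofReal (max 1 K) + 1, by simp, fun v hv => ?_⟩
    have h1 := (h z).memLp_diff_eLpNorm_le hl hK hp (Lp.memLp v)
    exact ⟨h1.1, h1.2.trans (mul_le_mul' le_rfl (eLpNorm_le_sobN hp (Lp.memLp v)))⟩
  · intro z v φ hφ hv
    filter_upwards [hv, (h z).ae_comp hl hK hv] with x h2 h3
    simp only [opI, h2, h3]
  · intro z φ hφ
    exact ((hφ.sm.nat n).comp ((h z).contDiff_tau.of_le (by norm_cast; omega))).sub (hφ.sm.nat n)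
  · intro φ hφ
    have hv : Measurable φ := hφ.1.continuous.measurable
    exact (measurable_comp_mark hm hv).sub (hv.comp measurable_fst)
  · intro z φ hφ
    have := (hb' _ _ ((h z).mono (by omega)) φ hφ).1 0 le_rfl Fin.elim0
    rw [classicalD_zero] at this
    refine this.trans (mul_le_mul' (ENNReal.ofReal_le_ofReal ?_) le_rfl)
    exact mul_le_mul_of_nonneg_right (by linarith) (h z).delta_nonneg
  · intro z φ hφ k hk α
    refine ((hb _ _ (h z) φ hφ).1 k hk α).trans (mul_le_mul' (ENNReal.ofReal_le_ofReal ?_) le_rfl)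
    exact mul_le_mul_of_nonneg_right (by linarith) (h z).delta_nonneg
  · intro z φ hφ
    refine (hb _ _ (h z) φ hφ).2.trans (mul_le_mul_of_nonneg_right ?_ (pow_nonneg (normW_nonneg _) _))
    exact mul_le_mul_of_nonneg_right (by linarith) (h z).delta_nonneg

lemma exists_markOp_J (d n : ℕ) {q : ℕ} (hq : 1 ≤ q) {K : ℝ} (hK : 0 < K) : ∃ C : ℝ, 0 ≤ C ∧
    ∀ (Z : Type*) [MeasurableSpace Z] (μ : Measure Z) [SFinite μ] (ηbar : Z → ℝ)
      (η : Z → Rd d → Rd d), (Measurable fun y : Rd d × Z => η y.2 y.1) →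
      (∀ z, JumpHyp (max n 2) K (ηbar z) (η z)) →
      MarkOp n q μ (fun z => ηbar z ^ 2) C (fun z v => opJ η z v) (fun z φ => jump (η z) φ) := by
  have hp : 1 ≤ 2 * q := by omega
  have hp' : (1 : ℝ≥0∞) ≤ ((2 * q : ℕ) : ℝ≥0∞) := by exact_mod_cast hp
  have hl : 1 ≤ max n 2 := by omega
  obtain ⟨C, hC, hb⟩ := exists_jump_mark d n hq hK
  obtain ⟨C', hC', hb'⟩ := exists_jump_mark d 0 hq hK
  have hηi : ∀ {Z : Type _} [MeasurableSpace Z] {η : Z → Rd d → Rd d},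
      (Measurable fun y : Rd d × Z => η y.2 y.1) → ∀ i : Fin d,
      Measurable fun y : Rd d × Z => η y.2 y.1 i := fun hm i =>
    (EuclideanSpace.proj (𝕜 := ℝ) i).continuous.measurable.comp hm
  refine ⟨C + C', add_nonneg hC hC', fun Z _ μ _ ηbar η hm h => ⟨?_, ?_, ?_, ?_, ?_, ?_, ?_, ?_, ?_⟩⟩
  · intro v hvW
    have hv : Measurable v := (Lp.stronglyMeasurable v).measurable
    refine ((measurable_comp_mark hm hv).sub (hv.comp measurable_fst)).aestronglyMeasurable.sub ?_
    refine Finset.univ.aestronglyMeasurable_fun_sum fun i _ => ?_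
    exact (hηi hm i).aestronglyMeasurable.mul (hvW.memLp_weakD (by omega) ![i]).1.comp_fst
  · intro z v w hv hw
    have h1 := Lp.coeFn_sub v w
    have h2 : ∀ᵐ x, ∀ i : Fin d, weakD ![i] ((v - w : LpSpace d (2 * q)) : Rd d → ℝ) x =
        weakD ![i] v x - weakD ![i] w x := ae_all_iff.2 fun i =>
      (weakD_congr h1 _).trans (hv.weakD_sub hw (by omega) _)
    filter_upwards [h1, (h z).ae_comp hl hK h1, h2] with x h2 h3 h4
    simp only [opJ, h2, h3, h4, Pi.sub_apply, mul_sub, Finset.sum_sub_distrib]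
    ring
  · intro z
    have hc : ∀ i, AEStronglyMeasurable (fun x => η z x i) (volume : Measure (Rd d)) := fun i =>
      ((h z).contDiff_comp i).continuous.aestronglyMeasurable
    refine ⟨ENNReal.ofReal (max 1 K) + 1 + ENNReal.ofReal (ηbar z) * d,
      ENNReal.add_ne_top.2 ⟨by simp, ENNReal.mul_ne_top (by simp) (by simp)⟩, fun v hv => ?_⟩
    have h1 := (h z).memLp_diff_eLpNorm_le hl hK hp (Lp.memLp v)
    have hw : ∀ i : Fin d, MemLp (weakD ![i] (v : Rd d → ℝ)) ((2 * q : ℕ) : ℝ≥0∞) := fun i =>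
      hv.memLp_weakD (by omega) ![i]
    have h2 : MemLp (fun x => ∑ i, η z x i * weakD ![i] (v : Rd d → ℝ) x)
        ((2 * q : ℕ) : ℝ≥0∞) := memLp_finsetSum _ fun i _ =>
      (hw i).of_le_mul ((hc i).mul (hw i).1) (c := ηbar z) (Eventually.of_forall fun x => by
        rw [norm_mul]
        exact mul_le_mul_of_nonneg_right ((h z).abs_comp_le i x) (norm_nonneg _))
    refine ⟨h1.1.sub h2, (eLpNorm_sub_le h1.1.1 h2.1 hp').trans ?_⟩
    rw [add_mul]
    refine add_le_add (h1.2.trans (mul_le_mul' le_rfl (eLpNorm_le_sobN hp (Lp.memLp v)))) ?_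
    refine (eLpNorm_sum_mul_le hp' (fun i x => (h z).abs_comp_le i x) hc fun i => (hw i).1).trans ?_
    rw [mul_assoc]
    refine mul_le_mul' le_rfl ((Finset.sum_le_sum fun i _ =>
      eLpNorm_weakD_le_sobN (n := 2) (by omega) ![i] _).trans (le_of_eq ?_))
    rw [Finset.sum_const, Finset.card_univ, Fintype.card_fin, nsmul_eq_mul]
  · intro z v φ hφ hv
    have h1 : ∀ᵐ x, ∀ i : Fin d, weakD ![i] (v : Rd d → ℝ) x = pd i φ x := ae_all_iff.2 fun i => by
      rw [← classicalD_one]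
      exact weakD_classical (hφ.sm.nat 1) _ hv
    filter_upwards [hv, (h z).ae_comp hl hK hv, h1] with x h2 h3 h4
    simp only [opJ, jump, h2, h3, h4]
  · intro z φ hφ
    exact contDiff_jump (fun j => ((h z).contDiff_comp j).of_le (by norm_cast; omega)) hφ.sm
  · intro φ hφ
    have hv : Measurable φ := hφ.1.continuous.measurable
    refine ((measurable_comp_mark hm hv).sub (hv.comp measurable_fst)).sub ?_
    exact Finset.univ.measurable_fun_sum fun i _ =>
      (hηi hm i).mul ((hφ.pd i).1.continuous.measurable.comp measurable_fst)
  · intro z φ hφ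
    have := (hb' _ _ ((h z).mono (by omega)) φ hφ).1 0 le_rfl Fin.elim0
    rw [classicalD_zero] at this
    refine this.trans (mul_le_mul' (ENNReal.ofReal_le_ofReal ?_) le_rfl)
    exact mul_le_mul_of_nonneg_right (by linarith) (sq_nonneg _)
  · intro z φ hφ k hk α
    refine ((hb _ _ (h z) φ hφ).1 k hk α).trans (mul_le_mul' (ENNReal.ofReal_le_ofReal ?_) le_rfl)
    exact mul_le_mul_of_nonneg_right (by linarith) (sq_nonneg _)
  · intro z φ hφ
    refine (hb _ _ (h z) φ hφ).2.trans (mul_le_mul_of_nonneg_right ?_ (pow_nonneg (normW_nonneg _) _))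
    exact mul_le_mul_of_nonneg_right (by linarith) (sq_nonneg _)

end nonlocal

end IntegroDiff

end

noncomputable section

namespace IntegroDiff

/-! ### Commutators of derivatives and differential operators with smooth coefficients -/

section diffCommutator
variable {d : ℕ} {S : Type*}

/-- `a^{ij} D_{ij} φ`. -/
def secondOrder (a : Fin d → Fin d → Rd d → ℝ) (φ : Rd d → ℝ) (x : Rd d) : ℝ :=
  ∑ i, ∑ j, a i j x * pd i (pd j φ) x

/-- `b^i D_i φ`. -/
def firstOrder (b : Fin d → Rd d → ℝ) (φ : Rd d → ℝ) (x : Rd d) : ℝ := ∑ i, b i x * pd i φ x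

/-- Sums of terms `P D_β φ` with `|β| ≤ n` and derivatives of `P` up to order `r` bounded. -/
abbrev LowTerm (r n : ℕ) (T : S → (Rd d → ℝ) → Rd d → ℝ) : Prop :=
  ErrorTerm (fun _ _ => 0) (fun _ => 1) (fun _ => 0) r n T

lemma jumpFamily_zero (l : ℕ) :
    JumpFamily (S := S) l (fun _ => 0) (fun _ _ => (0 : Rd d)) := by
  have h : ∀ (w : S → ℝ) (i j : Fin d), SymbolBound w (l - 1)
      (fun _ => pd i (fun _ : Rd d => (0 : Rd d) j)) := fun w i j => by
    have : (fun (_ : S) => pd i (fun _ : Rd d => (0 : Rd d) j)) = fun _ _ => 0 := by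
      ext; simp [pd]
    rw [this]
    exact SymbolBound.zero
  exact ⟨fun _ => le_rfl, fun _ _ => contDiff_const, h _, h _⟩

namespace LowTerm
variable {r n : ℕ} {T : S → (Rd d → ℝ) → Rd d → ℝ}

lemma gen {k : ℕ} (hk : k ≤ n) (β : Fin k → Fin d) {P : S → Rd d → ℝ}
    (hP : SymbolBound (fun _ => 1) r P) : LowTerm r n (fun s φ x => P s x * classicalD β φ x) :=
  (ErrorTerm.comp (η := fun _ _ => 0) hk β hP).congr fun s φ _ => by simp

lemma pd (h : LowTerm (r + 1) n T) (i : Fin d) : LowTerm r (n + 1) (fun s φ => pd i (T s φ)) :=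
  ErrorTerm.pd (jumpFamily_zero (r + 1)) le_rfl (fun _ => by simp) h i

lemma contDiff (h : LowTerm r n T) (s : S) {φ : Rd d → ℝ} (hφ : Sm φ) : ContDiff ℝ r (T s φ) :=
  ErrorTerm.contDiff (jumpFamily_zero r) le_rfl h s hφ

lemma bound (h : LowTerm r n T) : ∃ C : ℝ, 0 ≤ C ∧ ∀ s φ, Sm φ → ∀ x,
    |T s φ x| ≤ C * jetAbs n φ x := by
  obtain ⟨C, hC, h1⟩ := ErrorTerm.bound h (fun _ => zero_le_one) (fun _ => le_rfl)
  exact ⟨C, hC, fun s φ hφ x => by simpa using h1 s φ hφ x⟩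

end LowTerm

lemma pd_firstOrder {b : Fin d → Rd d → ℝ} (hb : ∀ i, Differentiable ℝ (b i)) {φ : Rd d → ℝ}
    (hφ : Sm φ) (k : Fin d) : pd k (firstOrder b φ) = fun x => firstOrder b (pd k φ) x +
      firstOrder (fun i => pd k (b i)) φ x := by
  have e : firstOrder b φ = fun x => ∑ i, b i x * pd i φ x := rfl
  have h1 : ∀ i, Differentiable ℝ fun x => b i x * pd i φ x := fun i =>
    (hb i).mul (hφ.pd i).differentiable
  ext x
  rw [e, pd_sum fun i _ => h1 i]
  simp only [fun i => pd_mul (hb i) (hφ.pd i).differentiable k, firstOrder,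
    Finset.sum_add_distrib, pd_comm (hφ.nat 2) k]
  ring

lemma pd_secondOrder {a : Fin d → Fin d → Rd d → ℝ} (ha : ∀ i j, Differentiable ℝ (a i j))
    {φ : Rd d → ℝ} (hφ : Sm φ) (k : Fin d) : pd k (secondOrder a φ) = fun x =>
      secondOrder a (pd k φ) x + secondOrder (fun i j => pd k (a i j)) φ x := by
  have e : secondOrder a φ = fun x => ∑ i, ∑ j, a i j x * pd i (pd j φ) x := rfl
  have h1 : ∀ i j, Differentiable ℝ fun x => a i j x * pd i (pd j φ) x := fun i j =>
    (ha i j).mul ((hφ.pd j).pd i).differentiable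
  have h2 : ∀ i j, pd k (pd i (pd j φ)) = pd i (pd j (pd k φ)) := fun i j => by
    rw [pd_comm ((hφ.pd j).nat 2), pd_comm (hφ.nat 2) k]
  ext x
  rw [e, pd_sum fun i _ => Differentiable.fun_sum fun j _ => h1 i j]
  simp only [fun i => pd_sum (fun j _ => h1 i j) (s := Finset.univ) k,
    fun i j => pd_mul (ha i j) ((hφ.pd j).pd i).differentiable k, secondOrder,
    Finset.sum_add_distrib, h2]
  ring

lemma contDiff_secondOrder {r : ℕ} {a : Fin d → Fin d → Rd d → ℝ} (ha : ∀ i j, ContDiff ℝ r (a i j))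
    {φ : Rd d → ℝ} (hφ : Sm φ) : ContDiff ℝ r (secondOrder a φ) :=
  ContDiff.sum fun i _ => ContDiff.sum fun j _ => (ha i j).mul (((hφ.pd j).pd i).nat r)

lemma contDiff_firstOrder {r : ℕ} {b : Fin d → Rd d → ℝ} (hb : ∀ i, ContDiff ℝ r (b i))
    {φ : Rd d → ℝ} (hφ : Sm φ) : ContDiff ℝ r (firstOrder b φ) :=
  ContDiff.sum fun i _ => (hb i).mul ((hφ.pd i).nat r)

lemma lowTerm_zeroOrder {c : S → Rd d → ℝ} {l : ℕ} (hc : SymbolBound (fun _ => 1) l c) :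
    ∀ n, n ≤ l → ∀ α : Fin n → Fin d,
      LowTerm (l - n) n (fun s φ x => classicalD α (fun x => c s x * φ x) x) := by
  intro n
  induction n with
  | zero =>
    intro _ α
    refine (LowTerm.gen (le_refl 0) α hc).congr fun s φ _ => ?_
    simp only [classicalD_zero]
  | succ n ih =>
    intro hn α
    obtain ⟨i, β, rfl⟩ : ∃ i β, α = Fin.cons i β := ⟨α 0, Fin.tail α, (Fin.cons_self_tail α).symm⟩
    have h0 := ih (by omega) β
    have hr : l - n = l - (n + 1) + 1 := by omega
    rw [hr] at h0
    refine (h0.pd i).congr fun s φ hφ => ?_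
    rw [classicalD_cons (((hc.1 s).of_le (by exact_mod_cast hn)).mul (hφ.nat _))]

lemma lowTerm_firstOrder {b : S → Fin d → Rd d → ℝ} {l : ℕ}
    (hb : ∀ i, SymbolBound (fun _ => 1) l (fun s => b s i)) :
    ∀ n, n ≤ l → ∀ α : Fin n → Fin d, LowTerm (l - n) n
      (fun s φ x => classicalD α (firstOrder (b s) φ) x - firstOrder (b s) (classicalD α φ) x) := by
  intro n
  induction n with
  | zero =>
    intro _ α
    refine ErrorTerm.zero.congr fun s φ _ => ?_
    simp only [classicalD_zero, sub_self]
  | succ n ih =>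
    intro hn α
    obtain ⟨i, β, rfl⟩ : ∃ i β, α = Fin.cons i β := ⟨α 0, Fin.tail α, (Fin.cons_self_tail α).symm⟩
    have h0 := ih (by omega) β
    have hr : l - n = l - (n + 1) + 1 := by omega
    rw [hr] at h0
    have h2 : ∀ j : Fin d, LowTerm (l - (n + 1)) (n + 1) (fun s φ x => pd i (b s j) x *
        classicalD (Fin.cons j β : Fin (n + 1) → Fin d) φ x) := fun j =>
      LowTerm.gen le_rfl _ ((SymbolBound.pd (r := l - 1) ((hb j).mono (by omega)) i).mono (by omega))
    refine ((h0.pd i).add (ErrorTerm.sum Finset.univ fun j _ => h2 j)).congr fun s φ hφ => ?_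
    have hbn : ∀ j, ContDiff ℝ (n + 1 : ℕ) (b s j) := fun j => ((hb j).1 s).of_le (by exact_mod_cast hn)
    have hb1 : ∀ j, Differentiable ℝ (b s j) := fun j => (hbn j).differentiable (by norm_cast)
    have hc : ContDiff ℝ (n + 1 : ℕ) (firstOrder (b s) φ) := contDiff_firstOrder hbn hφ
    have d1 : Differentiable ℝ (classicalD β (firstOrder (b s) φ)) :=
      (contDiff_classicalD (r := 1) (hc.of_le (by norm_cast; omega)) β).differentiable (by simp)
    have d2 : Differentiable ℝ (firstOrder (b s) (classicalD β φ)) :=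
      (contDiff_firstOrder (fun j => (hbn j).of_le (by norm_cast; omega : ((1 : ℕ) : WithTop ℕ∞) ≤ _))
        (hφ.cD β)).differentiable (by simp)
    ext x
    rw [pd_sub d1 d2, pd_firstOrder hb1 (hφ.cD β), classicalD_cons hc]
    simp only [classicalD_cons (hφ.nat (n + 1)), firstOrder]
    ring

/-- Sums of terms `D_k a^{ij} D_{ij} D_β φ` with `|β| + 1 = n`. -/
inductive TopTerm (a : S → Fin d → Fin d → Rd d → ℝ) :
    ℕ → (S → (Rd d → ℝ) → Rd d → ℝ) → Prop
  | gen {m : ℕ} (k : Fin d) (β : Fin m → Fin d) : TopTerm a (m + 1)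
      (fun s φ => secondOrder (fun i j => pd k (a s i j)) (classicalD β φ))
  | zero (n : ℕ) : TopTerm a n (fun _ _ _ => 0)
  | add {n : ℕ} {T T' : S → (Rd d → ℝ) → Rd d → ℝ} (hT : TopTerm a n T) (hT' : TopTerm a n T') :
      TopTerm a n (fun s φ x => T s φ x + T' s φ x)

lemma TopTerm.contDiff {a : S → Fin d → Fin d → Rd d → ℝ} (ha : ∀ s i j, Sm (a s i j)) {n : ℕ}
    {T : S → (Rd d → ℝ) → Rd d → ℝ} (h : TopTerm a n T) (s : S) {φ : Rd d → ℝ} (hφ : Sm φ) :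
    ContDiff ℝ (1 : ℕ) (T s φ) := by
  induction h with
  | gen k β => exact contDiff_secondOrder (fun i j => ((ha s i j).pd k).nat 1) (hφ.cD β)
  | zero n => exact contDiff_const
  | add _ _ h1 h2 => exact h1.add h2

lemma TopTerm.pd {a : S → Fin d → Fin d → Rd d → ℝ} {l : ℕ} (ha : ∀ s i j, Sm (a s i j))
    (hab : ∀ i j, SymbolBound (fun _ => 1) l (fun s => a s i j)) {n : ℕ} (hn : n + 1 ≤ l)
    {T : S → (Rd d → ℝ) → Rd d → ℝ} (h : TopTerm a n T) (i : Fin d) :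
    ∃ T₁ T₂ : S → (Rd d → ℝ) → Rd d → ℝ, TopTerm a (n + 1) T₁ ∧ LowTerm (l - (n + 1)) (n + 1) T₂ ∧
      ∀ s φ, Sm φ → pd i (T s φ) = fun x => T₁ s φ x + T₂ s φ x := by
  induction h with
  | @gen m k β =>
    refine ⟨_, _, TopTerm.gen k (Fin.cons i β : Fin (m + 1) → Fin d),
      ErrorTerm.sum Finset.univ fun i' _ => ErrorTerm.sum Finset.univ fun j _ =>
        LowTerm.gen (P := fun s => IntegroDiff.pd i (IntegroDiff.pd k (a s i' j)))
          (le_refl (m + 1 + 1)) (Fin.cons i' (Fin.cons j β : Fin (m + 1) → Fin d)) ?_,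
      fun s φ hφ => ?_⟩
    · exact (SymbolBound.pd (r := l - 2) (SymbolBound.pd (r := l - 2 + 1)
        ((hab i' j).mono (by omega)) k) i).mono (by omega)
    · rw [pd_secondOrder (fun i' j => ((ha s i' j).pd k).differentiable) (hφ.cD β)]
      ext x
      simp only [classicalD_cons (hφ.nat (m + 1)), classicalD_cons (hφ.nat (m + 1 + 1)), secondOrder]
  | zero n => exact ⟨_, _, TopTerm.zero _, ErrorTerm.zero, fun s φ _ => by ext; simp [IntegroDiff.pd]⟩
  | @add n T T' hT hT' h1 h2 =>
    obtain ⟨A, B, hA, hB, e1⟩ := h1 hn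
    obtain ⟨A', B', hA', hB', e2⟩ := h2 hn
    refine ⟨_, _, hA.add hA', hB.add hB', fun s φ hφ => ?_⟩
    rw [pd_add ((hT.contDiff ha s hφ).differentiable (by simp))
      ((hT'.contDiff ha s hφ).differentiable (by simp)), e1 s φ hφ, e2 s φ hφ]
    ext x
    ring

lemma exists_secondOrder_commutator {a : S → Fin d → Fin d → Rd d → ℝ} {l : ℕ}
    (ha : ∀ s i j, Sm (a s i j))
    (hab : ∀ i j, SymbolBound (fun _ => 1) l (fun s => a s i j)) :
    ∀ n, n ≤ l → ∀ α : Fin n → Fin d, ∃ T₁ T₂ : S → (Rd d → ℝ) → Rd d → ℝ,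
      TopTerm a n T₁ ∧ LowTerm (l - n) n T₂ ∧ ∀ s φ, Sm φ → classicalD α (secondOrder (a s) φ) =
        fun x => secondOrder (a s) (classicalD α φ) x + T₁ s φ x + T₂ s φ x := by
  intro n
  induction n with
  | zero =>
    intro _ α
    refine ⟨_, _, TopTerm.zero 0, ErrorTerm.zero, fun s φ _ => ?_⟩
    simp only [classicalD_zero, add_zero]
  | succ n ih =>
    intro hn α
    obtain ⟨i, β, rfl⟩ : ∃ i β, α = Fin.cons i β := ⟨α 0, Fin.tail α, (Fin.cons_self_tail α).symm⟩
    obtain ⟨T₁, T₂, h1, h2, e⟩ := ih (by omega) β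
    obtain ⟨A, B, hA, hB, e1⟩ := h1.pd ha hab hn i
    have hr : l - n = l - (n + 1) + 1 := by omega
    rw [hr] at h2
    refine ⟨_, _, (TopTerm.gen i β).add hA, hB.add (h2.pd i), fun s φ hφ => ?_⟩
    have d0 : Differentiable ℝ (secondOrder (a s) (classicalD β φ)) :=
      (contDiff_secondOrder (fun i j => (ha s i j).nat 1) (hφ.cD β)).differentiable (by simp)
    have d1 : Differentiable ℝ (T₁ s φ) := (h1.contDiff ha s hφ).differentiable (by simp)
    have d2 : Differentiable ℝ (T₂ s φ) := (h2.contDiff s hφ).differentiable (by norm_cast)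
    have d3 : Differentiable ℝ fun x => secondOrder (a s) (classicalD β φ) x + T₁ s φ x := d0.add d1
    rw [classicalD_cons (contDiff_secondOrder (fun i j => (ha s i j).nat _) hφ), e s φ hφ,
      pd_add d3 d2, pd_add d0 d1, e1 s φ hφ,
      pd_secondOrder (fun i j => (ha s i j).differentiable) (hφ.cD β)]
    ext x
    rw [classicalD_cons (hφ.nat (n + 1))]
    ring

end diffCommutator

end IntegroDiff

end

noncomputable section

namespace IntegroDiff

/-! ### Oleinik's inequality -/

section oleinik
variable {d : ℕ}

/-- A nonnegative function with bounded second derivative: `(g')² ≤ 4 sup |g''| g`. -/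
lemma sq_deriv_le_of_nonneg {g g₁ g₂ : ℝ → ℝ} {M : ℝ} (h1 : ∀ t, HasDerivAt g (g₁ t) t)
    (h2 : ∀ t, HasDerivAt g₁ (g₂ t) t) (hM : ∀ t, |g₂ t| ≤ M) (h0 : ∀ t, 0 ≤ g t) :
    g₁ 0 ^ 2 ≤ 4 * M * g 0 := by
  have hM0 : 0 ≤ M := (abs_nonneg _).trans (hM 0)
  have h3 : ∀ t, |g₁ t - g₁ 0| ≤ M * |t| := fun t => by
    have := Convex.norm_image_sub_le_of_norm_hasDerivWithin_le (f := g₁) (f' := g₂)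
      (s := Set.univ) (C := M) (x := 0) (y := t)
      (fun t _ => (h2 t).hasDerivWithinAt) (fun t _ => hM t) convex_univ trivial trivial
    simpa using this
  have h4 : ∀ h : ℝ, |g h - g₁ 0 * h - g 0| ≤ M * |h| * |h| := fun h => by
    have := Convex.norm_image_sub_le_of_norm_hasDerivWithin_le (f := fun t => g t - g₁ 0 * t)
      (f' := fun t => g₁ t - g₁ 0) (s := Set.uIcc 0 h) (C := M * |h|) (x := 0) (y := h)
      (fun t _ => by
        have h5 := (h1 t).sub ((hasDerivAt_id t).const_mul (g₁ 0))
        simp only [mul_one] at h5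
        exact h5.hasDerivWithinAt)
      (fun t ht => (h3 t).trans (mul_le_mul_of_nonneg_left (by
        have := Set.abs_sub_left_of_mem_uIcc ht
        simpa using this) hM0)) (convex_uIcc 0 h)
      Set.left_mem_uIcc Set.right_mem_uIcc
    simpa using this
  have h5 : ∀ h : ℝ, 0 ≤ M * (h * h) + g₁ 0 * h + g 0 := fun h => by
    have h6 := (abs_le.1 (h4 h)).2
    rw [mul_assoc, abs_mul_abs_self] at h6
    have := h0 h
    linarith
  have := discrim_le_zero h5
  rw [discrim] at this
  linarith

lemma hasDerivAt_line {f : Rd d → ℝ} (hf : Differentiable ℝ f) (x : Rd d) (k : Fin d) (t : ℝ) :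
    HasDerivAt (fun t : ℝ => f (x + t • EuclideanSpace.single k (1 : ℝ)))
      (pd k f (x + t • EuclideanSpace.single k (1 : ℝ))) t := by
  have h4 : HasDerivAt (fun t : ℝ => x + t • EuclideanSpace.single k (1 : ℝ))
      (EuclideanSpace.single k (1 : ℝ)) t := by
    simpa using ((hasDerivAt_id t).smul_const (EuclideanSpace.single k (1 : ℝ))).const_add x
  exact (hf _).hasFDerivAt.comp_hasDerivAt t h4

lemma sq_pd_quadratic_le {a : Fin d → Fin d → Rd d → ℝ} (ha : ∀ i j, Sm (a i j)) {K : ℝ}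
    (hK : ∀ k i j x, |pd k (pd k (a i j)) x| ≤ K)
    (hnn : ∀ x (y : Fin d → ℝ), 0 ≤ ∑ i, ∑ j, a i j x * y i * y j) (k : Fin d) (x : Rd d)
    {y : Fin d → ℝ} (hy : ∑ i, y i ^ 2 = 1) :
    (∑ i, ∑ j, pd k (a i j) x * y i * y j) ^ 2 ≤ 4 * (K * d) * ∑ i, ∑ j, a i j x * y i * y j := by
  have hsm : ∀ {b : Fin d → Fin d → Rd d → ℝ}, (∀ i j, Sm (b i j)) →
      Sm fun x => ∑ i, ∑ j, b i j x * y i * y j := fun hb =>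
    Sm.sum fun i _ => Sm.sum fun j _ => ((hb i j).mul contDiff_const).mul contDiff_const
  have hpd : ∀ {b : Fin d → Fin d → Rd d → ℝ}, (∀ i j, Sm (b i j)) →
      pd k (fun x => ∑ i, ∑ j, b i j x * y i * y j) =
        fun x => ∑ i, ∑ j, pd k (b i j) x * y i * y j := fun {b} hb => by
    have h1 : ∀ i j, Differentiable ℝ fun x => b i j x * y i * y j := fun i j =>
      ((hb i j).differentiable.mul_const _).mul_const _
    rw [pd_sum fun i _ => Differentiable.fun_sum fun j _ => h1 i j]
    simp only [fun i => pd_sum (fun j _ => h1 i j) (s := Finset.univ) k]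
    have h2 : ∀ i j, pd k (fun x => b i j x * y i * y j) = fun x => pd k (b i j) x * y i * y j :=
      fun i j => by
        ext x
        simp only [mul_assoc]
        rw [pd_mul (hb i j).differentiable (differentiable_const _)]
        simp [pd]
    simp only [h2]
  have h1 := hasDerivAt_line (hsm ha).differentiable x k
  have h2 := hasDerivAt_line (hsm fun i j => (ha i j).pd k).differentiable x k
  rw [hpd ha] at h1
  rw [hpd fun i j => (ha i j).pd k] at h2
  have h3 := sq_deriv_le_of_nonneg h1 h2 (M := K * d) (fun t => ?_) fun t => hnn _ y
  · simpa using h3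
  · have hK0 : ∀ i : Fin d, 0 ≤ K := fun i => (abs_nonneg _).trans (hK k i i x)
    set z := x + t • EuclideanSpace.single k (1 : ℝ)
    calc |∑ i, ∑ j, pd k (pd k (a i j)) z * y i * y j|
        ≤ ∑ i, ∑ j, K * (|y i| * |y j|) := by
          refine (Finset.abs_sum_le_sum_abs _ _).trans (Finset.sum_le_sum fun i _ => ?_)
          refine (Finset.abs_sum_le_sum_abs _ _).trans (Finset.sum_le_sum fun j _ => ?_)
          rw [abs_mul, abs_mul, mul_assoc]
          exact mul_le_mul_of_nonneg_right (hK k i j z) (by positivity)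
      _ = K * (∑ i, |y i|) ^ 2 := by
          rw [pow_two, Finset.sum_mul_sum, Finset.mul_sum]
          simp only [Finset.mul_sum]
      _ ≤ K * d := by
          have := sq_sum_abs_le y
          rw [hy, Fintype.card_fin, mul_one] at this
          exact mul_le_mul_of_nonneg_left this (hK0 k)

lemma exists_spectral {W : Fin d → Fin d → ℝ} (hW : ∀ i j, W i j = W j i) :
    ∃ (r : Fin d → ℝ) (e : Fin d → Fin d → ℝ),
      (∀ s t, ∑ i, e s i * e t i = if s = t then 1 else 0) ∧
      ∀ i j, W i j = ∑ s, r s * e s i * e s j := by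
  have hA : (Matrix.of W).IsHermitian := by
    ext i j
    simp [hW i j]
  refine ⟨hA.eigenvalues, fun s i => (hA.eigenvectorUnitary : Matrix (Fin d) (Fin d) ℝ) i s,
    fun s t => ?_, fun i j => ?_⟩
  · have h1 : star (hA.eigenvectorUnitary : Matrix (Fin d) (Fin d) ℝ) * hA.eigenvectorUnitary = 1 :=
      Unitary.coe_star_mul_self _
    have h2 := congrFun (congrFun h1 s) t
    rw [Matrix.mul_apply, Matrix.one_apply] at h2
    simpa [Matrix.star_apply] using h2
  · have h1 := congrFun (congrFun hA.spectral_theorem i) j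
    rw [Unitary.conjStarAlgAut_apply, Matrix.mul_apply] at h1
    simp only [Matrix.mul_diagonal, Matrix.star_apply, Matrix.of_apply] at h1
    rw [h1]
    refine Finset.sum_congr rfl fun s _ => ?_
    simp only [Function.comp, RCLike.ofReal_real_eq_id, id, star_trivial]
    ring

lemma oleinik {a : Fin d → Fin d → Rd d → ℝ} (ha : ∀ i j, Sm (a i j)) {K : ℝ}
    (hK : ∀ k i j x, |pd k (pd k (a i j)) x| ≤ K)
    (hnn : ∀ x (y : Fin d → ℝ), 0 ≤ ∑ i, ∑ j, a i j x * y i * y j) (k : Fin d) (x : Rd d)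
    {W : Fin d → Fin d → ℝ} (hW : ∀ i j, W i j = W j i) :
    (∑ i, ∑ j, pd k (a i j) x * W i j) ^ 2 ≤
      d * (4 * (K * d)) * ∑ s, ∑ i, ∑ j, a i j x * W i s * W j s := by
  obtain ⟨r, e, he, hWe⟩ := exists_spectral hW
  have hsw : ∀ b : Fin d → Fin d → ℝ, ∑ i, ∑ j, b i j * (∑ s, r s * e s i * e s j) =
      ∑ s, r s * ∑ i, ∑ j, b i j * e s i * e s j := fun b => by
    simp only [Finset.mul_sum]
    rw [Finset.sum_congr rfl fun i _ => Finset.sum_comm, Finset.sum_comm]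
    refine Finset.sum_congr rfl fun s _ => Finset.sum_congr rfl fun i _ =>
      Finset.sum_congr rfl fun j _ => by ring
  have hWW : ∀ i j, ∑ s, W i s * W j s = ∑ s, (r s ^ 2) * e s i * e s j := fun i j => by
    have h1 : ∀ s, W i s * W j s = ∑ t, ∑ u, (r t * e t i) * (r u * e u j) * (e t s * e u s) :=
      fun s => by
        rw [hWe i s, hWe j s, Finset.sum_mul_sum]
        refine Finset.sum_congr rfl fun t _ => Finset.sum_congr rfl fun u _ => by ring
    simp only [h1]
    rw [Finset.sum_comm]
    refine Finset.sum_congr rfl fun t _ => ?_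
    rw [Finset.sum_comm]
    simp only [← Finset.mul_sum, he]
    simp
    ring
  have hR : ∑ s, ∑ i, ∑ j, a i j x * W i s * W j s =
      ∑ s, r s ^ 2 * ∑ i, ∑ j, a i j x * e s i * e s j := by
    have h1 : ∑ s, ∑ i, ∑ j, a i j x * W i s * W j s =
        ∑ i, ∑ j, a i j x * ∑ s, W i s * W j s := by
      rw [Finset.sum_comm]
      refine Finset.sum_congr rfl fun i _ => ?_
      rw [Finset.sum_comm]
      simp only [Finset.mul_sum, mul_assoc]
    rw [h1]
    simp only [hWW, Finset.mul_sum]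
    rw [Finset.sum_congr rfl fun i _ => Finset.sum_comm, Finset.sum_comm]
    refine Finset.sum_congr rfl fun s _ => Finset.sum_congr rfl fun i _ =>
      Finset.sum_congr rfl fun j _ => by ring
  simp only [hWe]
  rw [hsw (fun i j => pd k (a i j) x)]
  simp only [← hWe]
  rw [hR]
  have h2 := sq_sum_le_card_mul_sum_sq (s := Finset.univ)
    (f := fun s => r s * ∑ i, ∑ j, pd k (a i j) x * e s i * e s j)
  rw [Finset.card_univ, Fintype.card_fin] at h2
  refine h2.trans ?_
  rw [mul_assoc, Finset.mul_sum (a := 4 * (K * d))]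
  refine mul_le_mul_of_nonneg_left (Finset.sum_le_sum fun s _ => ?_) (Nat.cast_nonneg d)
  rw [mul_pow]
  have h3 := sq_pd_quadratic_le ha hK hnn k x (y := e s) (by
    have := he s s
    simpa [pow_two] using this)
  have h4 := mul_le_mul_of_nonneg_left h3 (sq_nonneg (r s))
  refine h4.trans (le_of_eq (by ring))

variable {S : Type*}

/-- `∑_{|γ| = n} a^{ij} D_i D_γ φ D_j D_γ φ`. -/
def gradForm (n : ℕ) (a : Fin d → Fin d → Rd d → ℝ) (φ : Rd d → ℝ) (x : Rd d) : ℝ :=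
  ∑ γ : Fin n → Fin d, ∑ i, ∑ j, a i j x * pd i (classicalD γ φ) x * pd j (classicalD γ φ) x

lemma TopTerm.sq_le {a : S → Fin d → Fin d → Rd d → ℝ} (ha : ∀ s i j, Sm (a s i j)) {K : ℝ}
    (hK0 : 0 ≤ K) (hK : ∀ s k i j x, |IntegroDiff.pd k (IntegroDiff.pd k (a s i j)) x| ≤ K)
    (hnn : ∀ s x (y : Fin d → ℝ), 0 ≤ ∑ i, ∑ j, a s i j x * y i * y j) {n : ℕ}
    {T : S → (Rd d → ℝ) → Rd d → ℝ} (h : TopTerm a n T) :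
    ∃ C : ℝ, 0 ≤ C ∧ ∀ s φ, Sm φ → ∀ x, T s φ x ^ 2 ≤ C * gradForm n (a s) φ x := by
  have hQ : ∀ (n : ℕ) (s : S) (φ : Rd d → ℝ) x, 0 ≤ gradForm n (a s) φ x := fun n s φ x =>
    Finset.sum_nonneg fun γ _ => hnn s x fun i => IntegroDiff.pd i (classicalD γ φ) x
  induction h with
  | @gen m k β =>
    refine ⟨d * (4 * (K * d)), by positivity, fun s φ hφ x => ?_⟩
    refine (oleinik (ha s) (hK s) (hnn s) k x
      (W := fun i j => IntegroDiff.pd i (IntegroDiff.pd j (classicalD β φ)) x) fun i j => by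
        rw [pd_comm ((hφ.cD β).nat 2)]).trans (mul_le_mul_of_nonneg_left ?_ (by positivity))
    simp only [← classicalD_cons (hφ.nat (m + 1))]
    rw [← Finset.sum_image (s := Finset.univ) (f := fun γ : Fin (m + 1) → Fin d =>
      ∑ i, ∑ j, a s i j x * IntegroDiff.pd i (classicalD γ φ) x *
        IntegroDiff.pd j (classicalD γ φ) x)
      (g := fun r : Fin d => (Fin.cons r β : Fin (m + 1) → Fin d))
      (fun r _ t _ h => (Fin.cons_injective2 h).1)]
    exact Finset.sum_le_sum_of_subset_of_nonneg (Finset.subset_univ _) fun γ _ _ =>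
      hnn s x fun i => IntegroDiff.pd i (classicalD γ φ) x
  | zero n => exact ⟨0, le_rfl, fun s φ _ x => by simp⟩
  | @add n T T' _ _ h1 h2 =>
    obtain ⟨C, hC, h1⟩ := h1
    obtain ⟨D, hD, h2⟩ := h2
    refine ⟨2 * C + 2 * D, by positivity, fun s φ hφ x => ?_⟩
    have h3 := h1 s φ hφ x
    have h4 := h2 s φ hφ x
    nlinarith [sq_nonneg (T s φ x - T' s φ x)]

end oleinik

end IntegroDiff

end

noncomputable section

namespace IntegroDiff

/-! ### The differential operator with smooth coefficients -/

section smoothOp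
variable {d : ℕ}

/-- `a^{ij} D_{ij} φ + b^i D_i φ + c φ`. -/
def diffOp (a : Fin d → Fin d → Rd d → ℝ) (b : Fin d → Rd d → ℝ) (c : Rd d → ℝ)
    (φ : Rd d → ℝ) (x : Rd d) : ℝ := secondOrder a φ x + firstOrder b φ x + c x * φ x

/-- The sum of the absolute values of the derivatives up to order `n` of all coefficients. -/
def coefJet (n : ℕ) (a : Fin d → Fin d → Rd d → ℝ) (b : Fin d → Rd d → ℝ) (c : Rd d → ℝ)
    (x : Rd d) : ℝ :=
  (∑ i, ∑ j, jetAbs n (a i j) x) + (∑ i, jetAbs n (b i) x) + jetAbs n c x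

section general
variable {a : Fin d → Fin d → Rd d → ℝ} {b : Fin d → Rd d → ℝ} {c : Rd d → ℝ}

lemma isTestFunction_diffOp (ha : ∀ i j, Sm (a i j)) (hb : ∀ i, Sm (b i)) (hc : Sm c)
    {φ : Rd d → ℝ} (hφ : IsTestFunction φ) : IsTestFunction (diffOp a b c φ) := by
  refine ⟨((Sm.sum fun i _ => Sm.sum fun j _ => (ha i j).mul ((hφ.sm.pd j).pd i)).add
    (Sm.sum fun i _ => (hb i).mul (hφ.sm.pd i))).add (hc.mul hφ.sm), ?_⟩
  refine HasCompactSupport.intro hφ.2.isCompact fun x hx => ?_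
  have h0 : φ x = 0 := image_eq_zero_of_notMem_tsupport hx
  have h1 : ∀ {ψ : Rd d → ℝ} (i : Fin d), x ∉ tsupport ψ → x ∉ tsupport (pd i ψ) := fun i hx h =>
    hx ((closure_minimal (fun y hy => by
      by_contra hn
      refine hy ?_
      have := image_eq_zero_of_notMem_tsupport (f := fderiv ℝ _) fun h =>
        hn (tsupport_fderiv_subset ℝ h)
      simp [pd, this]) (isClosed_tsupport _)) h)
  have h2 : ∀ i, pd i φ x = 0 := fun i => image_eq_zero_of_notMem_tsupport (h1 i hx)
  have h3 : ∀ i j, pd i (pd j φ) x = 0 := fun i j =>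
    image_eq_zero_of_notMem_tsupport (h1 i (h1 j hx))
  simp [diffOp, secondOrder, firstOrder, h0, h2, h3]

lemma abs_classicalD_diffOp_le {n k : ℕ} (hk : k ≤ n) (ha : ∀ i j, Sm (a i j)) (hb : ∀ i, Sm (b i))
    (hc : Sm c) {φ : Rd d → ℝ} (hφ : Sm φ) (α : Fin k → Fin d) (x : Rd d) :
    |classicalD α (diffOp a b c φ) x| ≤ 2 ^ n * (coefJet n a b c x * jetAbs (n + 2) φ x) := by
  have key : ∀ f g : Rd d → ℝ, Sm f → Sm g → jetAbs k g x ≤ jetAbs (n + 2) φ x →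
      |classicalD α (fun x => f x * g x) x| ≤ 2 ^ n * (jetAbs n f x * jetAbs (n + 2) φ x) := by
    intro f g hf hg h
    refine (abs_classicalD_mul_le α (hf.nat k) (hg.nat k) x).trans ?_
    refine mul_le_mul (pow_le_pow_right₀ one_le_two hk) (mul_le_mul (jetAbs_mono hk _ _) h
      (jetAbs_nonneg _ _ _) (jetAbs_nonneg _ _ _))
      (mul_nonneg (jetAbs_nonneg _ _ _) (jetAbs_nonneg _ _ _)) (by positivity)
  have s1 : ∀ i j, ContDiff ℝ k fun x => a i j x * pd i (pd j φ) x := fun i j =>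
    ((ha i j).mul ((hφ.pd j).pd i)).nat k
  have s2 : ∀ i, ContDiff ℝ k fun x => b i x * pd i φ x := fun i => ((hb i).mul (hφ.pd i)).nat k
  have e : diffOp a b c φ = fun x => (fun x => (∑ i, ∑ j, a i j x * pd i (pd j φ) x) +
      ∑ i, b i x * pd i φ x) x + c x * φ x := rfl
  rw [e, classicalD_add ((ContDiff.sum fun i _ => ContDiff.sum fun j _ => s1 i j).add
    (ContDiff.sum fun i _ => s2 i)) ((hc.mul hφ).nat k),
    classicalD_add (ContDiff.sum fun i _ => ContDiff.sum fun j _ => s1 i j)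
      (ContDiff.sum fun i _ => s2 i),
    classicalD_sum fun i _ => ContDiff.sum fun j _ => s1 i j, classicalD_sum fun i _ => s2 i]
  simp only [fun i => classicalD_sum (s := Finset.univ) (fun j _ => s1 i j) α]
  rw [coefJet, add_mul, add_mul, mul_add, mul_add]
  refine (abs_add_le _ _).trans (add_le_add ((abs_add_le _ _).trans (add_le_add ?_ ?_)) ?_)
  · rw [Finset.sum_mul, Finset.mul_sum]
    refine (Finset.abs_sum_le_sum_abs _ _).trans (Finset.sum_le_sum fun i _ => ?_)
    rw [Finset.sum_mul, Finset.mul_sum]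
    refine (Finset.abs_sum_le_sum_abs _ _).trans (Finset.sum_le_sum fun j _ => ?_)
    exact key _ _ (ha i j) ((hφ.pd j).pd i) ((jetAbs_pd_le ((hφ.pd j).nat _) i x).trans
      ((jetAbs_pd_le (hφ.nat _) j x).trans (jetAbs_mono (by omega) _ _)))
  · rw [Finset.sum_mul, Finset.mul_sum]
    refine (Finset.abs_sum_le_sum_abs _ _).trans (Finset.sum_le_sum fun i _ => ?_)
    exact key _ _ (hb i) (hφ.pd i) ((jetAbs_pd_le (hφ.nat _) i x).trans (jetAbs_mono (by omega) _ _))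
  · exact key _ _ hc hφ (jetAbs_mono (by omega) _ _)

lemma integral_secondOrder {F : Rd d → ℝ} (ha : ∀ i j, Sm (a i j)) (hF : IsTestFunction F) :
    ∫ x, secondOrder a F x = ∑ i, ∑ j, ∫ x, pd j (pd i (a i j)) x * F x := by
  have i1 : ∀ i j, Integrable fun x => a i j x * pd i (pd j F) x := fun i j =>
    ((hF.pd j).pd i).integrable_mul ((ha i j).continuous.locallyIntegrable)
  simp only [secondOrder]
  rw [integral_finsetSum _ fun i _ => integrable_finsetSum _ fun j _ => i1 i j]
  refine Finset.sum_congr rfl fun i _ => ?_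
  rw [integral_finsetSum _ fun j _ => i1 i j]
  refine Finset.sum_congr rfl fun j _ => ?_
  rw [integral_mul_pd ((ha i j).nat 1) ((hF.pd j).sm.nat 1) (hF.pd j).2,
    integral_mul_pd (((ha i j).pd i).nat 1) (hF.sm.nat 1) hF.2, neg_neg]

lemma integral_firstOrder {F : Rd d → ℝ} (hb : ∀ i, Sm (b i)) (hF : IsTestFunction F) :
    ∫ x, firstOrder b F x = - ∑ i, ∫ x, pd i (b i) x * F x := by
  have i1 : ∀ i, Integrable fun x => b i x * pd i F x := fun i =>
    (hF.pd i).integrable_mul ((hb i).continuous.locallyIntegrable)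
  simp only [firstOrder]
  rw [integral_finsetSum _ fun i _ => i1 i, ← Finset.sum_neg_distrib]
  refine Finset.sum_congr rfl fun i _ => ?_
  rw [integral_mul_pd ((hb i).nat 1) (hF.sm.nat 1) hF.2]

lemma integral_mul_le_of_abs_le {g F : Rd d → ℝ} {K : ℝ} (hg : Continuous g) (hF : IsTestFunction F)
    (hF0 : ∀ x, 0 ≤ F x) (hK : ∀ x, |g x| ≤ K) : |∫ x, g x * F x| ≤ K * ∫ x, F x := by
  rw [← integral_const_mul]
  refine (abs_integral_le_integral_abs).trans (integral_mono
    (hF.integrable_mul hg.locallyIntegrable).abs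
    ((hF.1.continuous.integrable_of_hasCompactSupport hF.2).const_mul K) fun x => ?_)
  simp only [abs_mul, abs_of_nonneg (hF0 x)]
  exact mul_le_mul_of_nonneg_right (hK x) (hF0 x)

variable {ι : Type*} [Fintype ι]

/-- The second order operator applied to `|u|^{2q}`. -/
lemma sum_vpow_mul_secondOrder_le {q : ℕ} (hq : 1 ≤ q) {u : ι → Rd d → ℝ} (hu : ∀ α, Sm (u α))
    (hnn : ∀ x (y : Fin d → ℝ), 0 ≤ ∑ i, ∑ j, a i j x * y i * y j) (x : Rd d) :
    ∑ α, vpow q (fun β => u β x) α * secondOrder a (u α) x ≤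
      1 / (2 * q) * secondOrder a (fun x => (∑ α, u α x ^ 2) ^ q) x -
        (∑ α, u α x ^ 2) ^ (q - 1) *
          ∑ α, ∑ i, ∑ j, a i j x * pd i (u α) x * pd j (u α) x := by
  have hq0 : (0 : ℝ) < q := by exact_mod_cast hq
  set f : Rd d → ℝ := fun x => ∑ α, u α x ^ 2 with hf
  have hfs : Sm f := Sm.sum fun α _ => (hu α).pow 2
  have hf0 : 0 ≤ f x := Finset.sum_nonneg fun _ _ => sq_nonneg _
  have e1 : ∀ j, pd j f = fun x => 2 * ∑ α, u α x * pd j (u α) x := fun j => by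
    rw [hf, pd_sum fun α _ => ((hu α).pow 2).differentiable]
    ext x
    simp only [fun α => pd_pow (hu α).differentiable 2 j, Finset.mul_sum]
    refine Finset.sum_congr rfl fun α _ => ?_
    norm_num
    ring
  have e2 : ∀ i j, pd i (pd j f) x =
      2 * ∑ α, (pd i (u α) x * pd j (u α) x + u α x * pd i (pd j (u α)) x) := fun i j => by
    have h1 : ∀ α, Differentiable ℝ fun x => u α x * pd j (u α) x := fun α =>
      ((hu α).mul ((hu α).pd j)).differentiable
    rw [e1 j, pd_mul (differentiable_const 2) (Differentiable.fun_sum fun α _ => h1 α),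
      pd_sum fun α _ => h1 α]
    simp only [fun α => pd_mul (hu α).differentiable ((hu α).pd j).differentiable i]
    simp [pd]
  have e3 : ∀ i j, pd i (pd j (fun x => f x ^ q)) x =
      q * ((q - 1 : ℕ) * f x ^ (q - 1 - 1) * pd i f x) * pd j f x +
        q * f x ^ (q - 1) * pd i (pd j f) x := fun i j => by
    rw [pd_pow hfs.differentiable, pd_mul ((hfs.pow (q - 1)).differentiable.const_mul _)
      (hfs.pd j).differentiable, pd_mul (differentiable_const _) (hfs.pow (q - 1)).differentiable,
      pd_pow hfs.differentiable]
    simp [pd]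
  have e4 : secondOrder a (fun x => f x ^ q) x =
      q * (q - 1 : ℕ) * f x ^ (q - 1 - 1) * (∑ i, ∑ j, a i j x * pd i f x * pd j f x) +
      2 * q * f x ^ (q - 1) * (∑ α, ∑ i, ∑ j, a i j x * pd i (u α) x * pd j (u α) x) +
      2 * q * f x ^ (q - 1) * ∑ α, u α x * secondOrder a (u α) x := by
    have h1 : ∑ α, ∑ i, ∑ j, a i j x * pd i (u α) x * pd j (u α) x =
        ∑ i, ∑ j, ∑ α, a i j x * pd i (u α) x * pd j (u α) x := by
      rw [Finset.sum_comm]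
      exact Finset.sum_congr rfl fun i _ => Finset.sum_comm
    have h2 : ∑ α, u α x * secondOrder a (u α) x =
        ∑ i, ∑ j, ∑ α, a i j x * (u α x * pd i (pd j (u α)) x) := by
      simp only [secondOrder, Finset.mul_sum]
      rw [Finset.sum_comm]
      refine Finset.sum_congr rfl fun i _ => ?_
      rw [Finset.sum_comm]
      exact Finset.sum_congr rfl fun j _ => Finset.sum_congr rfl fun α _ => by ring
    rw [h1, h2]
    simp only [secondOrder, e3, e2, Finset.mul_sum, ← Finset.sum_add_distrib, mul_add]
    refine Finset.sum_congr rfl fun i _ => Finset.sum_congr rfl fun j _ => ?_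
    rw [Finset.sum_add_distrib, add_assoc]
    refine congrArg₂ _ (by ring) (congrArg₂ _ ?_ ?_) <;>
    exact Finset.sum_congr rfl fun α _ => by ring
  have h5 : 0 ≤ q * (q - 1 : ℕ) * f x ^ (q - 1 - 1) * (∑ i, ∑ j, a i j x * pd i f x * pd j f x) :=
    mul_nonneg (by positivity) (hnn x fun i => pd i f x)
  have h6 : ∑ α, vpow q (fun β => u β x) α * secondOrder a (u α) x =
      f x ^ (q - 1) * ∑ α, u α x * secondOrder a (u α) x := by
    simp only [vpow, mul_assoc, ← Finset.mul_sum, hf]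
  rw [h6, e4]
  set P := f x ^ (q - 1)
  set R := ∑ α, u α x * secondOrder a (u α) x
  set Q := ∑ α, ∑ i, ∑ j, a i j x * pd i (u α) x * pd j (u α) x
  have h7 : 1 / (2 * q) * (q * (q - 1 : ℕ) * f x ^ (q - 1 - 1) *
      (∑ i, ∑ j, a i j x * pd i f x * pd j f x) + 2 * q * P * Q + 2 * q * P * R) - P * Q =
      1 / (2 * q) * (q * (q - 1 : ℕ) * f x ^ (q - 1 - 1) *
      (∑ i, ∑ j, a i j x * pd i f x * pd j f x)) + P * R := by
    field_simp
    ring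
  rw [h7]
  exact le_add_of_nonneg_left (mul_nonneg (by positivity) h5)

lemma sum_vpow_mul_firstOrder {q : ℕ} (hq : 1 ≤ q) {u : ι → Rd d → ℝ} (hu : ∀ α, Sm (u α))
    (x : Rd d) : ∑ α, vpow q (fun β => u β x) α * firstOrder b (u α) x =
      1 / (2 * q) * firstOrder b (fun x => (∑ α, u α x ^ 2) ^ q) x := by
  have hq0 : (q : ℝ) ≠ 0 := by exact_mod_cast (by omega : q ≠ 0)
  simp only [firstOrder, fun i => pd_sum_sq_pow hu q i x, Finset.mul_sum]
  rw [Finset.sum_comm]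
  refine Finset.sum_congr rfl fun i _ => Finset.sum_congr rfl fun α _ => ?_
  field_simp

lemma sum_vpow_mul_le_of_sq_le {q : ℕ} (hq : 1 ≤ q) (u T : ι → ℝ) {C Q : ℝ} (hC : 0 ≤ C) (hQ : 0 ≤ Q)
    (h : ∀ α, T α ^ 2 ≤ C * Q) : ∑ α, vpow q u α * T α ≤ (∑ α, u α ^ 2) ^ (q - 1) * Q +
      Fintype.card ι * C * (∑ α, u α ^ 2) ^ q := by
  rcases isEmpty_or_nonempty ι with hι | hι
  · simp only [Finset.univ_eq_empty, Finset.sum_empty]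
    positivity
  have hm : (0 : ℝ) < Fintype.card ι := by exact_mod_cast Fintype.card_pos
  have hA : 0 ≤ ∑ α, u α ^ 2 := Finset.sum_nonneg fun _ _ => sq_nonneg _
  set A := ∑ α, u α ^ 2 with hAdef
  have hP0 : 0 ≤ A ^ (q - 1) := pow_nonneg hA _
  have hAq : A ^ (q - 1) * A = A ^ q := by rw [← pow_succ]; congr 1; omega
  set m : ℝ := (Fintype.card ι : ℝ) with hmdef
  have h1 : ∀ α, u α * T α ≤ m * C * u α ^ 2 + Q / m := fun α => by
    rcases hC.eq_or_lt with h0 | h0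
    · have := h α
      rw [← h0, zero_mul] at this
      have hT : T α = 0 := by nlinarith [sq_nonneg (T α)]
      rw [hT, ← h0]
      simp only [mul_zero, zero_mul, zero_add]
      positivity
    · have h2 : (m * C * u α - T α) ^ 2 ≥ 0 := sq_nonneg _
      have h3 : 0 < m * C := by positivity
      refine le_of_mul_le_mul_left ?_ h3
      have h4 : m * C * (m * C * u α ^ 2 + Q / m) = (m * C) ^ 2 * u α ^ 2 + C * Q := by
        field_simp
      rw [h4]
      nlinarith [h α, sq_nonneg (m * C * u α), sq_nonneg (T α)]
  have h2 : ∑ α, u α * T α ≤ Q + m * C * A := by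
    refine (Finset.sum_le_sum fun α _ => h1 α).trans (le_of_eq ?_)
    rw [Finset.sum_add_distrib, ← Finset.mul_sum, Finset.sum_const, Finset.card_univ, nsmul_eq_mul,
      ← hmdef, mul_div_cancel₀ _ hm.ne', add_comm]
  have h3 : ∑ α, vpow q u α * T α = A ^ (q - 1) * ∑ α, u α * T α := by
    simp only [vpow, mul_assoc, ← Finset.mul_sum, hAdef]
  rw [h3]
  refine (mul_le_mul_of_nonneg_left h2 hP0).trans (le_of_eq ?_)
  rw [← hAq]
  ring

end general

end smoothOp

end IntegroDiff

end

noncomputable section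

namespace IntegroDiff

/-! ### Estimates for the differential operator with smooth coefficients -/

section smoothEnergy
variable {d : ℕ}

lemma classicalD_two {f : Rd d → ℝ} (hf : ContDiff ℝ 2 f) (i j : Fin d) :
    classicalD ![i, j] f = pd i (pd j f) := by
  have := classicalD_cons (k := 1) (by exact_mod_cast hf) i ![j]
  rw [classicalD_one] at this
  exact this

/-- Smooth coefficients, with derivatives bounded by `K`, and a nonnegative principal part. -/
structure SmoothCoef (n : ℕ) (K : ℝ) (a : Fin d → Fin d → Rd d → ℝ) (b : Fin d → Rd d → ℝ)
    (c : Rd d → ℝ) : Prop where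
  smooth_a : ∀ i j, Sm (a i j)
  smooth_b : ∀ i, Sm (b i)
  smooth_c : Sm c
  bound_a : ∀ i j, ∀ k ≤ max n 2, ∀ (α : Fin k → Fin d) x, |classicalD α (a i j) x| ≤ K
  bound_b : ∀ i, ∀ k ≤ max n 1, ∀ (α : Fin k → Fin d) x, |classicalD α (b i) x| ≤ K
  bound_c : ∀ k ≤ n, ∀ (α : Fin k → Fin d) x, |classicalD α c x| ≤ K
  nonneg : ∀ x (y : Fin d → ℝ), 0 ≤ ∑ i, ∑ j, a i j x * y i * y j

/-- The coefficients in `SmoothCoef` as an index type. -/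
def CoefIndex (d n : ℕ) (K : ℝ) : Type :=
  {s : (Fin d → Fin d → Rd d → ℝ) × (Fin d → Rd d → ℝ) × (Rd d → ℝ) // SmoothCoef n K s.1 s.2.1 s.2.2}

/-- The number of multi-numbers of length at most `r`. -/
def numIndices (d r : ℕ) : ℝ := ∑ k ∈ Finset.range (r + 1), ∑ _β : Fin k → Fin d, (1 : ℝ)

lemma numIndices_nonneg (d r : ℕ) : 0 ≤ numIndices d r :=
  Finset.sum_nonneg fun _ _ => Finset.sum_nonneg fun _ _ => zero_le_one

lemma jetAbs_le_of_bound {r : ℕ} {K : ℝ} {f : Rd d → ℝ} {x : Rd d}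
    (h : ∀ k ≤ r, ∀ α : Fin k → Fin d, |classicalD α f x| ≤ K) : jetAbs r f x ≤ numIndices d r * K := by
  rw [jetAbs, numIndices, Finset.sum_mul]
  refine Finset.sum_le_sum fun k hk => ?_
  rw [Finset.sum_mul]
  refine Finset.sum_le_sum fun α _ => ?_
  rw [one_mul]
  exact h k (by have := Finset.mem_range.1 hk; omega) α

lemma symbolBound_of_bound {S : Type*} {r : ℕ} {K : ℝ} (hK : 0 ≤ K) {f : S → Rd d → ℝ}
    (hf : ∀ s, ContDiff ℝ r (f s)) (h : ∀ s, ∀ k ≤ r, ∀ (α : Fin k → Fin d) x,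
      |classicalD α (f s) x| ≤ K) : SymbolBound (fun _ => 1) r f :=
  ⟨hf, numIndices d r * K, mul_nonneg (numIndices_nonneg d r) hK, fun s x => by
    rw [mul_one]
    exact jetAbs_le_of_bound fun k hk α => h s k hk α x⟩

lemma exists_diffOp_commutator (d n : ℕ) {K : ℝ} (hK : 0 ≤ K) (α : Fin n → Fin d) :
    ∃ C : ℝ, 0 ≤ C ∧ ∀ a b c, SmoothCoef (d := d) n K a b c → ∀ φ, Sm φ → ∃ T : Rd d → ℝ, ∀ x,
      T x ^ 2 ≤ C * gradForm n a φ x ∧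
      |classicalD α (diffOp a b c φ) x - (secondOrder a (classicalD α φ) x +
        firstOrder b (classicalD α φ) x + T x)| ≤ C * jetAbs n φ x := by
  have hsa : ∀ (s : CoefIndex d n K) i j, Sm (s.1.1 i j) := fun s => s.2.smooth_a
  have hA : ∀ i j, SymbolBound (fun _ => 1) (max n 2) (fun s : CoefIndex d n K => s.1.1 i j) :=
    fun i j => symbolBound_of_bound hK (fun s => (s.2.smooth_a i j).nat _) fun s => s.2.bound_a i j
  have hB : ∀ i, SymbolBound (fun _ => 1) (max n 1) (fun s : CoefIndex d n K => s.1.2.1 i) :=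
    fun i => symbolBound_of_bound hK (fun s => (s.2.smooth_b i).nat _) fun s => s.2.bound_b i
  have hC : SymbolBound (fun _ => 1) n (fun s : CoefIndex d n K => s.1.2.2) :=
    symbolBound_of_bound hK (fun s => s.2.smooth_c.nat _) fun s => s.2.bound_c
  obtain ⟨T₁, T₂, h1, h2, e⟩ := exists_secondOrder_commutator hsa hA n (by omega) α
  have h3 := lowTerm_firstOrder hB n (by omega) α
  have h4 := lowTerm_zeroOrder hC n le_rfl α
  obtain ⟨C₁, hC₁, b1⟩ := h1.sq_le hsa hK (fun s k i j x => by
    have := s.2.bound_a i j 2 (by omega) ![k, k] x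
    rwa [classicalD_two ((hsa s i j).nat 2)] at this) (fun s => s.2.nonneg)
  obtain ⟨C₂, hC₂, b2⟩ := h2.bound
  obtain ⟨C₃, hC₃, b3⟩ := h3.bound
  obtain ⟨C₄, hC₄, b4⟩ := h4.bound
  refine ⟨C₁ + (C₂ + C₃ + C₄), by positivity, fun a b c h φ hφ => ?_⟩
  set s : CoefIndex d n K := ⟨(a, b, c), h⟩ with hs
  refine ⟨T₁ s φ, fun x => ⟨?_, ?_⟩⟩
  · refine (b1 s φ hφ x).trans (mul_le_mul_of_nonneg_right (by linarith) ?_)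
    exact Finset.sum_nonneg fun γ _ => h.nonneg x fun i => pd i (classicalD γ φ) x
  · have e1 : diffOp a b c φ =
        fun x => (fun x => secondOrder a φ x + firstOrder b φ x) x + (fun x => c x * φ x) x := rfl
    have cA : ContDiff ℝ n (secondOrder a φ) := contDiff_secondOrder (fun i j => (h.smooth_a i j).nat n) hφ
    have cB : ContDiff ℝ n (firstOrder b φ) := contDiff_firstOrder (fun i => (h.smooth_b i).nat n) hφ
    rw [e1, classicalD_add (cA.add cB) ((h.smooth_c.mul hφ).nat n), classicalD_add cA cB,
      show classicalD α (secondOrder a φ) = _ from e s φ hφ]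
    have e2 : secondOrder s.1.1 (classicalD α φ) x + T₁ s φ x + T₂ s φ x +
        classicalD α (firstOrder b φ) x + classicalD α (fun x => c x * φ x) x -
        (secondOrder a (classicalD α φ) x + firstOrder b (classicalD α φ) x + T₁ s φ x) =
        T₂ s φ x + (classicalD α (firstOrder b φ) x - firstOrder b (classicalD α φ) x) +
          classicalD α (fun x => c x * φ x) x := by
      simp only [hs]
      ring
    rw [e2, add_mul, add_mul, add_mul]
    have := mul_nonneg hC₁ (jetAbs_nonneg n φ x)
    have t1 := b2 s φ hφ x
    have t2 := b3 s φ hφ x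
    have t3 := b4 s φ hφ x
    refine (abs_add_three _ _ _).trans ?_
    linarith

lemma exists_diffOp_smooth (d n : ℕ) {q : ℕ} (hq : 1 ≤ q) {K : ℝ} (hK : 0 ≤ K) : ∃ C : ℝ, 0 ≤ C ∧
    ∀ a b c, SmoothCoef (d := d) n K a b c → ∀ φ, IsTestFunction φ →
      (∀ k ≤ n, ∀ α : Fin k → Fin d,
        eLpNorm (classicalD α (diffOp a b c φ)) ((2 * q : ℕ) : ℝ≥0∞) volume ≤
          ENNReal.ofReal C * sobN (n + 2) (2 * q) φ) ∧
      ∑ α : Fin n → Fin d, ∫ x, vpow q (fun β : Fin n → Fin d => classicalD β φ x) α *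
        classicalD α (diffOp a b c φ) x ≤ C * normW n (2 * q) φ ^ (2 * q) := by
  have hp : 1 ≤ 2 * q := by omega
  choose C₀ hC₀ hcom using exists_diffOp_commutator d n hK
  set C₁ := ∑ α, C₀ α with hC₁
  have hC₁0 : 0 ≤ C₁ := Finset.sum_nonneg fun α _ => hC₀ α
  have hle : ∀ α, C₀ α ≤ C₁ := fun α => Finset.single_le_sum (fun α _ => hC₀ α) (Finset.mem_univ α)
  set D : ℝ := 2 ^ n * ((d * d + d + 1) * (numIndices d n * K)) with hD
  have hD0 : 0 ≤ D := by have := numIndices_nonneg d n; positivity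
  set m : ℝ := (Fintype.card (Fin n → Fin d) : ℝ) with hm
  set E : ℝ := (1 / (2 * q) * (d * (d * K) + d * K) + m * C₁) * m + m * C₁ with hE
  have hE0 : 0 ≤ E := by positivity
  refine ⟨D + E, by positivity, fun a b c h φ hφ => ⟨fun k hk α => ?_, ?_⟩⟩
  · have hpt : ∀ x, |classicalD α (diffOp a b c φ) x| ≤ D * jetAbs (n + 2) φ x := fun x => by
      refine (abs_classicalD_diffOp_le hk h.smooth_a h.smooth_b h.smooth_c hφ.sm α x).trans ?_
      rw [hD, mul_assoc (2 ^ n)]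
      refine mul_le_mul_of_nonneg_left (mul_le_mul_of_nonneg_right ?_ (jetAbs_nonneg _ _ _))
        (by positivity)
      rw [coefJet, add_mul, add_mul, one_mul]
      refine add_le_add (add_le_add ?_ ?_) ?_
      · refine (Finset.sum_le_sum fun i _ => Finset.sum_le_sum fun j _ =>
          jetAbs_le_of_bound fun k hk α => h.bound_a i j k (by omega) α x).trans (le_of_eq ?_)
        simp only [Finset.sum_const, Finset.card_univ, Fintype.card_fin, nsmul_eq_mul]
        ring
      · refine (Finset.sum_le_sum fun i _ =>
          jetAbs_le_of_bound fun k hk α => h.bound_b i k (by omega) α x).trans (le_of_eq ?_)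
        simp only [Finset.sum_const, Finset.card_univ, Fintype.card_fin, nsmul_eq_mul]
      · exact jetAbs_le_of_bound fun k hk α => h.bound_c k hk α x
    refine (eLpNorm_mono_real hpt).trans ?_
    refine (eLpNorm_mul_le_of_abs_le (fun _ => (abs_of_nonneg hD0).le)).trans ?_
    exact mul_le_mul' (ENNReal.ofReal_le_ofReal (by linarith)) (eLpNorm_jetAbs_le hp hφ)
  · set A := normW n (2 * q) φ with hA
    have hA0 : 0 ≤ A := normW_nonneg φ
    have hAS : ENNReal.ofReal A = sobN n (2 * q) φ := (hφ.memW n (2 * q)).ofReal_normW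
    have h1 : ∑ β : Fin n → Fin d, eLpNorm (classicalD β φ) ((2 * q : ℕ) : ℝ≥0∞) volume ≤
        ENNReal.ofReal A := by
      rw [hAS]; exact sum_eLpNorm_classicalD_le hφ.sm
    have huL : ∀ α : Fin n → Fin d, MemLp (classicalD α φ) ((2 * q : ℕ) : ℝ≥0∞) :=
      fun α => (hφ.cD α).memLp _
    have hWm : MemLp (fun x => C₁ * jetAbs n φ x) ((2 * q : ℕ) : ℝ≥0∞) :=
      (memLp_jetAbs fun _ _ β => (hφ.cD β).memLp _).const_mul C₁
    have hWn : eLpNorm (fun x => C₁ * jetAbs n φ x) ((2 * q : ℕ) : ℝ≥0∞) volume ≤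
        ENNReal.ofReal (C₁ * A) := by
      rw [ENNReal.ofReal_mul hC₁0, hAS]
      exact (eLpNorm_mul_le_of_abs_le (fun _ => (abs_of_nonneg hC₁0).le)).trans
        (mul_le_mul' le_rfl (eLpNorm_jetAbs_le hp hφ))
    have hF := isTestFunction_sum_sq_pow (fun α : Fin n → Fin d => hφ.cD α) hq
    set F : Rd d → ℝ := fun x => (∑ α : Fin n → Fin d, classicalD α φ x ^ 2) ^ q with hFdef
    have hF0 : ∀ x, 0 ≤ F x := fun x => by positivity
    have h6 : ∫ x, F x ≤ m * A ^ (2 * q) := integral_sum_sq_pow_le hq huL hA0 h1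
    have iF : Integrable F := hF.1.continuous.integrable_of_hasCompactSupport hF.2
    have hG := isTestFunction_diffOp h.smooth_a h.smooth_b h.smooth_c hφ
    choose T hT using fun α => hcom α a b c h φ hφ.sm
    have hgf : ∀ x, 0 ≤ gradForm n a φ x := fun x =>
      Finset.sum_nonneg fun γ _ => h.nonneg x fun i => pd i (classicalD γ φ) x
    have hpt : ∀ x, ∑ α : Fin n → Fin d, vpow q (fun β : Fin n → Fin d => classicalD β φ x) α *
        classicalD α (diffOp a b c φ) x ≤
        1 / (2 * q) * (secondOrder a F x + firstOrder b F x) + m * C₁ * F x +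
          ∑ α : Fin n → Fin d, |vpow q (fun β : Fin n → Fin d => classicalD β φ x) α *
            (C₁ * jetAbs n φ x)| := by
      intro x
      have s1 := sum_vpow_mul_secondOrder_le hq (fun α : Fin n → Fin d => (hφ.cD α).sm) h.nonneg x
      have s2 := sum_vpow_mul_firstOrder (b := b) hq (fun α : Fin n → Fin d => (hφ.cD α).sm) x
      have s3 := sum_vpow_mul_le_of_sq_le hq (fun α : Fin n → Fin d => classicalD α φ x)
        (fun α => T α x) hC₁0 (hgf x) fun α => (hT α x).1.trans
          (mul_le_mul_of_nonneg_right (hle α) (hgf x))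
      have s4 : ∑ α : Fin n → Fin d, vpow q (fun β : Fin n → Fin d => classicalD β φ x) α *
          (classicalD α (diffOp a b c φ) x - (secondOrder a (classicalD α φ) x +
            firstOrder b (classicalD α φ) x + T α x)) ≤
          ∑ α : Fin n → Fin d, |vpow q (fun β : Fin n → Fin d => classicalD β φ x) α *
            (C₁ * jetAbs n φ x)| := by
        refine Finset.sum_le_sum fun α _ => (le_abs_self _).trans ?_
        rw [abs_mul, abs_mul]
        refine mul_le_mul_of_nonneg_left ((hT α x).2.trans ((mul_le_mul_of_nonneg_right (hle α)
          (jetAbs_nonneg _ _ _)).trans (le_abs_self _))) (abs_nonneg _)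
      have s5 : ∑ α : Fin n → Fin d, vpow q (fun β : Fin n → Fin d => classicalD β φ x) α *
          classicalD α (diffOp a b c φ) x =
          ∑ α : Fin n → Fin d, vpow q (fun β : Fin n → Fin d => classicalD β φ x) α *
            secondOrder a (classicalD α φ) x +
          ∑ α : Fin n → Fin d, vpow q (fun β : Fin n → Fin d => classicalD β φ x) α *
            firstOrder b (classicalD α φ) x +
          ∑ α : Fin n → Fin d, vpow q (fun β : Fin n → Fin d => classicalD β φ x) α * T α x +
          ∑ α : Fin n → Fin d, vpow q (fun β : Fin n → Fin d => classicalD β φ x) α *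
          (classicalD α (diffOp a b c φ) x - (secondOrder a (classicalD α φ) x +
            firstOrder b (classicalD α φ) x + T α x)) := by
        simp only [← Finset.sum_add_distrib]
        exact Finset.sum_congr rfl fun α _ => by ring
      rw [s5, s2]
      have s6 : (∑ α : Fin n → Fin d, classicalD α φ x ^ 2) ^ (q - 1) * gradForm n a φ x =
          (∑ α : Fin n → Fin d, classicalD α φ x ^ 2) ^ (q - 1) * ∑ α : Fin n → Fin d, ∑ i, ∑ j,
            a i j x * pd i (classicalD α φ) x * pd j (classicalD α φ) x := rfl
      rw [s6] at s3
      rw [mul_add]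
      linarith
    have iv : ∀ α : Fin n → Fin d, Integrable fun x =>
        vpow q (fun β : Fin n → Fin d => classicalD β φ x) α * classicalD α (diffOp a b c φ) x :=
      fun α => vpow_mul_integrable hq huL ((hG.cD α).memLp _) α
    have iW : ∀ α : Fin n → Fin d, Integrable fun x =>
        |vpow q (fun β : Fin n → Fin d => classicalD β φ x) α * (C₁ * jetAbs n φ x)| := fun α =>
      (vpow_mul_integrable hq huL hWm α).abs
    have iA : Integrable fun x => secondOrder a F x :=
      integrable_finsetSum _ fun i _ => integrable_finsetSum _ fun j _ =>
        ((hF.pd j).pd i).integrable_mul (h.smooth_a i j).continuous.locallyIntegrable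
    have iB : Integrable fun x => firstOrder b F x :=
      integrable_finsetSum _ fun i _ =>
        (hF.pd i).integrable_mul (h.smooth_b i).continuous.locallyIntegrable
    have iAB : Integrable fun x => 1 / (2 * (q : ℝ)) * (secondOrder a F x + firstOrder b F x) :=
      (iA.add iB).const_mul _
    have iABF : Integrable fun x => 1 / (2 * (q : ℝ)) * (secondOrder a F x + firstOrder b F x) +
      m * C₁ * F x := iAB.add (iF.const_mul _)
    have hIF : 0 ≤ ∫ x, F x := integral_nonneg hF0
    have tA : ∫ x, secondOrder a F x ≤ d * (d * K) * ∫ x, F x := by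
      rw [integral_secondOrder h.smooth_a hF]
      refine (Finset.sum_le_sum fun i _ => Finset.sum_le_sum fun j _ => (le_abs_self _).trans
        (integral_mul_le_of_abs_le (K := K) (((h.smooth_a i j).pd i).pd j).continuous hF hF0
          fun x => ?_)).trans (le_of_eq ?_)
      · have := h.bound_a i j 2 (by omega) ![j, i] x
        rwa [classicalD_two ((h.smooth_a i j).nat 2)] at this
      · simp only [Finset.sum_const, Finset.card_univ, Fintype.card_fin, nsmul_eq_mul]
        ring
    have tB : ∫ x, firstOrder b F x ≤ d * K * ∫ x, F x := by
      rw [integral_firstOrder h.smooth_b hF, ← Finset.sum_neg_distrib]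
      refine (Finset.sum_le_sum fun i _ => (neg_le_abs _).trans
        (integral_mul_le_of_abs_le (K := K) ((h.smooth_b i).pd i).continuous hF hF0
          fun x => ?_)).trans (le_of_eq ?_)
      · have := h.bound_b i 1 (by omega) ![i] x
        rwa [classicalD_one] at this
      · simp only [Finset.sum_const, Finset.card_univ, Fintype.card_fin, nsmul_eq_mul]
        ring
    have iS : Integrable fun x => ∑ α : Fin n → Fin d,
        |vpow q (fun β : Fin n → Fin d => classicalD β φ x) α * (C₁ * jetAbs n φ x)| :=
      integrable_finsetSum _ fun α _ => iW α
    have iTot : Integrable fun x => 1 / (2 * (q : ℝ)) * (secondOrder a F x + firstOrder b F x) +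
        m * C₁ * F x + ∑ α : Fin n → Fin d,
          |vpow q (fun β : Fin n → Fin d => classicalD β φ x) α * (C₁ * jetAbs n φ x)| :=
      iABF.add iS
    rw [← integral_finsetSum _ fun α _ => iv α]
    refine (integral_mono (integrable_finsetSum _ fun α _ => iv α) iTot hpt).trans ?_
    rw [integral_add iABF iS,
      integral_add iAB (iF.const_mul _), integral_const_mul, integral_const_mul,
      integral_add iA iB, integral_finsetSum _ fun α _ => iW α]
    have tW : ∑ α : Fin n → Fin d, ∫ x, |vpow q (fun β : Fin n → Fin d => classicalD β φ x) α *
        (C₁ * jetAbs n φ x)| ≤ m * (A ^ (2 * q - 1) * (C₁ * A)) := by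
      refine (Finset.sum_le_sum fun α _ =>
        integral_abs_vpow_mul_le hq huL hWm α hA0 (mul_nonneg hC₁0 hA0) h1 hWn).trans ?_
      simp [hm]
    have h7 : A ^ (2 * q) = A ^ (2 * q - 1) * A := by rw [← pow_succ]; congr 1; omega
    have t1 : 1 / (2 * (q : ℝ)) * ((∫ x, secondOrder a F x) + ∫ x, firstOrder b F x) ≤
        1 / (2 * q) * ((d * (d * K) + d * K) * ∫ x, F x) :=
      mul_le_mul_of_nonneg_left (by rw [add_mul]; exact add_le_add tA tB) (by positivity)
    have t2 : (1 / (2 * q) * (d * (d * K) + d * K) + m * C₁) * ∫ x, F x ≤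
        (1 / (2 * q) * (d * (d * K) + d * K) + m * C₁) * (m * A ^ (2 * q)) :=
      mul_le_mul_of_nonneg_left h6 (by positivity)
    have t3 : 0 ≤ D * A ^ (2 * q) := by positivity
    have t4 : (D + E) * A ^ (2 * q) = D * A ^ (2 * q) +
        ((1 / (2 * q) * (d * (d * K) + d * K) + m * C₁) * (m * A ^ (2 * q)) +
          m * (A ^ (2 * q - 1) * (C₁ * A))) := by
      rw [hE, h7]; ring
    rw [t4]
    linarith

end smoothEnergy

end IntegroDiff

end

noncomputable section

namespace IntegroDiff

/-! ### The differential operator with coefficients having bounded generalised derivatives -/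

section roughCoef
open Filter Topology
variable {d : ℕ}

/-- `f` and its generalised derivatives up to order `l` are bounded by `K`. -/
structure CoefHyp (l : ℕ) (K : ℝ) (f : Rd d → ℝ) : Prop where
  aesm : AEStronglyMeasurable f
  bound : ∀ x, |f x| ≤ K
  deriv : ∀ k ≤ l, ∀ α : Fin k → Fin d, ∃ g, IsWeakDeriv α f g ∧ ∀ x, |g x| ≤ K

namespace CoefHyp
variable {l : ℕ} {K : ℝ} {f : Rd d → ℝ}

lemma mono (h : CoefHyp l K f) {l' : ℕ} (hl : l' ≤ l) : CoefHyp l' K f :=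
  ⟨h.aesm, h.bound, fun k hk => h.deriv k (hk.trans hl)⟩

lemma locInt (h : CoefHyp l K f) : LocallyIntegrable f :=
  (h.deriv 0 (Nat.zero_le l) Fin.elim0).choose_spec.1.1

lemma abs_classicalD_mol_le (h : CoefHyp l K f) (j : ℕ) {k : ℕ} (hk : k ≤ l) (α : Fin k → Fin d)
    (x : Rd d) : |classicalD α (mol j f) x| ≤ K := by
  obtain ⟨g, hg, hb⟩ := h.deriv k hk α
  rw [classicalD_mol hg]
  exact abs_mol_le j hb x

lemma exists_rate (h : CoefHyp l K f) : ∃ w : ℕ → Rd d → ℝ, (∀ j, AEStronglyMeasurable (w j)) ∧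
    (∀ j x, 0 ≤ w j x) ∧ (∀ j x, w j x ≤ numIndices d l * (2 * K)) ∧
    (∀ᵐ x, Tendsto (fun j => w j x) atTop (𝓝 0)) ∧
    ∀ j i x, jetAbs l (fun x => mol j f x - mol i f x) x ≤ w j x + w i x := by
  have hd : ∀ k (α : Fin k → Fin d), ∃ g, k ≤ l → IsWeakDeriv α f g ∧ ∀ x, |g x| ≤ K := fun k α => by
    by_cases hk : k ≤ l
    · obtain ⟨g, hg⟩ := h.deriv k hk α
      exact ⟨g, fun _ => hg⟩
    · exact ⟨0, fun h => absurd h hk⟩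
  choose g hg using hd
  have hr : ∀ k ∈ Finset.range (l + 1), k ≤ l := fun k hk => by
    have := Finset.mem_range.1 hk; omega
  refine ⟨fun j x => ∑ k ∈ Finset.range (l + 1), ∑ α : Fin k → Fin d, |mol j (g k α) x - g k α x|,
    fun j => ?_, fun j x => ?_, fun j x => ?_, ?_, fun j i x => ?_⟩
  · refine Finset.aestronglyMeasurable_fun_sum _ fun k hk =>
      Finset.aestronglyMeasurable_fun_sum _ fun α _ => ?_
    have hw := (hg k α (hr k hk)).1.2.1
    exact ((sm_mol j hw).continuous.aestronglyMeasurable.sub hw.aestronglyMeasurable).norm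
  · exact Finset.sum_nonneg fun _ _ => Finset.sum_nonneg fun _ _ => abs_nonneg _
  · rw [numIndices, Finset.sum_mul]
    refine Finset.sum_le_sum fun k hk => ?_
    rw [Finset.sum_mul]
    refine Finset.sum_le_sum fun α _ => ?_
    have hb := (hg k α (hr k hk)).2
    rw [one_mul, two_mul]
    exact (abs_sub _ _).trans (add_le_add (abs_mol_le j hb x) (hb x))
  · have h1 : ∀ k (α : Fin k → Fin d), ∀ᵐ x, k ≤ l →
        Tendsto (fun j => mol j (g k α) x) atTop (𝓝 (g k α x)) := fun k α => by
      by_cases hk : k ≤ l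
      · filter_upwards [tendsto_mol_ae (hg k α hk).1.2.1] with x hx
        exact fun _ => hx
      · exact Eventually.of_forall fun x h => absurd h hk
    filter_upwards [ae_all_iff.2 fun k => ae_all_iff.2 fun α => h1 k α] with x hx
    have h2 : Tendsto (fun j => ∑ k ∈ Finset.range (l + 1), ∑ α : Fin k → Fin d,
        |mol j (g k α) x - g k α x|) atTop
        (𝓝 (∑ k ∈ Finset.range (l + 1), ∑ _α : Fin k → Fin d, 0)) := by
      refine tendsto_finsetSum _ fun k hk => tendsto_finsetSum _ fun α _ => ?_
      have := ((hx k α (hr k hk)).sub_const (g k α x)).abs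
      simpa using this
    simpa using h2
  · rw [jetAbs, ← Finset.sum_add_distrib]
    refine Finset.sum_le_sum fun k hk => ?_
    rw [← Finset.sum_add_distrib]
    refine Finset.sum_le_sum fun α _ => ?_
    rw [classicalD_sub ((sm_mol j h.locInt).nat k) ((sm_mol i h.locInt).nat k),
      classicalD_mol (hg k α (hr k hk)).1, classicalD_mol (hg k α (hr k hk)).1]
    rw [abs_sub_comm (mol i _ _)]
    exact abs_sub_le _ _ _

end CoefHyp

lemma abs_coef_sum_le {K J : ℝ} {A D₂ : Fin d → Fin d → ℝ} {B D₁ : Fin d → ℝ} {c D₀ : ℝ}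
    (hA : ∀ i j, |A i j| ≤ K) (hB : ∀ i, |B i| ≤ K) (hc : |c| ≤ K) (h2 : ∀ i j, |D₂ i j| ≤ J)
    (h1 : ∀ i, |D₁ i| ≤ J) (h0 : |D₀| ≤ J) :
    |(∑ i, ∑ j, A i j * D₂ i j) + (∑ i, B i * D₁ i) + c * D₀| ≤ (d * d + d + 1) * K * J := by
  have key : ∀ {s t : ℝ}, |s| ≤ K → |t| ≤ J → |s * t| ≤ K * J := fun hs ht => by
    rw [abs_mul]
    exact mul_le_mul hs ht (abs_nonneg _) ((abs_nonneg _).trans hs)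
  have e : (d * d + d + 1) * K * J = (∑ _i : Fin d, ∑ _j : Fin d, K * J) + (∑ _i : Fin d, K * J) +
      K * J := by
    simp only [Finset.sum_const, Finset.card_univ, Fintype.card_fin, nsmul_eq_mul]
    ring
  rw [e]
  refine (abs_add_three _ _ _).trans (add_le_add (add_le_add ?_ ?_) (key hc h0))
  · exact (Finset.abs_sum_le_sum_abs _ _).trans (Finset.sum_le_sum fun i _ =>
      (Finset.abs_sum_le_sum_abs _ _).trans (Finset.sum_le_sum fun j _ => key (hA i j) (h2 i j)))
  · exact (Finset.abs_sum_le_sum_abs _ _).trans (Finset.sum_le_sum fun i _ => key (hB i) (h1 i))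

section op
variable {a : Fin d → Fin d → Rd d → ℝ} {b : Fin d → Rd d → ℝ} {c : Rd d → ℝ}

lemma abs_diffOp_le {K : ℝ} {φ : Rd d → ℝ} (hφ : Sm φ) {x : Rd d} (hA : ∀ i j, |a i j x| ≤ K)
    (hB : ∀ i, |b i x| ≤ K) (hc : |c x| ≤ K) :
    |diffOp a b c φ x| ≤ (d * d + d + 1) * K * jetAbs 2 φ x := by
  refine abs_coef_sum_le hA hB hc (fun i j => ?_) (fun i => ?_) ?_
  · rw [← classicalD_two (hφ.nat 2)]
    exact abs_classicalD_le_jetAbs le_rfl _ _ _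
  · rw [← classicalD_one]
    exact abs_classicalD_le_jetAbs (by norm_num) _ _ _
  · have := abs_classicalD_le_jetAbs (k := 2) (Nat.zero_le 2) Fin.elim0 φ x
    rwa [classicalD_zero] at this

lemma opL_ae_eq_diffOp {v φ : Rd d → ℝ} (hφ : Sm φ) (hv : v =ᵐ[volume] φ) :
    opL a b c v =ᵐ[volume] diffOp a b c φ := by
  filter_upwards [hv, ae_all_iff.2 fun i => weakD_classical (hφ.nat 1) ![i] hv,
    ae_all_iff.2 fun i => ae_all_iff.2 fun j => weakD_classical (hφ.nat 2) ![i, j] hv] with x h0 h1 h2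
  simp only [opL, h0, h1, h2, diffOp, secondOrder, firstOrder, classicalD_one,
    classicalD_two (hφ.nat 2)]

lemma memLp_opL {p : ℕ} (hp : 1 ≤ p) {K : ℝ} (hK : 0 ≤ K) (ha : ∀ i j, CoefHyp 0 K (a i j))
    (hb : ∀ i, CoefHyp 0 K (b i)) (hc : CoefHyp 0 K c) {v : Rd d → ℝ} (hv : MemW 2 p v) :
    MemLp (opL a b c v) (p : ℝ≥0∞) ∧ eLpNorm (opL a b c v) (p : ℝ≥0∞) volume ≤
      ENNReal.ofReal ((d * d + d + 1) * K) * sobN 2 p v := by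
  have hp' : (1 : ℝ≥0∞) ≤ p := by exact_mod_cast hp
  set J : Rd d → ℝ := fun x => ∑ k ∈ Finset.range (2 + 1), ∑ α : Fin k → Fin d, |weakD α v x|
    with hJ
  have hr : ∀ k ∈ Finset.range (2 + 1), k ≤ 2 := fun k hk => by
    have := Finset.mem_range.1 hk; omega
  have hJn : eLpNorm J (p : ℝ≥0∞) volume ≤ sobN 2 p v := by
    have e : J = ∑ k ∈ Finset.range (2 + 1), fun x => ∑ α : Fin k → Fin d, |weakD α v x| := by
      ext x; simp [hJ]
    rw [e]
    refine (eLpNorm_sum_le (fun k hk => aesm_sum_abs fun α =>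
      (hv.memLp_weakD (hr k hk) α).1) hp').trans (Finset.sum_le_sum fun k hk => ?_)
    exact eLpNorm_sum_abs_le hp' fun α => (hv.memLp_weakD (hr k hk) α).1
  have hle : ∀ k ≤ 2, ∀ (α : Fin k → Fin d) x, |weakD α v x| ≤ J x := fun k hk α x =>
    (Finset.single_le_sum (f := fun α : Fin k → Fin d => |weakD α v x|) (fun _ _ => abs_nonneg _)
      (Finset.mem_univ α)).trans
      (Finset.single_le_sum (f := fun k => ∑ α : Fin k → Fin d, |weakD α v x|)
        (fun _ _ => Finset.sum_nonneg fun _ _ => abs_nonneg _)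
        (Finset.mem_range.2 (Nat.lt_succ_of_le hk)))
  have hbd : ∀ᵐ x, ‖opL a b c v x‖ ≤ (d * d + d + 1) * K * J x := by
    filter_upwards [weakD_zero_ae hp hv.1 Fin.elim0] with x hx
    refine abs_coef_sum_le (fun i j => (ha i j).bound x) (fun i => (hb i).bound x) (hc.bound x)
      (fun i j => hle 2 le_rfl _ x) (fun i => hle 1 (by norm_num) _ x) ?_
    rw [← hx]
    exact hle 0 (by norm_num) _ x
  have hm : AEStronglyMeasurable (opL a b c v) volume := by
    refine ((Finset.aestronglyMeasurable_fun_sum _ fun i _ =>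
      Finset.aestronglyMeasurable_fun_sum _ fun j _ => (ha i j).aesm.mul
        (hv.memLp_weakD le_rfl _).1).add (Finset.aestronglyMeasurable_fun_sum _ fun i _ =>
        (hb i).aesm.mul (hv.memLp_weakD (by norm_num) _).1)).add (hc.aesm.mul hv.1.1)
  have hn : eLpNorm (opL a b c v) (p : ℝ≥0∞) volume ≤
      ENNReal.ofReal ((d * d + d + 1) * K) * sobN 2 p v := by
    refine (eLpNorm_mono_ae_real hbd).trans ?_
    exact (eLpNorm_mul_le_of_abs_le (fun _ => (abs_of_nonneg (by positivity)).le)).trans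
      (mul_le_mul' le_rfl hJn)
  exact ⟨⟨hm, hn.trans_lt (ENNReal.mul_lt_top ENNReal.ofReal_lt_top hv.sobN_lt_top)⟩, hn⟩

lemma opL_sub {p : ℕ} {u v w : Rd d → ℝ} (hu : u =ᵐ[volume] fun x => v x - w x)
    (hv : MemW 2 p v) (hw : MemW 2 p w) :
    opL a b c u =ᵐ[volume] fun x => opL a b c v x - opL a b c w x := by
  have key : ∀ k ≤ 2, ∀ α : Fin k → Fin d, ∀ᵐ x, weakD α u x = weakD α v x - weakD α w x :=
    fun k hk α => (weakD_congr hu α).trans (hv.weakD_sub hw hk α)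
  filter_upwards [hu, ae_all_iff.2 fun i => key 1 (by norm_num) ![i],
    ae_all_iff.2 fun i => ae_all_iff.2 fun j => key 2 le_rfl ![i, j]] with x h0 h1 h2
  simp only [opL, h0, h1, h2, mul_sub, Finset.sum_sub_distrib]
  ring

lemma diffOp_sub {a' : Fin d → Fin d → Rd d → ℝ} {b' : Fin d → Rd d → ℝ} {c' : Rd d → ℝ}
    (φ : Rd d → ℝ) : diffOp (fun i j x => a i j x - a' i j x) (fun i x => b i x - b' i x)
      (fun x => c x - c' x) φ = fun x => diffOp a b c φ x - diffOp a' b' c' φ x := by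
  ext x
  simp only [diffOp, secondOrder, firstOrder, sub_mul, Finset.sum_sub_distrib]
  ring

lemma smoothCoef_mol {n : ℕ} {K : ℝ} (ha : ∀ i j, CoefHyp (max n 2) K (a i j))
    (hb : ∀ i, CoefHyp (max n 1) K (b i)) (hc : CoefHyp n K c)
    (h0 : ∀ᵐ x, ∀ y : Fin d → ℝ, 0 ≤ ∑ i, ∑ j, a i j x * y i * y j) (l : ℕ) :
    SmoothCoef n K (fun i j => mol l (a i j)) (fun i => mol l (b i)) (mol l c) where
  smooth_a i j := sm_mol l (ha i j).locInt
  smooth_b i := sm_mol l (hb i).locInt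
  smooth_c := sm_mol l hc.locInt
  bound_a i j k hk α x := (ha i j).abs_classicalD_mol_le l hk α x
  bound_b i k hk α x := (hb i).abs_classicalD_mol_le l hk α x
  bound_c k hk α x := hc.abs_classicalD_mol_le l hk α x
  nonneg x y := by
    have hi : ∀ i j, Integrable fun z => (bumpSeq d l).normed volume z * a i j (x - z) * y i * y j :=
      fun i j => ((integrable_mol l (ha i j).locInt x).mul_const _).mul_const _
    have e : ∑ i, ∑ j, mol l (a i j) x * y i * y j =
        ∫ z, ∑ i, ∑ j, (bumpSeq d l).normed volume z * a i j (x - z) * y i * y j := by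
      rw [integral_finsetSum _ fun i _ => integrable_finsetSum _ fun j _ => hi i j]
      refine Finset.sum_congr rfl fun i _ => ?_
      rw [integral_finsetSum _ fun j _ => hi i j]
      refine Finset.sum_congr rfl fun j _ => ?_
      rw [integral_mul_const, integral_mul_const, mol_apply]
    rw [e]
    have hq : ∀ᵐ z, ∀ y : Fin d → ℝ, 0 ≤ ∑ i, ∑ j, a i j (x - z) * y i * y j :=
      (Measure.measurePreserving_sub_left volume x).quasiMeasurePreserving.ae h0
    refine integral_nonneg_of_ae ?_
    filter_upwards [hq] with z hz
    have := mul_nonneg ((bumpSeq d l).nonneg_normed (μ := volume) z) (hz y)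
    refine this.trans (le_of_eq ?_)
    simp only [Finset.mul_sum, mul_assoc]

lemma exists_coefJet_rate {n : ℕ} {K : ℝ} (ha : ∀ i j, CoefHyp n K (a i j))
    (hb : ∀ i, CoefHyp n K (b i)) (hc : CoefHyp n K c) :
    ∃ (w : ℕ → Rd d → ℝ) (M : ℝ), (∀ j, AEStronglyMeasurable (w j)) ∧
    (∀ j x, 0 ≤ w j x) ∧ (∀ j x, w j x ≤ M) ∧
    (∀ᵐ x, Tendsto (fun j => w j x) atTop (𝓝 0)) ∧
    ∀ r s x, coefJet n (fun i j x => mol r (a i j) x - mol s (a i j) x)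
      (fun i x => mol r (b i) x - mol s (b i) x) (fun x => mol r c x - mol s c x) x ≤
        w r x + w s x := by
  choose wa a1 a2 a3 a4 a5 using fun i j => (ha i j).exists_rate
  choose wb b1 b2 b3 b4 b5 using fun i => (hb i).exists_rate
  obtain ⟨wc, c1, c2, c3, c4, c5⟩ := hc.exists_rate
  refine ⟨fun r x => (∑ i, ∑ j, wa i j r x) + (∑ i, wb i r x) + wc r x,
    (∑ _i : Fin d, ∑ _j : Fin d, numIndices d n * (2 * K)) + (∑ _i : Fin d, numIndices d n * (2 * K)) +
      numIndices d n * (2 * K), fun r => ?_, fun r x => ?_, fun r x => ?_, ?_, fun r s x => ?_⟩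
  · exact ((Finset.aestronglyMeasurable_fun_sum _ fun i _ =>
      Finset.aestronglyMeasurable_fun_sum _ fun j _ => a1 i j r).add
        (Finset.aestronglyMeasurable_fun_sum _ fun i _ => b1 i r)).add (c1 r)
  · exact add_nonneg (add_nonneg (Finset.sum_nonneg fun i _ => Finset.sum_nonneg fun j _ =>
      a2 i j r x) (Finset.sum_nonneg fun i _ => b2 i r x)) (c2 r x)
  · exact add_le_add (add_le_add (Finset.sum_le_sum fun i _ => Finset.sum_le_sum fun j _ =>
      a3 i j r x) (Finset.sum_le_sum fun i _ => b3 i r x)) (c3 r x)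
  · filter_upwards [ae_all_iff.2 fun i => ae_all_iff.2 fun j => a4 i j, ae_all_iff.2 fun i => b4 i, c4]
      with x h1 h2 h3
    have := ((tendsto_finsetSum Finset.univ fun i _ => tendsto_finsetSum Finset.univ fun j _ =>
      h1 i j).add (tendsto_finsetSum Finset.univ fun i _ => h2 i)).add h3
    simpa using this
  · have e : (∑ i, ∑ j, wa i j r x) + (∑ i, wb i r x) + wc r x +
        ((∑ i, ∑ j, wa i j s x) + (∑ i, wb i s x) + wc s x) =
        (∑ i, ∑ j, (wa i j r x + wa i j s x)) + (∑ i, (wb i r x + wb i s x)) +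
          (wc r x + wc s x) := by
      simp only [Finset.sum_add_distrib]
      ring
    rw [e]
    exact add_le_add (add_le_add (Finset.sum_le_sum fun i _ => Finset.sum_le_sum fun j _ =>
      a5 i j r s x) (Finset.sum_le_sum fun i _ => b5 i r s x)) (c5 r s x)

/-- The operators with mollified coefficients converge. -/
lemma tendsto_diffOp_mol {n p : ℕ} (hp : 1 ≤ p) {K : ℝ} (hK : 0 ≤ K)
    (ha : ∀ i j, CoefHyp n K (a i j)) (hb : ∀ i, CoefHyp n K (b i)) (hc : CoefHyp n K c)
    {φ : Rd d → ℝ} (hφ : IsTestFunction φ) :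
    MemW n p (diffOp a b c φ) ∧ Tendsto (fun r => sobN n p (fun x => diffOp (fun i j => mol r (a i j))
      (fun i => mol r (b i)) (mol r c) φ x - diffOp a b c φ x)) atTop (𝓝 0) := by
  have hp' : (1 : ℝ≥0∞) ≤ p := by exact_mod_cast hp
  set F : ℕ → Rd d → ℝ := fun r => diffOp (fun i j => mol r (a i j)) (fun i => mol r (b i))
    (mol r c) φ with hF
  have hFt : ∀ r, IsTestFunction (F r) := fun r => isTestFunction_diffOp
    (fun i j => sm_mol r (ha i j).locInt) (fun i => sm_mol r (hb i).locInt) (sm_mol r hc.locInt) hφ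
  have hJ : ∀ k, MemLp (jetAbs k φ) (p : ℝ≥0∞) := fun k =>
    memLp_jetAbs fun _ _ β => (hφ.cD β).memLp _
  have hop : opL a b c φ =ᵐ[volume] diffOp a b c φ := opL_ae_eq_diffOp hφ.sm (EventuallyEq.refl _ _)
  have hf : MemLp (diffOp a b c φ) (p : ℝ≥0∞) := (memLp_congr_ae hop).1
    (memLp_opL hp hK (fun i j => (ha i j).mono (Nat.zero_le n)) (fun i => (hb i).mono (Nat.zero_le n))
      (hc.mono (Nat.zero_le n)) (hφ.memW 2 p)).1
  have hl0 : ∀ᵐ x, Tendsto (fun r => F r x - diffOp a b c φ x) atTop (𝓝 0) := by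
    filter_upwards [ae_all_iff.2 fun i => ae_all_iff.2 fun j => tendsto_mol_ae (ha i j).locInt,
      ae_all_iff.2 fun i => tendsto_mol_ae (hb i).locInt, tendsto_mol_ae hc.locInt] with x h1 h2 h3
    have h4 : Tendsto (fun r => F r x) atTop (𝓝 (diffOp a b c φ x)) :=
      ((tendsto_finsetSum Finset.univ fun i _ => tendsto_finsetSum Finset.univ fun j _ =>
        (h1 i j).mul_const _).add (tendsto_finsetSum Finset.univ fun i _ =>
        (h2 i).mul_const _)).add (h3.mul_const _)
    simpa using h4.sub_const (diffOp a b c φ x)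
  have h0 : Tendsto (fun r => eLpNorm (fun x => F r x - diffOp a b c φ x) (p : ℝ≥0∞) volume) atTop
      (𝓝 0) := by
    refine tendsto_eLpNorm_of_dominated hp
      (h := fun x => (d * d + d + 1) * K * jetAbs 2 φ x + (d * d + d + 1) * K * jetAbs 2 φ x)
      (fun r => (hFt r).1.continuous.aestronglyMeasurable.sub hf.1)
      (((hJ 2).const_mul _).add ((hJ 2).const_mul _)) (fun r => Eventually.of_forall fun x => ?_) hl0
    refine (abs_sub _ _).trans (add_le_add (abs_diffOp_le hφ.sm ?_ ?_ ?_)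
      (abs_diffOp_le hφ.sm (fun i j => (ha i j).bound x) (fun i => (hb i).bound x) (hc.bound x)))
    · exact fun i j => abs_mol_le r (ha i j).bound x
    · exact fun i => abs_mol_le r (hb i).bound x
    · exact abs_mol_le r hc.bound x
  obtain ⟨w, M, w1, w2, w3, w4, w5⟩ := exists_coefJet_rate ha hb hc
  have hJm : AEStronglyMeasurable (jetAbs (n + 2) φ) volume := (hJ (n + 2)).1
  set g : ℕ → Rd d → ℝ := fun r x => 2 ^ n * (w r x * jetAbs (n + 2) φ x) with hg
  have hgm : ∀ r, AEStronglyMeasurable (g r) volume := fun r => ((w1 r).mul hJm).const_mul _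
  have hgl : Tendsto (fun r => eLpNorm (g r) (p : ℝ≥0∞) volume) atTop (𝓝 0) := by
    refine tendsto_eLpNorm_of_dominated hp (h := fun x => 2 ^ n * (M * jetAbs (n + 2) φ x)) hgm
      (((hJ (n + 2)).const_mul _).const_mul _) (fun r => Eventually.of_forall fun x => ?_) ?_
    · have hj := jetAbs_nonneg (n + 2) φ x
      rw [abs_of_nonneg (mul_nonneg (by positivity) (mul_nonneg (w2 r x) hj))]
      exact mul_le_mul_of_nonneg_left (mul_le_mul_of_nonneg_right (w3 r x) hj) (by positivity)
    · filter_upwards [w4] with x hx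
      simpa using (hx.mul_const (jetAbs (n + 2) φ x)).const_mul (2 ^ n)
  have hb0 : Tendsto (fun r => ∑ k ∈ Finset.range (n + 1), ∑ _α : Fin k → Fin d,
      eLpNorm (g r) (p : ℝ≥0∞) volume) atTop (𝓝 0) := by
    have := tendsto_finsetSum (Finset.range (n + 1)) fun k _ =>
      tendsto_finsetSum (Finset.univ : Finset (Fin k → Fin d)) fun _ _ => hgl
    simpa using this
  refine memW_of_cauchy hp (fun r => (hFt r).memW n p) hf h0 hb0 fun r s => ?_
  have e : (fun x => F r x - F s x) = diffOp (fun i j x => mol r (a i j) x - mol s (a i j) x)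
      (fun i x => mol r (b i) x - mol s (b i) x) (fun x => mol r c x - mol s c x) φ :=
    (diffOp_sub φ).symm
  rw [sobN_classical (((hFt r).sub (hFt s)).sm.nat n), ← Finset.sum_add_distrib]
  refine Finset.sum_le_sum fun k hk => ?_
  rw [← Finset.sum_add_distrib]
  refine Finset.sum_le_sum fun α _ => ?_
  refine (eLpNorm_mono_real (g := fun x => g r x + g s x) fun x => ?_).trans
    (eLpNorm_add_le (hgm r) (hgm s) hp')
  rw [e]
  refine (abs_classicalD_diffOp_le (n := n) (by have := Finset.mem_range.1 hk; omega)
    (fun i j => (sm_mol r (ha i j).locInt).sub (sm_mol s (ha i j).locInt))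
    (fun i => (sm_mol r (hb i).locInt).sub (sm_mol s (hb i).locInt))
    ((sm_mol r hc.locInt).sub (sm_mol s hc.locInt)) hφ.sm α x).trans ?_
  rw [hg, ← mul_add, ← add_mul]
  exact mul_le_mul_of_nonneg_left (mul_le_mul_of_nonneg_right (w5 r s x)
    (jetAbs_nonneg _ _ _)) (by positivity)

end op

lemma exists_goodOp_opL (d n : ℕ) {q : ℕ} (hq : 1 ≤ q) {K : ℝ} (hK : 0 ≤ K) : ∃ C : ℝ, 0 ≤ C ∧
    ∀ (a : Fin d → Fin d → Rd d → ℝ) (b : Fin d → Rd d → ℝ) (c : Rd d → ℝ),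
      (∀ i j, CoefHyp (max n 2) K (a i j)) → (∀ i, CoefHyp (max n 1) K (b i)) → CoefHyp n K c →
      (∀ᵐ x, ∀ y : Fin d → ℝ, 0 ≤ ∑ i, ∑ j, a i j x * y i * y j) →
      GoodOp n q C (fun v => opL a b c v) := by
  obtain ⟨C, hC, hest⟩ := exists_diffOp_smooth d n hq hK
  have hp : 1 ≤ 2 * q := by omega
  refine ⟨C, hC, fun a b c ha hb hc h0 => ?_⟩
  have ha' := fun i j => (ha i j).mono (le_max_left n 2)
  have hb' := fun i => (hb i).mono (le_max_left n 1)
  have hlim := fun φ (hφ : IsTestFunction φ) => tendsto_diffOp_mol hp hK ha' hb' hc hφ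
  have hsm := smoothCoef_mol ha hb hc h0
  set F : ℕ → (Rd d → ℝ) → Rd d → ℝ := fun r φ => diffOp (fun i j => mol r (a i j))
    (fun i => mol r (b i)) (mol r c) φ with hF
  have hFt : ∀ r φ, IsTestFunction φ → IsTestFunction (F r φ) := fun r φ hφ =>
    isTestFunction_diffOp (hsm r).smooth_a (hsm r).smooth_b (hsm r).smooth_c hφ
  have hvφ : ∀ (v : LpSpace d (2 * q)) φ, IsTestFunction φ → v =ᵐ[volume] φ →
      MemW n (2 * q) (opL a b c v) := fun v φ hφ hv =>
    (hlim φ hφ).1.congr (opL_ae_eq_diffOp hφ.sm hv).symm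
  refine ⟨⟨_, ENNReal.ofReal_ne_top, fun v hv => memLp_opL hp hK
    (fun i j => (ha i j).mono (Nat.zero_le _)) (fun i => (hb i).mono (Nat.zero_le _))
    (hc.mono (Nat.zero_le _)) hv⟩, fun v w hv hw => opL_sub (Lp.coeFn_sub v w) hv hw, ?_, ?_⟩
  · refine ⟨(∑ k ∈ Finset.range (n + 1), ∑ _α : Fin k → Fin d, ENNReal.ofReal C),
      ENNReal.sum_ne_top.2 fun _ _ => ENNReal.sum_ne_top.2 fun _ _ => ENNReal.ofReal_ne_top,
      fun v φ hφ hv => ⟨hvφ v φ hφ hv, ?_⟩⟩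
    rw [sobN_congr (opL_ae_eq_diffOp hφ.sm hv), sobN_congr hv]
    refine le_of_tendsto' (tendsto_sobN_self hp (fun r => (hFt r φ hφ).memW n _) (hlim φ hφ).1
      (hlim φ hφ).2) fun r => ?_
    rw [sobN_classical ((hFt r φ hφ).sm.nat n), Finset.sum_mul]
    refine Finset.sum_le_sum fun k hk => ?_
    rw [Finset.sum_mul]
    exact Finset.sum_le_sum fun α _ => (hest _ _ _ (hsm r) φ hφ).1 k
      (by have := Finset.mem_range.1 hk; omega) α
  · intro v φ hφ hv
    have hvW : MemW n (2 * q) v := (hφ.memW n (2 * q)).congr hv.symm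
    have hnorm : normW n (2 * q) (v : Rd d → ℝ) = normW n (2 * q) φ := by
      rw [hvW.normW_eq, (hφ.memW n (2 * q)).normW_eq, sobN_congr hv]
    have hz : Tendsto (fun _ : ℕ => sobN n (2 * q) (fun x => v x - v x)) atTop (𝓝 0) := by
      have e : sobN n (2 * q) (fun x => (v : Rd d → ℝ) x - v x) = 0 := by
        have : (fun x => (v : Rd d → ℝ) x - v x) = fun _ => 0 := by ext x; simp
        rw [this]
        have h1 : ∀ k (α : Fin k → Fin d), classicalD α (fun _ : Rd d => (0 : ℝ)) = fun _ => 0 :=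
          fun k α => by
            have := classicalD_const_mul (k := k) (f := fun _ : Rd d => (0 : ℝ)) contDiff_const 0 α
            simpa using this
        rw [sobN_classical contDiff_const]
        simp [h1]
      rw [e]
      exact tendsto_const_nhds
    have hop := opL_ae_eq_diffOp (a := a) (b := b) (c := c) hφ.sm hv
    have hl2 : Tendsto (fun r => sobN n (2 * q) (fun x => F r φ x - opL a b c v x)) atTop (𝓝 0) := by
      refine (hlim φ hφ).2.congr fun r => sobN_congr ?_
      filter_upwards [hop] with x hx
      rw [hx]
    refine le_of_tendsto' (tendsto_energy hq (V := fun _ => v) (fun _ => hvW) hvW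
      (fun r => (hFt r φ hφ).memW n _) (hvφ v φ hφ hv) hz hl2) fun r => ?_
    rw [energy_eq, hnorm]
    refine (le_of_eq ?_).trans (hest _ _ _ (hsm r) φ hφ).2
    refine Finset.sum_congr rfl fun α _ => integral_congr_ae ?_
    filter_upwards [ae_all_iff.2 fun β : Fin n → Fin d => weakD_classical (hφ.sm.nat n) β hv,
      weakD_classical ((hFt r φ hφ).sm.nat n) α (EventuallyEq.refl _ _)] with x h1 h2
    simp only [h1, h2]
    rfl

end roughCoef

end IntegroDiff

end

noncomputable section

namespace IntegroDiff

/-! ### The time dependent operators -/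

section assembly
variable {d : ℕ} {T : ℝ}

lemma AssumptionJump.jumpHyp {Z : Type*} [MeasurableSpace Z] {l l' : ℕ} {K : ℝ} {ηbar : Z → ℝ}
    {η : TimeInterval T → Z → Rd d → Rd d} (h : AssumptionJump l K ηbar η) (hl : l' ≤ l)
    (t : TimeInterval T) (z : Z) : JumpHyp l' K (ηbar z) (η t z) :=
  JumpHyp.mono ⟨h.contDiff t z, h.bound t z, fun k h1 h2 x => h.deriv_bound k h1 h2 t z x,
    h.det_bound t z⟩ hl

lemma AssumptionJump.measurable_fixed {Z : Type*} [MeasurableSpace Z] {l : ℕ} {K : ℝ} {ηbar : Z → ℝ}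
    {η : TimeInterval T → Z → Rd d → Rd d} (h : AssumptionJump l K ηbar η) (t : TimeInterval T) :
    Measurable fun y : Rd d × Z => η t y.2 y.1 :=
  h.measurable.comp ((measurable_const.prodMk measurable_fst).prodMk measurable_snd :
    Measurable fun y : Rd d × Z => ((t, y.1), y.2))

lemma BoundedDerivs.ae_coefHyp {l : ℕ} {K : ℝ} {f : TimeInterval T → Rd d → ℝ}
    (h : BoundedDerivs l K f) : ∀ᵐ t : TimeInterval T, CoefHyp l K (f t) := by
  have hm : ∀ t, Measurable (f t) := fun t => h.measurable.comp measurable_prodMk_left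
  have h1 : ∀ k (α : Fin k → Fin d), ∀ᵐ t : TimeInterval T, 1 ≤ k → k ≤ l →
      ∃ g, IsWeakDeriv α (f t) g ∧ ∀ x, |g x| ≤ K := fun k α => by
    by_cases hk : 1 ≤ k ∧ k ≤ l
    · obtain ⟨g, _, hb, hw⟩ := h.deriv k hk.1 hk.2 α
      filter_upwards [hw] with t ht
      exact fun _ _ => ⟨g t, ht, hb t⟩
    · exact Filter.Eventually.of_forall fun t h1 h2 => absurd ⟨h1, h2⟩ hk
  filter_upwards [ae_all_iff.2 fun k => ae_all_iff.2 fun α => h1 k α] with t ht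
  refine ⟨(hm t).aestronglyMeasurable, h.bound t, fun k hk α => ?_⟩
  rcases Nat.eq_zero_or_pos k with rfl | h0
  · have hL : MemLp (f t) ∞ (volume : Measure (Rd d)) :=
      memLp_top_of_bound (hm t).aestronglyMeasurable K (Filter.Eventually.of_forall (h.bound t))
    exact ⟨f t, isWeakDeriv_zero (hL.locallyIntegrable le_top) α, h.bound t⟩
  · exact ht k α h0 hk

/-- The estimate for an even exponent. -/
lemma exists_energy_bound (d p : ℕ) [Fact ((1 : ℝ≥0∞) ≤ (p : ℝ≥0∞))] (hp : Even p)
    (m : ℝ) (K Kξ Kη : ℝ) (hK : 0 < K) (hKξ : 0 ≤ Kξ) :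
    ∃ N : ℝ, ∀ (T : ℝ),
      ∀ (Z : Type*) [MeasurableSpace Z] (μ ν : Measure Z) [SigmaFinite μ] [SigmaFinite ν]
        (ηbar ξbar : Z → ℝ)
        (a : TimeInterval T → Fin d → Fin d → Rd d → ℝ) (b : TimeInterval T → Fin d → Rd d → ℝ)
        (c : TimeInterval T → Rd d → ℝ) (η ξ : TimeInterval T → Z → Rd d → Rd d)
        (R : TimeInterval T → LpSpace d p →L[ℝ] LpSpace d p),
      Integrable (fun z => ηbar z ^ 2) μ → ∫ z, ηbar z ^ 2 ∂μ = Kη ^ 2 →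
      Integrable ξbar ν → ∫ z, ξbar z ∂ν = Kξ →
      AssumptionL m K a b c →
      AssumptionJump (max ⌈m⌉₊ 3) K ηbar η →
      AssumptionJump (max ⌈m⌉₊ 2) K ξbar ξ →
      AssumptionR m K R →
      ∀ᵐ t : TimeInterval T, ∀ n : ℕ, (n : ℝ) ≤ m →
        ∀ v : LpSpace d p, MemW (n + 2) p v →
          (∀ᵐ x : Rd d, Integrable (fun z => opJ (η t) z v x) μ) ∧
          (∀ᵐ x : Rd d, Integrable (fun z => opI (ξ t) z v x) ν) ∧
          MemW n p (opA (a t) (b t) (c t) μ (η t) ν (ξ t) (R t) v) ∧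
          (∀ α : Fin n → Fin d, Integrable fun x =>
            weakDNorm n v x ^ (p - 2) * weakD α v x *
              weakD α (opA (a t) (b t) (c t) μ (η t) ν (ξ t) (R t) v) x) ∧
          energy n p v (opA (a t) (b t) (c t) μ (η t) ν (ξ t) (R t) v)
            ≤ N * normW n p v ^ p := by
  obtain ⟨q, rfl⟩ := even_iff_exists_two_mul.1 hp
  have hq : 1 ≤ q := by
    have h : (1 : ℝ≥0∞) ≤ ((2 * q : ℕ) : ℝ≥0∞) := Fact.out
    have h' : 1 ≤ 2 * q := by exact_mod_cast h
    omega
  choose CL hCL hL using fun n => exists_goodOp_opL d n hq hK.le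
  choose CJ hCJ hJ using fun n => exists_markOp_J d n hq hK
  choose CI hCI hI using fun n => exists_markOp_I d n hq hK
  set Q : ℕ → ℝ := fun n => CL n + CJ n * Kη ^ 2 + CI n * Kξ + (d : ℝ) ^ n * K with hQ
  have hQ0 : ∀ n, 0 ≤ Q n := fun n => by
    have h1 := hCL n
    have h2 := hCJ n
    have h3 := hCI n
    positivity
  refine ⟨∑ n ∈ Finset.range (⌈m⌉₊ + 1), Q n, ?_⟩
  intro T Z _ μ ν _ _ ηbar ξbar a b c η ξ R iη eη iξ eξ hcoef hη hξ hR
  filter_upwards [ae_all_iff.2 fun i => ae_all_iff.2 fun j => (hcoef.a_bound i j).ae_coefHyp,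
    ae_all_iff.2 fun i => (hcoef.b_bound i).ae_coefHyp, hcoef.c_bound.ae_coefHyp,
    Measure.ae_ae_of_ae_prod hcoef.a_nonneg] with t ha hb hc h0 n hn v hv
  have hnm : n ≤ ⌈m⌉₊ := by
    have := hn.trans (Nat.le_ceil m)
    exact_mod_cast this
  have gL : GoodOp n q (CL n) (fun v => opL (a t) (b t) (c t) v) := hL n (a t) (b t) (c t)
    (fun i j => (ha i j).mono (by omega)) (fun i => (hb i).mono (by omega)) (hc.mono hnm) h0
  have kJ := hJ n Z μ ηbar (η t) (hη.measurable_fixed t) fun z => hη.jumpHyp (by omega) t z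
  have kI := hI n Z ν ξbar (ξ t) (hξ.measurable_fixed t) fun z => hξ.jumpHyp (by omega) t z
  have mη : Measurable fun z => ηbar z ^ 2 := hη.bar_measurable.pow_const 2
  have gJ := kJ.goodOp hq mη (fun z => sq_nonneg _) (hCJ n) iη
  have gI := kI.goodOp hq hξ.bar_measurable hξ.bar_nonneg (hCI n) iξ
  have gR := goodOp_bounded (n := n) hq hK.le (R t) fun φ hφ => hR t φ hφ n hnm
  rw [eη] at gJ
  rw [eξ] at gI
  have gA : GoodOp n q (Q n) (fun v => opA (a t) (b t) (c t) μ (η t) ν (ξ t) (R t) v) :=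
    ((gL.add hq gJ).add hq gI).add hq gR
  have hv2 : MemW 2 (2 * q) v := hv.mono (by omega)
  have fin : ∀ {ρ : Measure Z} {w : Z → ℝ}, Integrable w ρ → ∫⁻ z, ENNReal.ofReal (w z) ∂ρ ≠ ∞ :=
    fun h => h.lintegral_lt_top.ne
  obtain ⟨hW, hE⟩ := (gA.mono (Finset.single_le_sum (fun n _ => hQ0 n)
    (Finset.mem_range.2 (Nat.lt_succ_of_le hnm)))).extend hq hv
  exact ⟨(kJ.minkowski hq mη (hCJ n) (fin iη) hv2).1,
    (kI.minkowski hq hξ.bar_measurable (hCI n) (fin iξ) hv2).1, hW,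
    energy_integrable hq (hv.mono (by omega)) hW, hE⟩

end assembly

end IntegroDiff

end

open IntegroDiff in
theorem theorem4p1 (d k : ℕ) (hk : 1 ≤ k) (m : ℝ) (hm : 0 ≤ m) (K Kξ Kη : ℝ)
    (hK : 0 < K) (hKξ : 0 ≤ Kξ) (hKη : 0 ≤ Kη) :
    ∃ N : ℝ, ∀ (T : ℝ), 0 < T →
      ∀ (Z : Type*) [MeasurableSpace Z] (μ ν : Measure Z) [SigmaFinite μ] [SigmaFinite ν]
        (ηbar ξbar : Z → ℝ)
        (a : TimeInterval T → Fin d → Fin d → Rd d → ℝ) (b : TimeInterval T → Fin d → Rd d → ℝ)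
        (c : TimeInterval T → Rd d → ℝ) (η ξ : TimeInterval T → Z → Rd d → Rd d)
        (R : TimeInterval T → LpSpace d (2 ^ k) →L[ℝ] LpSpace d (2 ^ k)),
      Integrable (fun z => ηbar z ^ 2) μ → ∫ z, ηbar z ^ 2 ∂μ = Kη ^ 2 →
      Integrable ξbar ν → ∫ z, ξbar z ∂ν = Kξ →
      AssumptionL m K a b c →
      AssumptionJump (max ⌈m⌉₊ 3) K ηbar η →
      AssumptionJump (max ⌈m⌉₊ 2) K ξbar ξ →
      AssumptionR m K R →
      ∀ᵐ t : TimeInterval T, ∀ n : ℕ, (n : ℝ) ≤ m →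
        ∀ v : LpSpace d (2 ^ k), MemW (n + 2) (2 ^ k) v →
          (∀ᵐ x : Rd d, Integrable (fun z => opJ (η t) z v x) μ) ∧
          (∀ᵐ x : Rd d, Integrable (fun z => opI (ξ t) z v x) ν) ∧
          MemW n (2 ^ k) (opA (a t) (b t) (c t) μ (η t) ν (ξ t) (R t) v) ∧
          (∀ α : Fin n → Fin d, Integrable fun x =>
            weakDNorm n v x ^ (2 ^ k - 2) * weakD α v x *
              weakD α (opA (a t) (b t) (c t) μ (η t) ν (ξ t) (R t) v) x) ∧
          ∑ α : Fin n → Fin d, ∫ x,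
            weakDNorm n v x ^ (2 ^ k - 2) * weakD α v x *
              weakD α (opA (a t) (b t) (c t) μ (η t) ν (ξ t) (R t) v) x
            ≤ N * normW n (2 ^ k) v ^ (2 ^ k) := by
  obtain ⟨N, hN⟩ := exists_energy_bound d (2 ^ k) (even_two.pow_of_ne_zero (by omega)) m K Kξ Kη
    hK hKξ
  exact ⟨N, fun T _ => hN T⟩
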